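/- Let $\mathbb T^2=\mathbb S^1\times\mathbb S^1$ be the torus with angular coordinates $(\theta,\varphi)$, and identify $\mathbb S^3\subset\mathbb R^4$ with the join $\mathbb S^1*\mathbb S^1$ by $(\theta,\varphi,\tau)\mapsto(\cos\tfrac{\pi\tau}2\cos\varphi,\cos\tfrac{\pi\tau}2\sin\varphi,\sin\tfrac{\pi\tau}2\cos\theta,\sin\tfrac{\pi\tau}2\sin\theta)$, $\tau\in[0,1]$, oriented so that $(\theta,\varphi,\tau)$ is a positive coordinate system. Let $$\xi_\pm=\ker\bigl(\cos^2(\pi\tau/2)\,d\varphi\pm\sin^2(\pi\tau/2)\,d\theta\bigr).$$ A *rectangular diagram of a link* is a finite set $R\subset\mathbb T^2$ such that every meridian $\{\theta\}\times\mathbb S^1$ and every longitude $\mathbb S^1\times\{\varphi\}$ contains either no or exactly two points of $R$; two points of $R$ on the same meridian or longitude form an *edge*. An *orientation* of $R$ is an assignment of signs to the points of $R$ such that the endpoints of every edge have different signs. For $v\in\mathbb T^2$ let $\widehat v\subset\mathbb S^3$ be the image of $v\times[0,1]$. The link associated with $R$ is $\widehat R=\bigcup_{v\in R}\widehat v$;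 if $R$ is oriented, $\widehat R$ is oriented so that $\tau$ increases on $\widehat v$ if $v$ is positive and decreases if $v$ is negative. The *Thurston–Bennequin numbers* of an oriented $R$ are $$\mathrm{tb}_+(R)=\mathrm{lk}(\widehat R,\widehat{R^{\nearrow}}),\qquad \mathrm{tb}_-(R)=-\mathrm{lk}(\widehat R,\widehat{R^{\nwarrow}}),$$ where $R^{\nearrow}$ and $R^{\nwarrow}$ are obtained from $R$ by a sufficiently small shift in the direction $(1,1)$ and $(-1,1)$, respectively, with the inherited orientation. A *surface with corners* is a subset $F$ of a $C^1$-embedded two-dimensional submanifold $M\subset\mathbb S^3$ bounded in $M$ by a finite collection, denoted $\partial F$, of disjoint piecewise smooth cusp-free simple closed curves. If $\widehat R\subset\partial F$, we denote by $\widehat R^F$ any piecewise smooth link in $F$ that together with $\widehat R$ bounds a collar neighbourhood of $\widehat R$ in $F$, oriented coherently with $\widehat R$. A *framing* of $R$ is an ordering of each pair of points of $R$ forming an edge. A framing $f$ of $R$ is represented by a surface with corners $F$ if: $F$ is a disjoint union of annuli, each having one boundary component that is a component of $\widehat R$ and the other smooth and disjoint from $\widehat R$, every component of $\widehat R$ being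 used exactly once; at every point of $\widehat R$ the surface $F$ is tangent to $\xi_+$ or to $\xi_-$; and for every edge $\{v,w\}$ with $w>v$ in $f$, at the corresponding point $p$ of $\widehat R$ on the circle $\tau=0$ (for $v,w$ on a common longitude) or $\tau=1$ (for $v,w$ on a common meridian) the surface $F$ approaches $p$ from the side of the sector $[v,w]\times[0,1]/{\sim}$, i.e. the distance from $x\in F$ to this sector is $o(d(x,p))$ as $x\to p$; here $[v,w]$ is the positively directed arc from $v$ to $w$ of the longitude or meridian. In this case we put $\langle f\rangle=\mathrm{lk}(\widehat R,\widehat R^{f})$, where $\widehat R^f=\partial F\setminus\widehat R$ is oriented coherently with $\widehat R$. **Proposition.** Let $R$ be an oriented rectangular diagram of a link. (i) If $F\subset\mathbb S^3$ is a surface with corners with $\partial F\supset\widehat R$ that is tangent to $\xi_+$ (respectively, to $\xi_-$) at all points of $\widehat R$, then $\mathrm{lk}(\widehat R,\widehat R^F)$ equals $\mathrm{tb}_+(R)$ (respectively, $-\mathrm{tb}_-(R)$). (ii) $\mathrm{tb}_+(R)+\mathrm{tb}_-(R)=-|R|/2$, where $|R|$ is the number of points of $R$. (iii) Every framing $f$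 of $R$ is represented by a surface, $\langle f\rangle$ does not depend on the choice of the surface, and $$\{\langle f\rangle\;:\;f\text{ is a framing of }R\}=[\mathrm{tb}_+(R),-\mathrm{tb}_-(R)]\cap\mathbb Z.$$ -/

import Mathlib

open Set Filter Topology Asymptotics

noncomputable section

/-! ## The torus, the three-sphere and rectangular diagrams of links -/

/-- The torus `𝕋² = 𝕊¹ × 𝕊¹` with coordinates `(θ, φ)`, both taken modulo `2π`. -/
abbrev Torus : Type := Real.Angle × Real.Angle

/-- The ambient space of the unit sphere `𝕊³`. -/
abbrev E4 : Type := EuclideanSpace ℝ (Fin 4)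

/-- The coordinates `(θ, φ, τ)`, `τ ∈ [0, 1]`, on `𝕊³ = 𝕊¹ * 𝕊¹`, as points of the unit sphere. -/
def joinPoint (θ φ : Real.Angle) (τ : ℝ) : E4 :=
  !₂[Real.cos (Real.pi * τ / 2) * φ.cos, Real.cos (Real.pi * τ / 2) * φ.sin,
    Real.sin (Real.pi * τ / 2) * θ.cos, Real.sin (Real.pi * τ / 2) * θ.sin]

/-- A rectangular diagram of a link: every meridian and every longitude contains
no or exactly two points of `R`. -/
def IsLinkDiagram (R : Finset Torus) : Prop :=
  (∀ θ : Real.Angle, {v : Torus | v ∈ R ∧ v.1 = θ}.ncard = 0 ∨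
    {v : Torus | v ∈ R ∧ v.1 = θ}.ncard = 2) ∧
  (∀ φ : Real.Angle, {v : Torus | v ∈ R ∧ v.2 = φ}.ncard = 0 ∨
    {v : Torus | v ∈ R ∧ v.2 = φ}.ncard = 2)

/-- `{v, w}` is an edge of `R`: two vertices on the same meridian or on the same longitude. -/
def IsEdge (R : Finset Torus) (v w : Torus) : Prop :=
  v ∈ R ∧ w ∈ R ∧ v ≠ w ∧ (v.1 = w.1 ∨ v.2 = w.2)

/-- An orientation of a diagram: the endpoints of every edge have different signs. -/
def IsOrientation (R : Finset Torus) (ε : Torus → ℤˣ) : Prop :=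
  ∀ v w, IsEdge R v w → ε v ≠ ε w

/-- The parametrization `τ ↦ (θ, φ, τ)` of the arc `v̂`, where `v = (θ, φ)` and `τ ∈ [0, 1]`. -/
def vertexArc (v : Torus) (τ : ℝ) : E4 := joinPoint v.1 v.2 τ

/-- The link `R̂` associated with `R`. -/
def linkOf (R : Finset Torus) : Set E4 := ⋃ v ∈ R, vertexArc v '' Icc (0 : ℝ) 1

/-! ## Linking numbers in the three-sphere -/

/-- The Gauss linking integral in the unit sphere `𝕊³ ⊂ ℝ⁴` of two curves `α, β : [0, 1] → 𝕊³`.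
For disjoint oriented closed curves it is the degree of the map
`(α(s), β(t), u) ↦ (α(s) - u β(t)) / ‖α(s) - u β(t)‖`, `u ∈ [0, ∞]`, from their join to `𝕊³`,
that is the integral of the pulled back volume form divided by `vol 𝕊³ = 2π²`.
Integrating out `u` gives the formula of DeTurck-Gluck and Kuperberg with the kernel
`((π - a) cos a + sin a) / (4π² sin³ a)`, `a` being the spherical distance. The sign is such that
the oriented unit circles of the planes `(x₁, x₂)` and `(x₃, x₄)` have linking number `1`, i.e.
`𝕊³` is oriented as the boundary of the ball; `(θ, φ, τ)` is then a positive coordinate system. -/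
def gaussIntegral (α β : ℝ → E4) : ℝ :=
  (1 / (2 * Real.pi ^ 2)) *
    ∫ s in (0 : ℝ)..1, ∫ t in (0 : ℝ)..1, ∫ u in Ioi (0 : ℝ),
      u * Matrix.det (Matrix.of ![(α s).ofLp, (deriv α s).ofLp, (β t).ofLp, (deriv β t).ofLp]) /
        ‖α s - u • β t‖ ^ 4

/-- The linking number of two oriented links, each of which is presented as a finite union of arcs
`A i` (`i ∈ S`), respectively `B j` (`j ∈ T`), parametrized by `[0, 1]`; the arc is traversed
in the direction of the parametrization if its sign is `1` and in the opposite one otherwise. -/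
def linkingNumber {ι κ : Type*} (S : Finset ι) (a : ι → ℤˣ) (A : ι → ℝ → E4)
    (T : Finset κ) (b : κ → ℤˣ) (B : κ → ℝ → E4) : ℝ :=
  ∑ i ∈ S, ∑ j ∈ T, (((a i : ℤ) * (b j : ℤ) : ℤ) : ℝ) * gaussIntegral (A i) (B j)

/-- `lk(R̂, R̂')` for two oriented diagrams: `τ` increases on `v̂` if `v` is positive and decreases
otherwise. -/
def diagramLk (R : Finset Torus) (ε : Torus → ℤˣ) (R' : Finset Torus) (ε' : Torus → ℤˣ) : ℝ :=
  linkingNumber R ε vertexArc R' ε' vertexArc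

/-- `lk(R̂, β(R̂))` where `β` is an injective map from `R̂` to `𝕊³` and the link `β(R̂)`
is oriented coherently with `R̂`. -/
def pushOffLk (R : Finset Torus) (ε : Torus → ℤˣ) (β : E4 → E4) : ℝ :=
  linkingNumber R ε vertexArc R ε (fun v t => β (vertexArc v t))

/-! ## Thurston–Bennequin numbers of a diagram -/

/-- `δ > 0` is so small that no vertex of `R` has its `θ`-coordinate (`φ`-coordinate)
at distance in `(0, δ]` from that of a vertex of `R`. -/
def IsSmallShift (R : Finset Torus) (δ : ℝ) : Prop :=
  0 < δ ∧ ∀ v ∈ R, ∀ w ∈ R, ∀ s ∈ Ioc (0 : ℝ) δ,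
    w.1 ≠ v.1 + (s : Real.Angle) ∧ w.2 ≠ v.2 + (s : Real.Angle) ∧
    w.1 ≠ v.1 - (s : Real.Angle) ∧ w.2 ≠ v.2 - (s : Real.Angle)

lemma eventually_coe_ne (a : Real.Angle) : ∀ᶠ s : ℝ in 𝓝[>] 0, (s : Real.Angle) ≠ a := by
  by_cases ha : a = 0
  · subst ha
    filter_upwards [Ioo_mem_nhdsGT Real.pi_pos] with s hs h
    have h1 := Real.Angle.sin_coe s
    rw [h, Real.Angle.sin_zero] at h1
    exact (Real.sin_pos_of_pos_of_lt_pi hs.1 hs.2).ne h1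
  · have hc : ContinuousAt (fun s : ℝ => (s : Real.Angle)) 0 :=
      Real.Angle.continuous_coe.continuousAt
    have : ∀ᶠ s : ℝ in 𝓝 0, (s : Real.Angle) ≠ a := by
      refine hc.eventually_ne ?_
      simpa using fun h => ha h.symm
    exact this.filter_mono nhdsWithin_le_nhds

lemma exists_isSmallShift (R : Finset Torus) : ∃ δ, IsSmallShift R δ := by
  have h : ∀ᶠ s : ℝ in 𝓝[>] 0, ∀ v ∈ R, ∀ w ∈ R,
      w.1 ≠ v.1 + (s : Real.Angle) ∧ w.2 ≠ v.2 + (s : Real.Angle) ∧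
      w.1 ≠ v.1 - (s : Real.Angle) ∧ w.2 ≠ v.2 - (s : Real.Angle) := by
    refine (Finset.eventually_all R).2 fun v _ => (Finset.eventually_all R).2 fun w _ => ?_
    filter_upwards [eventually_coe_ne (w.1 - v.1), eventually_coe_ne (w.2 - v.2),
      eventually_coe_ne (v.1 - w.1), eventually_coe_ne (v.2 - w.2)] with s h1 h2 h3 h4
    refine ⟨fun h => h1 ?_, fun h => h2 ?_, fun h => h3 ?_, fun h => h4 ?_⟩ <;> rw [h] <;> abel
  obtain ⟨u, hu, hs⟩ := (mem_nhdsGT_iff_exists_Ioc_subset).1 h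
  exact ⟨u, hu, fun v hv w hw s hsu => hs hsu v hv w hw⟩

/-- A small shift length for `R`. -/
def smallShift (R : Finset Torus) : ℝ := (exists_isSmallShift R).choose

lemma smallShift_spec (R : Finset Torus) : IsSmallShift R (smallShift R) :=
  (exists_isSmallShift R).choose_spec

/-- The diagram `R` shifted by the vector `d`. -/
def shiftDiagram (R : Finset Torus) (d : Torus) : Finset Torus := R.map (addRightEmbedding d)

/-- `lk(R̂, R̂')` where `R'` is `R` shifted by `d`, with the orientation inherited from `R`. -/
def shiftLk (R : Finset Torus) (ε : Torus → ℤˣ) (d : Torus) : ℝ :=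
  diagramLk R ε (shiftDiagram R d) (fun v => ε (v - d))

/-- `tb₊(R)`: a small shift in the `(1, 1)`-direction. -/
def tbPlus (R : Finset Torus) (ε : Torus → ℤˣ) : ℝ :=
  shiftLk R ε ((smallShift R : Real.Angle), (smallShift R : Real.Angle))

/-- `tb₋(R)`: a small shift in the `(-1, 1)`-direction. -/
def tbMinus (R : Finset Torus) (ε : Torus → ℤˣ) : ℝ :=
  -shiftLk R ε (-(smallShift R : Real.Angle), (smallShift R : Real.Angle))

/-! ## Surfaces with corners -/

/-- `c` is continuous and piecewise `C¹` on `[0, 1]`. -/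
def IsPiecewiseC1 (c : ℝ → E4) : Prop :=
  ContinuousOn c (Icc 0 1) ∧ ∃ (k : ℕ) (t : Fin (k + 1) → ℝ), StrictMono t ∧
    t 0 = 0 ∧ t (Fin.last k) = 1 ∧
    ∀ i : Fin k, ContDiffOn ℝ 1 c (Icc (t i.castSucc) (t i.succ))

/-- `γ` is a `1`-periodic parametrization of a simple closed curve that is piecewise `C¹`,
regular (with non-zero one-sided derivatives) and cusp-free. -/
structure IsCuspFreeClosedCurve (γ : ℝ → E4) : Prop where
  periodic : Function.Periodic γ 1
  injOn : InjOn γ (Ico 0 1)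
  piecewiseC1 : IsPiecewiseC1 γ
  left_ne_zero : ∀ t, derivWithin γ (Iic t) t ≠ 0
  right_ne_zero : ∀ t, derivWithin γ (Ici t) t ≠ 0
  cuspFree : ∀ t, ¬ SameRay ℝ (derivWithin γ (Iic t) t) (-derivWithin γ (Ici t) t)

/-- `γ` is a `1`-periodic regular smooth parametrization of a simple closed curve. -/
structure IsSmoothClosedCurve (γ : ℝ → E4) : Prop where
  periodic : Function.Periodic γ 1
  injOn : InjOn γ (Ico 0 1)
  smooth : ContDiff ℝ ((⊤ : ℕ∞) : WithTop ℕ∞) γ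
  deriv_ne_zero : ∀ t, deriv γ t ≠ 0

/-- `B` is a finite disjoint union of simple closed curves whose parametrizations satisfy `P`. -/
def IsUnionOfCurves (P : (ℝ → E4) → Prop) (B : Set E4) : Prop :=
  ∃ (k : ℕ) (γ : Fin k → ℝ → E4), (∀ i, P (γ i)) ∧
    Pairwise (fun i j => Disjoint (range (γ i)) (range (γ j))) ∧ B = ⋃ i, range (γ i)

/-- `M` is an embedded two-dimensional `C¹` submanifold of `ℝ⁴` (without boundary):
near each of its points it can be straightened to a coordinate plane. -/
def IsC1Surface (M : Set E4) : Prop :=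
  ∀ p ∈ M, ∃ Φ : OpenPartialHomeomorph E4 E4, p ∈ Φ.source ∧
    ContDiffOn ℝ 1 Φ Φ.source ∧ ContDiffOn ℝ 1 Φ.symm Φ.target ∧
    ∀ x ∈ Φ.source, (x ∈ M ↔ (Φ x) 2 = 0 ∧ (Φ x) 3 = 0)

/-- `F ⊂ 𝕊³` is a surface with corners and `B = ∂F`: `F` lies in a `C¹` surface `M ⊂ 𝕊³` and is
bounded in `M` by a finite collection of disjoint piecewise smooth cusp-free simple closed
curves, which form the set `B` of those points of `F` that are not interior to `F` in `M`.
(A surface with boundary extends a little beyond its boundary, so `M` may be taken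
without boundary.) -/
def IsSurfaceWithCorners (F B : Set E4) : Prop :=
  ∃ M : Set E4, IsC1Surface M ∧ M ⊆ Metric.sphere (0 : E4) 1 ∧ F ⊆ M ∧ M ∩ closure F ⊆ F ∧
    F ⊆ closure {p | p ∈ F ∧ F ∈ 𝓝[M] p} ∧ B = {p | p ∈ F ∧ F ∉ 𝓝[M] p} ∧
    IsUnionOfCurves IsCuspFreeClosedCurve B

/-- The tangent plane of a surface with corners `F` at `p ∈ F`. -/
def tangentPlane (F : Set E4) (p : E4) : Submodule ℝ E4 :=
  Submodule.span ℝ (tangentConeAt ℝ F p)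

/-- The subspace of `T_p 𝕊³` given by `(x₁ dx₂ - x₂ dx₁) + σ (x₃ dx₄ - x₄ dx₃) = 0`. -/
def contactPlane (σ : ℝ) (p : E4) : Submodule ℝ E4 where
  carrier := {w | inner ℝ p w = 0 ∧ (p 0 * w 1 - p 1 * w 0) + σ * (p 2 * w 3 - p 3 * w 2) = 0}
  zero_mem' := by simp
  add_mem' := by
    rintro a b ⟨ha, ha'⟩ ⟨hb, hb'⟩
    refine ⟨by rw [inner_add_right, ha, hb, add_zero], ?_⟩
    simp only [PiLp.add_apply]
    linear_combination ha' + hb'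
  smul_mem' := by
    rintro c a ⟨ha, ha'⟩
    refine ⟨by rw [inner_smul_right, ha, mul_zero], ?_⟩
    simp only [PiLp.smul_apply, smul_eq_mul]
    linear_combination c * ha'

/-- `ξ₊ = ker (cos² (πτ/2) dφ + sin² (πτ/2) dθ)`; on `𝕊³` one has
`cos² (πτ/2) dφ = x₁ dx₂ - x₂ dx₁` and `sin² (πτ/2) dθ = x₃ dx₄ - x₄ dx₃`. -/
def xiPlus (p : E4) : Submodule ℝ E4 := contactPlane 1 p

/-- `ξ₋ = ker (cos² (πτ/2) dφ - sin² (πτ/2) dθ)`. -/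
def xiMinus (p : E4) : Submodule ℝ E4 := contactPlane (-1) p

/-- `H` identifies `L × [0, 1]` with a collar neighbourhood of `L` in `F`. -/
structure IsCollar (L F : Set E4) (H : E4 → ℝ → E4) : Prop where
  continuousOn : ContinuousOn (Function.uncurry H) (L ×ˢ Icc 0 1)
  injOn : InjOn (Function.uncurry H) (L ×ˢ Icc 0 1)
  zero : ∀ x ∈ L, H x 0 = x
  subset : Function.uncurry H '' (L ×ˢ Icc 0 1) ⊆ F
  nhds : ∀ x ∈ L, Function.uncurry H '' (L ×ˢ Icc 0 1) ∈ 𝓝[F] x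

/-- `β` is a parametrization by `R̂` of a link of the form `R̂^F`: the link `β(R̂)` together
with `R̂` bounds a collar neighbourhood of `R̂` in `F`, and `β` is the corresponding
identification of `R̂` with `β(R̂)`, so that `β(R̂)` is oriented coherently with `R̂`. -/
def IsPushOff (R : Finset Torus) (F : Set E4) (β : E4 → E4) : Prop :=
  ∃ H : E4 → ℝ → E4, IsCollar (linkOf R) F H ∧ (∀ x ∈ linkOf R, β x = H x 1) ∧
    ∀ v ∈ R, IsPiecewiseC1 (fun t => β (vertexArc v t))

/-! ## Framings -/

/-- A framing of `R`: an ordering in each pair of vertices forming an edge of `R`. -/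
structure DiagramFraming (R : Finset Torus) where
  lt : Torus → Torus → Prop
  isEdge : ∀ {v w}, lt v w → IsEdge R v w
  total : ∀ {v w}, IsEdge R v w → lt v w ∨ lt w v
  asymm : ∀ {v w}, lt v w → ¬ lt w v

/-- `F` is a surface with corners presenting a framing of the link `R̂`: it is a disjoint union
of annuli, identified by `H` with `R̂ × [0, 1]`, whose boundary consists of `R̂ = H(R̂ × 0)` and
of the smooth link `H(R̂ × 1)`, which is denoted by `R̂^f` and parametrized by `x ↦ H(x, 1)`. -/
structure IsFramingSurface (R : Finset Torus) (F : Set E4) (H : E4 → ℝ → E4) : Prop where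
  collar : IsCollar (linkOf R) F H
  image_eq : Function.uncurry H '' (linkOf R ×ˢ Icc 0 1) = F
  corners : IsSurfaceWithCorners F (linkOf R ∪ (fun x => H x 1) '' linkOf R)
  smooth : IsUnionOfCurves IsSmoothClosedCurve ((fun x => H x 1) '' linkOf R)
  piecewiseC1 : ∀ v ∈ R, IsPiecewiseC1 (fun t => H (vertexArc v t) 1)

/-- The closed arc `[a, b]` of the oriented circle. -/
def circleArc (a b : Real.Angle) : Set Real.Angle :=
  {x | ∃ s t : ℝ, 0 ≤ s ∧ s ≤ t ∧ t < 2 * Real.pi ∧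
    x = a + (s : Real.Angle) ∧ b = a + (t : Real.Angle)}

/-- The image in `𝕊³` of `[v, w] × [0, 1]`, where `{v, w}` is an edge and `[v, w]` is the arc
from `v` to `w` of the corresponding meridian or longitude (note that `[a, a] = {a}`). -/
def edgeSector (v w : Torus) : Set E4 :=
  {x | ∃ θ ∈ circleArc v.1 w.1, ∃ φ ∈ circleArc v.2 w.2, ∃ τ ∈ Icc (0 : ℝ) 1,
    x = joinPoint θ φ τ}

/-- `F` approaches its boundary point `p` from the side of the sector `D`: the germs of `F` and
of `D` at `p` are equivalent pizza slices. -/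
def ApproachesAlong (F D : Set E4) (p : E4) : Prop :=
  (fun x => Metric.infDist x D) =o[𝓝[F] p] (fun x => dist x p)

/-- The framing `f` of `R` is associated with the surface `F`: if `w > v` in `f`, then at the
point `p` of the circle `τ = 0` or `τ = 1` corresponding to the edge `{v, w}` the
surface `F` approaches `p` along `[v, w] × [0, 1]`. -/
def IsAssociatedFraming {R : Finset Torus} (f : DiagramFraming R) (F : Set E4) : Prop :=
  ∀ v w, f.lt v w →
    (v.2 = w.2 → ApproachesAlong F (edgeSector v w) (joinPoint v.1 v.2 0)) ∧
    (v.1 = w.1 → ApproachesAlong F (edgeSector v w) (joinPoint v.1 v.2 1))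

/-- `x = ⟨f⟩ = lk(R̂, R̂^f)`: computed from a surface which is tangent to `ξ₊` or to `ξ₋`
at every point of `R̂` and with which the framing `f` of `R` is associated. -/
def IsFramingNumber (R : Finset Torus) (ε : Torus → ℤˣ) (f : DiagramFraming R) (x : ℝ) : Prop :=
  ∃ (F : Set E4) (H : E4 → ℝ → E4), IsFramingSurface R F H ∧
    (∀ p ∈ linkOf R, tangentPlane F p = xiPlus p ∨ tangentPlane F p = xiMinus p) ∧
    IsAssociatedFraming f F ∧ x = pushOffLk R ε (fun y => H y 1)

end

open MeasureTheory Real ContDiff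

noncomputable section

/-- The measure on the open positive quadrant. -/
abbrev quadrantMeasure : Measure (ℝ × ℝ) :=
  (volume.restrict (Ioi (0 : ℝ))).prod (volume.restrict (Ioi (0 : ℝ)))

/-- The squared distance from `x` to the point `(p, 0, q, 0)`. -/
def sqDist (x : E4) (a : ℝ × ℝ) : ℝ :=
  (a.1 - x 0) ^ 2 + x 1 ^ 2 + (a.2 - x 2) ^ 2 + x 3 ^ 2

/-- The closed quadrant of the points `(p, 0, q, 0)`, `p, q ≥ 0`. -/
def stdQuadrant : Set E4 := {x | 0 ≤ x 0 ∧ x 1 = 0 ∧ 0 ≤ x 2 ∧ x 3 = 0}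

/-- The integral of the Gauss kernel over the standard quadrant. -/
def quadrantPotential (x : E4) : ℝ := ∫ a, (sqDist x a ^ 2)⁻¹ ∂quadrantMeasure

lemma sqDist_lower_bound_sq {x : E4} (hx : x ∉ stdQuadrant) :
    ∃ c > 0, ∀ᶠ y in 𝓝 x, ∀ p q : ℝ, 0 ≤ p → 0 ≤ q →
      c * (1 + p ^ 2 + q ^ 2) ^ 2 ≤ sqDist y (p, q) ^ 2 ∧ 0 < sqDist y (p, q) := by
  set m : E4 → ℝ := fun y => y 1 ^ 2 + y 3 ^ 2 + min (y 0) 0 ^ 2 + min (y 2) 0 ^ 2 with hm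
  have hmc : Continuous m := by
    have h (i : Fin 4) : Continuous fun y : E4 => y i := by fun_prop
    exact ((((h 1).pow 2).add ((h 3).pow 2)).add (((h 0).min continuous_const).pow 2)).add
      (((h 2).min continuous_const).pow 2)
  have hm0 : 0 < m x := by
    by_contra hn
    apply hx
    have h1 := sq_nonneg (x 1)
    have h2 := sq_nonneg (x 3)
    have h3 := sq_nonneg (min (x 0) 0)
    have h4 := sq_nonneg (min (x 2) 0)
    simp only [hm, not_lt] at hn
    have e1 : x 1 ^ 2 = 0 := by linarith
    have e2 : x 3 ^ 2 = 0 := by linarith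
    have e3 : min (x 0) 0 ^ 2 = 0 := by linarith
    have e4 : min (x 2) 0 ^ 2 = 0 := by linarith
    simp only [ne_eq, OfNat.ofNat_ne_zero, not_false_eq_true, pow_eq_zero_iff] at e1 e2 e3 e4
    exact ⟨by simpa using e3, e1, by simpa using e4, e2⟩
  set K : E4 → ℝ := fun y => y 0 ^ 2 + y 2 ^ 2 with hK
  have hKc : Continuous K := by simp only [hK]; fun_prop
  set D : ℝ := 2 + (1 + 2 * (K x + 1)) / (m x / 2) with hD
  refine ⟨(D ^ 2)⁻¹, by positivity, ?_⟩
  filter_upwards [hmc.continuousAt.eventually_const_lt (half_lt_self hm0),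
    hKc.continuousAt.eventually_lt_const (lt_add_one (K x))] with y h1 h2 p q hp hq
  set r := sqDist y (p, q) with hr
  have a1 : m y ≤ r := by
    have h0 : min (y 0) 0 ^ 2 ≤ (p - y 0) ^ 2 := by
      rcases le_total (y 0) 0 with h | h
      · rw [min_eq_left h]; nlinarith
      · rw [min_eq_right h]; nlinarith [sq_nonneg (p - y 0)]
    have h0' : min (y 2) 0 ^ 2 ≤ (q - y 2) ^ 2 := by
      rcases le_total (y 2) 0 with h | h
      · rw [min_eq_left h]; nlinarith
      · rw [min_eq_right h]; nlinarith [sq_nonneg (q - y 2)]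
    simp only [hr, sqDist, hm]; linarith
  have a2 : (p ^ 2 + q ^ 2) / 2 - K y ≤ r := by
    simp only [hr, sqDist, hK]
    nlinarith [sq_nonneg (p - 2 * y 0), sq_nonneg (q - 2 * y 2), sq_nonneg (y 1), sq_nonneg (y 3)]
  have hrpos : 0 < r := by linarith [half_pos hm0]
  have a3 : 1 + p ^ 2 + q ^ 2 ≤ D * r := by
    have : (1 + 2 * (K x + 1)) ≤ (1 + 2 * (K x + 1)) / (m x / 2) * r := by
      rw [div_mul_eq_mul_div, le_div_iff₀ (half_pos hm0)]
      exact mul_le_mul_of_nonneg_left (by linarith) (by positivity)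
    rw [hD, add_mul]; linarith
  refine ⟨?_, hrpos⟩
  rw [inv_mul_le_iff₀ (by positivity), ← mul_pow]
  gcongr

lemma sqDist_lower_bound {x : E4} (hx : x ∉ stdQuadrant) :
    ∃ c > 0, ∀ᶠ y in 𝓝 x, ∀ p q : ℝ, 0 ≤ p → 0 ≤ q →
      c * ((1 + p ^ 2) * (1 + q ^ 2)) ≤ sqDist y (p, q) ^ 2 ∧ 0 < sqDist y (p, q) := by
  obtain ⟨c, hc, h⟩ := sqDist_lower_bound_sq hx
  refine ⟨c, hc, h.mono fun y hy p q hp hq => ⟨le_trans ?_ (hy p q hp hq).1, (hy p q hp hq).2⟩⟩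
  gcongr
  nlinarith [sq_nonneg p, sq_nonneg q, mul_nonneg (sq_nonneg p) (sq_nonneg q)]

lemma ae_quadrantMeasure : ∀ᵐ a ∂quadrantMeasure, 0 < a.1 ∧ 0 < a.2 := by
  rw [quadrantMeasure, Measure.prod_restrict, ae_restrict_iff' (measurableSet_Ioi.prod measurableSet_Ioi)]
  exact ae_of_all _ fun a ha => ha

lemma integrable_quadrant_bound (K : ℝ) :
    Integrable (fun a : ℝ × ℝ => K * ((1 + a.1 ^ 2)⁻¹ * (1 + a.2 ^ 2)⁻¹)) quadrantMeasure := by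
  have h := (integrable_inv_one_add_sq.restrict (s := Ioi (0 : ℝ)))
  exact (h.mul_prod h).const_mul K

lemma sqDist_continuous : Continuous fun y : E4 × ℝ × ℝ => sqDist y.1 y.2 := by
  unfold sqDist; fun_prop

lemma sqDist_measurable (x : E4) : Measurable (sqDist x) := by
  unfold sqDist; fun_prop

/-- The linear functional `ξ ↦ ⟨y, ξ⟩` with `y = (p, 0, q, 0) - x`. -/
def quadFunctional (x : E4) (a : ℝ × ℝ) : E4 →L[ℝ] ℝ :=
  (a.1 - x 0) • EuclideanSpace.proj (0 : Fin 4) + (-x 1) • EuclideanSpace.proj (1 : Fin 4)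
    + (a.2 - x 2) • EuclideanSpace.proj (2 : Fin 4) + (-x 3) • EuclideanSpace.proj (3 : Fin 4)

lemma quadFunctional_apply (x : E4) (a : ℝ × ℝ) (ξ : E4) : quadFunctional x a ξ =
    (a.1 - x 0) * ξ 0 - x 1 * ξ 1 + (a.2 - x 2) * ξ 2 - x 3 * ξ 3 := by
  simp [quadFunctional]; ring

lemma quadFunctional_norm_sq_le (x : E4) (a : ℝ × ℝ) : ‖quadFunctional x a‖ ^ 2 ≤ sqDist x a := by
  have h0 : 0 ≤ sqDist x a := by unfold sqDist; positivity
  have : ‖quadFunctional x a‖ ≤ √(sqDist x a) := by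
    refine ContinuousLinearMap.opNorm_le_bound _ (sqrt_nonneg _) fun ξ => ?_
    rw [EuclideanSpace.norm_eq, ← sqrt_mul h0, norm_eq_abs]
    apply abs_le_sqrt
    simp only [quadFunctional_apply, Fin.sum_univ_four, norm_eq_abs, sq_abs, sqDist]
    set A := a.1 - x 0
    set B := a.2 - x 2
    nlinarith [sq_nonneg (A * ξ 1 + x 1 * ξ 0), sq_nonneg (A * ξ 2 - B * ξ 0),
      sq_nonneg (A * ξ 3 + x 3 * ξ 0), sq_nonneg (x 1 * ξ 2 + B * ξ 1),
      sq_nonneg (x 1 * ξ 3 - x 3 * ξ 1), sq_nonneg (B * ξ 3 + x 3 * ξ 2)]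
  calc _ ≤ √(sqDist x a) ^ 2 := by gcongr
    _ = _ := sq_sqrt h0

lemma hasFDerivAt_sqDist (x : E4) (a : ℝ × ℝ) :
    HasFDerivAt (fun y => sqDist y a) ((-2 : ℝ) • quadFunctional x a) x := by
  have h (i : Fin 4) : HasFDerivAt (fun y : E4 => y i) (EuclideanSpace.proj i : E4 →L[ℝ] ℝ) x :=
    (EuclideanSpace.proj i : E4 →L[ℝ] ℝ).hasFDerivAt
  have := (((((h 0).const_sub a.1).pow 2).add ((h 1).pow 2)).add (((h 2).const_sub a.2).pow 2)).add
    ((h 3).pow 2)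
  refine this.congr_fderiv ?_
  ext ξ
  simp [quadFunctional_apply]
  ring

lemma hasFDerivAt_quadKernel (x : E4) (a : ℝ × ℝ) (h : 0 < sqDist x a) :
    HasFDerivAt (fun y => (sqDist y a ^ 2)⁻¹)
      ((4 * (sqDist x a ^ 3)⁻¹) • quadFunctional x a) x := by
  have h1 := ((hasFDerivAt_sqDist x a).pow 2)
  have h2 := (hasDerivAt_inv (pow_pos h 2).ne').comp_hasFDerivAt x h1
  refine h2.congr_fderiv ?_
  ext ξ
  simp [quadFunctional_apply]
  field_simp
  ring

lemma norm_quadKernel_fderiv_le {x : E4} {a : ℝ × ℝ} (h : 0 < sqDist x a) :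
    ‖(4 * (sqDist x a ^ 3)⁻¹) • quadFunctional x a‖ ≤ 4 * ((sqDist x a ^ 2)⁻¹ + (sqDist x a ^ 3)⁻¹) := by
  have h1 := quadFunctional_norm_sq_le x a
  rw [norm_smul, norm_of_nonneg (by positivity)]
  set N := ‖quadFunctional x a‖
  set r := sqDist x a
  have : N ≤ r + 1 := by nlinarith [sq_nonneg (N - 1)]
  calc 4 * (r ^ 3)⁻¹ * N ≤ 4 * (r ^ 3)⁻¹ * (r + 1) := by gcongr
    _ = _ := by field_simp

lemma integrable_quadKernel {x : E4} (hx : x ∉ stdQuadrant) :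
    Integrable (fun a => (sqDist x a ^ 2)⁻¹) quadrantMeasure := by
  obtain ⟨c, hc, h⟩ := sqDist_lower_bound hx
  have h := h.self_of_nhds
  refine (integrable_quadrant_bound c⁻¹).mono' ?_ ?_
  · exact ((sqDist_measurable x).pow_const 2).inv.aestronglyMeasurable
  · filter_upwards [ae_quadrantMeasure] with a ha
    have := h a.1 a.2 ha.1.le ha.2.le
    rw [norm_of_nonneg (by positivity), ← mul_inv, ← mul_inv]
    exact inv_anti₀ (by positivity) this.1

/-- The derivative of `quadrantPotential`. -/
def quadrantPotentialDeriv (x : E4) : E4 →L[ℝ] ℝ :=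
  ∫ a, (4 * (sqDist x a ^ 3)⁻¹) • quadFunctional x a ∂quadrantMeasure

lemma quadFunctional_measurable (x : E4) :
    AEStronglyMeasurable (fun a => (4 * (sqDist x a ^ 3)⁻¹) • quadFunctional x a) quadrantMeasure := by
  have h1 : Measurable fun a => 4 * (sqDist x a ^ 3)⁻¹ :=
    (((sqDist_measurable x).pow_const 3).inv).const_mul 4
  have h2 : Continuous fun a => quadFunctional x a := by unfold quadFunctional; fun_prop
  exact h1.aestronglyMeasurable.smul h2.aestronglyMeasurable

lemma hasFDerivAt_quadrantPotential {x : E4} (hx : x ∉ stdQuadrant) :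
    Integrable (fun a => (4 * (sqDist x a ^ 3)⁻¹) • quadFunctional x a) quadrantMeasure ∧
    HasFDerivAt quadrantPotential (quadrantPotentialDeriv x) x := by
  obtain ⟨c, hc, h⟩ := sqDist_lower_bound hx
  set bd : ℝ × ℝ → ℝ := fun a => 4 * (c⁻¹ + c⁻¹ + c⁻¹ ^ 2) * ((1 + a.1 ^ 2)⁻¹ * (1 + a.2 ^ 2)⁻¹)
  have hb : ∀ y, (∀ p q : ℝ, 0 ≤ p → 0 ≤ q →
      c * ((1 + p ^ 2) * (1 + q ^ 2)) ≤ sqDist y (p, q) ^ 2 ∧ 0 < sqDist y (p, q)) →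
      ∀ a : ℝ × ℝ, 0 < a.1 ∧ 0 < a.2 → ‖(4 * (sqDist y a ^ 3)⁻¹) • quadFunctional y a‖ ≤ bd a := by
    intro y hy a ha
    obtain ⟨h1, h2⟩ := hy a.1 a.2 ha.1.le ha.2.le
    refine (norm_quadKernel_fderiv_le h2).trans ?_
    set r := sqDist y a
    change _ ≤ _ at h1
    set m := (1 + a.1 ^ 2) * (1 + a.2 ^ 2) with hm
    have hm1 : 1 ≤ m := by nlinarith [sq_nonneg a.1, sq_nonneg a.2, mul_nonneg (sq_nonneg a.1) (sq_nonneg a.2)]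
    have e1 : (r ^ 2)⁻¹ ≤ c⁻¹ * m⁻¹ := by
      rw [← mul_inv]; exact inv_anti₀ (by positivity) h1
    have e2 : (r ^ 3)⁻¹ ≤ (r ^ 2)⁻¹ + ((r ^ 2)⁻¹) ^ 2 := by
      have : 1 ≤ r + r⁻¹ := by
        rcases le_total 1 r with h | h
        · have := inv_pos.2 h2; linarith
        · have := one_le_inv_iff₀.2 ⟨h2, h⟩; linarith
      calc (r ^ 3)⁻¹ = (r ^ 3)⁻¹ * 1 := by ring
        _ ≤ (r ^ 3)⁻¹ * (r + r⁻¹) := by gcongr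
        _ = _ := by field_simp
    have e3 : ((r ^ 2)⁻¹) ^ 2 ≤ c⁻¹ ^ 2 * m⁻¹ := by
      calc ((r ^ 2)⁻¹) ^ 2 ≤ (c⁻¹ * m⁻¹) ^ 2 := by gcongr
        _ = c⁻¹ ^ 2 * (m⁻¹ * m⁻¹) := by ring
        _ ≤ c⁻¹ ^ 2 * (m⁻¹ * 1) := by gcongr; exact inv_le_one_of_one_le₀ hm1
        _ = _ := by ring
    have : bd a = 4 * (c⁻¹ * m⁻¹ + (c⁻¹ * m⁻¹ + c⁻¹ ^ 2 * m⁻¹)) := by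
      simp only [bd, hm, mul_inv]; ring
    rw [this]
    linarith
  have hint : Integrable bd quadrantMeasure := integrable_quadrant_bound _
  refine ⟨hint.mono' (quadFunctional_measurable x) ?_, ?_⟩
  · filter_upwards [ae_quadrantMeasure] with a ha
    exact hb x h.self_of_nhds a ha
  · refine hasFDerivAt_integral_of_dominated_of_fderiv_le (F := fun y a => (sqDist y a ^ 2)⁻¹)
      (F' := fun y a => (4 * (sqDist y a ^ 3)⁻¹) • quadFunctional y a) (bound := bd) h ?_
      (integrable_quadKernel hx) (quadFunctional_measurable x) ?_ hint ?_
    · exact .of_forall fun y => ((sqDist_measurable y).pow_const 2).inv.aestronglyMeasurable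
    · filter_upwards [ae_quadrantMeasure] with a ha y hy
      exact hb y hy a ha
    · filter_upwards [ae_quadrantMeasure] with a ha y hy
      exact hasFDerivAt_quadKernel y a (hy a.1 a.2 ha.1.le ha.2.le).2

/-- The determinant of three vectors projected to three coordinates. -/
def det3 (a b c : Fin 4) (x y z : E4) : ℝ :=
  x a * (y b * z c - y c * z b) - x b * (y a * z c - y c * z a) + x c * (y a * z b - y b * z a)

lemma integral_Ioi_deriv_div_sq (x₀ h α β c : ℝ) (hc : 0 < c)
    (hb : ∀ p : ℝ, 0 ≤ p → c * (1 + p ^ 2) ≤ ((p - x₀) ^ 2 + h) ^ 2 ∧ 0 < (p - x₀) ^ 2 + h)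
    (hi : IntegrableOn (fun p => α * (((p - x₀) ^ 2 + h) ^ 2)⁻¹
      - 4 * (p - x₀) * (α * (p - x₀) + β) * (((p - x₀) ^ 2 + h) ^ 3)⁻¹) (Ioi 0)) :
    ∫ p in Ioi (0 : ℝ), (α * (((p - x₀) ^ 2 + h) ^ 2)⁻¹
      - 4 * (p - x₀) * (α * (p - x₀) + β) * (((p - x₀) ^ 2 + h) ^ 3)⁻¹)
      = -((α * (0 - x₀) + β) * (((0 - x₀) ^ 2 + h) ^ 2)⁻¹) := by
  set f : ℝ → ℝ := fun p => (α * (p - x₀) + β) * (((p - x₀) ^ 2 + h) ^ 2)⁻¹ with hf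
  have hd : ∀ p : ℝ, 0 ≤ p → HasDerivAt f (α * (((p - x₀) ^ 2 + h) ^ 2)⁻¹
      - 4 * (p - x₀) * (α * (p - x₀) + β) * (((p - x₀) ^ 2 + h) ^ 3)⁻¹) p := by
    intro p hp
    have h0 := (hb p hp).2
    have h1 : HasDerivAt (fun p : ℝ => p - x₀) 1 p := (hasDerivAt_id p).sub_const _
    have h2 := ((h1.pow 2).add_const h).pow 2
    have h3 := ((h1.const_mul α).add_const β).mul (h2.inv (pow_pos h0 2).ne')
    refine h3.congr_deriv ?_
    simp only [Pi.pow_apply, Pi.inv_apply]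
    field_simp
    push_cast
    ring
  have ht : Tendsto f atTop (𝓝 0) := by
    have e : Tendsto (fun p : ℝ => c⁻¹ * ((|α| + |β - α * x₀|) * p⁻¹)) atTop (𝓝 0) := by
      simpa using (tendsto_inv_atTop_zero.const_mul (|α| + |β - α * x₀|)).const_mul c⁻¹
    refine squeeze_zero_norm' ?_ e
    filter_upwards [eventually_ge_atTop (1 : ℝ)] with p hp
    have hp0 : (0 : ℝ) < p := by linarith
    obtain ⟨h1, h2⟩ := hb p hp0.le
    have h3 : |α * (p - x₀) + β| ≤ (|α| + |β - α * x₀|) * p := by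
      calc |α * (p - x₀) + β| = |α * p + (β - α * x₀)| := by ring_nf
        _ ≤ |α * p| + |β - α * x₀| := abs_add_le _ _
        _ = |α| * p + |β - α * x₀| * 1 := by rw [abs_mul, abs_of_pos hp0, mul_one]
        _ ≤ |α| * p + |β - α * x₀| * p := by gcongr
        _ = _ := by ring
    have h4 : (((p - x₀) ^ 2 + h) ^ 2)⁻¹ ≤ c⁻¹ * (p ^ 2)⁻¹ := by
      rw [← mul_inv]
      exact inv_anti₀ (by positivity) (le_trans (by gcongr; linarith) h1)
    rw [hf, norm_mul, norm_eq_abs, norm_of_nonneg (by positivity)]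
    calc _ ≤ (|α| + |β - α * x₀|) * p * (c⁻¹ * (p ^ 2)⁻¹) := by gcongr
      _ = _ := by field_simp
  have := integral_Ioi_of_hasDerivAt_of_tendsto (hd 0 le_rfl).continuousAt.continuousWithinAt
    (fun p hp => hd p (le_of_lt hp)) hi ht
  rw [this, zero_sub]

lemma integrable_quad_mul {x : E4} (hx : x ∉ stdQuadrant) {u : ℝ × ℝ → ℝ} (hu : Measurable u)
    (h : ∀ a, |u a| ≤ sqDist x a) :
    Integrable (fun a => u a * (sqDist x a ^ 3)⁻¹) quadrantMeasure := by
  obtain ⟨c, hc, hl⟩ := sqDist_lower_bound hx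
  have hl := hl.self_of_nhds
  refine (integrable_quadKernel hx).mono' ?_ ?_
  · exact (hu.mul ((sqDist_measurable x).pow_const 3).inv).aestronglyMeasurable
  · filter_upwards [ae_quadrantMeasure] with a ha
    have h0 := (hl a.1 a.2 ha.1.le ha.2.le).2
    rw [norm_mul, norm_eq_abs, norm_of_nonneg (by positivity)]
    calc _ ≤ sqDist x a * (sqDist x a ^ 3)⁻¹ := by gcongr; exact h a
      _ = _ := by
        field_simp

/-- The integral of the kernel over the first bounding ray of the quadrant. -/
def rayPotentialFst (x : E4) : ℝ := ∫ p in Ioi (0 : ℝ), (sqDist x (p, 0) ^ 2)⁻¹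

/-- The integral of the kernel over the second bounding ray of the quadrant. -/
def rayPotentialSnd (x : E4) : ℝ := ∫ q in Ioi (0 : ℝ), (sqDist x (0, q) ^ 2)⁻¹

lemma quadrant_stokes {x : E4} (hx : x ∉ stdQuadrant) (ξ η : E4) :
    2 * (ξ 3 * η 1 - ξ 1 * η 3) * quadrantPotential x +
      (x 3 * η 1 - x 1 * η 3) * quadrantPotentialDeriv x ξ -
      (x 3 * ξ 1 - x 1 * ξ 3) * quadrantPotentialDeriv x η =
    det3 0 1 3 x ξ η * rayPotentialSnd x - det3 1 2 3 x ξ η * rayPotentialFst x := by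
  obtain ⟨c, hc, hl⟩ := sqDist_lower_bound hx
  have hl := hl.self_of_nhds
  have hK := integrable_quadKernel hx
  obtain ⟨hD, -⟩ := hasFDerivAt_quadrantPotential hx
  have m1 : Measurable fun a : ℝ × ℝ => a.1 - x 0 := by fun_prop
  have m2 : Measurable fun a : ℝ × ℝ => a.2 - x 2 := by fun_prop
  have i00 := integrable_quad_mul hx (m1.mul m1) fun a => by
    simp only [Pi.mul_apply, sqDist]; rw [abs_le]
    constructor <;> nlinarith [sq_nonneg (a.1 - x 0), sq_nonneg (a.2 - x 2), sq_nonneg (x 1), sq_nonneg (x 3)]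
  have i22 := integrable_quad_mul hx (m2.mul m2) fun a => by
    simp only [Pi.mul_apply, sqDist]; rw [abs_le]
    constructor <;> nlinarith [sq_nonneg (a.1 - x 0), sq_nonneg (a.2 - x 2), sq_nonneg (x 1), sq_nonneg (x 3)]
  have i01 (i : Fin 4) (hi : i = 1 ∨ i = 3) := integrable_quad_mul hx (m1.mul_const (x i)) fun a => by
    simp only [sqDist]; rw [abs_le]
    rcases hi with rfl | rfl <;> constructor <;> nlinarith [sq_nonneg (a.1 - x 0 - x 1), sq_nonneg (a.1 - x 0 + x 1), sq_nonneg (a.1 - x 0 - x 3), sq_nonneg (a.1 - x 0 + x 3), sq_nonneg (a.2 - x 2), sq_nonneg (x 1), sq_nonneg (x 3)]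
  have i21 (i : Fin 4) (hi : i = 1 ∨ i = 3) := integrable_quad_mul hx (m2.mul_const (x i)) fun a => by
    simp only [sqDist]; rw [abs_le]
    rcases hi with rfl | rfl <;> constructor <;> nlinarith [sq_nonneg (a.2 - x 2 - x 1), sq_nonneg (a.2 - x 2 + x 1), sq_nonneg (a.2 - x 2 - x 3), sq_nonneg (a.2 - x 2 + x 3), sq_nonneg (a.1 - x 0), sq_nonneg (x 1), sq_nonneg (x 3)]
  set α := -(ξ 1 * η 3 - ξ 3 * η 1) with hα
  set β := -(x 1 * (ξ 0 * η 3 - ξ 3 * η 0) - x 3 * (ξ 0 * η 1 - ξ 1 * η 0)) with hβ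
  set β' := -(x 1 * (ξ 2 * η 3 - ξ 3 * η 2)) - x 3 * (ξ 1 * η 2 - ξ 2 * η 1) with hβ'
  set dA : ℝ × ℝ → ℝ := fun a => α * (sqDist x a ^ 2)⁻¹
    - 4 * (a.1 - x 0) * (α * (a.1 - x 0) + β) * (sqDist x a ^ 3)⁻¹ with hdA
  set dB : ℝ × ℝ → ℝ := fun a => α * (sqDist x a ^ 2)⁻¹
    - 4 * (a.2 - x 2) * (α * (a.2 - x 2) + β') * (sqDist x a ^ 3)⁻¹ with hdB
  have iA : Integrable dA quadrantMeasure := by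
    have := ((hK.const_mul α).sub (((i00.const_mul (4 * α)).add
      ((i01 1 (.inl rfl)).const_mul (-4 * (ξ 0 * η 3 - ξ 3 * η 0)))).add
      ((i01 3 (.inr rfl)).const_mul (4 * (ξ 0 * η 1 - ξ 1 * η 0)))))
    refine this.congr (.of_forall fun a => ?_)
    simp only [hdA, hβ, Pi.sub_apply, Pi.add_apply, Pi.mul_apply]
    ring
  have iB : Integrable dB quadrantMeasure := by
    have := ((hK.const_mul α).sub (((i22.const_mul (4 * α)).add
      ((i21 1 (.inl rfl)).const_mul (-4 * (ξ 2 * η 3 - ξ 3 * η 2)))).add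
      ((i21 3 (.inr rfl)).const_mul (-4 * (ξ 1 * η 2 - ξ 2 * η 1)))))
    refine this.congr (.of_forall fun a => ?_)
    simp only [hdB, hβ', Pi.sub_apply, Pi.add_apply, Pi.mul_apply]
    ring
  have eA : ∫ a, dA a ∂quadrantMeasure = -(det3 0 1 3 x ξ η * rayPotentialSnd x) := by
    rw [quadrantMeasure, integral_prod_symm _ iA, rayPotentialSnd, ← integral_const_mul,
      ← integral_neg]
    have iA' := iA.prod_left_ae
    refine integral_congr_ae ?_
    filter_upwards [iA', ae_restrict_mem measurableSet_Ioi] with q hq1 hq2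
    have e : ∀ p, sqDist x (p, q) = (p - x 0) ^ 2 + (x 1 ^ 2 + (q - x 2) ^ 2 + x 3 ^ 2) :=
      fun p => by simp only [sqDist]; ring
    simp only [hdA, e] at hq1 ⊢
    rw [integral_Ioi_deriv_div_sq (x 0) _ α β c hc ?_ hq1]
    · simp only [det3, hα, hβ]; ring
    · intro p hp
      have := hl p q hp (le_of_lt hq2)
      rw [e] at this
      refine ⟨le_trans ?_ this.1, this.2⟩
      gcongr
      nlinarith [sq_nonneg p, sq_nonneg q, mul_nonneg (sq_nonneg p) (sq_nonneg q)]
  have eB : ∫ a, dB a ∂quadrantMeasure = det3 1 2 3 x ξ η * rayPotentialFst x := by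
    rw [quadrantMeasure, integral_prod _ iB, rayPotentialFst, ← integral_const_mul]
    have iB' := iB.prod_right_ae
    refine integral_congr_ae ?_
    filter_upwards [iB', ae_restrict_mem measurableSet_Ioi] with p hq1 hq2
    have e : ∀ q, sqDist x (p, q) = (q - x 2) ^ 2 + (x 1 ^ 2 + (p - x 0) ^ 2 + x 3 ^ 2) :=
      fun q => by simp only [sqDist]; ring
    simp only [hdB, e] at hq1 ⊢
    rw [integral_Ioi_deriv_div_sq (x 2) _ α β' c hc ?_ hq1]
    · simp only [det3, hα, hβ']; ring
    · intro q hp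
      have := hl p q (le_of_lt hq2) hp
      rw [e] at this
      refine ⟨le_trans ?_ this.1, this.2⟩
      gcongr
      nlinarith [sq_nonneg p, sq_nonneg q, mul_nonneg (sq_nonneg p) (sq_nonneg q)]
  have eD : ∀ ζ, quadrantPotentialDeriv x ζ =
      ∫ a, (4 * (sqDist x a ^ 3)⁻¹) * quadFunctional x a ζ ∂quadrantMeasure := fun ζ => by
    rw [quadrantPotentialDeriv, ContinuousLinearMap.integral_apply hD]
    rfl
  have iD : ∀ ζ, Integrable (fun a => (4 * (sqDist x a ^ 3)⁻¹) * quadFunctional x a ζ) quadrantMeasure :=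
    fun ζ => (ContinuousLinearMap.apply ℝ ℝ ζ).integrable_comp hD
  have key : det3 0 1 3 x ξ η * rayPotentialSnd x - det3 1 2 3 x ξ η * rayPotentialFst x =
      -∫ a, (dA a + dB a) ∂quadrantMeasure := by
    rw [integral_add iA iB, eA, eB]; ring
  rw [key, eD, eD, quadrantPotential, ← integral_const_mul, ← integral_const_mul,
    ← integral_const_mul, ← integral_add (hK.const_mul _) ((iD ξ).const_mul _)]
  refine (integral_sub ((hK.const_mul _).add ((iD ξ).const_mul _))
    ((iD η).const_mul _)).symm.trans ?_
  rw [← integral_neg]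
  refine integral_congr_ae ?_
  filter_upwards [ae_quadrantMeasure] with a ha
  simp only [hdA, hdB, quadFunctional_apply, Pi.add_apply]
  field_simp
  clear_value α β β'
  subst hα hβ hβ'
  have e : sqDist x a = (a.1 - x 0) ^ 2 + x 1 ^ 2 + (a.2 - x 2) ^ 2 + x 3 ^ 2 := rfl
  rw [e]
  ring

/-- The two coordinates of the torus: `φ` for `false` and `θ` for `true`. -/
def ang : Bool → Torus → Angle
  | false, v => v.2
  | true, v => v.1

lemma eq_of_ang {v w : Torus} (i : Bool) (h : ang i v = ang i w) (h' : ang (!i) v = ang (!i) w) :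
    v = w := by
  cases i
  · exact Prod.ext h' h
  · exact Prod.ext h h'

open Classical in
/-- The other vertex of `R` with the same coordinate number `i` as `v`. -/
def partner (R : Finset Torus) (i : Bool) (v : Torus) : Torus :=
  if h : ∃ w, w ∈ R ∧ w ≠ v ∧ ang i w = ang i v then h.choose else v

section Diagram

variable {R : Finset Torus}

lemma ncard_ang_eq (hR : IsLinkDiagram R) (i : Bool) {v : Torus} (hv : v ∈ R) :
    {w : Torus | w ∈ R ∧ ang i w = ang i v}.ncard = 2 := by
  have h : {w : Torus | w ∈ R ∧ ang i w = ang i v}.ncard = 0 ∨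
      {w : Torus | w ∈ R ∧ ang i w = ang i v}.ncard = 2 := by
    cases i
    · exact hR.2 v.2
    · exact hR.1 v.1
  refine h.resolve_left fun h0 => ?_
  have hf : {w : Torus | w ∈ R ∧ ang i w = ang i v}.Finite := R.finite_toSet.subset fun w hw => hw.1
  rw [Set.ncard_eq_zero hf] at h0
  exact (h0 ▸ (⟨hv, rfl⟩ : v ∈ {w : Torus | w ∈ R ∧ ang i w = ang i v}) : v ∈ (∅ : Set Torus))

lemma partner_spec (hR : IsLinkDiagram R) (i : Bool) {v : Torus} (hv : v ∈ R) :
    partner R i v ∈ R ∧ partner R i v ≠ v ∧ ang i (partner R i v) = ang i v := by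
  have h : ∃ w, w ∈ R ∧ w ≠ v ∧ ang i w = ang i v := by
    obtain ⟨a, b, hab, he⟩ := Set.ncard_eq_two.1 (ncard_ang_eq hR i hv)
    have hv' : v ∈ ({a, b} : Set Torus) := he ▸ (⟨hv, rfl⟩ : v ∈ {w : Torus | w ∈ R ∧ ang i w = ang i v})
    have ha : a ∈ {w : Torus | w ∈ R ∧ ang i w = ang i v} := he ▸ mem_insert _ _
    have hb : b ∈ {w : Torus | w ∈ R ∧ ang i w = ang i v} := he ▸ mem_insert_of_mem _ rfl
    rcases hv' with rfl | rfl
    · exact ⟨b, hb.1, hab.symm, hb.2⟩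
    · exact ⟨a, ha.1, hab, ha.2⟩
  rw [partner, dif_pos h]
  exact h.choose_spec

lemma eq_or_eq_partner (hR : IsLinkDiagram R) (i : Bool) {v w : Torus} (hv : v ∈ R) (hw : w ∈ R)
    (h : ang i w = ang i v) : w = v ∨ w = partner R i v := by
  obtain ⟨h1, h2, h3⟩ := partner_spec hR i hv
  by_contra hn
  push Not at hn
  have hf : {w : Torus | w ∈ R ∧ ang i w = ang i v}.Finite := R.finite_toSet.subset fun w hw => hw.1
  have : ({v, partner R i v, w} : Set Torus) ⊆ {w : Torus | w ∈ R ∧ ang i w = ang i v} := by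
    rintro x (rfl | rfl | rfl)
    exacts [⟨hv, rfl⟩, ⟨h1, h3⟩, ⟨hw, h⟩]
  have hc := Set.ncard_le_ncard this hf
  rw [ncard_ang_eq hR i hv, Set.ncard_eq_three.2 ⟨v, partner R i v, w, h2.symm, hn.1.symm, hn.2.symm, rfl⟩] at hc
  omega

lemma partner_partner (hR : IsLinkDiagram R) (i : Bool) {v : Torus} (hv : v ∈ R) :
    partner R i (partner R i v) = v := by
  obtain ⟨h1, h2, h3⟩ := partner_spec hR i hv
  exact ((eq_or_eq_partner hR i h1 hv h3.symm).resolve_left h2.symm).symm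

lemma ang_not_partner_ne (hR : IsLinkDiagram R) (i : Bool) {v : Torus} (hv : v ∈ R) :
    ang (!i) (partner R i v) ≠ ang (!i) v := fun h =>
  (partner_spec hR i hv).2.1 (eq_of_ang i (partner_spec hR i hv).2.2 h)

lemma isEdge_partner (hR : IsLinkDiagram R) (i : Bool) {v : Torus} (hv : v ∈ R) :
    IsEdge R v (partner R i v) := by
  obtain ⟨h1, h2, h3⟩ := partner_spec hR i hv
  refine ⟨hv, h1, h2.symm, ?_⟩
  cases i
  · exact .inr h3.symm
  · exact .inl h3.symm

lemma isEdge_iff_partner (hR : IsLinkDiagram R) {v w : Torus} :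
    IsEdge R v w ↔ v ∈ R ∧ ∃ i, w = partner R i v := by
  constructor
  · rintro ⟨hv, hw, hne, h | h⟩
    · exact ⟨hv, true, (eq_or_eq_partner hR true hv hw h.symm).resolve_left hne.symm⟩
    · exact ⟨hv, false, (eq_or_eq_partner hR false hv hw h.symm).resolve_left hne.symm⟩
  · rintro ⟨hv, i, rfl⟩
    exact isEdge_partner hR i hv

lemma sign_partner (hR : IsLinkDiagram R) {ε : Torus → ℤˣ} (hε : IsOrientation R ε) (i : Bool)
    {v : Torus} (hv : v ∈ R) : ε (partner R i v) = -ε v := by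
  have h := hε _ _ (isEdge_partner hR i hv)
  rcases Int.units_eq_one_or (ε v) with h1 | h1 <;>
    rcases Int.units_eq_one_or (ε (partner R i v)) with h2 | h2 <;> simp_all

lemma sum_partner_eq_zero {A : Type*} [AddCommGroup A] [Module ℝ A] (hR : IsLinkDiagram R)
    {ε : Torus → ℤˣ} (hε : IsOrientation R ε)
    (i : Bool) (f : Torus → A) (hf : ∀ v ∈ R, f (partner R i v) = f v) :
    ∑ v ∈ R, (((ε v : ℤ) : ℝ)) • f v = 0 := by
  refine Finset.sum_involution (fun v _ => partner R i v) ?_ ?_ ?_ ?_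
  · intro v hv
    rw [sign_partner hR hε i hv, hf v hv]
    simp
  · intro v hv _
    exact (partner_spec hR i hv).2.1
  · exact fun v hv => (partner_spec hR i hv).1
  · exact fun v hv => partner_partner hR i hv

lemma sum_sign_smul_ang {A : Type*} [AddCommGroup A] [Module ℝ A] (hR : IsLinkDiagram R)
    {ε : Torus → ℤˣ} (hε : IsOrientation R ε)
    (i : Bool) (f : Angle → A) :
    ∑ v ∈ R, (((ε v : ℤ) : ℝ)) • f (ang i v) = 0 :=
  sum_partner_eq_zero hR hε i (fun v => f (ang i v)) fun v hv => by
    rw [(partner_spec hR i hv).2.2]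

end Diagram

/-! ## The Gauss form of an arc -/

lemma proj4_apply (i : Fin 4) (x : E4) : (EuclideanSpace.proj i : E4 →L[ℝ] ℝ) x = x i := rfl

/-- The coordinates in the orthonormal frame adapted to the arc `v̂`. -/
def frame (v : Torus) : E4 →L[ℝ] E4 :=
  (EuclideanSpace.equiv (Fin 4) ℝ).symm.toContinuousLinearMap.comp <| ContinuousLinearMap.pi
    ![v.2.cos • EuclideanSpace.proj (0 : Fin 4) + v.2.sin • EuclideanSpace.proj (1 : Fin 4),
      (-v.2.sin) • EuclideanSpace.proj (0 : Fin 4) + v.2.cos • EuclideanSpace.proj (1 : Fin 4),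
      v.1.cos • EuclideanSpace.proj (2 : Fin 4) + v.1.sin • EuclideanSpace.proj (3 : Fin 4),
      (-v.1.sin) • EuclideanSpace.proj (2 : Fin 4) + v.1.cos • EuclideanSpace.proj (3 : Fin 4)]

@[simp] lemma frame_zero (v : Torus) (x : E4) : frame v x 0 = v.2.cos * x 0 + v.2.sin * x 1 := by
  simp [frame]
@[simp] lemma frame_one (v : Torus) (x : E4) : frame v x 1 = -v.2.sin * x 0 + v.2.cos * x 1 := by
  simp [frame]
@[simp] lemma frame_two (v : Torus) (x : E4) : frame v x 2 = v.1.cos * x 2 + v.1.sin * x 3 := by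
  simp [frame]
@[simp] lemma frame_three (v : Torus) (x : E4) : frame v x 3 = -v.1.sin * x 2 + v.1.cos * x 3 := by
  simp [frame]

/-- The linear form `ξ ↦ ` "Gauss kernel of the arc `v̂` at `x`". -/
def arcForm (v : Torus) (x : E4) : E4 →L[ℝ] ℝ :=
  quadrantPotential (frame v x) •
    ((frame v x 3) • (EuclideanSpace.proj (1 : Fin 4) : E4 →L[ℝ] ℝ).comp (frame v)
      - (frame v x 1) • (EuclideanSpace.proj (3 : Fin 4) : E4 →L[ℝ] ℝ).comp (frame v))

lemma arcForm_apply (v : Torus) (x ξ : E4) : arcForm v x ξ = quadrantPotential (frame v x) *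
    (frame v x 3 * frame v ξ 1 - frame v x 1 * frame v ξ 3) := by
  simp only [arcForm, smul_apply, sub_apply, smul_eq_mul,
    ContinuousLinearMap.comp_apply, proj4_apply]

/-- The boundary term of the exterior derivative of `arcForm` depending on `φ` only. -/
def rowTerm (x ξ η : E4) (φ : Angle) : ℝ :=
  ((-φ.sin * x 0 + φ.cos * x 1) * (ξ 2 * η 3 - ξ 3 * η 2)
    - x 2 * ((-φ.sin * ξ 0 + φ.cos * ξ 1) * η 3 - ξ 3 * (-φ.sin * η 0 + φ.cos * η 1))
    + x 3 * ((-φ.sin * ξ 0 + φ.cos * ξ 1) * η 2 - ξ 2 * (-φ.sin * η 0 + φ.cos * η 1))) *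
  ∫ p in Ioi (0 : ℝ), (((p - (φ.cos * x 0 + φ.sin * x 1)) ^ 2 + (-φ.sin * x 0 + φ.cos * x 1) ^ 2
    + x 2 ^ 2 + x 3 ^ 2) ^ 2)⁻¹

/-- The boundary term of the exterior derivative of `arcForm` depending on `θ` only. -/
def colTerm (x ξ η : E4) (θ : Angle) : ℝ :=
  (x 0 * (ξ 1 * (-θ.sin * η 2 + θ.cos * η 3) - (-θ.sin * ξ 2 + θ.cos * ξ 3) * η 1)
    - x 1 * (ξ 0 * (-θ.sin * η 2 + θ.cos * η 3) - (-θ.sin * ξ 2 + θ.cos * ξ 3) * η 0)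
    + (-θ.sin * x 2 + θ.cos * x 3) * (ξ 0 * η 1 - ξ 1 * η 0)) *
  ∫ q in Ioi (0 : ℝ), ((x 0 ^ 2 + x 1 ^ 2 + (q - (θ.cos * x 2 + θ.sin * x 3)) ^ 2
    + (-θ.sin * x 2 + θ.cos * x 3) ^ 2) ^ 2)⁻¹

lemma arcForm_hasFDerivAt {v : Torus} {x : E4} (hx : frame v x ∉ stdQuadrant) :
    ∃ D : E4 →L[ℝ] E4 →L[ℝ] ℝ, HasFDerivAt (arcForm v) D x ∧
      ∀ ξ η, D ξ η - D η ξ = colTerm x ξ η v.1 - rowTerm x ξ η v.2 := by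
  have hG := (hasFDerivAt_quadrantPotential hx).2.comp x (frame v).hasFDerivAt
  have hc (i : Fin 4) : HasFDerivAt (fun y => frame v y i)
      ((EuclideanSpace.proj i : E4 →L[ℝ] ℝ).comp (frame v)) x :=
    ((EuclideanSpace.proj i : E4 →L[ℝ] ℝ).comp (frame v)).hasFDerivAt
  have hN := ((hc 3).smul_const ((EuclideanSpace.proj (1 : Fin 4) : E4 →L[ℝ] ℝ).comp (frame v))).sub
    ((hc 1).smul_const ((EuclideanSpace.proj (3 : Fin 4) : E4 →L[ℝ] ℝ).comp (frame v)))
  have h := hG.smul hN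
  refine ⟨_, h, fun ξ η => ?_⟩
  have hs := quadrant_stokes hx (frame v ξ) (frame v η)
  have e1 : rowTerm x ξ η v.2 =
      det3 1 2 3 (frame v x) (frame v ξ) (frame v η) * rayPotentialFst (frame v x) := by
    have h1 := Angle.cos_sq_add_sin_sq v.1
    simp only [rowTerm, rayPotentialFst]
    congr 1
    · simp only [det3, frame_one, frame_two, frame_three]
      linear_combination (-1 : ℝ) * ((-v.2.sin * x 0 + v.2.cos * x 1) * (ξ 2 * η 3 - ξ 3 * η 2)
        - x 2 * ((-v.2.sin * ξ 0 + v.2.cos * ξ 1) * η 3 - ξ 3 * (-v.2.sin * η 0 + v.2.cos * η 1))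
        + x 3 * ((-v.2.sin * ξ 0 + v.2.cos * ξ 1) * η 2 - ξ 2 * (-v.2.sin * η 0 + v.2.cos * η 1))) * h1
    · congr 1
      funext p
      congr 2
      simp only [sqDist, frame_zero, frame_one, frame_two, frame_three]
      linear_combination (-1 : ℝ) * (x 2 ^ 2 + x 3 ^ 2) * h1
  have e2 : colTerm x ξ η v.1 =
      det3 0 1 3 (frame v x) (frame v ξ) (frame v η) * rayPotentialSnd (frame v x) := by
    have h1 := Angle.cos_sq_add_sin_sq v.2
    simp only [colTerm, rayPotentialSnd]
    congr 1
    · simp only [det3, frame_zero, frame_one, frame_three]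
      linear_combination (-1 : ℝ) * (x 0 * (ξ 1 * (-v.1.sin * η 2 + v.1.cos * η 3) - (-v.1.sin * ξ 2 + v.1.cos * ξ 3) * η 1)
    - x 1 * (ξ 0 * (-v.1.sin * η 2 + v.1.cos * η 3) - (-v.1.sin * ξ 2 + v.1.cos * ξ 3) * η 0)
    + (-v.1.sin * x 2 + v.1.cos * x 3) * (ξ 0 * η 1 - ξ 1 * η 0)) * h1
    · congr 1
      funext p
      congr 2
      simp only [sqDist, frame_zero, frame_one, frame_two, frame_three]
      linear_combination (-1 : ℝ) * (x 0 ^ 2 + x 1 ^ 2) * h1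
  rw [e1, e2, ← hs]
  simp only [add_apply, smul_apply,
    sub_apply, smul_eq_mul, ContinuousLinearMap.smulRight_apply,
    ContinuousLinearMap.comp_apply, proj4_apply, Function.comp, Pi.sub_apply]
  ring

/-- The region where the Gauss form of the link `R̂` is defined. -/
def linkFormDomain (R : Finset Torus) : Set E4 := {x | ∀ v ∈ R, frame v x ∉ stdQuadrant}

lemma isClosed_stdQuadrant : IsClosed stdQuadrant := by
  have h (i : Fin 4) : Continuous fun y : E4 => y i := by fun_prop
  exact (isClosed_le continuous_const (h 0)).inter ((isClosed_eq (h 1) continuous_const).inter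
    ((isClosed_le continuous_const (h 2)).inter (isClosed_eq (h 3) continuous_const)))

lemma isOpen_linkFormDomain (R : Finset Torus) : IsOpen (linkFormDomain R) := by
  have : linkFormDomain R = ⋂ v ∈ R, (frame v ⁻¹' stdQuadrant)ᶜ := by
    ext x; simp [linkFormDomain]
  rw [this]
  exact isOpen_biInter_finset fun v _ => (isClosed_stdQuadrant.preimage (frame v).continuous).isOpen_compl

/-- The Gauss form of the link `R̂`. -/
def linkForm (R : Finset Torus) (ε : Torus → ℤˣ) (x : E4) : E4 →L[ℝ] ℝ :=
  ∑ v ∈ R, ((ε v : ℤ) : ℝ) • arcForm v x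

lemma linkForm_closed {R : Finset Torus} (hR : IsLinkDiagram R) {ε : Torus → ℤˣ}
    (hε : IsOrientation R ε) {x : E4} (hx : x ∈ linkFormDomain R) :
    DifferentiableAt ℝ (linkForm R ε) x ∧
      ∀ ξ η, fderiv ℝ (linkForm R ε) x ξ η = fderiv ℝ (linkForm R ε) x η ξ := by
  have h : ∀ v, ∃ D : E4 →L[ℝ] E4 →L[ℝ] ℝ, v ∈ R → HasFDerivAt (arcForm v) D x ∧
      ∀ ξ η, D ξ η - D η ξ = colTerm x ξ η v.1 - rowTerm x ξ η v.2 := fun v => by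
    by_cases hv : v ∈ R
    · obtain ⟨D, hD⟩ := arcForm_hasFDerivAt (hx v hv)
      exact ⟨D, fun _ => hD⟩
    · exact ⟨0, fun h => absurd h hv⟩
  choose D hD using h
  have hd : HasFDerivAt (linkForm R ε) (∑ v ∈ R, ((ε v : ℤ) : ℝ) • D v) x := by
    unfold linkForm
    exact HasFDerivAt.fun_sum fun v hv => (hD v hv).1.fun_const_smul _
  refine ⟨hd.differentiableAt, fun ξ η => ?_⟩
  rw [hd.fderiv, ← sub_eq_zero]
  have e : ∀ ξ η, (∑ v ∈ R, ((ε v : ℤ) : ℝ) • D v) ξ η = ∑ v ∈ R, ((ε v : ℤ) : ℝ) • D v ξ η := by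
    intro ξ η
    simp
  rw [e, e, ← Finset.sum_sub_distrib]
  have h1 := sum_sign_smul_ang hR hε true (colTerm x ξ η)
  have h2 := sum_sign_smul_ang hR hε false (rowTerm x ξ η)
  calc _ = ∑ v ∈ R, (((ε v : ℤ) : ℝ) • colTerm x ξ η (ang true v) -
        ((ε v : ℤ) : ℝ) • rowTerm x ξ η (ang false v)) :=
        Finset.sum_congr rfl fun v hv => by
          rw [← smul_sub, ← smul_sub, (hD v hv).2]; rfl
    _ = 0 := by rw [Finset.sum_sub_distrib, h1, h2, sub_zero]

lemma linkForm_exists_primitive {R : Finset Torus} (hR : IsLinkDiagram R) {ε : Torus → ℤˣ}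
    (hε : IsOrientation R ε) {x : E4} {r : ℝ} (hr : Metric.ball x r ⊆ linkFormDomain R) :
    ∃ f : E4 → ℝ, ∀ y ∈ Metric.ball x r, HasFDerivAt f (linkForm R ε y) y :=
  (convex_ball x r).exists_forall_hasFDerivAt_of_fderiv_symmetric Metric.isOpen_ball
    (fun _ hy => (linkForm_closed hR hε (hr hy)).1.differentiableWithinAt)
    fun _ hy => (linkForm_closed hR hε (hr hy)).2

lemma mem_linkFormDomain {R : Finset Torus} {x : E4} (hx : x ∈ Metric.sphere (0 : E4) 1)
    (h : x ∉ linkOf R) : x ∈ linkFormDomain R := by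
  rintro v hv ⟨h0, h1, h2, h3⟩
  apply h
  have hn : x 0 ^ 2 + x 1 ^ 2 + x 2 ^ 2 + x 3 ^ 2 = 1 := by
    have := mem_sphere_zero_iff_norm.1 hx
    rw [EuclideanSpace.norm_eq, sqrt_eq_one] at this
    simpa [Fin.sum_univ_four] using this
  have c1 := Angle.cos_sq_add_sin_sq v.1
  have c2 := Angle.cos_sq_add_sin_sq v.2
  set X0 := frame v x 0 with hX0
  set X2 := frame v x 2 with hX2
  rw [frame_one] at h1
  rw [frame_three] at h3
  rw [frame_zero] at hX0
  rw [frame_two] at hX2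
  have e0 : x 0 = X0 * v.2.cos := by rw [hX0]; linear_combination -x 0 * c2 + v.2.sin * h1 * (-1)
  have e1 : x 1 = X0 * v.2.sin := by rw [hX0]; linear_combination -x 1 * c2 + v.2.cos * h1
  have e2 : x 2 = X2 * v.1.cos := by rw [hX2]; linear_combination -x 2 * c1 + v.1.sin * h3 * (-1)
  have e3 : x 3 = X2 * v.1.sin := by rw [hX2]; linear_combination -x 3 * c1 + v.1.cos * h3
  have hs : X0 ^ 2 + X2 ^ 2 = 1 := by
    rw [e0, e1, e2, e3] at hn; linear_combination hn - X0 ^ 2 * c2 - X2 ^ 2 * c1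
  have hle : X2 ≤ 1 := by nlinarith
  refine mem_biUnion hv ⟨2 * arcsin X2 / π, ⟨?_, ?_⟩, ?_⟩
  · have := arcsin_nonneg.2 h2; positivity
  · rw [div_le_one pi_pos]; linarith [arcsin_le_pi_div_two X2]
  · have ea : π * (2 * arcsin X2 / π) / 2 = arcsin X2 := by field_simp
    have es := sin_arcsin (by linarith) hle
    have ec : cos (arcsin X2) = X0 := by
      rw [cos_arcsin, show 1 - X2 ^ 2 = X0 ^ 2 by linarith, sqrt_sq h0]
    ext i
    fin_cases i <;> simp [vertexArc, joinPoint, ea, es, ec, e0, e1, e2, e3]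

/-- `γ` is continuous on `[0, 1]` and has a bounded derivative there off a finite set. -/
def IsTameCurve (γ : ℝ → E4) : Prop :=
  ContinuousOn γ (Icc 0 1) ∧ ∃ (S : Finset ℝ) (M : ℝ), ∀ t ∈ Icc (0 : ℝ) 1, t ∉ S →
    DifferentiableAt ℝ γ t ∧ ‖deriv γ t‖ ≤ M

lemma IsPiecewiseC1.isTameCurve {γ : ℝ → E4} (h : IsPiecewiseC1 γ) : IsTameCurve γ := by
  obtain ⟨hc, k, t, ht, h0, h1, hd⟩ := h
  have hM : ∀ i : Fin k, ∃ M, ∀ s ∈ Icc (t i.castSucc) (t i.succ),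
      ‖derivWithin γ (Icc (t i.castSucc) (t i.succ)) s‖ ≤ M := fun i =>
    (isCompact_Icc).exists_bound_of_continuousOn
      ((hd i).continuousOn_derivWithin (uniqueDiffOn_Icc (ht Fin.castSucc_lt_succ)) le_rfl)
  choose M hM using hM
  refine ⟨hc, Finset.univ.image t, ∑ i, |M i|, fun s hs hsS => ?_⟩
  have hne : ∀ i, t i ≠ s := fun i hi => hsS (Finset.mem_image.2 ⟨i, Finset.mem_univ _, hi⟩)
  set A : Finset (Fin (k + 1)) := Finset.univ.filter fun i => t i ≤ s with hA
  have hA0 : A.Nonempty := ⟨0, by simp [hA, h0, hs.1]⟩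
  set i := A.max' hA0 with hi
  have hiA : t i ≤ s := (Finset.mem_filter.1 (A.max'_mem hA0)).2
  have hil : i ≠ Fin.last k := fun h => by
    have := hne (Fin.last k)
    rw [h, h1] at hiA
    exact this (by rw [h1]; exact le_antisymm hiA hs.2)
  obtain ⟨j, hj⟩ := Fin.exists_castSucc_eq.2 hil
  have hj1 : t j.castSucc < s := by rw [hj]; exact lt_of_le_of_ne hiA (hne _)
  have hj2 : s < t j.succ := by
    by_contra hn
    have : j.succ ≤ i := A.le_max' _ (by simp [hA]; exact not_lt.1 hn)
    rw [← hj] at this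
    exact absurd this (not_le.2 Fin.castSucc_lt_succ)
  have hnhds : Icc (t j.castSucc) (t j.succ) ∈ 𝓝 s := Icc_mem_nhds hj1 hj2
  refine ⟨((hd j).differentiableOn one_ne_zero s ⟨hj1.le, hj2.le⟩).differentiableAt hnhds, ?_⟩
  rw [← derivWithin_of_mem_nhds hnhds]
  calc _ ≤ M j := hM j s ⟨hj1.le, hj2.le⟩
    _ ≤ |M j| := le_abs_self _
    _ ≤ _ := Finset.single_le_sum (f := fun i => |M i|) (fun i _ => abs_nonneg _) (Finset.mem_univ j)

lemma sqDist_uniform_lower_bound {S : Set E4} (hS : IsCompact S) (h : ∀ x ∈ S, x ∉ stdQuadrant) :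
    ∃ c > 0, ∀ x ∈ S, ∀ p q : ℝ, 0 ≤ p → 0 ≤ q →
      c * (1 + p ^ 2 + q ^ 2) ^ 2 ≤ sqDist x (p, q) ^ 2 ∧ 0 < sqDist x (p, q) := by
  refine hS.induction_on (p := fun S => ∃ c > 0, ∀ x ∈ S, ∀ p q : ℝ, 0 ≤ p → 0 ≤ q →
      c * (1 + p ^ 2 + q ^ 2) ^ 2 ≤ sqDist x (p, q) ^ 2 ∧ 0 < sqDist x (p, q)) ?_ ?_ ?_ ?_
  · exact ⟨1, one_pos, fun x hx => hx.elim⟩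
  · rintro s t hst ⟨c, hc, h⟩
    exact ⟨c, hc, fun x hx => h x (hst hx)⟩
  · rintro s t ⟨c, hc, h⟩ ⟨c', hc', h'⟩
    refine ⟨min c c', lt_min hc hc', fun x hx p q hp hq => ?_⟩
    rcases hx with hx | hx
    · exact ⟨le_trans (by gcongr; exact min_le_left _ _) (h x hx p q hp hq).1, (h x hx p q hp hq).2⟩
    · exact ⟨le_trans (by gcongr; exact min_le_right _ _) (h' x hx p q hp hq).1, (h' x hx p q hp hq).2⟩
  · intro x hx
    obtain ⟨c, hc, hc'⟩ := sqDist_lower_bound_sq (h x hx)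
    exact ⟨_, mem_nhdsWithin_of_mem_nhds hc', c, hc, fun y hy => hy⟩

/-- The radial integral of the Gauss kernel. -/
def radialPotential (x : E4) (s : ℝ) : ℝ :=
  ∫ r in Ioi (0 : ℝ), r * (sqDist x (r * cos s, r * sin s) ^ 2)⁻¹

lemma radial_kernel_bound {x : E4} {c : ℝ} (hc : 0 < c)
    (h : ∀ p q : ℝ, 0 ≤ p → 0 ≤ q →
      c * (1 + p ^ 2 + q ^ 2) ^ 2 ≤ sqDist x (p, q) ^ 2 ∧ 0 < sqDist x (p, q))
    {r s : ℝ} (hr : 0 < r) (hs : s ∈ Icc 0 (π / 2)) :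
    ‖r * (sqDist x (r * cos s, r * sin s) ^ 2)⁻¹‖ ≤ c⁻¹ * (1 + r ^ 2)⁻¹ := by
  have h1 := cos_nonneg_of_mem_Icc ⟨by linarith [hs.1, pi_pos], hs.2⟩
  have h2 := sin_nonneg_of_mem_Icc ⟨hs.1, by linarith [hs.2, pi_pos]⟩
  obtain ⟨h3, h4⟩ := h (r * cos s) (r * sin s) (by positivity) (by positivity)
  have e : 1 + (r * cos s) ^ 2 + (r * sin s) ^ 2 = 1 + r ^ 2 := by
    linear_combination r ^ 2 * sin_sq_add_cos_sq s
  rw [e] at h3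
  rw [norm_of_nonneg (by positivity)]
  calc r * (sqDist x (r * cos s, r * sin s) ^ 2)⁻¹ ≤ r * (c * (1 + r ^ 2) ^ 2)⁻¹ := by
        gcongr
    _ = c⁻¹ * (1 + r ^ 2)⁻¹ * (r * (1 + r ^ 2)⁻¹) := by field_simp
    _ ≤ c⁻¹ * (1 + r ^ 2)⁻¹ * 1 := by
        gcongr
        rw [mul_inv_le_iff₀ (by positivity)]
        nlinarith [sq_nonneg (r - 1)]
    _ = _ := mul_one _

lemma quadrantPotential_eq_radial {x : E4} (hx : x ∉ stdQuadrant) :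
    quadrantPotential x = π / 2 * ∫ s in (0 : ℝ)..1, radialPotential x (π / 2 * s) := by
  obtain ⟨c, hc, h⟩ := sqDist_lower_bound_sq hx
  have h := h.self_of_nhds
  have hpi := pi_pos
  set f : ℝ × ℝ → ℝ := fun a => (sqDist x a ^ 2)⁻¹ with hf
  set Q : Set (ℝ × ℝ) := Ioi 0 ×ˢ Ioi 0
  have hQ : MeasurableSet Q := measurableSet_Ioi.prod measurableSet_Ioi
  set g : ℝ × ℝ → ℝ := fun p => p.1 * (sqDist x (p.1 * cos p.2, p.1 * sin p.2) ^ 2)⁻¹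
  have hmg : Measurable g := by
    have : Continuous fun p : ℝ × ℝ => sqDist x (p.1 * cos p.2, p.1 * sin p.2) := by
      unfold sqDist; fun_prop
    exact measurable_fst.mul ((this.measurable.pow_const 2).inv)
  have e1 : quadrantPotential x = ∫ a, Q.indicator f a := by
    rw [integral_indicator hQ, quadrantPotential, quadrantMeasure, Measure.prod_restrict]
    rfl
  set T : Set (ℝ × ℝ) := Ioi 0 ×ˢ Ioo 0 (π / 2)
  have e2 : ∫ a, Q.indicator f a = ∫ p in T, g p := by
    rw [← integral_comp_polarCoord_symm]
    have hT : T = polarCoord.target ∩ T := by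
      refine (inter_eq_right.2 ?_).symm
      rw [polarCoord_target]
      exact prod_mono subset_rfl (Ioo_subset_Ioo (by linarith) (by linarith))
    rw [hT, ← setIntegral_indicator (measurableSet_Ioi.prod measurableSet_Ioo)]
    refine setIntegral_congr_fun polarCoord.open_target.measurableSet fun p hp => ?_
    rw [polarCoord_target] at hp
    obtain ⟨hp1, hp2, hp3⟩ := hp
    have hp1 : 0 < p.1 := hp1
    simp only [polarCoord_symm_apply, smul_eq_mul]
    by_cases hpT : p ∈ T
    · have hpQ : (p.1 * cos p.2, p.1 * sin p.2) ∈ Q :=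
        ⟨mul_pos hp1 (cos_pos_of_mem_Ioo ⟨by linarith [hpT.2.1], hpT.2.2⟩),
          mul_pos hp1 (sin_pos_of_mem_Ioo ⟨hpT.2.1, by linarith [hpT.2.2]⟩)⟩
      rw [indicator_of_mem hpQ, indicator_of_mem hpT]
    · have hpQ : (p.1 * cos p.2, p.1 * sin p.2) ∉ Q := fun hQ => by
        have c1 : 0 < cos p.2 := (mul_pos_iff_of_pos_left hp1).1 hQ.1
        have c2 : 0 < sin p.2 := (mul_pos_iff_of_pos_left hp1).1 hQ.2
        refine hpT ⟨hp1, ?_, ?_⟩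
        · by_contra hn
          exact absurd c2 (not_lt.2 (sin_nonpos_of_nonpos_of_neg_pi_le (not_lt.1 hn) hp2.le))
        · by_contra hn
          exact absurd c1 (not_lt.2 (cos_nonpos_of_pi_div_two_le_of_le (not_lt.1 hn) (by linarith)))
      rw [indicator_of_notMem hpQ, indicator_of_notMem hpT, mul_zero]
  have hi : Integrable g ((volume.restrict (Ioi (0 : ℝ))).prod (volume.restrict (Ioo 0 (π / 2)))) := by
    have hb : Integrable (fun p : ℝ × ℝ => c⁻¹ * (1 + p.1 ^ 2)⁻¹ * 1)
        ((volume.restrict (Ioi (0 : ℝ))).prod (volume.restrict (Ioo 0 (π / 2)))) :=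
      ((integrable_inv_one_add_sq.restrict (s := Ioi (0 : ℝ))).const_mul c⁻¹).mul_prod
        (integrable_const (1 : ℝ))
    refine hb.mono' hmg.aestronglyMeasurable ?_
    rw [Measure.prod_restrict, ae_restrict_iff' (measurableSet_Ioi.prod measurableSet_Ioo)]
    refine ae_of_all _ fun p hp => ?_
    rw [mul_one]
    exact radial_kernel_bound hc h hp.1 ⟨hp.2.1.le, hp.2.2.le⟩
  have e3 : ∫ p in T, g p = ∫ s in Ioo 0 (π / 2), radialPotential x s := by
    have : (volume : Measure (ℝ × ℝ)).restrict T =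
        (volume.restrict (Ioi (0 : ℝ))).prod (volume.restrict (Ioo 0 (π / 2))) := by
      rw [Measure.prod_restrict]; rfl
    rw [this, integral_prod_symm _ hi]
    rfl
  rw [e1, e2, e3, ← integral_Ioc_eq_integral_Ioo,
    ← intervalIntegral.integral_of_le (by positivity), intervalIntegral.integral_comp_mul_left _ (by positivity)]
  simp only [mul_zero, mul_one, smul_eq_mul]
  field_simp

lemma norm_sub_smul_sq (v : Torus) (s u : ℝ) (x : E4) :
    ‖vertexArc v s - u • x‖ ^ 2 = (cos (π / 2 * s) - u * frame v x 0) ^ 2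
      + (u * frame v x 1) ^ 2 + (sin (π / 2 * s) - u * frame v x 2) ^ 2
      + (u * frame v x 3) ^ 2 := by
  have c1 := Angle.cos_sq_add_sin_sq v.1
  have c2 := Angle.cos_sq_add_sin_sq v.2
  have e : π * s / 2 = π / 2 * s := by ring
  rw [EuclideanSpace.norm_sq_eq]
  simp only [Fin.sum_univ_four, vertexArc, joinPoint, e, norm_eq_abs, sq_abs, frame_zero,
    frame_one, frame_two, frame_three]
  simp
  set C := cos (π / 2 * s)
  set S := sin (π / 2 * s)
  linear_combination (C ^ 2 - u ^ 2 * x 0 ^ 2 - u ^ 2 * x 1 ^ 2) * c2 +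
    (S ^ 2 - u ^ 2 * x 2 ^ 2 - u ^ 2 * x 3 ^ 2) * c1

lemma hasDerivAt_E4 {f : ℝ → E4} {f' : E4} {t : ℝ} :
    HasDerivAt f f' t ↔ ∀ i, HasDerivAt (fun x => f x i) (f' i) t := by
  rw [hasDerivAt_iff_hasFDerivAt, ← hasFDerivWithinAt_univ, hasFDerivWithinAt_euclidean]
  refine forall_congr' fun i => ?_
  rw [hasFDerivWithinAt_univ, hasDerivAt_iff_hasFDerivAt]
  have : (EuclideanSpace.proj i : E4 →L[ℝ] ℝ).comp (ContinuousLinearMap.toSpanSingleton ℝ f') =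
      ContinuousLinearMap.toSpanSingleton ℝ (f' i) := by
    ext; simp
  exact iff_of_eq (by rw [← this])

lemma vertexArc_hasDerivAt (v : Torus) (s : ℝ) : HasDerivAt (vertexArc v)
    (!₂[-(π / 2) * sin (π / 2 * s) * v.2.cos,
      -(π / 2) * sin (π / 2 * s) * v.2.sin,
      π / 2 * cos (π / 2 * s) * v.1.cos,
      π / 2 * cos (π / 2 * s) * v.1.sin] : E4) s := by
  rw [hasDerivAt_E4]
  have h0 : HasDerivAt (fun s : ℝ => π * s / 2) (π / 2) s := by
    simpa using ((hasDerivAt_id s).const_mul π).div_const 2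
  have hc := h0.cos
  have hs := h0.sin
  have e : π * s / 2 = π / 2 * s := by ring
  rw [e] at hc hs
  intro i
  fin_cases i
  · refine (hc.mul_const v.2.cos).congr_deriv ?_
    simp; left; ring
  · refine (hc.mul_const v.2.sin).congr_deriv ?_
    simp; left; ring
  · refine (hs.mul_const v.1.cos).congr_deriv ?_
    simp; left; ring
  · refine (hs.mul_const v.1.sin).congr_deriv ?_
    simp; left; ring

lemma det_vertexArc (v : Torus) (s : ℝ) (x ξ : E4) :
    Matrix.det (Matrix.of ![(vertexArc v s).ofLp, (deriv (vertexArc v) s).ofLp, x.ofLp, ξ.ofLp]) =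
      π / 2 * (frame v x 3 * frame v ξ 1 - frame v x 1 * frame v ξ 3) := by
  rw [(vertexArc_hasDerivAt v s).deriv]
  have e : π * s / 2 = π / 2 * s := by ring
  have c := sin_sq_add_cos_sq (π / 2 * s)
  simp [Matrix.det_succ_row_zero, Fin.sum_univ_succ, vertexArc, joinPoint, e, Fin.succAbove]
  set C := cos (π / 2 * s)
  set S := sin (π / 2 * s)
  linear_combination π / 2 * ((-(v.1.sin * x 2) + v.1.cos * x 3) *
    (-(v.2.sin * ξ 0) + v.2.cos * ξ 1) - (-(v.2.sin * x 0) + v.2.cos * x 1) *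
    (-(v.1.sin * ξ 2) + v.1.cos * ξ 3)) * c

lemma integral_inner_gauss (v : Torus) (s : ℝ) (x : E4) (D : ℝ) :
    ∫ u in Ioi (0 : ℝ), u * D / ‖vertexArc v s - u • x‖ ^ 4 =
      D * radialPotential (frame v x) (π / 2 * s) := by
  rw [radialPotential, ← integral_const_mul, ← integral_comp_rpow_Ioi _ (show (-1 : ℝ) ≠ 0 by norm_num)]
  refine setIntegral_congr_fun measurableSet_Ioi fun u hu => ?_
  have hu : 0 < u := hu
  have h1 : u ^ (-1 - 1 : ℝ) = (u ^ 2)⁻¹ := by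
    rw [show (-1 - 1 : ℝ) = -(2 : ℕ) by norm_num, rpow_neg hu.le, rpow_natCast]
  have h2 : ‖vertexArc v s - u⁻¹ • x‖ ^ 4 = (‖vertexArc v s - u⁻¹ • x‖ ^ 2) ^ 2 := by ring
  have h3 : ‖vertexArc v s - u⁻¹ • x‖ ^ 2 =
      sqDist (frame v x) (u * cos (π / 2 * s), u * sin (π / 2 * s)) / u ^ 2 := by
    rw [norm_sub_smul_sq, sqDist]
    field_simp
  simp only [rpow_neg_one, h1, h2, h3, smul_eq_mul, abs_neg, abs_one, one_mul]
  generalize sqDist (frame v x) _ = N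
  rcases eq_or_ne N 0 with rfl | hN
  · simp
  · field_simp

lemma abs_apply_le (x : E4) (i : Fin 4) : |x i| ≤ ‖x‖ := PiLp.norm_apply_le x i

lemma gaussIntegral_vertexArc (v : Torus) {γ : ℝ → E4} (hγ : IsTameCurve γ)
    (h : ∀ t ∈ Icc (0 : ℝ) 1, frame v (γ t) ∉ stdQuadrant) :
    gaussIntegral (vertexArc v) γ =
      1 / (2 * π ^ 2) * ∫ t in (0 : ℝ)..1, arcForm v (γ t) (deriv γ t) := by
  obtain ⟨hc, S, M, hM⟩ := hγ
  rw [gaussIntegral]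
  congr 1
  set P : ℝ → E4 := fun t => γ (projIcc 0 1 zero_le_one t) with hP
  have hPc : Continuous P := by
    have := hc.domRestrict
    exact this.comp continuous_projIcc
  have hPe : ∀ t ∈ Icc (0 : ℝ) 1, P t = γ t := fun t ht => by
    simp only [hP, projIcc_of_mem _ ht]
  set X : ℝ → E4 := fun t => frame v (P t)
  have hXc : Continuous X := (frame v).continuous.comp hPc
  set N : ℝ → ℝ := fun t => π / 2 * (X t 3 * frame v (deriv γ t) 1 - X t 1 * frame v (deriv γ t) 3)
  have hNm : Measurable N := by
    have hX (i : Fin 4) : Measurable fun t => X t i := by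
      have : Continuous fun t => X t i := by fun_prop
      exact this.measurable
    have hd (i : Fin 4) : Measurable fun t => frame v (deriv γ t) i := by
      have : Continuous fun y : E4 => frame v y i := by fun_prop
      exact this.measurable.comp (measurable_deriv γ)
    exact (((hX 3).mul (hd 1)).sub ((hX 1).mul (hd 3))).const_mul _
  set F : ℝ → ℝ → ℝ := fun s t => N t * radialPotential (X t) (π / 2 * s) with hF
  have e1 : ∀ s, ∀ t ∈ Icc (0 : ℝ) 1, ∫ u in Ioi (0 : ℝ),
      u * Matrix.det (Matrix.of ![(vertexArc v s).ofLp, (deriv (vertexArc v) s).ofLp, (γ t).ofLp,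
        (deriv γ t).ofLp]) / ‖vertexArc v s - u • γ t‖ ^ 4 = F s t := by
    intro s t ht
    rw [integral_inner_gauss, det_vertexArc]
    simp only [hF, N, X, hPe t ht]
  have hI : ∀ t ∈ uIcc (0 : ℝ) 1, t ∈ Icc (0 : ℝ) 1 := fun t ht => by rwa [uIcc_of_le zero_le_one] at ht
  calc _ = ∫ s in (0 : ℝ)..1, ∫ t in (0 : ℝ)..1, F s t :=
        intervalIntegral.integral_congr fun s hs =>
          intervalIntegral.integral_congr fun t ht => e1 s t (hI t ht)
    _ = ∫ t in (0 : ℝ)..1, ∫ s in (0 : ℝ)..1, F s t := by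
        simp only [intervalIntegral.integral_of_le zero_le_one]
        refine integral_integral_swap ?_
        obtain ⟨c, hc0, hcb⟩ := sqDist_uniform_lower_bound (S := X '' Icc 0 1)
          (isCompact_Icc.image hXc) (by
            rintro _ ⟨t, ht, rfl⟩
            simp only [X, hPe t ht]
            exact h t ht)
        obtain ⟨B, hB⟩ := isCompact_Icc.exists_bound_of_continuousOn (s := Icc (0 : ℝ) 1) hXc.continuousOn
        have hB0 : 0 ≤ B := le_trans (norm_nonneg _) (hB 0 ⟨le_rfl, zero_le_one⟩)
        set A := c⁻¹ * ∫ r in Ioi (0 : ℝ), (1 + r ^ 2)⁻¹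
        set L := ‖frame v‖
        refine Integrable.of_bound (C := π / 2 * (B * (L * M) + B * (L * M)) * A) ?_ ?_
        · refine AEStronglyMeasurable.mul (hNm.comp measurable_snd).aestronglyMeasurable ?_
          refine StronglyMeasurable.aestronglyMeasurable ?_
          refine StronglyMeasurable.integral_prod_right (f := fun (z : ℝ × ℝ) (r : ℝ) =>
            r * (sqDist (X z.2) (r * cos (π / 2 * z.1), r * sin (π / 2 * z.1)) ^ 2)⁻¹) ?_
          have hcont : Continuous fun w : (ℝ × ℝ) × ℝ => sqDist (X w.1.2)
              (w.2 * cos (π / 2 * w.1.1), w.2 * sin (π / 2 * w.1.1)) :=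
            sqDist_continuous.comp ((hXc.comp (by fun_prop)).prodMk (by fun_prop))
          exact (measurable_snd.mul (hcont.measurable.pow_const 2).inv).stronglyMeasurable
        · rw [Measure.prod_restrict, ae_restrict_iff' (measurableSet_Ioc.prod measurableSet_Ioc)]
          have hS : ∀ᵐ z : ℝ × ℝ ∂(volume.prod volume), z.2 ∉ S := by
            have h0 : ∀ᵐ t : ℝ, t ∉ S := S.countable_toSet.ae_notMem volume
            exact Measure.quasiMeasurePreserving_snd.ae h0
          filter_upwards [hS] with z hz1 hz2
          have ht : z.2 ∈ Icc (0 : ℝ) 1 := Ioc_subset_Icc_self hz2.2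
          have hs : π / 2 * z.1 ∈ Icc 0 (π / 2) := by
            have := pi_pos
            have h1 := hz2.1.1
            have h2 := hz2.1.2
            exact ⟨by positivity, by nlinarith⟩
          have hM' := (hM z.2 ht hz1).2
          have hfr : ∀ i, |frame v (deriv γ z.2) i| ≤ L * M := fun i =>
            calc |frame v (deriv γ z.2) i| ≤ ‖frame v (deriv γ z.2)‖ := abs_apply_le _ i
              _ ≤ L * ‖deriv γ z.2‖ := (frame v).le_opNorm _
              _ ≤ L * M := by gcongr
          have hX : ∀ i, |X z.2 i| ≤ B := fun i => (abs_apply_le _ i).trans (hB z.2 ht)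
          have hM0 : 0 ≤ M := le_trans (norm_nonneg _) hM'
          have hN : |N z.2| ≤ π / 2 * (B * (L * M) + B * (L * M)) := by
            simp only [N, abs_mul]
            rw [abs_of_pos (by positivity : (0 : ℝ) < π / 2)]
            gcongr
            refine (abs_sub _ _).trans ?_
            rw [abs_mul, abs_mul]
            gcongr
            exacts [hX 3, hfr 1, hX 1, hfr 3]
          have hR : ‖radialPotential (X z.2) (π / 2 * z.1)‖ ≤ A := by
            have hx := hcb (X z.2) ⟨z.2, ht, rfl⟩
            simp only [A]
            rw [← integral_const_mul]
            refine norm_integral_le_of_norm_le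
              ((integrable_inv_one_add_sq.restrict (s := Ioi (0 : ℝ))).const_mul c⁻¹) ?_
            filter_upwards [ae_restrict_mem measurableSet_Ioi] with r hr
            exact radial_kernel_bound hc0 hx hr hs
          change ‖N z.2 * radialPotential (X z.2) (π / 2 * z.1)‖ ≤ _
          rw [norm_mul, norm_eq_abs]
          exact mul_le_mul hN hR (norm_nonneg _) (by positivity)
    _ = _ := by
        refine intervalIntegral.integral_congr fun t ht => ?_
        have ht := hI t ht
        simp only [hF]
        rw [intervalIntegral.integral_const_mul, arcForm_apply, quadrantPotential_eq_radial (h t ht)]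
        simp only [N, X, hPe t ht]
        ring

lemma IsTameCurve.integrableOn {U : Set E4} {χ : E4 → E4 →L[ℝ] ℝ} (hχ : ContinuousOn χ U)
    {γ : ℝ → E4} (hγ : IsTameCurve γ) (h : ∀ t ∈ Icc (0 : ℝ) 1, γ t ∈ U) :
    IntegrableOn (fun t => χ (γ t) (deriv γ t)) (Icc 0 1) := by
  obtain ⟨hc, S, M, hM⟩ := hγ
  set P : ℝ → E4 := fun t => γ (projIcc 0 1 zero_le_one t) with hP
  have hPc : Continuous P := hc.domRestrict.comp continuous_projIcc
  have hPe : ∀ t ∈ Icc (0 : ℝ) 1, P t = γ t := fun t ht => by simp only [hP, projIcc_of_mem _ ht]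
  have hPU : ∀ t, P t ∈ U := fun t => h _ (projIcc 0 1 zero_le_one t).2
  have hχP : Continuous fun t => χ (P t) := hχ.comp_continuous hPc hPU
  obtain ⟨B, hB⟩ := isCompact_Icc.exists_bound_of_continuousOn (s := Icc (0 : ℝ) 1) hχP.continuousOn
  have hint : IntegrableOn (fun t => χ (P t) (deriv γ t)) (Icc 0 1) := by
    refine Measure.integrableOn_of_bounded (M := B * M) (by simp) ?_ ?_
    · exact isBoundedBilinearMap_apply.continuous.comp_aestronglyMeasurable
        (hχP.aestronglyMeasurable.prodMk (stronglyMeasurable_deriv γ).aestronglyMeasurable)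
    · have h0 : ∀ᵐ t : ℝ, t ∉ S := S.countable_toSet.ae_notMem volume
      filter_upwards [ae_restrict_of_ae h0, ae_restrict_mem measurableSet_Icc] with t ht1 ht2
      have h1 := (hM t ht2 ht1).2
      calc _ ≤ ‖χ (P t)‖ * ‖deriv γ t‖ := (χ (P t)).le_opNorm _
        _ ≤ B * M := mul_le_mul (hB t ht2) h1 (norm_nonneg _) ((norm_nonneg _).trans (hB t ht2))
  exact hint.congr_fun (fun t ht => by simp only [hPe t ht]) measurableSet_Icc

lemma IsTameCurve.integral_eq_sub {U : Set E4} {χ : E4 → E4 →L[ℝ] ℝ} (hχ : ContinuousOn χ U)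
    {γ : ℝ → E4} (hγ : IsTameCurve γ) (h : ∀ t ∈ Icc (0 : ℝ) 1, γ t ∈ U) {a b : ℝ} (ha : 0 ≤ a)
    (hab : a ≤ b) (hb : b ≤ 1) {f : E4 → ℝ}
    (hf : ∀ t ∈ Icc a b, HasFDerivAt f (χ (γ t)) (γ t)) :
    ∫ t in a..b, χ (γ t) (deriv γ t) = f (γ b) - f (γ a) := by
  have hint := hγ.integrableOn hχ h
  obtain ⟨hc, S, M, hM⟩ := hγ
  have hsub : Icc a b ⊆ Icc 0 1 := Icc_subset_Icc ha hb
  refine MeasureTheory.integral_eq_of_hasDerivAt_off_countable_of_le (fun t => f (γ t)) _ hab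
    S.countable_toSet ?_ ?_ ?_
  · intro t ht
    exact (hf t ht).continuousAt.comp_continuousWithinAt ((hc t (hsub ht)).mono hsub)
  · rintro t ⟨ht, htS⟩
    have ht' := Ioo_subset_Icc_self ht
    exact (hf t ht').comp_hasDerivAt t (hM t (hsub ht') htS).1.hasDerivAt
  · rw [intervalIntegrable_iff_integrableOn_Icc_of_le hab]
    exact hint.mono_set hsub

section Homotopy

variable {R : Finset Torus}

lemma linkForm_continuousOn (hR : IsLinkDiagram R) {ε : Torus → ℤˣ} (hε : IsOrientation R ε) :
    ContinuousOn (linkForm R ε) (linkFormDomain R) := fun _ hx =>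
  (linkForm_closed hR hε hx).1.continuousAt.continuousWithinAt

lemma arcForm_continuousOn {v : Torus} (hv : v ∈ R) :
    ContinuousOn (arcForm v) (linkFormDomain R) := fun _ hx =>
  (arcForm_hasFDerivAt (hx v hv)).choose_spec.1.continuousAt.continuousWithinAt

lemma linkingNumber_eq_integral (ε : Torus → ℤˣ) {κ : Type*} (T : Finset κ) (b : κ → ℤˣ)
    (B : κ → ℝ → E4) (hB : ∀ j ∈ T, IsTameCurve (B j))
    (hU : ∀ j ∈ T, ∀ t ∈ Icc (0 : ℝ) 1, B j t ∈ linkFormDomain R) :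
    linkingNumber R ε vertexArc T b B = 1 / (2 * π ^ 2) *
      ∑ j ∈ T, ((b j : ℤ) : ℝ) * ∫ t in (0 : ℝ)..1, linkForm R ε (B j t) (deriv (B j) t) := by
  rw [linkingNumber, Finset.sum_comm, Finset.mul_sum]
  refine Finset.sum_congr rfl fun j hj => ?_
  have hi : ∀ v ∈ R, IntervalIntegrable (fun t => arcForm v (B j t) (deriv (B j) t)) volume 0 1 :=
    fun v hv => by
      rw [intervalIntegrable_iff_integrableOn_Icc_of_le zero_le_one]
      exact (hB j hj).integrableOn (arcForm_continuousOn hv) (hU j hj)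
  have e : ∫ t in (0 : ℝ)..1, linkForm R ε (B j t) (deriv (B j) t) =
      ∑ v ∈ R, ((ε v : ℤ) : ℝ) * ∫ t in (0 : ℝ)..1, arcForm v (B j t) (deriv (B j) t) := by
    simp only [← intervalIntegral.integral_const_mul]
    rw [← intervalIntegral.integral_finsetSum fun v hv => (hi v hv).const_mul _]
    refine intervalIntegral.integral_congr fun t _ => ?_
    simp [linkForm]
  rw [e, Finset.mul_sum, Finset.mul_sum]
  refine Finset.sum_congr rfl fun v hv => ?_
  rw [gaussIntegral_vertexArc v (hB j hj) fun t ht => hU j hj t ht v hv]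
  push_cast
  ring

theorem linkingNumber_homotopy (hR : IsLinkDiagram R) {ε : Torus → ℤˣ} (hε : IsOrientation R ε)
    (K : Torus → ℝ → ℝ → E4)
    (hc : ∀ v ∈ R, ContinuousOn (Function.uncurry (K v)) (Icc 0 1 ×ˢ Icc 0 1))
    (hU : ∀ v ∈ R, ∀ t ∈ Icc (0 : ℝ) 1, ∀ s ∈ Icc (0 : ℝ) 1, K v t s ∈ linkFormDomain R)
    (hK0 : ∀ v ∈ R, ∀ s ∈ Icc (0 : ℝ) 1, K (partner R false v) 0 s = K v 0 s)
    (hK1 : ∀ v ∈ R, ∀ s ∈ Icc (0 : ℝ) 1, K (partner R true v) 1 s = K v 1 s)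
    (ht0 : ∀ v ∈ R, IsTameCurve fun t => K v t 0) (ht1 : ∀ v ∈ R, IsTameCurve fun t => K v t 1) :
    linkingNumber R ε vertexArc R ε (fun v t => K v t 0) =
      linkingNumber R ε vertexArc R ε (fun v t => K v t 1) := by
  set I2 : Set (ℝ × ℝ) := Icc 0 1 ×ˢ Icc 0 1 with hI2
  have hI2c : IsCompact I2 := isCompact_Icc.prod isCompact_Icc
  set C : Set E4 := ⋃ v ∈ R, Function.uncurry (K v) '' I2 with hC
  have hCc : IsCompact C := R.finite_toSet.isCompact_biUnion fun v hv => hI2c.image_of_continuousOn (hc v hv)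
  have hCU : C ⊆ linkFormDomain R := by
    intro x hx
    simp only [hC, mem_iUnion] at hx
    obtain ⟨v, hv, z, hz, rfl⟩ := hx
    exact hU v hv z.1 hz.1 z.2 hz.2
  have hmem : ∀ v ∈ R, ∀ t ∈ Icc (0 : ℝ) 1, ∀ s ∈ Icc (0 : ℝ) 1, K v t s ∈ C := fun v hv t ht s hs =>
    mem_biUnion hv ⟨(t, s), ⟨ht, hs⟩, rfl⟩
  obtain ⟨r, hr, hrU⟩ := hCc.exists_thickening_subset_open (isOpen_linkFormDomain R) hCU
  have hball : ∀ x ∈ C, Metric.ball x r ⊆ linkFormDomain R := fun x hx =>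
    (Metric.ball_subset_thickening hx r).trans hrU
  have hprim : ∀ x, ∃ f : E4 → ℝ, x ∈ C → ∀ y ∈ Metric.ball x r, HasFDerivAt f (linkForm R ε y) y := by
    intro x
    by_cases hx : x ∈ C
    · obtain ⟨f, hf⟩ := linkForm_exists_primitive hR hε (hball x hx)
      exact ⟨f, fun _ => hf⟩
    · exact ⟨0, fun h => absurd h hx⟩
  choose f hf using hprim
  have hconst : ∀ x ∈ C, ∀ x' ∈ C, ∀ y z, y ∈ Metric.ball x r → z ∈ Metric.ball x r →
      y ∈ Metric.ball x' r → z ∈ Metric.ball x' r → f x z - f x y = f x' z - f x' y := by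
    intro x hx x' hx' y z h1 h2 h3 h4
    have hconv : Convex ℝ (Metric.ball x r ∩ Metric.ball x' r) := (convex_ball x r).inter (convex_ball x' r)
    have hd : ∀ w ∈ Metric.ball x r ∩ Metric.ball x' r,
        HasFDerivAt (fun w => f x w - f x' w) (0 : E4 →L[ℝ] ℝ) w := fun w hw => by
      have := (hf x hx w hw.1).sub (hf x' hx' w hw.2)
      rwa [sub_self] at this
    have := hconv.is_const_of_fderivWithin_eq_zero (𝕜 := ℝ)
      (fun w hw => (hd w hw).differentiableAt.differentiableWithinAt)
      (fun w hw => by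
        rw [fderivWithin_of_isOpen (Metric.isOpen_ball.inter Metric.isOpen_ball) hw, (hd w hw).fderiv])
      ⟨h1, h3⟩ ⟨h2, h4⟩
    linarith
  have huc : ∃ δ > 0, ∀ v ∈ R, ∀ z ∈ I2, ∀ w ∈ I2, dist z w < δ →
      dist (Function.uncurry (K v) z) (Function.uncurry (K v) w) < r := by
    have h1 : ∀ v ∈ R, ∃ δ > 0, ∀ z ∈ I2, ∀ w ∈ I2, dist z w < δ →
        dist (Function.uncurry (K v) z) (Function.uncurry (K v) w) < r := fun v hv => by
      have := Metric.uniformContinuousOn_iff.1 (hI2c.uniformContinuousOn_of_continuous (hc v hv)) r hr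
      obtain ⟨δ, hδ, h⟩ := this
      exact ⟨δ, hδ, fun z hz w hw => h z hz w hw⟩
    have h2 : ∀ᶠ δ in 𝓝[>] (0 : ℝ), ∀ v ∈ R, ∀ z ∈ I2, ∀ w ∈ I2, dist z w < δ →
        dist (Function.uncurry (K v) z) (Function.uncurry (K v) w) < r := by
      refine (Finset.eventually_all R).2 fun v hv => ?_
      obtain ⟨δ, hδ, h⟩ := h1 v hv
      filter_upwards [Ioo_mem_nhdsGT hδ] with δ' hδ' z hz w hw hzw
      exact h z hz w hw (hzw.trans hδ'.2)
    obtain ⟨δ, h, hδ⟩ := (h2.and self_mem_nhdsWithin).exists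
    exact ⟨δ, hδ, h⟩
  obtain ⟨δ, hδ, huc⟩ := huc
  obtain ⟨n, hn⟩ := exists_nat_one_div_lt hδ
  set N : ℕ := n + 1
  have hN : (0 : ℝ) < N := by positivity
  have hN1 : 1 / (N : ℝ) < δ := by simpa [N] using hn
  set p : ℕ → ℝ := fun i => i / N with hp
  have hpI : ∀ i ≤ N, p i ∈ Icc (0 : ℝ) 1 := fun i hi =>
    ⟨by positivity, by simp only [hp]; rw [div_le_one hN]; exact_mod_cast hi⟩
  have hp1 : ∀ i, p (i + 1) - p i = 1 / N := fun i => by simp only [hp]; push_cast; ring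
  have hple : ∀ i, p i ≤ p (i + 1) := fun i => by
    have := hp1 i
    have h2 : 0 < 1 / (N : ℝ) := by positivity
    linarith
  have hclose : ∀ v ∈ R, ∀ a ∈ Icc (0 : ℝ) 1, ∀ b ∈ Icc (0 : ℝ) 1, ∀ a' ∈ Icc (0 : ℝ) 1,
      ∀ b' ∈ Icc (0 : ℝ) 1, |a' - a| ≤ 1 / N → |b' - b| ≤ 1 / N → K v a' b' ∈ Metric.ball (K v a b) r := by
    intro v hv a ha b hb a' ha' b' hb' h1 h2
    refine huc v hv (a', b') ⟨ha', hb'⟩ (a, b) ⟨ha, hb⟩ ?_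
    rw [Prod.dist_eq, dist_eq, dist_eq]
    exact lt_of_le_of_lt (max_le h1 h2) hN1
  have hN0 : (0 : ℝ) ≤ 1 / N := by positivity
  set P : E4 → E4 → ℝ := fun x y => f x y - f x x with hP
  have hcell : ∀ v ∈ R, ∀ i < N, ∀ j < N,
      P (K v (p i) (p j)) (K v (p (i + 1)) (p j)) + P (K v (p (i + 1)) (p j)) (K v (p (i + 1)) (p (j + 1))) =
      P (K v (p i) (p j)) (K v (p i) (p (j + 1))) + P (K v (p i) (p (j + 1))) (K v (p (i + 1)) (p (j + 1))) := by
    intro v hv i hi j hj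
    have i0 := hpI i hi.le
    have i1 := hpI (i + 1) hi
    have j0 := hpI j hj.le
    have j1 := hpI (j + 1) hj
    have di : |p (i + 1) - p i| ≤ 1 / N := by rw [hp1, abs_of_nonneg hN0]
    have dj : |p (j + 1) - p j| ≤ 1 / N := by rw [hp1, abs_of_nonneg hN0]
    have d0 (i) : |p i - p i| ≤ 1 / N := by simp
    have c := hclose v hv (p i) i0 (p j) j0
    have ab := c _ i1 _ j0 di (d0 j)
    have ac := c _ i0 _ j1 (d0 i) dj
    have ad := c _ i1 _ j1 di dj
    have bd := hclose v hv _ i1 _ j0 _ i1 _ j1 (d0 _) dj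
    have cd := hclose v hv _ i0 _ j1 _ i1 _ j1 di (d0 _)
    have e1 := hconst _ (hmem v hv _ i0 _ j0) _ (hmem v hv _ i1 _ j0) _ _ ab ad (Metric.mem_ball_self hr) bd
    have e2 := hconst _ (hmem v hv _ i0 _ j0) _ (hmem v hv _ i0 _ j1) _ _ ac ad (Metric.mem_ball_self hr) cd
    simp only [hP]
    linarith
  set A : Torus → ℕ → ℝ := fun v j => ∑ i ∈ Finset.range N, P (K v (p i) (p j)) (K v (p (i + 1)) (p j)) with hA
  have hstep : ∀ v ∈ R, ∀ j < N, A v j - A v (j + 1) =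
      P (K v 0 (p j)) (K v 0 (p (j + 1))) - P (K v 1 (p j)) (K v 1 (p (j + 1))) := by
    intro v hv j hj
    have hp0 : p 0 = 0 := by simp [hp]
    have hpN : p N = 1 := by simp only [hp]; exact div_self hN.ne'
    calc _ = ∑ i ∈ Finset.range N, (P (K v (p i) (p j)) (K v (p i) (p (j + 1)))
          - P (K v (p (i + 1)) (p j)) (K v (p (i + 1)) (p (j + 1)))) := by
          simp only [hA]
          rw [← Finset.sum_sub_distrib]
          refine Finset.sum_congr rfl fun i hi => ?_
          have := hcell v hv i (Finset.mem_range.1 hi) j hj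
          linarith
      _ = _ := by
          rw [Finset.sum_range_sub' (fun i => P (K v (p i) (p j)) (K v (p i) (p (j + 1)))), hp0, hpN]
  have hsum : ∀ j ≤ N, ∑ v ∈ R, ((ε v : ℤ) : ℝ) * A v 0 = ∑ v ∈ R, ((ε v : ℤ) : ℝ) * A v j := by
    intro j
    induction j with
    | zero => exact fun _ => rfl
    | succ j ih =>
      intro hj
      rw [ih (by omega), ← sub_eq_zero, ← Finset.sum_sub_distrib]
      have hj' : j < N := hj
      have s0 := hpI j hj'.le
      have s1 := hpI (j + 1) hj
      have h1 := sum_partner_eq_zero hR hε false (fun v => P (K v 0 (p j)) (K v 0 (p (j + 1))))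
        fun v hv => by rw [hK0 v hv _ s0, hK0 v hv _ s1]
      have h2 := sum_partner_eq_zero hR hε true (fun v => P (K v 1 (p j)) (K v 1 (p (j + 1))))
        fun v hv => by rw [hK1 v hv _ s0, hK1 v hv _ s1]
      simp only [smul_eq_mul] at h1 h2
      rw [← sub_eq_zero.2 (h1.trans h2.symm), ← Finset.sum_sub_distrib]
      refine Finset.sum_congr rfl fun v hv => ?_
      rw [← mul_sub, hstep v hv j hj', mul_sub]
  have hint : ∀ v ∈ R, ∀ j ≤ N, IsTameCurve (fun t => K v t (p j)) →
      ∫ t in (0 : ℝ)..1, linkForm R ε (K v t (p j)) (deriv (fun t => K v t (p j)) t) = A v j := by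
    intro v hv j hj ht
    have sj := hpI j hj
    have hχ := linkForm_continuousOn hR hε
    have hUU : ∀ t ∈ Icc (0 : ℝ) 1, K v t (p j) ∈ linkFormDomain R := fun t ht => hU v hv t ht _ sj
    have hp0 : p 0 = 0 := by simp [hp]
    have hpN : p N = 1 := by simp only [hp]; exact div_self hN.ne'
    have hII := ht.integrableOn hχ hUU
    rw [← hp0, ← hpN, ← intervalIntegral.sum_integral_adjacent_intervals]
    · refine Finset.sum_congr rfl fun i hi => ?_
      have hi : i < N := Finset.mem_range.1 hi
      have i0 := hpI i hi.le
      have i1 := hpI (i + 1) hi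
      rw [ht.integral_eq_sub hχ hUU (f := f (K v (p i) (p j))) i0.1 (hple i) i1.2]
      intro t ht'
      have htI : t ∈ Icc (0 : ℝ) 1 := ⟨i0.1.trans ht'.1, ht'.2.trans i1.2⟩
      refine hf _ (hmem v hv _ i0 _ sj) _ (hclose v hv _ i0 _ sj _ htI _ sj ?_ (by simp))
      have := hp1 i
      rw [abs_of_nonneg (by linarith [ht'.1])]
      linarith [ht'.2]
    · intro i hi
      rw [intervalIntegrable_iff_integrableOn_Icc_of_le (hple i)]
      exact hII.mono_set (Icc_subset_Icc (hpI i hi.le).1 (hpI (i + 1) hi).2)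
  have hp0 : p 0 = 0 := by simp [hp]
  have hpN : p N = 1 := by simp only [hp]; exact div_self hN.ne'
  rw [linkingNumber_eq_integral ε R ε _ ht0 fun v hv t ht => hU v hv t ht 0 ⟨le_rfl, zero_le_one⟩,
    linkingNumber_eq_integral ε R ε _ ht1 fun v hv t ht => hU v hv t ht 1 ⟨zero_le_one, le_rfl⟩]
  congr 1
  calc _ = ∑ v ∈ R, ((ε v : ℤ) : ℝ) * A v 0 := Finset.sum_congr rfl fun v hv => by
          have := hint v hv 0 (Nat.zero_le _) (by rw [hp0]; exact ht0 v hv)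
          rw [hp0] at this
          rw [this]
    _ = ∑ v ∈ R, ((ε v : ℤ) : ℝ) * A v N := hsum N le_rfl
    _ = _ := Finset.sum_congr rfl fun v hv => by
          have := hint v hv N le_rfl (by rw [hpN]; exact ht1 v hv)
          rw [hpN] at this
          rw [this]

end Homotopy

lemma quadraticKernel_pos {a : ℝ} (ha : |a| < 1) (m : ℝ) : 0 < 1 - 2 * m * a + m ^ 2 := by
  have := (sq_lt_one_iff_abs_lt_one a).2 ha
  nlinarith [sq_nonneg (m - a)]

lemma sin_mul_integral_quadraticKernel (Δ : Angle) (h0 : Δ.sin ≠ 0) :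
    IntegrableOn (fun m : ℝ => (1 - 2 * m * Δ.cos + m ^ 2)⁻¹) (Ioi 0) ∧
    Δ.sin * ∫ m in Ioi (0 : ℝ), (1 - 2 * m * Δ.cos + m ^ 2)⁻¹ =
      -(Δ + (π : Angle)).toReal := by
  have hcs := Angle.cos_sq_add_sin_sq Δ
  set c := Δ.cos with hc
  set s := Δ.sin with hs
  have hd : ∀ x ∈ Ici (0 : ℝ), HasDerivAt (fun m => arctan ((m - c) / s))
      (s * (1 - 2 * x * c + x ^ 2)⁻¹) x := by
    intro x _
    have h1 : HasDerivAt (fun m : ℝ => (m - c) / s) (1 / s) x :=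
      ((hasDerivAt_id x).sub_const c).div_const s
    convert h1.arctan using 1
    have h2 : 1 - 2 * x * c + x ^ 2 = s ^ 2 + (x - c) ^ 2 := by linear_combination -hcs
    rw [h2]
    field_simp
  have hX : ∀ x : ℝ, 0 ≤ (1 - 2 * x * c + x ^ 2)⁻¹ := fun x => by
    have : 1 - 2 * x * c + x ^ 2 = s ^ 2 + (x - c) ^ 2 := by linear_combination -hcs
    rw [this]; positivity
  have hint : IntegrableOn (fun m : ℝ => s * (1 - 2 * m * c + m ^ 2)⁻¹) (Ioi 0) →
      IntegrableOn (fun m : ℝ => (1 - 2 * m * c + m ^ 2)⁻¹) (Ioi 0) := fun h => by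
    refine (h.const_mul s⁻¹).congr (.of_forall fun x => ?_)
    simp only; rw [← mul_assoc, inv_mul_cancel₀ h0, one_mul]
  have hδ : (Δ.toReal : Angle) = Δ := Δ.coe_toReal
  have hd1 := Δ.neg_pi_lt_toReal
  have hd2 := Δ.toReal_le_pi
  have e1 : sin Δ.toReal = s := by rw [← Angle.sin_coe, hδ]
  have e2 : cos Δ.toReal = c := by rw [← Angle.cos_coe, hδ]
  set δ := Δ.toReal
  rw [← integral_const_mul, ← hδ, ← Angle.coe_add]
  have hneg : (0 - c) / s = -(c / s) := by ring
  have hcot : ∀ y, y ∈ Ioo (-(π / 2)) (π / 2) → sin y * s = cos y * c →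
      arctan (c / s) = y := fun y hy h => by
    refine arctan_eq_of_tan_eq ?_ hy
    have := cos_pos_of_mem_Ioo hy
    rw [tan_eq_sin_div_cos, div_eq_div_iff this.ne' h0]
    linarith
  rcases lt_or_gt_of_ne h0 with hneg' | hpos
  · have hlim : Tendsto (fun m => arctan ((m - c) / s)) atTop (𝓝 (-(π / 2))) := by
      refine (tendsto_arctan_atBot.mono_right nhdsWithin_le_nhds).comp ?_
      simp only [sub_eq_add_neg]
      exact (tendsto_atTop_add_const_right _ _ tendsto_id).atTop_div_const_of_neg hneg'
    have hn : ∀ x ∈ Ioi (0 : ℝ), s * (1 - 2 * x * c + x ^ 2)⁻¹ ≤ 0 := fun x _ =>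
      mul_nonpos_of_nonpos_of_nonneg hneg'.le (hX x)
    refine ⟨hint (integrableOn_Ioi_deriv_of_nonpos' hd hn hlim), ?_⟩
    rw [integral_Ioi_of_hasDerivAt_of_nonpos' hd hn hlim]
    have hδ0 : δ < 0 := by
      by_contra hcon
      have := sin_nonneg_of_nonneg_of_le_pi (not_lt.1 hcon) hd2
      linarith
    rw [Angle.toReal_coe_eq_self_iff.2 ⟨by linarith, by linarith⟩, hneg, arctan_neg,
      hcot (-(π / 2) - δ) ⟨by linarith, by linarith⟩]
    · ring
    · rw [← e1, ← e2, show -(π / 2) - δ = -(δ + π / 2) by ring, sin_neg, cos_neg,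
        sin_add_pi_div_two, cos_add_pi_div_two]
      ring
  · have hlim : Tendsto (fun m => arctan ((m - c) / s)) atTop (𝓝 (π / 2)) := by
      refine (tendsto_arctan_atTop.mono_right nhdsWithin_le_nhds).comp ?_
      simp only [sub_eq_add_neg]
      exact (tendsto_atTop_add_const_right _ _ tendsto_id).atTop_div_const hpos
    have hn : ∀ x ∈ Ioi (0 : ℝ), 0 ≤ s * (1 - 2 * x * c + x ^ 2)⁻¹ := fun x _ =>
      mul_nonneg hpos.le (hX x)
    refine ⟨hint (integrableOn_Ioi_deriv_of_nonneg' hd hn hlim), ?_⟩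
    rw [integral_Ioi_of_hasDerivAt_of_nonneg' hd hn hlim]
    have hδ0 : 0 < δ := by
      by_contra hcon
      have := sin_nonpos_of_nonpos_of_neg_pi_le (not_lt.1 hcon) hd1.le
      linarith
    have hδ1 : δ < π := lt_of_le_of_ne hd2 fun h => by
      rw [h, sin_pi] at e1; exact h0 e1.symm
    rw [Angle.toReal_coe_eq_self_sub_two_pi_iff.2 ⟨by linarith, by linarith⟩, hneg,
      arctan_neg, hcot (π / 2 - δ) ⟨by linarith, by linarith⟩]
    · ring
    · rw [← e1, ← e2, sin_pi_div_two_sub, cos_pi_div_two_sub]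
      ring

/-- The kernel of the Gauss integral of two arcs. -/
def arcPairKernel (a b t : ℝ) (z : ℝ × ℝ) : ℝ :=
  cos (π / 2 * t) * sin (π / 2 * t) *
    ((cos (π / 2 * t) ^ 2 * (1 - 2 * z.1 * a + z.1 ^ 2) +
      sin (π / 2 * t) ^ 2 * (1 - 2 * z.2 * b + z.2 ^ 2)) ^ 2)⁻¹

lemma half_angle_pos {t : ℝ} (ht : t ∈ Ioo (0 : ℝ) 1) :
    0 < cos (π / 2 * t) ∧ 0 < sin (π / 2 * t) := by
  have hpi := pi_pos
  exact ⟨cos_pos_of_mem_Ioo ⟨by nlinarith [ht.1], by nlinarith [ht.2]⟩,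
    sin_pos_of_pos_of_lt_pi (by nlinarith [ht.1]) (by nlinarith [ht.2])⟩

lemma half_angle_nonneg {t : ℝ} (ht : t ∈ Icc (0 : ℝ) 1) :
    0 ≤ cos (π / 2 * t) ∧ 0 ≤ sin (π / 2 * t) := by
  have hpi := pi_pos
  exact ⟨cos_nonneg_of_mem_Icc ⟨by nlinarith [ht.1], by nlinarith [ht.2]⟩,
    sin_nonneg_of_nonneg_of_le_pi (by nlinarith [ht.1]) (by nlinarith [ht.2])⟩

lemma arcPairKernel_denom_pos {X Y : ℝ} (hX : 0 < X) (hY : 0 < Y) (t : ℝ) :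
    0 < cos (π / 2 * t) ^ 2 * X + sin (π / 2 * t) ^ 2 * Y := by
  have := cos_sq_add_sin_sq (π / 2 * t)
  rcases (sq_nonneg (cos (π / 2 * t))).eq_or_lt with h | h
  · rw [← h] at this ⊢
    rw [zero_add] at this
    rw [this]; simpa
  · positivity

lemma arcPairKernel_primitive_aux {C S X Y : ℝ} (h : C ^ 2 + S ^ 2 = 1) (hX : X ≠ 0) :
    1 / (π * X) * ((((2 : ℕ) : ℝ) * S ^ (2 - 1) * (C * (π / 2)) * (C ^ 2 * X + S ^ 2 * Y) -
      S ^ 2 * (((2 : ℕ) : ℝ) * C ^ (2 - 1) * (-S * (π / 2)) * X +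
        ((2 : ℕ) : ℝ) * S ^ (2 - 1) * (C * (π / 2)) * Y)) / (C ^ 2 * X + S ^ 2 * Y) ^ 2) =
    C * S * ((C ^ 2 * X + S ^ 2 * Y) ^ 2)⁻¹ := by
  field_simp
  push_cast
  linear_combination 2 * S * C * X * ((C ^ 2 * X + S ^ 2 * Y) ^ 2)⁻¹ * h

lemma integral_arcPairKernel {a b : ℝ} (ha : |a| < 1) (hb : |b| < 1) (z : ℝ × ℝ) :
    Continuous (fun t => arcPairKernel a b t z) ∧
    ∫ t in (0 : ℝ)..1, arcPairKernel a b t z =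
      1 / π * ((1 - 2 * z.1 * a + z.1 ^ 2)⁻¹ * (1 - 2 * z.2 * b + z.2 ^ 2)⁻¹) := by
  have hX := quadraticKernel_pos ha z.1
  have hY := quadraticKernel_pos hb z.2
  simp only [arcPairKernel]
  set X := 1 - 2 * z.1 * a + z.1 ^ 2
  set Y := 1 - 2 * z.2 * b + z.2 ^ 2
  have hpos := arcPairKernel_denom_pos hX hY
  have hcont : Continuous fun t : ℝ => cos (π / 2 * t) * sin (π / 2 * t) *
    ((cos (π / 2 * t) ^ 2 * X + sin (π / 2 * t) ^ 2 * Y) ^ 2)⁻¹ := by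
    refine Continuous.mul (by fun_prop) (Continuous.inv₀ (by fun_prop) fun t => ?_)
    have := hpos t
    positivity
  refine ⟨hcont, ?_⟩
  rw [intervalIntegral.integral_eq_sub_of_hasDerivAt (f := fun t => 1 / (π * X) *
    (sin (π / 2 * t) ^ 2 / (cos (π / 2 * t) ^ 2 * X +
      sin (π / 2 * t) ^ 2 * Y))) ?_ (hcont.intervalIntegrable _ _)]
  · simp
    field_simp
  · intro t _
    have h0 : HasDerivAt (fun t : ℝ => π / 2 * t) (π / 2) t := by
      simpa using (hasDerivAt_id t).const_mul (π / 2)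
    have hs := (h0.sin).pow 2
    have hc := (h0.cos).pow 2
    have hD := hpos t
    refine HasDerivAt.congr_deriv ((hs.div ((hc.mul_const X).add (hs.mul_const Y)) hD.ne').const_mul
      (1 / (π * X))) ?_
    exact arcPairKernel_primitive_aux (cos_sq_add_sin_sq (π / 2 * t)) hX.ne'

lemma integrable_arcPairKernel {a b t : ℝ} (ht : t ∈ Ioo (0 : ℝ) 1) (ha : |a| < 1) (hb : |b| < 1)
    (hia : IntegrableOn (fun m : ℝ => (1 - 2 * m * a + m ^ 2)⁻¹) (Ioi 0))
    (hib : IntegrableOn (fun m : ℝ => (1 - 2 * m * b + m ^ 2)⁻¹) (Ioi 0)) :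
    Integrable (arcPairKernel a b t) quadrantMeasure := by
  obtain ⟨hC, hS⟩ := half_angle_pos ht
  set C := cos (π / 2 * t) with hCd
  set S := sin (π / 2 * t) with hSd
  refine ((hia.mul_prod hib).const_mul ((4 * C * S)⁻¹)).mono' ?_ (.of_forall fun z => ?_)
  · unfold arcPairKernel
    exact Measurable.aestronglyMeasurable (by fun_prop)
  · have hX := quadraticKernel_pos ha z.1
    have hY := quadraticKernel_pos hb z.2
    simp only [arcPairKernel, ← hCd, ← hSd]
    set X := 1 - 2 * z.1 * a + z.1 ^ 2
    set Y := 1 - 2 * z.2 * b + z.2 ^ 2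
    rw [norm_of_nonneg (by positivity)]
    have h1 : (2 * C * S) ^ 2 * (X * Y) ≤ (C ^ 2 * X + S ^ 2 * Y) ^ 2 := by
      nlinarith [sq_nonneg (C ^ 2 * X - S ^ 2 * Y)]
    calc C * S * ((C ^ 2 * X + S ^ 2 * Y) ^ 2)⁻¹ ≤ C * S * ((2 * C * S) ^ 2 * (X * Y))⁻¹ := by
          gcongr
      _ = _ := by field_simp; norm_num

lemma quadrantPotential_eq_arcPairKernel {t : ℝ} (ht : t ∈ Ioo (0 : ℝ) 1) {α β : Angle}
    (ha : |α.cos| < 1) (hb : |β.cos| < 1)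
    (hia : IntegrableOn (fun m : ℝ => (1 - 2 * m * α.cos + m ^ 2)⁻¹) (Ioi 0))
    (hib : IntegrableOn (fun m : ℝ => (1 - 2 * m * β.cos + m ^ 2)⁻¹) (Ioi 0)) {x : E4}
    (hx : x ∉ stdQuadrant)
    (h0 : x 0 = cos (π / 2 * t) * α.cos) (h1 : x 1 = cos (π / 2 * t) * α.sin)
    (h2 : x 2 = sin (π / 2 * t) * β.cos) (h3 : x 3 = sin (π / 2 * t) * β.sin) :
    quadrantPotential x = ∫ z, arcPairKernel α.cos β.cos t z ∂quadrantMeasure := by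
  obtain ⟨hC, hS⟩ := half_angle_pos ht
  rw [quadrantPotential, integral_prod _ (integrable_quadKernel hx),
    integral_prod _ (integrable_arcPairKernel ht ha hb hia hib)]
  set C := cos (π / 2 * t) with hCd
  set S := sin (π / 2 * t) with hSd
  have e1 := integral_comp_mul_left_Ioi
    (fun p => ∫ q in Ioi (0 : ℝ), (sqDist x (p, q) ^ 2)⁻¹) 0 hC
  have e2 : ∀ p, ∫ q in Ioi (0 : ℝ), (sqDist x (p, S * q) ^ 2)⁻¹ =
      S⁻¹ * ∫ q in Ioi (0 : ℝ), (sqDist x (p, q) ^ 2)⁻¹ := fun p => by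
    have := integral_comp_mul_left_Ioi (fun q => (sqDist x (p, q) ^ 2)⁻¹) 0 hS
    simpa only [mul_zero, smul_eq_mul] using this
  have e3 : ∀ m n, arcPairKernel α.cos β.cos t (m, n) = C * S * (sqDist x (C * m, S * n) ^ 2)⁻¹ := by
    intro m n
    simp only [arcPairKernel, ← hCd, ← hSd, sqDist, h0, h1, h2, h3]
    congr 3
    linear_combination -C ^ 2 * α.cos_sq_add_sin_sq - S ^ 2 * β.cos_sq_add_sin_sq
  simp only [e3, integral_const_mul, e2]
  rw [mul_zero, smul_eq_mul] at e1
  rw [← mul_assoc, mul_assoc C S, mul_inv_cancel₀ hS.ne', mul_one] at *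
  rw [e1, ← mul_assoc, mul_inv_cancel₀ hC.ne', one_mul]

lemma integral_integral_arcPairKernel {a b : ℝ} (ha : |a| < 1) (hb : |b| < 1)
    (hia : IntegrableOn (fun m : ℝ => (1 - 2 * m * a + m ^ 2)⁻¹) (Ioi 0))
    (hib : IntegrableOn (fun m : ℝ => (1 - 2 * m * b + m ^ 2)⁻¹) (Ioi 0)) :
    ∫ t in (0 : ℝ)..1, ∫ z, arcPairKernel a b t z ∂quadrantMeasure =
      1 / π * ((∫ m in Ioi (0 : ℝ), (1 - 2 * m * a + m ^ 2)⁻¹) *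
        ∫ m in Ioi (0 : ℝ), (1 - 2 * m * b + m ^ 2)⁻¹) := by
  have hz := integral_arcPairKernel ha hb
  rw [intervalIntegral.integral_of_le zero_le_one, integral_integral_swap]
  · simp only [← intervalIntegral.integral_of_le zero_le_one, (hz _).2]
    rw [integral_const_mul, ← integral_prod_mul]
  · rw [integrable_prod_iff']
    · constructor
      · refine .of_forall fun z => ?_
        exact (intervalIntegrable_iff_integrableOn_Ioc_of_le zero_le_one).1
          ((hz z).1.intervalIntegrable 0 1)
      · refine ((hia.mul_prod hib).const_mul (1 / π)).congr (.of_forall fun z => ?_)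
        simp only
        rw [← (hz z).2, intervalIntegral.integral_of_le zero_le_one]
        refine setIntegral_congr_fun measurableSet_Ioc fun t ht => ?_
        obtain ⟨h1, h2⟩ := half_angle_nonneg (Ioc_subset_Icc_self ht)
        simp only [Function.uncurry_apply_pair]
        exact (norm_of_nonneg (mul_nonneg (mul_nonneg h1 h2)
          (inv_nonneg.2 (sq_nonneg _)))).symm
    · unfold arcPairKernel Function.uncurry
      exact Measurable.aestronglyMeasurable (by fun_prop)

lemma vertexArc_isTameCurve (v : Torus) : IsTameCurve (vertexArc v) := by
  have hc : Continuous (vertexArc v) := continuous_iff_continuousAt.2 fun s =>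
    (vertexArc_hasDerivAt v s).continuousAt
  have hd : Continuous (deriv (vertexArc v)) := by
    rw [funext fun s => (vertexArc_hasDerivAt v s).deriv]
    refine (PiLp.continuous_toLp 2 _).comp (continuous_pi fun i => ?_)
    fin_cases i <;> simp <;> fun_prop
  obtain ⟨M, hM⟩ := isCompact_Icc.exists_bound_of_continuousOn (s := Icc (0 : ℝ) 1) hd.continuousOn
  exact ⟨hc.continuousOn, ∅, M, fun t ht _ =>
    ⟨(vertexArc_hasDerivAt v t).differentiableAt, hM t ht⟩⟩

lemma frame_vertexArc (v w : Torus) (t : ℝ) :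
    frame v (vertexArc w t) 0 = cos (π / 2 * t) * (w.2 - v.2).cos ∧
    frame v (vertexArc w t) 1 = cos (π / 2 * t) * (w.2 - v.2).sin ∧
    frame v (vertexArc w t) 2 = sin (π / 2 * t) * (w.1 - v.1).cos ∧
    frame v (vertexArc w t) 3 = sin (π / 2 * t) * (w.1 - v.1).sin := by
  have e : π * t / 2 = π / 2 * t := by ring
  refine ⟨?_, ?_, ?_, ?_⟩ <;>
    simp [vertexArc, joinPoint, e, sub_eq_add_neg, Angle.cos_add, Angle.sin_add] <;> ring

lemma frame_vertexArc_deriv (v w : Torus) (t : ℝ) :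
    frame v (deriv (vertexArc w) t) 1 = -(π / 2) * sin (π / 2 * t) * (w.2 - v.2).sin ∧
    frame v (deriv (vertexArc w) t) 3 = π / 2 * cos (π / 2 * t) * (w.1 - v.1).sin := by
  rw [(vertexArc_hasDerivAt w t).deriv]
  refine ⟨?_, ?_⟩ <;>
    simp [sub_eq_add_neg, Angle.sin_add] <;> ring

lemma eq_zero_of_sin_of_cos {Δ : Angle} (h1 : Δ.sin = 0) (h2 : 0 ≤ Δ.cos) : Δ = 0 := by
  rcases Angle.sin_eq_zero_iff.1 h1 with h | h
  · exact h
  · rw [h, Angle.cos_coe, cos_pi] at h2; linarith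

lemma gaussIntegral_vertexArc_vertexArc {v w : Torus} (h1 : w.1 ≠ v.1) (h2 : w.2 ≠ v.2) :
    gaussIntegral (vertexArc v) (vertexArc w) = -(1 / (4 * π ^ 2)) *
      ((w.2 - v.2 + (π : Angle)).toReal * (w.1 - v.1 + (π : Angle)).toReal) := by
  have hdis : ∀ t ∈ Icc (0 : ℝ) 1, frame v (vertexArc w t) ∉ stdQuadrant := by
    rintro t ht ⟨g0, g1, g2, g3⟩
    obtain ⟨e0, e1, e2, e3⟩ := frame_vertexArc v w t
    obtain ⟨hC, hS⟩ := half_angle_nonneg ht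
    rw [e0] at g0; rw [e1] at g1; rw [e2] at g2; rw [e3] at g3
    have hcs := cos_sq_add_sin_sq (π / 2 * t)
    rcases hC.eq_or_lt with hC | hC
    · have hS : 0 < sin (π / 2 * t) := hS.lt_of_ne fun h => by
        rw [← h, ← hC] at hcs; norm_num at hcs
      exact h1 (sub_eq_zero.1 (eq_zero_of_sin_of_cos ((mul_eq_zero.1 g3).resolve_left hS.ne')
        (nonneg_of_mul_nonneg_right g2 hS)))
    · exact h2 (sub_eq_zero.1 (eq_zero_of_sin_of_cos ((mul_eq_zero.1 g1).resolve_left hC.ne')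
        (nonneg_of_mul_nonneg_right g0 hC)))
  rw [gaussIntegral_vertexArc v (vertexArc_isTameCurve w) hdis]
  set α := w.2 - v.2
  set β := w.1 - v.1
  have hform : ∀ t, arcForm v (vertexArc w t) (deriv (vertexArc w) t) =
      -(π / 2) * (α.sin * β.sin) * quadrantPotential (frame v (vertexArc w t)) := fun t => by
    obtain ⟨e0, e1, e2, e3⟩ := frame_vertexArc v w t
    obtain ⟨d1, d3⟩ := frame_vertexArc_deriv v w t
    rw [arcForm_apply, e1, e3, d1, d3]
    linear_combination -(π / 2) * α.sin * β.sin * quadrantPotential (frame v (vertexArc w t)) *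
      cos_sq_add_sin_sq (π / 2 * t)
  simp only [hform, intervalIntegral.integral_const_mul]
  have hzero : ∀ Δ : Angle, Δ ≠ 0 → Δ.sin = 0 → (Δ + (π : Angle)).toReal = 0 := by
    intro Δ h h'
    rcases Angle.sin_eq_zero_iff.1 h' with h | h
    · contradiction
    · rw [h, ← Angle.coe_add, ← two_mul, Angle.coe_two_pi, Angle.toReal_zero]
  by_cases hα : α.sin = 0
  · rw [hα, hzero α (sub_ne_zero.2 h2) hα]; ring
  by_cases hβ : β.sin = 0
  · rw [hβ, hzero β (sub_ne_zero.2 h1) hβ]; ring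
  have hlt : ∀ Δ : Angle, Δ.sin ≠ 0 → |Δ.cos| < 1 := fun Δ h => by
    rw [← sq_lt_one_iff_abs_lt_one]
    have := Δ.cos_sq_add_sin_sq
    have : 0 < Δ.sin ^ 2 := by positivity
    linarith
  obtain ⟨ia, ea⟩ := sin_mul_integral_quadraticKernel α hα
  obtain ⟨ib, eb⟩ := sin_mul_integral_quadraticKernel β hβ
  have hint : ∫ t in (0 : ℝ)..1, quadrantPotential (frame v (vertexArc w t)) =
      ∫ t in (0 : ℝ)..1, ∫ z, arcPairKernel α.cos β.cos t z ∂quadrantMeasure := by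
    simp only [intervalIntegral.integral_of_le zero_le_one, integral_Ioc_eq_integral_Ioo]
    refine setIntegral_congr_fun measurableSet_Ioo fun t ht => ?_
    obtain ⟨e0, e1, e2, e3⟩ := frame_vertexArc v w t
    exact quadrantPotential_eq_arcPairKernel ht (hlt α hα) (hlt β hβ) ia ib
      (hdis t (Ioo_subset_Icc_self ht)) e0 e1 e2 e3
  rw [hint, integral_integral_arcPairKernel (hlt α hα) (hlt β hβ) ia ib]
  set A := ∫ m in Ioi (0 : ℝ), (1 - 2 * m * α.cos + m ^ 2)⁻¹
  set B := ∫ m in Ioi (0 : ℝ), (1 - 2 * m * β.cos + m ^ 2)⁻¹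
  have e : (α + (π : Angle)).toReal * (β + (π : Angle)).toReal =
      (α.sin * A) * (β.sin * B) := by rw [ea, eb]; ring
  rw [e]
  field_simp
  ring

/-- The sawtooth function `x ↦ x / 2π` at `Δ + π`, set to `0` at the jump. -/
def sawtooth (Δ : Angle) : ℝ :=
  open Classical in if Δ = 0 then 0 else (Δ + (π : Angle)).toReal / (2 * π)

lemma toReal_add_pi_shift {Δ : Angle} {σ s : ℝ} (hσ : 0 < σ) (hs : s = 1 ∨ s = -1)
    (h : ∀ x ∈ Ioc (0 : ℝ) σ, Δ + (x : Angle) ≠ 0 ∧ Δ - (x : Angle) ≠ 0) :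
    open Classical in
    (Δ + ((σ * s : ℝ) : Angle) + (π : Angle)).toReal / (2 * π) =
      sawtooth Δ + σ * s / (2 * π) - s * (if Δ = 0 then 1 / 2 else 0) := by
  by_cases h0 : Δ = 0
  · subst h0
    have h2 : σ < 2 * π := by
      by_contra hn
      refine (h (2 * π) ⟨by positivity, not_lt.1 hn⟩).1 ?_
      rw [zero_add, Angle.coe_two_pi]
    simp only [sawtooth, if_true, zero_add]
    rcases hs with rfl | rfl
    · rw [← Angle.coe_add, Angle.toReal_coe_eq_self_sub_two_pi_iff.2 ⟨by linarith, by linarith⟩]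
      field_simp; ring
    · rw [← Angle.coe_add, Angle.toReal_coe_eq_self_iff.2 ⟨by linarith, by linarith⟩]
      field_simp; ring
  · simp only [sawtooth, h0, if_false, mul_zero, sub_zero]
    set y := (Δ + (π : Angle)).toReal with hy
    have hyc : (y : Angle) = Δ + (π : Angle) := Angle.coe_toReal _
    have y1 := Angle.neg_pi_lt_toReal (Δ + (π : Angle))
    have y2 := Angle.toReal_le_pi (Δ + (π : Angle))
    rw [← hy] at y1 y2
    have y3 : y ≠ π := fun e => h0 (by
      rw [e] at hyc; exact (right_eq_add.1 hyc))
    have y4 : y < π := lt_of_le_of_ne y2 y3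
    have hΔ : Δ = ((y - π : ℝ) : Angle) := by rw [Angle.coe_sub, hyc, add_sub_cancel_right]
    have hu : y + σ < π := by
      by_contra hn
      refine (h (π - y) ⟨by linarith, by linarith⟩).1 ?_
      rw [hΔ, ← Angle.coe_add]; simp
    have hl : -π < y - σ := by
      by_contra hn
      refine (h (y + π) ⟨by linarith, by linarith⟩).2 ?_
      rw [hΔ, ← Angle.coe_sub, show y - π - (y + π) = -(2 * π) by ring,
        Angle.coe_neg, Angle.coe_two_pi, neg_zero]
    rw [← add_div]
    congr 1
    rw [add_right_comm, ← hyc, ← Angle.coe_add, Angle.toReal_coe_eq_self_iff]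
    rcases hs with rfl | rfl <;> constructor <;> linarith

lemma sawtooth_neg (Δ : Angle) : sawtooth (-Δ) = -sawtooth Δ := by
  by_cases h0 : Δ = 0
  · simp [sawtooth, h0]
  · have h1 : -Δ ≠ 0 := neg_ne_zero.2 h0
    simp only [sawtooth, h0, h1, if_false]
    have h2 : Δ + (π : Angle) ≠ (π : Angle) := by simpa using h0
    have h3 := Angle.toReal_neg_eq_neg_toReal_iff.2 h2
    rw [neg_add, Angle.neg_coe_pi] at h3
    rw [h3, neg_div]

/-- The vertex `w` shifted by `σ s₁(w)` in the `θ`-direction and by `σ s₀(w)` in the `φ`-direction. -/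
def shiftVertex (s0 s1 : Torus → ℝ) (σ : ℝ) (w : Torus) : Torus :=
  (w.1 + ((σ * s1 w : ℝ) : Angle), w.2 + ((σ * s0 w : ℝ) : Angle))

/-- A choice of signs on the edges of a diagram in direction `i`. -/
structure IsEdgeSign (R : Finset Torus) (i : Bool) (s : Torus → ℝ) : Prop where
  sign : ∀ v, s v = 1 ∨ s v = -1
  partner : ∀ v ∈ R, s (partner R i v) = s v

section SignSums

variable {R : Finset Torus} {ε : Torus → ℤˣ}

/-- The signed sum over pairs of vertices. -/
def pairSum (R : Finset Torus) (ε : Torus → ℤˣ) (T : Torus → Torus → ℝ) : ℝ :=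
  ∑ v ∈ R, ∑ w ∈ R, (((ε v : ℤ) : ℝ) * ((ε w : ℤ) : ℝ)) * T v w

lemma pairSum_add (T U : Torus → Torus → ℝ) :
    pairSum R ε (fun v w => T v w + U v w) = pairSum R ε T + pairSum R ε U := by
  simp only [pairSum, mul_add, Finset.sum_add_distrib]

lemma pairSum_neg (T : Torus → Torus → ℝ) :
    pairSum R ε (fun v w => -T v w) = -pairSum R ε T := by
  simp only [pairSum, mul_neg, Finset.sum_neg_distrib]

lemma pairSum_congr {T U : Torus → Torus → ℝ} (h : ∀ v ∈ R, ∀ w ∈ R, T v w = U v w) :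
    pairSum R ε T = pairSum R ε U :=
  Finset.sum_congr rfl fun v hv => Finset.sum_congr rfl fun w hw => by rw [h v hv w hw]

lemma pairSum_eq_zero_right (hR : IsLinkDiagram R) (hε : IsOrientation R ε) (i : Bool)
    {T : Torus → Torus → ℝ} (h : ∀ v ∈ R, ∀ w ∈ R, T v (partner R i w) = T v w) :
    pairSum R ε T = 0 :=
  Finset.sum_eq_zero fun v hv => by
    have := sum_partner_eq_zero hR hε i (T v) (h v hv)
    simp only [mul_assoc, ← Finset.mul_sum]
    simp only [smul_eq_mul] at this
    rw [this, mul_zero]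

lemma pairSum_swap (T : Torus → Torus → ℝ) : pairSum R ε (fun v w => T w v) = pairSum R ε T := by
  rw [pairSum, Finset.sum_comm]
  exact Finset.sum_congr rfl fun v _ => Finset.sum_congr rfl fun w _ => by ring

lemma pairSum_eq_zero_left (hR : IsLinkDiagram R) (hε : IsOrientation R ε) (i : Bool)
    {T : Torus → Torus → ℝ} (h : ∀ v ∈ R, ∀ w ∈ R, T (partner R i v) w = T v w) :
    pairSum R ε T = 0 := by
  rw [← pairSum_swap]
  exact pairSum_eq_zero_right hR hε i fun v hv w hw => h w hw v hv

lemma pairSum_eq_zero_of_antisymm {T : Torus → Torus → ℝ} (h : ∀ v ∈ R, ∀ w ∈ R, T w v = -T v w) :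
    pairSum R ε T = 0 := by
  have h1 := pairSum_swap (R := R) (ε := ε) T
  rw [pairSum_congr h, pairSum_neg] at h1
  linarith

/-- The linking number of `R̂` with the shifted link. -/
def shiftedLk (R : Finset Torus) (ε : Torus → ℤˣ) (s0 s1 : Torus → ℝ) (σ : ℝ) : ℝ :=
  linkingNumber R ε vertexArc R ε (fun v => vertexArc (shiftVertex s0 s1 σ v))

/-- The mean of the Thurston–Bennequin numbers `tb₊` and `-tb₋`. -/
def meanLk (R : Finset Torus) (ε : Torus → ℤˣ) : ℝ :=
  -pairSum R ε fun v w => sawtooth (w.2 - v.2) * sawtooth (w.1 - v.1)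

lemma shiftedLk_eq_pairSum {s0 s1 : Torus → ℝ} {σ : ℝ} (hσ : IsSmallShift R σ)
    (h0 : IsEdgeSign R false s0) (h1 : IsEdgeSign R true s1) :
    shiftedLk R ε s0 s1 σ = -pairSum R ε fun v w =>
      ((w.2 - v.2 + ((σ * s0 w : ℝ) : Angle) + (π : Angle)).toReal / (2 * π)) *
      ((w.1 - v.1 + ((σ * s1 w : ℝ) : Angle) + (π : Angle)).toReal / (2 * π)) := by
  rw [shiftedLk, linkingNumber, ← pairSum_neg]
  refine Finset.sum_congr rfl fun v hv => Finset.sum_congr rfl fun w hw => ?_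
  have hsh := hσ.2 w hw v hv σ ⟨hσ.1, le_rfl⟩
  have e1 : (shiftVertex s0 s1 σ w).1 ≠ v.1 := by
    rcases h1.sign w with h | h
    · simpa [shiftVertex, h] using hsh.1.symm
    · simpa [shiftVertex, h, ← sub_eq_add_neg] using hsh.2.2.1.symm
  have e2 : (shiftVertex s0 s1 σ w).2 ≠ v.2 := by
    rcases h0.sign w with h | h
    · simpa [shiftVertex, h] using hsh.2.1.symm
    · simpa [shiftVertex, h, ← sub_eq_add_neg] using hsh.2.2.2.symm
  rw [gaussIntegral_vertexArc_vertexArc e1 e2]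
  have a1 : (shiftVertex s0 s1 σ w).1 - v.1 = w.1 - v.1 + ((σ * s1 w : ℝ) : Angle) := by
    simp only [shiftVertex]; abel
  have a2 : (shiftVertex s0 s1 σ w).2 - v.2 = w.2 - v.2 + ((σ * s0 w : ℝ) : Angle) := by
    simp only [shiftVertex]; abel
  rw [a1, a2]
  push_cast
  field_simp
  ring

theorem shiftedLk_eq (hR : IsLinkDiagram R) (hε : IsOrientation R ε) {s0 s1 : Torus → ℝ} {σ : ℝ}
    (hσ : IsSmallShift R σ) (h0 : IsEdgeSign R false s0) (h1 : IsEdgeSign R true s1) :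
    shiftedLk R ε s0 s1 σ = meanLk R ε - 1 / 4 * ∑ v ∈ R, s0 v * s1 v := by
  classical
  set a : Torus → Torus → ℝ := fun v w => sawtooth (w.2 - v.2)
  set b : Torus → Torus → ℝ := fun v w => sawtooth (w.1 - v.1)
  set d0 : Torus → Torus → ℝ := fun v w => if w.2 - v.2 = 0 then 1 / 2 else 0
  set d1 : Torus → Torus → ℝ := fun v w => if w.1 - v.1 = 0 then 1 / 2 else 0
  set k := σ / (2 * π)
  have p2 : ∀ v ∈ R, (partner R false v).2 = v.2 := fun v hv => (partner_spec hR false hv).2.2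
  have p1 : ∀ v ∈ R, (partner R true v).1 = v.1 := fun v hv => (partner_spec hR true hv).2.2
  have eT : shiftedLk R ε s0 s1 σ = -pairSum R ε fun v w =>
      (a v w + k * s0 w - s0 w * d0 v w) * (b v w + k * s1 w - s1 w * d1 v w) := by
    rw [shiftedLk_eq_pairSum hσ h0 h1]
    congr 1
    refine pairSum_congr fun v hv w hw => ?_
    rw [toReal_add_pi_shift hσ.1 (h0.sign w), toReal_add_pi_shift hσ.1 (h1.sign w)]
    · simp only [a, b, d0, d1, k]; ring
    · intro x hx
      have := hσ.2 w hw v hv x hx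
      exact ⟨fun h => this.1 (by rw [← sub_eq_zero, ← neg_eq_zero, ← h]; abel),
        fun h => this.2.2.1 (by rw [← sub_eq_zero, ← neg_eq_zero, ← h]; abel)⟩
    · intro x hx
      have := hσ.2 w hw v hv x hx
      exact ⟨fun h => this.2.1 (by rw [← sub_eq_zero, ← neg_eq_zero, ← h]; abel),
        fun h => this.2.2.2 (by rw [← sub_eq_zero, ← neg_eq_zero, ← h]; abel)⟩
  have eS : pairSum R ε (fun v w => (a v w + k * s0 w - s0 w * d0 v w) *
      (b v w + k * s1 w - s1 w * d1 v w)) =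
      pairSum R ε (fun v w => a v w * b v w) +
      (pairSum R ε (fun v w => k * s1 w * (a v w + k * s0 w - s0 w * d0 v w)) +
      (pairSum R ε (fun v w => k * s0 w * (b v w - s1 w * d1 v w)) +
      (pairSum R ε (fun v w => -(a v w * s1 w * d1 v w)) +
      (pairSum R ε (fun v w => -(b v w * s0 w * d0 v w)) +
      pairSum R ε (fun v w => s0 w * s1 w * (d0 v w * d1 v w)))))) := by
    simp only [← pairSum_add]
    exact pairSum_congr fun v _ w _ => by ring
  have z1 : pairSum R ε (fun v w => k * s1 w * (a v w + k * s0 w - s0 w * d0 v w)) = 0 :=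
    pairSum_eq_zero_left hR hε false fun v hv w hw => by simp only [a, d0, p2 v hv]
  have z2 : pairSum R ε (fun v w => k * s0 w * (b v w - s1 w * d1 v w)) = 0 :=
    pairSum_eq_zero_left hR hε true fun v hv w hw => by simp only [b, d1, p1 v hv]
  have z3 : pairSum R ε (fun v w => -(a v w * s1 w * d1 v w)) = 0 :=
    pairSum_eq_zero_of_antisymm fun v hv w hw => by
      by_cases h : w.1 = v.1
      · have e : s1 w = s1 v := by
          rcases eq_or_eq_partner hR true hv hw h with h | h
          · rw [h]
          · rw [h, h1.partner v hv]
        have e2 : a w v = -a v w := by simp only [a]; rw [← sawtooth_neg, neg_sub]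
        simp only [e, e2, d1, h]; ring
      · simp [d1, sub_eq_zero, h, Ne.symm h]
  have z4 : pairSum R ε (fun v w => -(b v w * s0 w * d0 v w)) = 0 :=
    pairSum_eq_zero_of_antisymm fun v hv w hw => by
      by_cases h : w.2 = v.2
      · have e : s0 w = s0 v := by
          rcases eq_or_eq_partner hR false hv hw h with h | h
          · rw [h]
          · rw [h, h0.partner v hv]
        have e2 : b w v = -b v w := by simp only [b]; rw [← sawtooth_neg, neg_sub]
        simp only [e, e2, d0, h]; ring
      · simp [d0, sub_eq_zero, h, Ne.symm h]
  have z5 : pairSum R ε (fun v w => s0 w * s1 w * (d0 v w * d1 v w)) = 1 / 4 * ∑ v ∈ R, s0 v * s1 v := by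
    rw [pairSum, Finset.mul_sum]
    refine Finset.sum_congr rfl fun v hv => ?_
    rw [Finset.sum_eq_single v]
    · have : ((ε v : ℤ) : ℝ) * ((ε v : ℤ) : ℝ) = 1 := by
        rcases Int.units_eq_one_or (ε v) with h | h <;> simp [h]
      simp only [this, d0, d1, sub_self, if_true]; ring
    · intro w _ hne
      by_cases h : w.1 = v.1
      · have : w.2 ≠ v.2 := fun h' => hne (Prod.ext h h')
        simp [d0, sub_eq_zero, this]
      · simp [d1, sub_eq_zero, h]
    · exact fun h => absurd hv h
  rw [eT, eS, z1, z2, z3, z4, z5, meanLk]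
  ring

lemma exists_int_toReal (x : ℝ) :
    ∃ n : ℤ, ((x : Angle) + (π : Angle)).toReal / (2 * π) = x / (2 * π) + 1 / 2 - n := by
  have h : ((((x : Angle) + (π : Angle)).toReal : ℝ) : Angle) = ((x + π : ℝ) : Angle) := by
    rw [Angle.coe_toReal, Angle.coe_add]
  obtain ⟨n, hn⟩ := Angle.angle_eq_iff_two_pi_dvd_sub.1 h
  refine ⟨-n, ?_⟩
  push_cast
  rw [sub_eq_iff_eq_add.1 hn]
  field_simp
  ring

theorem shiftedLk_int (hR : IsLinkDiagram R) (hε : IsOrientation R ε) {s0 s1 : Torus → ℝ} {σ : ℝ}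
    (hσ : IsSmallShift R σ) (h0 : IsEdgeSign R false s0) (h1 : IsEdgeSign R true s1) :
    ∃ n : ℤ, shiftedLk R ε s0 s1 σ = n := by
  choose N hN using exists_int_toReal
  have p2 : ∀ v ∈ R, (partner R false v).2 = v.2 := fun v hv => (partner_spec hR false hv).2.2
  have p1 : ∀ v ∈ R, (partner R true v).1 = v.1 := fun v hv => (partner_spec hR true hv).2.2
  have q2 := h0.partner
  have q1 := h1.partner
  set a : Torus → ℝ := fun w => (w.2.toReal + σ * s0 w) / (2 * π)
  set b : Torus → ℝ := fun w => (w.1.toReal + σ * s1 w) / (2 * π)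
  set a' : Torus → ℝ := fun v => v.2.toReal / (2 * π)
  set b' : Torus → ℝ := fun v => v.1.toReal / (2 * π)
  set k : Torus → Torus → ℤ := fun v w => N (w.2.toReal + σ * s0 w - v.2.toReal)
  set l : Torus → Torus → ℤ := fun v w => N (w.1.toReal + σ * s1 w - v.1.toReal)
  have e : shiftedLk R ε s0 s1 σ = -pairSum R ε fun v w =>
      (a w - a' v + 1 / 2 - k v w) * (b w - b' v + 1 / 2 - l v w) := by
    rw [shiftedLk_eq_pairSum hσ h0 h1]
    congr 1
    refine pairSum_congr fun v _ w _ => ?_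
    have c2 : w.2 - v.2 + ((σ * s0 w : ℝ) : Angle) =
        ((w.2.toReal + σ * s0 w - v.2.toReal : ℝ) : Angle) := by
      rw [Angle.coe_sub, Angle.coe_add, Angle.coe_toReal, Angle.coe_toReal]; abel
    have c1 : w.1 - v.1 + ((σ * s1 w : ℝ) : Angle) =
        ((w.1.toReal + σ * s1 w - v.1.toReal : ℝ) : Angle) := by
      rw [Angle.coe_sub, Angle.coe_add, Angle.coe_toReal, Angle.coe_toReal]; abel
    rw [c2, c1, hN, hN]
    simp only [a, a', b, b', k, l]
    ring
  have e2 : pairSum R ε (fun v w => (a w - a' v + 1 / 2 - k v w) * (b w - b' v + 1 / 2 - l v w)) =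
      pairSum R ε (fun v w => k v w * l v w) +
      (pairSum R ε (fun v w => b w * (a w - a' v + 1 / 2 - k v w)) +
      (pairSum R ε (fun v w => (1 / 2 - b' v) * (a w - a' v + 1 / 2 - k v w)) +
      (pairSum R ε (fun v w => -(l v w * a w)) + pairSum R ε (fun v w => -(l v w * (1 / 2 - a' v)))))) := by
    simp only [← pairSum_add]
    exact pairSum_congr fun v _ w _ => by ring
  have z1 : pairSum R ε (fun v w => b w * (a w - a' v + 1 / 2 - k v w)) = 0 :=
    pairSum_eq_zero_left hR hε false fun v hv w hw => by simp only [a', k, p2 v hv]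
  have z2 : pairSum R ε (fun v w => (1 / 2 - b' v) * (a w - a' v + 1 / 2 - k v w)) = 0 :=
    pairSum_eq_zero_right hR hε false fun v hv w hw => by simp only [a, k, p2 w hw, q2 w hw]
  have z3 : pairSum R ε (fun v w => -(l v w * a w)) = 0 :=
    pairSum_eq_zero_left hR hε true fun v hv w hw => by simp only [l, p1 v hv]
  have z4 : pairSum R ε (fun v w => -(l v w * (1 / 2 - a' v))) = 0 :=
    pairSum_eq_zero_right hR hε true fun v hv w hw => by simp only [l, p1 w hw, q1 w hw]
  refine ⟨-∑ v ∈ R, ∑ w ∈ R, ((ε v : ℤ) * (ε w : ℤ)) * (k v w * l v w), ?_⟩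
  rw [e, e2, z1, z2, z3, z4, pairSum]
  push_cast
  ring

lemma shiftLk_eq_shiftedLk (s0 s1 : Torus → ℝ) (σ : ℝ) (d : Torus)
    (hd : ∀ v, shiftVertex s0 s1 σ v = v + d) : shiftLk R ε d = shiftedLk R ε s0 s1 σ := by
  simp only [shiftLk, diagramLk, shiftedLk, linkingNumber, shiftDiagram, Finset.sum_map,
    addRightEmbedding_apply, add_sub_cancel_right, hd]

lemma tbPlus_eq_shiftedLk : tbPlus R ε = shiftedLk R ε (fun _ => 1) (fun _ => 1) (smallShift R) :=
  shiftLk_eq_shiftedLk _ _ _ _ fun v => by simp [shiftVertex, Prod.ext_iff]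

lemma tbMinus_eq_shiftedLk :
    tbMinus R ε = -shiftedLk R ε (fun _ => 1) (fun _ => -1) (smallShift R) := by
  rw [tbMinus, neg_inj]
  exact shiftLk_eq_shiftedLk _ _ _ _ fun v => by simp [shiftVertex, Prod.ext_iff]

lemma isEdgeSign_one (R : Finset Torus) (i : Bool) : IsEdgeSign R i fun _ => 1 :=
  ⟨fun _ => .inl rfl, fun _ _ => rfl⟩

lemma isEdgeSign_neg_one (R : Finset Torus) (i : Bool) : IsEdgeSign R i fun _ => -1 :=
  ⟨fun _ => .inr rfl, fun _ _ => rfl⟩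

lemma tbPlus_eq (hR : IsLinkDiagram R) (hε : IsOrientation R ε) :
    tbPlus R ε = meanLk R ε - (R.card : ℝ) / 4 := by
  rw [tbPlus_eq_shiftedLk, shiftedLk_eq hR hε (smallShift_spec R) (isEdgeSign_one R _) (isEdgeSign_one R _)]
  simp; ring

lemma neg_tbMinus_eq (hR : IsLinkDiagram R) (hε : IsOrientation R ε) :
    -tbMinus R ε = meanLk R ε + (R.card : ℝ) / 4 := by
  rw [tbMinus_eq_shiftedLk, shiftedLk_eq hR hε (smallShift_spec R) (isEdgeSign_one R _) (isEdgeSign_neg_one R _)]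
  simp; ring

lemma tbPlus_int (hR : IsLinkDiagram R) (hε : IsOrientation R ε) : ∃ n : ℤ, tbPlus R ε = n := by
  rw [tbPlus_eq_shiftedLk]
  exact shiftedLk_int hR hε (smallShift_spec R) (isEdgeSign_one R _) (isEdgeSign_one R _)

end SignSums

/-! ## Complex coordinates -/

/-- The complex coordinates `z = x₀ + i x₁` (for `false`) and `w = x₂ + i x₃` (for `true`). -/
def cpx : Bool → E4 →L[ℝ] ℂ
  | false => Complex.ofRealCLM.comp (EuclideanSpace.proj (0 : Fin 4)) +
      Complex.I • Complex.ofRealCLM.comp (EuclideanSpace.proj (1 : Fin 4))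
  | true => Complex.ofRealCLM.comp (EuclideanSpace.proj (2 : Fin 4)) +
      Complex.I • Complex.ofRealCLM.comp (EuclideanSpace.proj (3 : Fin 4))

@[simp] lemma cpx_false_re (x : E4) : (cpx false x).re = x 0 := by simp [cpx]
@[simp] lemma cpx_false_im (x : E4) : (cpx false x).im = x 1 := by simp [cpx]
@[simp] lemma cpx_true_re (x : E4) : (cpx true x).re = x 2 := by simp [cpx]
@[simp] lemma cpx_true_im (x : E4) : (cpx true x).im = x 3 := by simp [cpx]

/-- The point with given complex coordinates. -/
def ofCpx (z w : ℂ) : E4 := !₂[z.re, z.im, w.re, w.im]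

@[simp] lemma cpx_ofCpx_false (z w : ℂ) : cpx false (ofCpx z w) = z := by
  apply Complex.ext <;> simp [ofCpx]
@[simp] lemma cpx_ofCpx_true (z w : ℂ) : cpx true (ofCpx z w) = w := by
  apply Complex.ext <;> simp [ofCpx]

lemma ext_cpx {x y : E4} (h : ∀ i, cpx i x = cpx i y) : x = y := by
  have h0 := congrArg Complex.re (h false)
  have h1 := congrArg Complex.im (h false)
  have h2 := congrArg Complex.re (h true)
  have h3 := congrArg Complex.im (h true)
  simp only [cpx_false_re, cpx_false_im, cpx_true_re, cpx_true_im] at h0 h1 h2 h3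
  ext i
  fin_cases i
  exacts [h0, h1, h2, h3]

lemma ofCpx_cpx (x : E4) : ofCpx (cpx false x) (cpx true x) = x :=
  ext_cpx fun i => by cases i <;> simp

lemma norm_sq_eq_cpx (x : E4) : ‖x‖ ^ 2 = ‖cpx false x‖ ^ 2 + ‖cpx true x‖ ^ 2 := by
  rw [EuclideanSpace.norm_sq_eq, Complex.sq_norm, Complex.sq_norm, Complex.normSq_apply,
    Complex.normSq_apply]
  simp [Fin.sum_univ_four]
  ring

lemma norm_sq_eq_cpx' (i : Bool) (x : E4) : ‖x‖ ^ 2 = ‖cpx i x‖ ^ 2 + ‖cpx (!i) x‖ ^ 2 := by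
  rw [norm_sq_eq_cpx]
  cases i
  · rfl
  · rw [add_comm]; rfl

lemma norm_cpx_le (i : Bool) (x : E4) : ‖cpx i x‖ ≤ ‖x‖ := by
  have := norm_sq_eq_cpx' i x
  have h2 := sq_nonneg ‖cpx (!i) x‖
  exact abs_le_of_sq_le_sq' (by linarith) (norm_nonneg x) |>.2

lemma norm_le_cpx_add (i : Bool) (x : E4) : ‖x‖ ≤ ‖cpx i x‖ + ‖cpx (!i) x‖ := by
  have := norm_sq_eq_cpx' i x
  refine (abs_le_of_sq_le_sq' (b := ‖cpx i x‖ + ‖cpx (!i) x‖) ?_ (by positivity)).2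
  have : 0 ≤ ‖cpx i x‖ * ‖cpx (!i) x‖ := by positivity
  nlinarith

lemma continuous_ofCpx : Continuous fun p : ℂ × ℂ => ofCpx p.1 p.2 := by
  refine (PiLp.continuous_toLp 2 _).comp (continuous_pi fun i => ?_)
  fin_cases i <;> simp <;> fun_prop

/-- The point of the unit circle with a given argument. -/
def angExp (a : Angle) : ℂ := ⟨a.cos, a.sin⟩

@[simp] lemma angExp_re (a : Angle) : (angExp a).re = a.cos := rfl
@[simp] lemma angExp_im (a : Angle) : (angExp a).im = a.sin := rfl

@[simp] lemma norm_angExp (a : Angle) : ‖angExp a‖ = 1 := by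
  have : ‖angExp a‖ ^ 2 = 1 := by
    rw [Complex.sq_norm, Complex.normSq_apply, angExp_re, angExp_im, ← sq, ← sq, a.cos_sq_add_sin_sq]
  nlinarith [norm_nonneg (angExp a)]

lemma angExp_ne_zero (a : Angle) : angExp a ≠ 0 := by
  rw [← norm_ne_zero_iff, norm_angExp]; exact one_ne_zero

lemma angExp_add (a b : Angle) : angExp (a + b) = angExp a * angExp b := by
  apply Complex.ext
  · simp [Angle.cos_add]
  · simp [Angle.sin_add]; ring

lemma angExp_neg (a : Angle) : angExp (-a) = (starRingEnd ℂ) (angExp a) := by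
  apply Complex.ext <;> simp

lemma angExp_coe (x : ℝ) : angExp (x : Angle) = Complex.exp (x * Complex.I) := by
  rw [Complex.exp_mul_I]
  apply Complex.ext <;> simp [Complex.cos_ofReal_re, Complex.sin_ofReal_re]

lemma angExp_injective : Function.Injective angExp := fun a b h => by
  have h1 := congrArg Complex.re h
  have h2 := congrArg Complex.im h
  induction a using Angle.induction_on
  induction b using Angle.induction_on
  exact Angle.cos_sin_inj h1 h2

lemma continuous_angExp : Continuous angExp := by
  have : angExp = fun a : Angle => (a.cos : ℂ) + a.sin * Complex.I := by
    funext a; apply Complex.ext <;> simp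
  rw [this]
  have h1 := Angle.continuous_cos
  have h2 := Angle.continuous_sin
  fun_prop

lemma cpx_joinPoint_false (θ φ : Angle) (τ : ℝ) :
    cpx false (joinPoint θ φ τ) = (cos (π / 2 * τ) : ℂ) * angExp φ := by
  have e : π * τ / 2 = π / 2 * τ := by ring
  apply Complex.ext <;> simp [joinPoint, e, -Complex.ofReal_cos]

lemma cpx_joinPoint_true (θ φ : Angle) (τ : ℝ) :
    cpx true (joinPoint θ φ τ) = (sin (π / 2 * τ) : ℂ) * angExp θ := by
  have e : π * τ / 2 = π / 2 * τ := by ring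
  apply Complex.ext <;> simp [joinPoint, e, -Complex.ofReal_sin]

/-! ## Differential of a surface -/

lemma IsC1Surface.exists_conormal {M : Set E4} (hM : IsC1Surface M) {p : E4} (hp : p ∈ M) :
    ∃ D : E4 →L[ℝ] ℝ × ℝ, Module.finrank ℝ D.ker ≤ 2 ∧
      (fun z : E4 × E4 => D (z.1 - z.2)) =o[𝓝[M ×ˢ M] (p, p)] (fun z => z.1 - z.2) := by
  obtain ⟨Φ, hpΦ, h1, h2, h3⟩ := hM p hp
  have hs : HasStrictFDerivAt Φ (fderiv ℝ Φ p) p :=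
    (h1.contDiffAt (Φ.open_source.mem_nhds hpΦ)).hasStrictFDerivAt one_ne_zero
  have ht : HasFDerivAt Φ.symm (fderiv ℝ Φ.symm (Φ p)) (Φ p) :=
    ((h2.contDiffAt (Φ.open_target.mem_nhds (Φ.map_source hpΦ))).differentiableAt one_ne_zero).hasFDerivAt
  have hid : (fderiv ℝ Φ.symm (Φ p)).comp (fderiv ℝ Φ p) = ContinuousLinearMap.id ℝ E4 := by
    refine HasFDerivAt.unique (ht.comp p hs.hasFDerivAt) ((hasFDerivAt_id p).congr_of_eventuallyEq ?_)
    filter_upwards [Φ.open_source.mem_nhds hpΦ] with x hx using Φ.left_inv hx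
  set A := fderiv ℝ Φ p
  have hinj : Function.Injective A := fun x y hxy => by
    have := congrArg (fderiv ℝ Φ.symm (Φ p)) hxy
    simpa only [← ContinuousLinearMap.comp_apply, hid, ContinuousLinearMap.id_apply] using this
  set P : E4 →L[ℝ] ℝ × ℝ := (EuclideanSpace.proj (2 : Fin 4)).prod (EuclideanSpace.proj (3 : Fin 4))
  refine ⟨P.comp A, ?_, ?_⟩
  · set Q : E4 →ₗ[ℝ] ℝ × ℝ := (((EuclideanSpace.proj (0 : Fin 4)).prod
      (EuclideanSpace.proj (1 : Fin 4)) : E4 →L[ℝ] ℝ × ℝ) : E4 →ₗ[ℝ] ℝ × ℝ)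
    have hk : Function.Injective ((Q ∘ₗ (A : E4 →ₗ[ℝ] E4)).domRestrict (P.comp A).ker) := by
      rw [← LinearMap.ker_eq_bot, LinearMap.ker_eq_bot']
      rintro ⟨x, hx⟩ h
      have e1 : (A x 0, A x 1) = ((0, 0) : ℝ × ℝ) := h
      have e2 : (A x 2, A x 3) = ((0, 0) : ℝ × ℝ) := hx
      rw [Prod.ext_iff] at e1 e2
      have : A x = 0 := by
        ext i
        fin_cases i
        exacts [e1.1, e1.2, e2.1, e2.2]
      exact Subtype.ext (hinj (this.trans (map_zero A).symm))
    have := LinearMap.finrank_le_finrank_of_injective hk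
    simpa using this
  · have h4 := (P.hasStrictFDerivAt.comp p hs).isLittleO.mono
      (nhdsWithin_le_nhds (s := M ×ˢ M) (a := (p, p)))
    refine h4.congr' ?_ .rfl |>.of_neg_left
    have hmem : Φ.source ×ˢ Φ.source ∈ 𝓝 (p, p) :=
      (Φ.open_source.prod Φ.open_source).mem_nhds ⟨hpΦ, hpΦ⟩
    filter_upwards [nhdsWithin_le_nhds hmem, self_mem_nhdsWithin] with z hz hzM
    have e : ∀ x ∈ Φ.source, x ∈ M → P (Φ x) = 0 := fun x hx hxM =>
      Prod.ext ((h3 x hx).1 hxM).1 ((h3 x hx).1 hxM).2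
    simp only [e z.1 hz.1 hzM.1, e z.2 hz.2 hzM.2, sub_self, zero_sub]

lemma contactPlane_finrank (σ : ℝ) (p : E4) : 2 ≤ Module.finrank ℝ (contactPlane σ p) := by
  set f : E4 →ₗ[ℝ] ℝ × ℝ := ((innerSL ℝ p : E4 →L[ℝ] ℝ) : E4 →ₗ[ℝ] ℝ).prod
    (p 0 • (EuclideanSpace.proj (1 : Fin 4) : E4 →L[ℝ] ℝ) - p 1 • EuclideanSpace.proj (0 : Fin 4) +
      σ • (p 2 • EuclideanSpace.proj (3 : Fin 4) - p 3 • EuclideanSpace.proj (2 : Fin 4)) : E4 →L[ℝ] ℝ)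
  have e : LinearMap.ker f = contactPlane σ p := by
    ext w
    rw [LinearMap.mem_ker]
    simp [f, Prod.ext_iff, contactPlane]
  have h1 := LinearMap.finrank_range_add_finrank_ker f
  have h2 := Submodule.finrank_le (LinearMap.range f)
  rw [e] at h1
  simp at h1 h2
  omega

/-- The contact form, in complex notation. -/
def contactForm (σ : ℝ) (p : E4) : E4 →L[ℝ] ℝ :=
  p 0 • (EuclideanSpace.proj (1 : Fin 4) : E4 →L[ℝ] ℝ) - p 1 • EuclideanSpace.proj (0 : Fin 4) +
      σ • (p 2 • EuclideanSpace.proj (3 : Fin 4) - p 3 • EuclideanSpace.proj (2 : Fin 4))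

lemma contactForm_apply (σ : ℝ) (p w : E4) : contactForm σ p w =
    ((starRingEnd ℂ) (cpx false p) * cpx false w).im +
      σ * ((starRingEnd ℂ) (cpx true p) * cpx true w).im := by
  simp [contactForm]
  ring

lemma mem_contactPlane {σ : ℝ} {p w : E4} :
    w ∈ contactPlane σ p ↔ inner ℝ p w = 0 ∧ contactForm σ p w = 0 := by
  have e : w ∈ contactPlane σ p ↔ inner ℝ p w = 0 ∧
      (p 0 * w 1 - p 1 * w 0) + σ * (p 2 * w 3 - p 3 * w 2) = 0 := Iff.rfl
  rw [e]
  simp [contactForm]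

lemma tangentPlane_le_ker {M F : Set E4} (hF : F ⊆ M) {p : E4} (hp : p ∈ M) {D : E4 →L[ℝ] ℝ × ℝ}
    (hlo : (fun z : E4 × E4 => D (z.1 - z.2)) =o[𝓝[M ×ˢ M] (p, p)] (fun z => z.1 - z.2)) : tangentPlane F p ≤ D.ker := by
  refine Submodule.span_le.2 fun w hw => ?_
  have h1 : HasFDerivWithinAt D D M p := D.hasFDerivWithinAt
  have h2 : HasFDerivWithinAt D (0 : E4 →L[ℝ] ℝ × ℝ) M p := by
    rw [hasFDerivWithinAt_iff_isLittleO]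
    have hto : Tendsto (fun x : E4 => (x, p)) (𝓝[M] p) (𝓝[M ×ˢ M] (p, p)) := by
      refine tendsto_nhdsWithin_iff.2 ⟨?_, ?_⟩
      · exact (Continuous.tendsto (by fun_prop : Continuous fun x : E4 => (x, p)) p).mono_left
          nhdsWithin_le_nhds
      · filter_upwards [self_mem_nhdsWithin] with x hx using ⟨hx, hp⟩
    refine (hlo.comp_tendsto hto).congr_left fun x => ?_
    simp
  exact h1.unique_on h2 (tangentConeAt_mono hF hw)

lemma IsC1Surface.isLittleO_of_tangentPlane {M F : Set E4} (hM : IsC1Surface M) (hF : F ⊆ M) {p : E4}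
    (hp : p ∈ M) {σ : ℝ} (ht : tangentPlane F p = contactPlane σ p) :
    (fun z : E4 × E4 => contactForm σ p (z.1 - z.2)) =o[𝓝[M ×ˢ M] (p, p)] (fun z => z.1 - z.2) := by
  obtain ⟨D, hD, hlo⟩ := hM.exists_conormal hp
  have hsub := tangentPlane_le_ker hF hp hlo
  have heq : contactPlane σ p = D.ker := Submodule.eq_of_le_of_finrank_le (ht ▸ hsub)
    (hD.trans (contactPlane_finrank σ p))
  have hk : LinearMap.ker (D : E4 →ₗ[ℝ] ℝ × ℝ) ≤ LinearMap.ker (contactForm σ p : E4 →ₗ[ℝ] ℝ) := by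
    intro w hw
    have : w ∈ contactPlane σ p := heq ▸ hw
    exact (mem_contactPlane.1 this).2
  obtain ⟨g, hg⟩ : ∃ g : (ℝ × ℝ) →ₗ[ℝ] ℝ, (contactForm σ p : E4 →ₗ[ℝ] ℝ) = g ∘ₗ (D : E4 →ₗ[ℝ] ℝ × ℝ) := by
    have : (contactForm σ p : E4 →ₗ[ℝ] ℝ) ∈ LinearMap.range (LinearMap.dualMap (D : E4 →ₗ[ℝ] ℝ × ℝ)) := by
      rw [LinearMap.range_dualMap_eq_dualAnnihilator_ker, Submodule.mem_dualAnnihilator]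
      exact fun w hw => hk hw
    obtain ⟨g, hg⟩ := this
    exact ⟨g, hg.symm⟩
  have e : ∀ w, contactForm σ p w = LinearMap.toContinuousLinearMap g (D w) := fun w =>
    LinearMap.congr_fun hg w
  simp only [e]
  exact ((LinearMap.toContinuousLinearMap g).isBigO_comp _ _).trans_isLittleO hlo

/-! ## Push-offs along a transverse rotation field -/

/-- The rotation of the two complex coordinates by the angles `a` and `b`. -/
def rotate (a b : ℝ) (x : E4) : E4 :=
  ofCpx (Complex.exp (a * Complex.I) * cpx false x) (Complex.exp (b * Complex.I) * cpx true x)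

lemma rotate_zero (x : E4) : rotate 0 0 x = x := by
  simp [rotate, ofCpx_cpx]

lemma norm_rotate (a b : ℝ) (x : E4) : ‖rotate a b x‖ = ‖x‖ := by
  have h : ‖rotate a b x‖ ^ 2 = ‖x‖ ^ 2 := by
    rw [norm_sq_eq_cpx, norm_sq_eq_cpx x]
    simp [rotate, Complex.norm_exp_ofReal_mul_I]
  exact (sq_eq_sq₀ (norm_nonneg _) (norm_nonneg _)).1 h

lemma continuous_rotate : Continuous fun q : (ℝ × ℝ) × E4 => rotate q.1.1 q.1.2 q.2 :=
  continuous_ofCpx.comp (f := fun q : (ℝ × ℝ) × E4 =>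
    (Complex.exp (q.1.1 * Complex.I) * cpx false q.2, Complex.exp (q.1.2 * Complex.I) * cpx true q.2))
    (by fun_prop)

lemma rotate_joinPoint (a b : ℝ) (θ φ : Angle) (τ : ℝ) :
    rotate a b (joinPoint θ φ τ) = joinPoint (θ + (b : Angle)) (φ + (a : Angle)) τ := by
  refine ext_cpx fun i => ?_
  cases i
  · rw [rotate, cpx_ofCpx_false, cpx_joinPoint_false, cpx_joinPoint_false, angExp_add, angExp_coe]; ring
  · rw [rotate, cpx_ofCpx_true, cpx_joinPoint_true, cpx_joinPoint_true, angExp_add, angExp_coe]; ring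

lemma norm_joinPoint (θ φ : Angle) (τ : ℝ) : ‖joinPoint θ φ τ‖ = 1 := by
  have h : ‖joinPoint θ φ τ‖ ^ 2 = 1 := by
    rw [norm_sq_eq_cpx, cpx_joinPoint_false, cpx_joinPoint_true, norm_mul, norm_mul, norm_angExp,
      norm_angExp]
    simp [-Complex.ofReal_cos, -Complex.ofReal_sin]
  nlinarith [norm_nonneg (joinPoint θ φ τ)]

lemma joinPoint_mem_sphere (θ φ : Angle) (τ : ℝ) : joinPoint θ φ τ ∈ Metric.sphere (0 : E4) 1 := by
  simp [norm_joinPoint]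

lemma continuous_vertexArc (v : Torus) : Continuous (vertexArc v) := continuous_iff_continuousAt.2
  fun s => (vertexArc_hasDerivAt v s).continuousAt

lemma isCompact_linkOf (R : Finset Torus) : IsCompact (linkOf R) :=
  R.finite_toSet.isCompact_biUnion fun v _ => isCompact_Icc.image (continuous_vertexArc v)

lemma vertexArc_mem_linkOf {R : Finset Torus} {v : Torus} (hv : v ∈ R) {τ : ℝ} (hτ : τ ∈ Icc (0 : ℝ) 1) :
    vertexArc v τ ∈ linkOf R := mem_biUnion hv ⟨τ, hτ, rfl⟩

lemma exp_rotation_tendsto {σ a : ℕ → ℝ} {a0 : ℝ} (hσ : Tendsto σ atTop (𝓝 0)) (hσ0 : ∀ n, σ n ≠ 0)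
    (ha : Tendsto a atTop (𝓝 a0)) :
    Tendsto (fun n => ((σ n : ℂ)⁻¹) * (Complex.exp ((σ n * a n : ℝ) * Complex.I) - 1)) atTop
      (𝓝 (a0 * Complex.I)) := by
  have h0 : Tendsto (fun n => σ n * a n) atTop (𝓝 0) := by simpa using hσ.mul ha
  have h1 : Tendsto (fun n => (a n : ℂ) * Complex.I) atTop (𝓝 (a0 * Complex.I)) :=
    ((Complex.continuous_ofReal.tendsto _).comp ha).mul_const _
  have h2 : Tendsto (fun n => |σ n| * (a n) ^ 2) atTop (𝓝 0) := by
    simpa using hσ.abs.mul (ha.pow 2)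
  have h3 : Tendsto (fun n => ((σ n : ℂ)⁻¹) * (Complex.exp ((σ n * a n : ℝ) * Complex.I) - 1) -
      (a n : ℂ) * Complex.I) atTop (𝓝 0) := by
    refine squeeze_zero_norm' ?_ h2
    filter_upwards [h0.eventually (Metric.ball_mem_nhds 0 one_pos)] with n hn
    have hn' : ‖((σ n * a n : ℝ) : ℂ) * Complex.I‖ ≤ 1 := by
      rw [norm_mul, Complex.norm_I, mul_one, Complex.norm_real]
      exact (mem_ball_zero_iff.1 hn).le
    have h4 := Complex.norm_exp_sub_one_sub_id_le hn'
    have hs : (σ n : ℂ) ≠ 0 := Complex.ofReal_ne_zero.2 (hσ0 n)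
    have e : ((σ n : ℂ)⁻¹) * (Complex.exp ((σ n * a n : ℝ) * Complex.I) - 1) - (a n : ℂ) * Complex.I =
        (σ n : ℂ)⁻¹ * (Complex.exp ((σ n * a n : ℝ) * Complex.I) - 1 - ((σ n * a n : ℝ) : ℂ) * Complex.I) := by
      rw [mul_sub _ _ (((σ n * a n : ℝ) : ℂ) * Complex.I)]
      push_cast
      congr 1
      field_simp
    rw [e, norm_mul, norm_inv, Complex.norm_real, norm_eq_abs]
    rw [norm_mul, Complex.norm_I, mul_one, Complex.norm_real, norm_eq_abs, abs_mul, mul_pow] at h4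
    calc _ ≤ |σ n|⁻¹ * (|σ n| ^ 2 * |a n| ^ 2) := by gcongr
      _ = |σ n| * (a n) ^ 2 := by rw [sq_abs (a n)]; field_simp
  simpa using h3.add h1

/-- The rotation used to push `R̂` off the surface, at parameter `τ` of the arc `v̂`. -/
def arcRotate (s0 s1 : Torus → ℝ) (σ : ℝ) (v : Torus) (τ : ℝ) : E4 → E4 :=
  rotate (σ * (s0 v * cos (π / 2 * τ) ^ 2)) (σ * (s1 v * sin (π / 2 * τ) ^ 2))

lemma continuous_arcRotate (s0 s1 : Torus → ℝ) (v : Torus) :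
    Continuous fun q : ℝ × ℝ × E4 => arcRotate s0 s1 q.1 v q.2.1 q.2.2 :=
  continuous_rotate.comp (f := fun q : ℝ × ℝ × E4 =>
    ((q.1 * (s0 v * cos (π / 2 * q.2.1) ^ 2),
      q.1 * (s1 v * sin (π / 2 * q.2.1) ^ 2)), q.2.2)) (by fun_prop)

lemma contactForm_rotation_ne_zero {p : E4} {s t : ℝ} (hs : s = 1 ∨ s = -1) (ht : t = 1 ∨ t = -1)
    (hp : ‖p‖ = 1) :
    contactForm (s * t) p (ofCpx ((s * ‖cpx false p‖ ^ 2 : ℝ) * Complex.I * cpx false p)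
      ((t * ‖cpx true p‖ ^ 2 : ℝ) * Complex.I * cpx true p)) ≠ 0 := by
  have e : ∀ (a : ℝ) (z : ℂ), ((starRingEnd ℂ) z * (a * Complex.I * z)).im = a * ‖z‖ ^ 2 := fun a z => by
    rw [Complex.sq_norm, Complex.normSq_apply]; simp; ring
  rw [contactForm_apply, cpx_ofCpx_false, cpx_ofCpx_true, e, e]
  have h2 := norm_sq_eq_cpx p
  rw [hp] at h2
  set A := ‖cpx false p‖ ^ 2
  set B := ‖cpx true p‖ ^ 2
  have hA : 0 < A * A + B * B := by nlinarith [sq_nonneg (A - B)]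
  have e2 : s * A * A + s * t * (t * B * B) = s * (A * A + B * B) := by
    rcases ht with rfl | rfl <;> ring
  rw [e2]
  rcases hs with rfl | rfl
  · linarith
  · linarith

lemma cos_sq_eq_norm (v : Torus) (τ : ℝ) : cos (π / 2 * τ) ^ 2 = ‖cpx false (vertexArc v τ)‖ ^ 2 := by
  rw [vertexArc, cpx_joinPoint_false, norm_mul, norm_angExp, mul_one,
    Complex.norm_real, norm_eq_abs, sq_abs]

lemma sin_sq_eq_norm (v : Torus) (τ : ℝ) : sin (π / 2 * τ) ^ 2 = ‖cpx true (vertexArc v τ)‖ ^ 2 := by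
  rw [vertexArc, cpx_joinPoint_true, norm_mul, norm_angExp, mul_one,
    Complex.norm_real, norm_eq_abs, sq_abs]

lemma IsCollar.eq_zero_of_mem {L F : Set E4} {H : E4 → ℝ → E4} (hH : IsCollar L F H) {x : E4}
    (hx : x ∈ L) {t : ℝ} (ht : t ∈ Icc (0 : ℝ) 1) (h : H x t ∈ L) : t = 0 := by
  have := @hH.injOn (x, t) ⟨hx, ht⟩ (H x t, 0) ⟨h, le_rfl, zero_le_one⟩ (hH.zero _ h).symm
  exact congrArg Prod.snd this

/-- A surface whose tangent planes along `R̂` are transverse to a rotation field can be pushed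
off `R̂` by that field. -/
lemma exists_arcRotate_disjoint {R : Finset Torus} {M F : Set E4} (hM : IsC1Surface M) (hF : F ⊆ M)
    {H : E4 → ℝ → E4} (hH : IsCollar (linkOf R) F H) {s0 s1 : Torus → ℝ}
    (h0 : ∀ v, s0 v = 1 ∨ s0 v = -1) (h1 : ∀ v, s1 v = 1 ∨ s1 v = -1)
    (ht : ∀ v ∈ R, ∀ τ ∈ Icc (0 : ℝ) 1,
      tangentPlane F (vertexArc v τ) = contactPlane (s0 v * s1 v) (vertexArc v τ)) :
    ∃ σ₀ > 0, ∀ σ ∈ Icc (0 : ℝ) σ₀, ∀ v ∈ R, ∀ τ ∈ Icc (0 : ℝ) 1, ∀ t ∈ Icc (0 : ℝ) 1,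
      (σ ≠ 0 ∨ t ≠ 0) → arcRotate s0 s1 σ v τ (H (vertexArc v τ) t) ∉ linkOf R := by
  by_contra hcon
  push Not at hcon
  have hpos (n : ℕ) : (0 : ℝ) < 1 / (n + 1) := by positivity
  choose σ hσ v hv τ hτ t htI hne hmem using fun n : ℕ => hcon _ (hpos n)
  -- pass to a subsequence
  have hcpt : IsCompact ((R : Set Torus) ×ˢ (Icc (0 : ℝ) 1 ×ˢ Icc (0 : ℝ) 1)) :=
    R.finite_toSet.isCompact.prod (isCompact_Icc.prod isCompact_Icc)
  obtain ⟨⟨v', τ', t'⟩, ⟨hv', hτ', ht'⟩, g, hg, hlim⟩ := hcpt.tendsto_subseq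
    (x := fun n => (v n, τ n, t n)) fun n => ⟨hv n, hτ n, htI n⟩
  have hlv : Tendsto (fun n => v (g n)) atTop (𝓝 v') := (continuous_fst.tendsto _).comp hlim
  have hlτ : Tendsto (fun n => τ (g n)) atTop (𝓝 τ') :=
    ((continuous_fst.comp continuous_snd).tendsto _).comp hlim
  have hlt : Tendsto (fun n => t (g n)) atTop (𝓝 t') :=
    ((continuous_snd.comp continuous_snd).tendsto _).comp hlim
  have hlσ : Tendsto (fun n => σ (g n)) atTop (𝓝 0) := by
    refine squeeze_zero (fun n => (hσ (g n)).1) (fun n => (hσ (g n)).2) ?_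
    exact tendsto_one_div_add_atTop_nhds_zero_nat.comp hg.tendsto_atTop
  have hvc : ∀ᶠ n in atTop, v (g n) = v' := by
    classical
    have hfin : ((R.erase v' : Finset Torus) : Set Torus)ᶜ ∈ 𝓝 v' :=
      (R.erase v').finite_toSet.isClosed.isOpen_compl.mem_nhds (by simp)
    filter_upwards [hlv hfin] with n hn
    by_contra h
    exact hn (by simpa [h] using hv (g n))
  set p := vertexArc v' τ' with hp
  have hpL : p ∈ linkOf R := vertexArc_mem_linkOf hv' hτ'
  set c : ℕ → E4 := fun n => vertexArc (v (g n)) (τ (g n))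
  have hcL : ∀ n, c n ∈ linkOf R := fun n => vertexArc_mem_linkOf (hv _) (hτ _)
  have hlc : Tendsto c atTop (𝓝 p) := by
    refine (((continuous_vertexArc v').tendsto τ').comp hlτ).congr' ?_
    filter_upwards [hvc] with n hn
    simp only [c, hn, Function.comp]
  set x : ℕ → E4 := fun n => H (c n) (t (g n))
  set y : ℕ → E4 := fun n => arcRotate s0 s1 (σ (g n)) (v (g n)) (τ (g n)) (x n)
  have hyL : ∀ n, y n ∈ linkOf R := fun n => hmem (g n)
  have hlx : Tendsto x atTop (𝓝 (H p t')) := by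
    have := hH.continuousOn (p, t') ⟨hpL, ht'⟩
    refine this.tendsto.comp (tendsto_nhdsWithin_iff.2 ⟨hlc.prodMk_nhds hlt, .of_forall fun n => ⟨hcL n, htI _⟩⟩)
  have hly : Tendsto y atTop (𝓝 (H p t')) := by
    have h2 := ((continuous_arcRotate s0 s1 v').tendsto (0, τ', H p t')).comp
      (hlσ.prodMk_nhds (hlτ.prodMk_nhds hlx))
    simp only [arcRotate, zero_mul, rotate_zero] at h2
    refine h2.congr' ?_
    filter_upwards [hvc] with n hn
    simp only [y, hn, Function.comp, arcRotate]
  have ht0 : t' = 0 := hH.eq_zero_of_mem hpL ht'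
    ((isCompact_linkOf R).isClosed.mem_of_tendsto hly (.of_forall hyL))
  rw [ht0, hH.zero p hpL] at hlx hly
  have hxM : ∀ n, x n ∈ M := fun n => hF (hH.subset ⟨(c n, t (g n)), ⟨hcL n, htI _⟩, rfl⟩)
  have hLM : linkOf R ⊆ M := fun q hq => hF (hH.subset ⟨(q, 0), ⟨hq, le_rfl, zero_le_one⟩, hH.zero q hq⟩)
  have hσ0 : ∀ n, σ (g n) ≠ 0 := fun n h => by
    have e : y n = x n := by simp only [y, h, arcRotate, zero_mul, rotate_zero]
    have := hH.eq_zero_of_mem (hcL n) (htI (g n)) (by have h2 := hyL n; rwa [e] at h2)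
    rcases hne (g n) with h' | h'
    · exact h' h
    · exact h' this
  have hlo := hM.isLittleO_of_tangentPlane hF (hLM hpL) (ht v' hv' τ' hτ')
  have hlo2 := hlo.comp_tendsto (k := fun n => (y n, x n)) (l' := atTop)
    (tendsto_nhdsWithin_iff.2 ⟨hly.prodMk_nhds hlx, .of_forall fun n => ⟨hLM (hyL n), hxM n⟩⟩)
  set V : E4 := ofCpx ((s0 v' * ‖cpx false p‖ ^ 2 : ℝ) * Complex.I * cpx false p)
      ((s1 v' * ‖cpx true p‖ ^ 2 : ℝ) * Complex.I * cpx true p)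
  have hq : Tendsto (fun n => (σ (g n))⁻¹ • (y n - x n)) atTop (𝓝 V) := by
    have ea : Tendsto (fun n => s0 v' * cos (π / 2 * τ (g n)) ^ 2) atTop
        (𝓝 (s0 v' * ‖cpx false p‖ ^ 2)) := by
      rw [hp, ← cos_sq_eq_norm]
      exact ((by fun_prop : Continuous fun τ : ℝ => s0 v' * cos (π / 2 * τ) ^ 2).tendsto τ').comp hlτ
    have eb : Tendsto (fun n => s1 v' * sin (π / 2 * τ (g n)) ^ 2) atTop
        (𝓝 (s1 v' * ‖cpx true p‖ ^ 2)) := by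
      rw [hp, ← sin_sq_eq_norm]
      exact ((by fun_prop : Continuous fun τ : ℝ => s1 v' * sin (π / 2 * τ) ^ 2).tendsto τ').comp hlτ
    have h2 := (exp_rotation_tendsto hlσ hσ0 ea).mul (((cpx false).continuous.tendsto _).comp hlx)
    have h3 := (exp_rotation_tendsto hlσ hσ0 eb).mul (((cpx true).continuous.tendsto _).comp hlx)
    refine ((continuous_ofCpx.tendsto _).comp (h2.prodMk_nhds h3)).congr' ?_
    filter_upwards [hvc] with n hn
    refine ext_cpx fun i => ?_
    have e : ∀ i, cpx i ((σ (g n))⁻¹ • (y n - x n)) = (σ (g n) : ℂ)⁻¹ * (cpx i (y n) - cpx i (x n)) := fun i => by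
      rw [map_smul, map_sub, Complex.real_smul, Complex.ofReal_inv]
    rw [e]
    cases i
    · simp only [Function.comp, cpx_ofCpx_false, y, arcRotate, rotate, hn]; ring
    · simp only [Function.comp, cpx_ofCpx_true, y, arcRotate, rotate, hn]; ring
  have hA : Tendsto (fun n => contactForm (s0 v' * s1 v') p ((σ (g n))⁻¹ • (y n - x n))) atTop
      (𝓝 (contactForm (s0 v' * s1 v') p V)) := ((contactForm _ p).continuous.tendsto _).comp hq
  have hB : Tendsto (fun n => contactForm (s0 v' * s1 v') p ((σ (g n))⁻¹ • (y n - x n))) atTop (𝓝 0) := by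
    have h2 : (fun n => contactForm (s0 v' * s1 v') p ((σ (g n))⁻¹ • (y n - x n))) =o[atTop]
        (fun n => (σ (g n))⁻¹ • (y n - x n)) := by
      simp only [map_smul]
      exact (isBigO_refl (fun n => (σ (g n))⁻¹) atTop).smul_isLittleO hlo2
    exact (isLittleO_one_iff ℝ).1 (h2.trans_isBigO (hq.isBigO_one ℝ))
  have := tendsto_nhds_unique hA hB
  exact contactForm_rotation_ne_zero (h0 v') (h1 v') (norm_joinPoint _ _ _) this

lemma ContDiff.isTameCurve {γ : ℝ → E4} (h : ContDiff ℝ 1 γ) : IsTameCurve γ := by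
  obtain ⟨M, hM⟩ := isCompact_Icc.exists_bound_of_continuousOn (s := Icc (0 : ℝ) 1)
    (h.continuous_deriv le_rfl).continuousOn
  exact ⟨h.continuous.continuousOn, ∅, M, fun t ht _ => ⟨h.differentiable one_ne_zero t, hM t ht⟩⟩

lemma contDiff_joinPoint {a b : ℝ → ℝ} (ha : ContDiff ℝ 1 a) (hb : ContDiff ℝ 1 b)
    (θ φ : Angle) : ContDiff ℝ 1 fun τ : ℝ => joinPoint (θ + (a τ : Angle)) (φ + (b τ : Angle)) τ := by
  rw [contDiff_euclidean]
  have hs : ContDiff ℝ 1 fun τ : ℝ => sin (π * τ / 2) :=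
    contDiff_sin.comp (by fun_prop)
  have hc : ContDiff ℝ 1 fun τ : ℝ => cos (π * τ / 2) :=
    contDiff_cos.comp (by fun_prop)
  have has := contDiff_sin.comp ha
  have hac := contDiff_cos.comp ha
  have hbs := contDiff_sin.comp hb
  have hbc := contDiff_cos.comp hb
  intro i
  fin_cases i
  · simp [joinPoint, Angle.cos_add]
    exact hc.mul ((contDiff_const.mul hbc).sub (contDiff_const.mul hbs))
  · simp [joinPoint, Angle.sin_add]
    exact hc.mul ((contDiff_const.mul hbc).add (contDiff_const.mul hbs))
  · simp [joinPoint, Angle.cos_add]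
    exact hs.mul ((contDiff_const.mul hac).sub (contDiff_const.mul has))
  · simp [joinPoint, Angle.sin_add]
    exact hs.mul ((contDiff_const.mul hac).add (contDiff_const.mul has))

section PushOff

variable {R : Finset Torus}

lemma vertexArc_partner_zero (hR : IsLinkDiagram R) {v : Torus} (hv : v ∈ R) :
    vertexArc (partner R false v) 0 = vertexArc v 0 := by
  have h : (partner R false v).2 = v.2 := (partner_spec hR false hv).2.2
  simp [vertexArc, joinPoint, h]

lemma vertexArc_partner_one (hR : IsLinkDiagram R) {v : Torus} (hv : v ∈ R) :
    vertexArc (partner R true v) 1 = vertexArc v 1 := by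
  have h : (partner R true v).1 = v.1 := (partner_spec hR true hv).2.2
  simp [vertexArc, joinPoint, h]

lemma joinPoint_shift_notMem {σ : ℝ} (hσ : IsSmallShift R σ) {s0 s1 : Torus → ℝ}
    (h0 : ∀ v, s0 v = 1 ∨ s0 v = -1) (h1 : ∀ v, s1 v = 1 ∨ s1 v = -1) {v : Torus} (hv : v ∈ R)
    {τ c d : ℝ} (hτ : τ ∈ Icc (0 : ℝ) 1) (hc : c ∈ Icc (0 : ℝ) 1) (hd : d ∈ Icc (0 : ℝ) 1)
    (hc0 : cos (π / 2 * τ) ≠ 0 → c ≠ 0) (hd0 : sin (π / 2 * τ) ≠ 0 → d ≠ 0) :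
    joinPoint (v.1 + ((σ * (s1 v * d) : ℝ) : Angle)) (v.2 + ((σ * (s0 v * c) : ℝ) : Angle)) τ
      ∉ linkOf R := by
  intro hmem
  simp only [linkOf, mem_iUnion] at hmem
  obtain ⟨w, hw, τ', hτ', he⟩ := hmem
  have key : ∀ {C C' : ℝ} {a b : Angle}, 0 ≤ C → 0 ≤ C' → (C : ℂ) * angExp a = C' * angExp b →
      C ≠ 0 → a = b := by
    intro C C' a b hC hC' h hne
    have hn := congrArg norm h
    rw [norm_mul, norm_mul, norm_angExp, norm_angExp, Complex.norm_real, Complex.norm_real,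
      norm_of_nonneg hC, norm_of_nonneg hC', mul_one, mul_one] at hn
    rw [← hn] at h
    exact angExp_injective (mul_left_cancel₀ (Complex.ofReal_ne_zero.2 hne) h)
  obtain ⟨C0, S0⟩ := half_angle_nonneg hτ
  obtain ⟨C0', S0'⟩ := half_angle_nonneg hτ'
  have e0 := congrArg (cpx false) he.symm
  have e1 := congrArg (cpx true) he.symm
  rw [vertexArc, cpx_joinPoint_false, cpx_joinPoint_false] at e0
  rw [vertexArc, cpx_joinPoint_true, cpx_joinPoint_true] at e1
  have small : ∀ {u : ℝ}, u ∈ Icc (0 : ℝ) 1 → u ≠ 0 → σ * u ∈ Ioc 0 σ := fun hu h =>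
    ⟨mul_pos hσ.1 (hu.1.lt_of_ne' h), mul_le_of_le_one_right hσ.1.le hu.2⟩
  by_cases hC : cos (π / 2 * τ) = 0
  · have hS : sin (π / 2 * τ) ≠ 0 := fun h => by
      have := sin_sq_add_cos_sq (π / 2 * τ)
      rw [hC, h] at this; norm_num at this
    have e := key S0 S0' e1 hS
    have hsm := hσ.2 v hv w hw _ (small hd (hd0 hS))
    rcases h1 v with h | h
    · exact hsm.1 (by rw [← e, h, one_mul])
    · exact hsm.2.2.1 (by rw [← e, h, neg_one_mul, mul_neg, Angle.coe_neg, sub_eq_add_neg])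
  · have e := key C0 C0' e0 hC
    have hsm := hσ.2 v hv w hw _ (small hc (hc0 hC))
    rcases h0 v with h | h
    · exact hsm.2.1 (by rw [← e, h, one_mul])
    · exact hsm.2.2.2 (by rw [← e, h, neg_one_mul, mul_neg, Angle.coe_neg, sub_eq_add_neg])

lemma IsSmallShift.mono {σ σ' : ℝ} (h : IsSmallShift R σ) (h0 : 0 < σ') (hle : σ' ≤ σ) :
    IsSmallShift R σ' :=
  ⟨h0, fun v hv w hw s hs => h.2 v hv w hw s ⟨hs.1, hs.2.trans hle⟩⟩

theorem pushOffLk_eq (hR : IsLinkDiagram R) {ε : Torus → ℤˣ} (hε : IsOrientation R ε)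
    {M F : Set E4} (hM : IsC1Surface M) (hMs : M ⊆ Metric.sphere (0 : E4) 1) (hF : F ⊆ M)
    {H : E4 → ℝ → E4} (hH : IsCollar (linkOf R) F H) {s0 s1 : Torus → ℝ}
    (h0 : IsEdgeSign R false s0) (h1 : IsEdgeSign R true s1)
    (ht : ∀ v ∈ R, ∀ τ ∈ Icc (0 : ℝ) 1,
      tangentPlane F (vertexArc v τ) = contactPlane (s0 v * s1 v) (vertexArc v τ))
    {β : E4 → E4} (hβ : ∀ x ∈ linkOf R, β x = H x 1)
    (hpc : ∀ v ∈ R, IsPiecewiseC1 (fun t => β (vertexArc v t))) :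
    pushOffLk R ε β = meanLk R ε - 1 / 4 * ∑ v ∈ R, s0 v * s1 v := by
  classical
  obtain ⟨σ₁, hσ₁, hdis⟩ := exists_arcRotate_disjoint hM hF hH h0.sign h1.sign ht
  set σ := min σ₁ (smallShift R) with hσd
  have hσpos : 0 < σ := lt_min hσ₁ (smallShift_spec R).1
  have hσ : IsSmallShift R σ := (smallShift_spec R).mono hσpos (min_le_right _ _)
  set H' : E4 → ℝ → E4 := fun x t => if t = 1 then β x else if t = 0 then x else H x t with hH'
  have hHe : ∀ x ∈ linkOf R, ∀ t, H' x t = H x t := by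
    intro x hx t
    simp only [hH']
    split_ifs with h1 h2
    · rw [h1, hβ x hx]
    · rw [h2, hH.zero x hx]
    · rfl
  set K1 : Torus → ℝ → ℝ → E4 := fun v τ l => arcRotate s0 s1 (σ * l) v τ (H' (vertexArc v τ) (1 - l)) with hK1
  set K2 : Torus → ℝ → ℝ → E4 := fun v τ l =>
    joinPoint (v.1 + ((σ * (s1 v * ((1 - l) * sin (π / 2 * τ) ^ 2 + l)) : ℝ) : Angle))
      (v.2 + ((σ * (s0 v * ((1 - l) * cos (π / 2 * τ) ^ 2 + l)) : ℝ) : Angle)) τ with hK2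
  have hI : ∀ l ∈ Icc (0 : ℝ) 1, 1 - l ∈ Icc (0 : ℝ) 1 := fun l hl => ⟨by linarith [hl.2], by linarith [hl.1]⟩
  have e10 : ∀ v, (fun t => K1 v t 0) = fun t => β (vertexArc v t) := fun v => by
    funext t; simp [hK1, hH', arcRotate, rotate_zero]
  have e12 : ∀ v, (fun t => K1 v t 1) = fun t => K2 v t 0 := fun v => by
    funext t; simp [hK1, hK2, hH', arcRotate, vertexArc, rotate_joinPoint]
  have e21 : ∀ v, (fun t => K2 v t 1) = fun t => vertexArc (shiftVertex s0 s1 σ v) t := fun v => by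
    funext t; simp [hK2, vertexArc, shiftVertex]
  have tame : ∀ v, IsTameCurve fun t => K2 v t 0 := fun v => by
    refine (contDiff_joinPoint ?_ ?_ _ _).isTameCurve
    · have : ContDiff ℝ 1 fun τ : ℝ => sin (π / 2 * τ) := contDiff_sin.comp (by fun_prop)
      fun_prop
    · have : ContDiff ℝ 1 fun τ : ℝ => cos (π / 2 * τ) := contDiff_cos.comp (by fun_prop)
      fun_prop
  have r0 : ∀ v ∈ R, s0 (partner R false v) = s0 v := h0.partner
  have r1 : ∀ v ∈ R, s1 (partner R true v) = s1 v := h1.partner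
  have step1 := linkingNumber_homotopy hR hε K1 ?_ ?_ ?_ ?_ ?_ ?_
  have step2 := linkingNumber_homotopy hR hε K2 ?_ ?_ ?_ ?_ ?_ ?_
  · rw [← shiftedLk_eq hR hε hσ h0 h1, shiftedLk, pushOffLk]
    have e12' := funext e12
    have e21' := funext e21
    have e10' := funext e10
    rw [← e10', ← e21', step1, ← step2, e12']
  · intro v hv
    refine Continuous.continuousOn ?_
    have hj : Continuous fun q : ℝ × ℝ × ℝ => rotate q.2.1 q.1 (vertexArc v q.2.2) :=
      continuous_rotate.comp (f := fun q : ℝ × ℝ × ℝ => ((q.2.1, q.1), vertexArc v q.2.2))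
        (by have := continuous_vertexArc v; fun_prop)
    have : Function.uncurry (K2 v) = fun q : ℝ × ℝ =>
        rotate (σ * (s0 v * ((1 - q.2) * cos (π / 2 * q.1) ^ 2 + q.2)))
        (σ * (s1 v * ((1 - q.2) * sin (π / 2 * q.1) ^ 2 + q.2))) (vertexArc v q.1) := by
      funext q
      simp only [Function.uncurry, hK2, vertexArc, rotate_joinPoint]
    rw [this]
    exact hj.comp (f := fun q : ℝ × ℝ => (σ * (s1 v * ((1 - q.2) * sin (π / 2 * q.1) ^ 2 + q.2)),
      σ * (s0 v * ((1 - q.2) * cos (π / 2 * q.1) ^ 2 + q.2)), q.1)) (by fun_prop)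
  · intro v hv τ hτ l hl
    refine mem_linkFormDomain (joinPoint_mem_sphere _ _ _) (joinPoint_shift_notMem hσ h0.sign h1.sign hv hτ ?_ ?_ ?_ ?_)
    · have := cos_sq_le_one (π / 2 * τ)
      have h3 := sq_nonneg (cos (π / 2 * τ))
      exact ⟨by nlinarith [hl.1, hl.2, mul_nonneg (hI l hl).1 h3], by nlinarith [(hI l hl).1]⟩
    · have := sin_sq_le_one (π / 2 * τ)
      have h3 := sq_nonneg (sin (π / 2 * τ))
      exact ⟨by nlinarith [hl.1, hl.2, mul_nonneg (hI l hl).1 h3], by nlinarith [(hI l hl).1]⟩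
    · intro h
      have h3 : 0 < cos (π / 2 * τ) ^ 2 := by positivity
      rcases hl.1.eq_or_lt with h4 | h4
      · rw [← h4]; simpa using h
      · nlinarith [mul_nonneg (hI l hl).1 h3.le]
    · intro h
      have h3 : 0 < sin (π / 2 * τ) ^ 2 := by positivity
      rcases hl.1.eq_or_lt with h4 | h4
      · rw [← h4]; simpa using h
      · nlinarith [mul_nonneg (hI l hl).1 h3.le]
  · intro v hv l _
    have h : (partner R false v).2 = v.2 := (partner_spec hR false hv).2.2
    simp [hK2, joinPoint, h, r0 v hv]
  · intro v hv l _
    have h : (partner R true v).1 = v.1 := (partner_spec hR true hv).2.2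
    simp [hK2, joinPoint, h, r1 v hv]
  · exact fun v _ => tame v
  · intro v _
    rw [e21 v]
    exact vertexArc_isTameCurve _
  · intro v hv
    have hc1 : ContinuousOn (fun q : ℝ × ℝ => H (vertexArc v q.1) (1 - q.2)) (Icc 0 1 ×ˢ Icc 0 1) :=
      hH.continuousOn.comp (f := fun q : ℝ × ℝ => (vertexArc v q.1, 1 - q.2))
        (by have := continuous_vertexArc v; fun_prop)
        fun q hq => ⟨vertexArc_mem_linkOf hv hq.1, hI _ hq.2⟩
    have hc2 := (continuous_arcRotate s0 s1 v).comp_continuousOn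
      (f := fun q : ℝ × ℝ => (σ * q.2, q.1, H (vertexArc v q.1) (1 - q.2))) (s := Icc 0 1 ×ˢ Icc 0 1)
      ((continuous_const.mul continuous_snd).continuousOn.prodMk (continuous_fst.continuousOn.prodMk hc1))
    refine hc2.congr fun q hq => ?_
    simp only [Function.uncurry, hK1, hHe _ (vertexArc_mem_linkOf hv hq.1)]
    rfl
  · intro v hv τ hτ l hl
    have hx := vertexArc_mem_linkOf hv hτ
    refine mem_linkFormDomain ?_ ?_
    · have : H (vertexArc v τ) (1 - l) ∈ Metric.sphere (0 : E4) 1 :=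
        hMs (hF (hH.subset ⟨(vertexArc v τ, 1 - l), ⟨hx, hI l hl⟩, rfl⟩))
      rw [mem_sphere_zero_iff_norm] at this ⊢
      simp only [hK1, arcRotate, norm_rotate, hHe _ hx, this]
    · simp only [hK1, hHe _ hx]
      refine hdis _ ⟨by have := hl.1; positivity, ?_⟩ v hv τ hτ _ (hI l hl) ?_
      · exact (mul_le_of_le_one_right hσpos.le hl.2).trans (min_le_left _ _)
      · by_contra hcon
        push Not at hcon
        have h1 := (mul_eq_zero.1 hcon.1).resolve_left hσpos.ne'
        rw [h1] at hcon
        norm_num at hcon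
  · intro v hv l hl
    simp only [hK1, vertexArc_partner_zero hR hv]
    simp [arcRotate, r0 v hv]
  · intro v hv l hl
    simp only [hK1, vertexArc_partner_one hR hv]
    simp [arcRotate, r1 v hv]
  · intro v hv
    rw [e10 v]
    exact (hpc v hv).isTameCurve
  · intro v hv
    rw [e12 v]
    exact tame v

end PushOff

theorem pushOffLk_of_xiPlus {R : Finset Torus} (hR : IsLinkDiagram R) {ε : Torus → ℤˣ}
    (hε : IsOrientation R ε) {F B : Set E4} {β : E4 → E4} (hF : IsSurfaceWithCorners F B)
    (hβ : IsPushOff R F β) (ht : ∀ p ∈ linkOf R, tangentPlane F p = xiPlus p) :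
    pushOffLk R ε β = tbPlus R ε := by
  obtain ⟨M, hM, hMs, hFM, -⟩ := hF
  obtain ⟨H, hH, hβ, hpc⟩ := hβ
  rw [pushOffLk_eq hR hε hM hMs hFM hH (isEdgeSign_one R _) (isEdgeSign_one R _)
    (fun v hv τ hτ => by rw [ht _ (vertexArc_mem_linkOf hv hτ), xiPlus, one_mul]) hβ hpc, tbPlus_eq hR hε]
  simp; ring

theorem pushOffLk_of_xiMinus {R : Finset Torus} (hR : IsLinkDiagram R) {ε : Torus → ℤˣ}
    (hε : IsOrientation R ε) {F B : Set E4} {β : E4 → E4} (hF : IsSurfaceWithCorners F B)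
    (hβ : IsPushOff R F β) (ht : ∀ p ∈ linkOf R, tangentPlane F p = xiMinus p) :
    pushOffLk R ε β = -tbMinus R ε := by
  obtain ⟨M, hM, hMs, hFM, -⟩ := hF
  obtain ⟨H, hH, hβ, hpc⟩ := hβ
  rw [pushOffLk_eq hR hε hM hMs hFM hH (isEdgeSign_one R _) (isEdgeSign_neg_one R _)
    (fun v hv τ hτ => by rw [ht _ (vertexArc_mem_linkOf hv hτ), xiMinus, one_mul]) hβ hpc, neg_tbMinus_eq hR hε]
  simp; ring

/-! ## The position of a surface with respect to an arc -/

lemma conj_angExp_mul (a : Angle) : (starRingEnd ℂ) (angExp a) * angExp a = 1 := by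
  rw [← Complex.normSq_eq_conj_mul_self, Complex.normSq_eq_norm_sq, norm_angExp]; simp

/-- The tangential component of the coordinate number `j` of `x` at the vertex `v`. -/
def side (j : Bool) (v : Torus) (x : E4) : ℝ :=
  ((starRingEnd ℂ) (angExp (ang j v)) * cpx j x).im

/-- The radial component of the coordinate number `j` of `x` at the vertex `v`. -/
def rad (j : Bool) (v : Torus) (x : E4) : ℝ :=
  ((starRingEnd ℂ) (angExp (ang j v)) * cpx j x).re

lemma continuous_side (j : Bool) (v : Torus) : Continuous (side j v) :=
  Complex.continuous_im.comp (continuous_const.mul (cpx j).continuous)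

lemma continuous_rad (j : Bool) (v : Torus) : Continuous (rad j v) :=
  Complex.continuous_re.comp (continuous_const.mul (cpx j).continuous)

lemma side_sub (j : Bool) (v : Torus) (x y : E4) : side j v (x - y) = side j v x - side j v y := by
  simp [side, mul_sub]

lemma rad_sub (j : Bool) (v : Torus) (x y : E4) : rad j v (x - y) = rad j v x - rad j v y := by
  simp [rad, mul_sub]

lemma norm_cpx_sq (j : Bool) (v : Torus) (x : E4) : ‖cpx j x‖ ^ 2 = rad j v x ^ 2 + side j v x ^ 2 := by
  have : ‖cpx j x‖ = ‖(starRingEnd ℂ) (angExp (ang j v)) * cpx j x‖ := by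
    rw [norm_mul, RCLike.norm_conj, norm_angExp, one_mul]
  rw [this, Complex.sq_norm, Complex.normSq_apply, rad, side]
  ring

lemma frame_eq_rad_side (v : Torus) (x : E4) : frame v x 0 = rad false v x ∧ frame v x 1 = side false v x ∧
    frame v x 2 = rad true v x ∧ frame v x 3 = side true v x := by
  refine ⟨?_, ?_, ?_, ?_⟩ <;> simp [rad, side, ang] <;> ring

lemma rad_side_of_cpx {j : Bool} {v : Torus} {x : E4} {C : ℝ} (h : cpx j x = C * angExp (ang j v)) :
    rad j v x = C ∧ side j v x = 0 := by
  have : (starRingEnd ℂ) (angExp (ang j v)) * cpx j x = C := by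
    rw [h, mul_left_comm, conj_angExp_mul, mul_one]
  rw [rad, side, this]
  simp

/-- The arc `v̂`, parametrized from its endpoint on the circle number `i`. -/
def arcFrom (i : Bool) (v : Torus) (u : ℝ) : E4 := vertexArc v (if i then 1 - u else u)

lemma continuous_arcFrom (i : Bool) (v : Torus) : Continuous (arcFrom i v) := by
  cases i
  · exact continuous_vertexArc v
  · exact (continuous_vertexArc v).comp (by fun_prop : Continuous fun u : ℝ => 1 - u)

lemma cpx_arcFrom (i : Bool) (v : Torus) (u : ℝ) :
    cpx i (arcFrom i v u) = (cos (π / 2 * u) : ℂ) * angExp (ang i v) ∧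
    cpx (!i) (arcFrom i v u) = (sin (π / 2 * u) : ℂ) * angExp (ang (!i) v) := by
  have e : π / 2 * (1 - u) = π / 2 - π / 2 * u := by ring
  cases i
  · exact ⟨cpx_joinPoint_false _ _ _, cpx_joinPoint_true _ _ _⟩
  · refine ⟨(cpx_joinPoint_true _ _ _).trans ?_, (cpx_joinPoint_false _ _ _).trans ?_⟩
    · simp only [if_true]; rw [e, sin_pi_div_two_sub]; rfl
    · simp only [if_true]; rw [e, cos_pi_div_two_sub]; rfl

lemma norm_arcFrom (i : Bool) (v : Torus) (u : ℝ) : ‖arcFrom i v u‖ = 1 := norm_joinPoint _ _ _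

lemma arcFrom_mem_linkOf {R : Finset Torus} {v : Torus} (hv : v ∈ R) (i : Bool) {u : ℝ}
    (hu : u ∈ Icc (0 : ℝ) 1) : arcFrom i v u ∈ linkOf R := by
  refine vertexArc_mem_linkOf hv ?_
  cases i
  · exact hu
  · exact ⟨by simp [hu.2], by simp [hu.1]⟩

/-- A point of the sphere with vanishing tangential components lies on the link. -/
lemma mem_linkOf_of_side {R : Finset Torus} {v : Torus} (hv : v ∈ R) {x : E4} (hx : ‖x‖ = 1)
    (h0 : ∀ j, side j v x = 0) (h1 : ∀ j, 0 ≤ rad j v x) : x ∈ linkOf R := by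
  by_contra h
  obtain ⟨e0, e1, e2, e3⟩ := frame_eq_rad_side v x
  refine mem_linkFormDomain (mem_sphere_zero_iff_norm.2 hx) h v hv ⟨?_, ?_, ?_, ?_⟩
  · rw [e0]; exact h1 false
  · rw [e1]; exact h0 false
  · rw [e2]; exact h1 true
  · rw [e3]; exact h0 true

lemma contactForm_vertexArc (σ : ℝ) (v : Torus) (τ : ℝ) (w : E4) : contactForm σ (vertexArc v τ) w =
    cos (π / 2 * τ) * side false v w + σ * (sin (π / 2 * τ) * side true v w) := by
  rw [contactForm_apply, vertexArc, cpx_joinPoint_false, cpx_joinPoint_true]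
  simp only [map_mul, Complex.conj_ofReal, mul_assoc, side, Complex.im_ofReal_mul]
  rfl

lemma foot_point_estimate (v : Torus) {x : E4} (hx : ‖x‖ = 1) (h0 : 0 < rad false v x)
    (h1 : 0 < rad true v x) :
    ∃ q : E4, ‖q‖ = 1 ∧ (∀ j, side j v q = 0) ∧ (∀ j, 0 ≤ rad j v q) ∧
      ‖x - q‖ ≤ 2 * (|side false v x| + |side true v x|) ∧
      (side false v x = 0 → side true v x = 0 → x = q) := by
  set a := rad false v x with ha
  set b := rad true v x with hb
  set A := side false v x with hA
  set B := side true v x with hB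
  have hn : a ^ 2 + A ^ 2 + (b ^ 2 + B ^ 2) = 1 := by
    have := norm_sq_eq_cpx x
    rw [norm_cpx_sq false v, norm_cpx_sq true v, hx] at this
    linarith
  set ρ := sqrt (a ^ 2 + b ^ 2)
  have hρ : ρ ^ 2 = a ^ 2 + b ^ 2 := sq_sqrt (by positivity)
  have hρ0 : 0 < ρ := sqrt_pos.2 (by positivity)
  set q : E4 := ofCpx (((a / ρ : ℝ) : ℂ) * angExp (ang false v)) (((b / ρ : ℝ) : ℂ) * angExp (ang true v)) with hq
  have q0 := rad_side_of_cpx (j := false) (v := v) (x := q) (C := a / ρ) (by rw [hq, cpx_ofCpx_false])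
  have q1 := rad_side_of_cpx (j := true) (v := v) (x := q) (C := b / ρ) (by rw [hq, cpx_ofCpx_true])
  have hqn : ‖q‖ = 1 := by
    have := norm_sq_eq_cpx q
    rw [norm_cpx_sq false v, norm_cpx_sq true v, q0.1, q0.2, q1.1, q1.2] at this
    have h2 : ‖q‖ ^ 2 = 1 := by
      rw [this, div_pow, div_pow, hρ]; field_simp; ring
    nlinarith [norm_nonneg q]
  have hd : ‖x - q‖ ^ 2 = (1 - ρ) ^ 2 + A ^ 2 + B ^ 2 := by
    have := norm_sq_eq_cpx (x - q)
    rw [norm_cpx_sq false v, norm_cpx_sq true v, rad_sub, rad_sub, side_sub, side_sub, q0.1, q0.2,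
      q1.1, q1.2, ← ha, ← hb, ← hA, ← hB] at this
    rw [this]
    have e1 : a - a / ρ = -(a / ρ) * (1 - ρ) := by field_simp; ring
    have e2 : b - b / ρ = -(b / ρ) * (1 - ρ) := by field_simp; ring
    have e3 : (a / ρ) ^ 2 + (b / ρ) ^ 2 = 1 := by
      rw [div_pow, div_pow, hρ]; field_simp
    rw [e1, e2]
    linear_combination (1 - ρ) ^ 2 * e3
  have hAB : (1 - ρ) ^ 2 ≤ A ^ 2 + B ^ 2 := by nlinarith [sq_nonneg A, sq_nonneg B]
  refine ⟨q, hqn, ?_, ?_, ?_, ?_⟩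
  · rintro (_ | _)
    exacts [q0.2, q1.2]
  · rintro (_ | _)
    · rw [q0.1]; positivity
    · rw [q1.1]; positivity
  · refine (abs_le_of_sq_le_sq' ?_ (by positivity)).2
    rw [hd]
    nlinarith [sq_abs A, sq_abs B, mul_nonneg (abs_nonneg A) (abs_nonneg B)]
  · intro h1 h2
    have h3 : ‖x - q‖ = 0 := by nlinarith [norm_nonneg (x - q)]
    exact sub_eq_zero.1 (norm_eq_zero.1 h3)

/-- Near an inner point of an arc, a surface tangent to `ξ_σ` lies in the two quadrants where
the tangential components have the sign prescribed by `σ`. -/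
lemma eventually_side_mul_neg {R : Finset Torus} {M F : Set E4} (hM : IsC1Surface M)
    (hMs : M ⊆ Metric.sphere (0 : E4) 1) (hF : F ⊆ M) (hL : linkOf R ⊆ F) {v : Torus} (hv : v ∈ R)
    {τ : ℝ} (hτ : τ ∈ Ioo (0 : ℝ) 1) {σ : ℝ} (hσ : σ = 1 ∨ σ = -1)
    (ht : tangentPlane F (vertexArc v τ) = contactPlane σ (vertexArc v τ)) :
    ∀ᶠ x in 𝓝[F] (vertexArc v τ), x ∉ linkOf R → σ * (side false v x * side true v x) < 0 := by
  set p := vertexArc v τ with hp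
  have hτI := Ioo_subset_Icc_self hτ
  obtain ⟨hC, hS⟩ := half_angle_pos hτ
  set C := cos (π / 2 * τ) with hCd
  set S := sin (π / 2 * τ) with hSd
  have p0 := rad_side_of_cpx (j := false) (v := v) (x := p) (cpx_joinPoint_false v.1 v.2 τ)
  have p1 := rad_side_of_cpx (j := true) (v := v) (x := p) (cpx_joinPoint_true v.1 v.2 τ)
  rw [← hCd] at p0
  rw [← hSd] at p1
  have hpM : p ∈ M := hF (hL (vertexArc_mem_linkOf hv hτI))
  set δ := min C S / 4 with hδ
  have hδ0 : 0 < δ := by positivity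
  have hlo := (hM.isLittleO_of_tangentPlane hF hpM ht).def hδ0
  -- the foot point
  obtain ⟨r, hr, hball⟩ : ∃ r > 0, ∀ z : E4 × E4, z.1 ∈ M → z.2 ∈ M → ‖z.1 - p‖ < r → ‖z.2 - p‖ < r →
      ‖contactForm σ p (z.1 - z.2)‖ ≤ δ * ‖z.1 - z.2‖ := by
    obtain ⟨r, hr, h⟩ := Metric.mem_nhdsWithin_iff.1 hlo
    refine ⟨r, hr, fun z h1 h2 h3 h4 => h ⟨?_, h1, h2⟩⟩
    rw [Metric.mem_ball, Prod.dist_eq, dist_eq_norm, dist_eq_norm]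
    exact max_lt h3 h4
  have hA0 : Tendsto (fun x => |side false v x| + |side true v x|) (𝓝 p) (𝓝 0) := by
    have h : Continuous fun x => |side false v x| + |side true v x| :=
      (continuous_side false v).abs.add (continuous_side true v).abs
    exact h.tendsto' p 0 (by rw [p0.2, p1.2, abs_zero, add_zero])
  have ev1 : ∀ᶠ x in 𝓝[F] p, 0 < rad false v x :=
    nhdsWithin_le_nhds (((continuous_rad false v).tendsto p).eventually_const_lt (by rw [p0.1]; exact hC))
  have ev2 : ∀ᶠ x in 𝓝[F] p, 0 < rad true v x :=
    nhdsWithin_le_nhds (((continuous_rad true v).tendsto p).eventually_const_lt (by rw [p1.1]; exact hS))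
  have ev3 : ∀ᶠ x in 𝓝[F] p, |side false v x| + |side true v x| < r / 4 :=
    nhdsWithin_le_nhds (hA0.eventually_lt_const (by positivity))
  have ev4 : ∀ᶠ x in 𝓝[F] p, ‖x - p‖ < r / 2 := by
    refine nhdsWithin_le_nhds ?_
    filter_upwards [Metric.ball_mem_nhds p (half_pos hr)] with x hx
    rwa [← dist_eq_norm]
  filter_upwards [ev1, ev2, ev3, ev4, self_mem_nhdsWithin] with x h1 h2 h3 h4 hxF hxL
  have hxn : ‖x‖ = 1 := mem_sphere_zero_iff_norm.1 (hMs (hF hxF))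
  obtain ⟨q, hqn, hq0, hq1, hqd, hqe⟩ := foot_point_estimate v hxn h1 h2
  have hqL : q ∈ linkOf R := mem_linkOf_of_side hv hqn hq0 hq1
  have hqp : ‖q - p‖ < r := by
    calc ‖q - p‖ = ‖(x - p) - (x - q)‖ := by congr 1; abel
      _ ≤ ‖x - p‖ + ‖x - q‖ := norm_sub_le _ _
      _ < r := by linarith
  have hb := hball (x, q) (hF hxF) (hF (hL hqL)) (by simp only; linarith) hqp
  simp only at hb
  rw [hp, contactForm_vertexArc, side_sub, side_sub, hq0, hq0, sub_zero, sub_zero, ← hCd, ← hSd,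
    norm_eq_abs] at hb
  set A := side false v x
  set B := side true v x
  by_contra hcon
  push Not at hcon
  have hsum : C * |A| + S * |B| ≤ |C * A + σ * (S * B)| := by
    have h5 : 0 ≤ (C * A) * (σ * (S * B)) := by
      have : (C * A) * (σ * (S * B)) = C * S * (σ * (A * B)) := by ring
      rw [this]; positivity
    have h6 : |C * A| + |σ * (S * B)| = |C * A + σ * (S * B)| := by
      exact ((abs_add_eq_add_abs_iff _ _).2 (mul_nonneg_iff.1 h5)).symm
    have h7 : |σ| = 1 := by rcases hσ with rfl | rfl <;> simp
    rw [← h6, abs_mul, abs_mul, abs_mul, h7, abs_of_pos hC, abs_of_pos hS, one_mul]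
  have hCδ : 4 * δ ≤ C := by rw [hδ]; linarith [min_le_left C S]
  have hSδ : 4 * δ ≤ S := by rw [hδ]; linarith [min_le_right C S]
  have h8 : 4 * δ * (|A| + |B|) ≤ δ * (2 * (|A| + |B|)) := by
    calc 4 * δ * (|A| + |B|) = 4 * δ * |A| + 4 * δ * |B| := by ring
      _ ≤ C * |A| + S * |B| := by gcongr
      _ ≤ δ * ‖x - q‖ := hsum.trans hb
      _ ≤ _ := by gcongr
  have h9 : |A| + |B| ≤ 0 := by nlinarith [abs_nonneg A, abs_nonneg B]
  have hA : A = 0 := abs_eq_zero.1 (by linarith [abs_nonneg A, abs_nonneg B])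
  have hB : B = 0 := abs_eq_zero.1 (by linarith [abs_nonneg A, abs_nonneg B])
  exact hxL (hqe hA hB ▸ hqL)

/-- Near an endpoint of an arc the surface is a graph over the coordinate plane number `!i`. -/
lemma exists_graph_nhds {M F : Set E4} (hM : IsC1Surface M)
    (hMs : M ⊆ Metric.sphere (0 : E4) 1) (hF : F ⊆ M) {v : Torus} (i : Bool) (hp : arcFrom i v 0 ∈ M)
    {σ : ℝ} (hσ : σ = 1 ∨ σ = -1) (ht : tangentPlane F (arcFrom i v 0) = contactPlane σ (arcFrom i v 0)) :
    ∃ r > 0, ∀ x ∈ M, ∀ y ∈ M, ‖x - arcFrom i v 0‖ < r → ‖y - arcFrom i v 0‖ < r →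
      ‖x - y‖ ≤ 2 * ‖cpx (!i) x - cpx (!i) y‖ := by
  set p := arcFrom i v 0
  have hform : ∀ w, |contactForm σ p w| = |side i v w| := by
    intro w
    have h7 : |σ| = 1 := by rcases hσ with rfl | rfl <;> simp
    cases i
    · simp only [p, arcFrom, contactForm_vertexArc]; simp
    · simp only [p, arcFrom, contactForm_vertexArc]; simp [abs_mul, h7]
  have hlo := (hM.isLittleO_of_tangentPlane hF hp ht).def (show (0 : ℝ) < 1 / 4 by norm_num)
  obtain ⟨r, hr, h⟩ := Metric.mem_nhdsWithin_iff.1 hlo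
  refine ⟨min r (1 / 4), by positivity, fun x hx y hy hxp hyp => ?_⟩
  have hxr := hxp.trans_le (min_le_left _ _)
  have hyr := hyp.trans_le (min_le_left _ _)
  have h1 : |side i v (x - y)| ≤ 1 / 4 * ‖x - y‖ := by
    rw [← hform]
    refine h (a := (x, y)) ⟨?_, hx, hy⟩
    rw [Metric.mem_ball, Prod.dist_eq, dist_eq_norm, dist_eq_norm]
    exact max_lt hxr hyr
  have h2 : |rad i v (x - y)| ≤ 1 / 4 * ‖x - y‖ := by
    have e0 : rad i v (x - y) = inner ℝ p (x - y) := by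
      simp only [p, arcFrom]
      cases i
      · simp [rad, ang, vertexArc, joinPoint, PiLp.inner_apply, Fin.sum_univ_four]; ring
      · simp [rad, ang, vertexArc, joinPoint, PiLp.inner_apply, Fin.sum_univ_four]; ring
    have hxn := mem_sphere_zero_iff_norm.1 (hMs hx)
    have hyn := mem_sphere_zero_iff_norm.1 (hMs hy)
    have e1 : inner ℝ (x + y) (x - y) = (0 : ℝ) := (real_inner_add_sub_eq_zero_iff x y).2 (hxn.trans hyn.symm)
    have e2 : inner ℝ p (x - y) = -(1 / 2) * inner ℝ ((x - p) + (y - p)) (x - y) := by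
      have : (x - p) + (y - p) = (x + y) - (2 : ℝ) • p := by rw [two_smul]; abel
      rw [this, inner_sub_left, e1, inner_smul_left]; simp
    rw [e0, e2, abs_mul]
    have h3 : ‖(x - p) + (y - p)‖ ≤ 1 / 2 := by
      have := norm_add_le (x - p) (y - p)
      have a1 := hxp.trans_le (min_le_right r (1 / 4))
      have a2 := hyp.trans_le (min_le_right r (1 / 4))
      linarith
    have h4 := abs_real_inner_le_norm ((x - p) + (y - p)) (x - y)
    have h5 : |(-(1 / 2) : ℝ)| = 1 / 2 := by norm_num
    rw [h5]
    nlinarith [norm_nonneg (x - y)]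
  have h3 := norm_sq_eq_cpx' i (x - y)
  rw [norm_cpx_sq i v, map_sub] at h3
  have h4 : rad i v (x - y) ^ 2 ≤ (1 / 4 * ‖x - y‖) ^ 2 := sq_le_sq' (by linarith [(abs_le.1 h2).1]) (abs_le.1 h2).2
  have h5 : side i v (x - y) ^ 2 ≤ (1 / 4 * ‖x - y‖) ^ 2 := sq_le_sq' (by linarith [(abs_le.1 h1).1]) (abs_le.1 h1).2
  refine (abs_le_of_sq_le_sq' ?_ (by positivity)).2
  nlinarith [norm_nonneg (x - y)]

/-! ## The position of a surface near a corner of `R̂` -/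

lemma exists_lift_of_ne {a b : Angle} (h : a ≠ b) :
    ∃ t ∈ Ioo 0 (2 * π), b = a + (t : Angle) ∧
      ∀ x ∈ circleArc a b, ∃ s ∈ Icc 0 t, x = a + (s : Angle) := by
  set y := (b - a).toReal with hy
  have hyc : (y : Angle) = b - a := Angle.coe_toReal _
  have y1 := Angle.neg_pi_lt_toReal (b - a)
  have y2 := Angle.toReal_le_pi (b - a)
  rw [← hy] at y1 y2
  have y0 : y ≠ 0 := fun h0 => h (by
    rw [h0, Angle.coe_zero] at hyc; exact (sub_eq_zero.1 hyc.symm).symm)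
  obtain ⟨t, ht, hbt⟩ : ∃ t ∈ Ioo 0 (2 * π), b = a + (t : Angle) := by
    rcases lt_or_gt_of_ne y0 with h0 | h0
    · refine ⟨y + 2 * π, ⟨by linarith, by linarith⟩, ?_⟩
      rw [Angle.coe_add, Angle.coe_two_pi, add_zero, hyc]; abel
    · refine ⟨y, ⟨h0, by linarith⟩, ?_⟩
      rw [hyc]; abel
  refine ⟨t, ht, hbt, ?_⟩
  rintro x ⟨s, t', hs, hst, ht', hx, hb⟩
  refine ⟨s, ⟨hs, ?_⟩, hx⟩
  have e : (t' : Angle) = (t : Angle) := by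
    rw [hbt] at hb; exact (add_left_cancel hb).symm
  obtain ⟨n, hn⟩ := Angle.angle_eq_iff_two_pi_dvd_sub.1 e
  have h1 : (-1 : ℝ) < n := by
    by_contra hcon
    nlinarith [ht.1, ht.2, hs.trans hst]
  have h2 : (n : ℝ) < 1 := by
    by_contra hcon
    nlinarith [ht.1, ht.2]
  have h3 : n = 0 := by
    have h1' : -1 < n := by exact_mod_cast h1
    have h2' : n < 1 := by exact_mod_cast h2
    omega
  rw [h3] at hn
  simp at hn
  linarith

/-- The argument of a complex number in `[0, 2π)`, continuous off the positive half-axis. -/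
def posArg (z : ℂ) : ℝ := π + Complex.arg (-z)

lemma posArg_spec {z : ℂ} : z = ‖z‖ * angExp (posArg z : Angle) := by
  rw [angExp_coe, posArg, Complex.ofReal_add, add_mul, Complex.exp_add, Complex.exp_pi_mul_I]
  have := Complex.norm_mul_exp_arg_mul_I (-z)
  rw [norm_neg] at this
  linear_combination this

lemma neg_mem_slitPlane {z : ℂ} (h : ∀ s : ℝ, 0 ≤ s → z ≠ s) : -z ∈ Complex.slitPlane := by
  rw [Complex.mem_slitPlane_iff]
  by_contra hcon
  push Not at hcon
  refine h z.re ?_ ?_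
  · have := hcon.1; simp at this; exact this
  · have := hcon.2
    apply Complex.ext
    · simp
    · simpa using this

lemma continuousAt_posArg {z : ℂ} (h : -z ∈ Complex.slitPlane) : ContinuousAt posArg z :=
  continuousAt_const.add ((Complex.continuousAt_arg h).comp continuous_neg.continuousAt)

lemma posArg_near_pos {z : ℂ} (h : -z ∈ Complex.slitPlane) (hre : 0 < z.re) {η : ℝ}
    (hη : |Complex.arg z| < η) : (0 < z.im ∧ posArg z < η) ∨ (z.im < 0 ∧ 2 * π - η < posArg z) := by
  have him : z.im ≠ 0 := by
    rcases Complex.mem_slitPlane_iff.1 h with h1 | h1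
    · simp at h1; linarith
    · simpa using h1
  rcases lt_or_gt_of_ne him with h1 | h1
  · right
    refine ⟨h1, ?_⟩
    rw [posArg, Complex.arg_neg_eq_arg_add_pi_of_im_neg h1]
    linarith [(abs_lt.1 hη).1]
  · left
    refine ⟨h1, ?_⟩
    rw [posArg, Complex.arg_neg_eq_arg_sub_pi_of_im_pos h1]
    linarith [(abs_lt.1 hη).2]

lemma norm_sub_angExp_sq (ρ s : ℝ) (a b : Angle) :
    ‖(ρ : ℂ) * angExp a - s * angExp b‖ ^ 2 = ρ ^ 2 + s ^ 2 - 2 * (ρ * s) * (a - b).cos := by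
  rw [Complex.sq_norm, Complex.normSq_apply, sub_eq_add_neg a b, Angle.cos_add]
  simp
  linear_combination ρ ^ 2 * a.cos_sq_add_sin_sq + s ^ 2 * b.cos_sq_add_sin_sq

lemma sector_distance {t : ℝ} (ht : t ∈ Ioo 0 (2 * π)) :
    ∃ κ > 0, ∀ (a : Angle) (ρ : ℝ), 0 ≤ ρ → ∀ (s : ℝ), 0 ≤ s → ∀ b ∈ Icc 0 t,
      κ * ρ ≤ ‖(ρ : ℂ) * angExp (a + ((t / 2 + π : ℝ) : Angle)) - s * angExp (a + (b : Angle))‖ := by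
  set k := max (-cos (t / 2)) 0
  have hk0 : 0 ≤ k := le_max_right _ _
  have hk1 : k < 1 := by
    refine max_lt ?_ one_pos
    have := cos_lt_cos_of_nonneg_of_le_pi (by linarith [ht.1] : 0 ≤ t / 2) le_rfl (by linarith [ht.2])
    rw [cos_pi] at this
    linarith
  refine ⟨1 - k, by linarith, fun a ρ hρ s hs b hb => ?_⟩
  refine (abs_le_of_sq_le_sq' ?_ (norm_nonneg _)).2
  rw [norm_sub_angExp_sq, add_sub_add_left_eq_sub, ← Angle.coe_sub, Angle.cos_coe]
  have hc : cos (t / 2 + π - b) ≤ k := by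
    rw [show t / 2 + π - b = (t / 2 - b) + π by ring, cos_add_pi]
    refine le_trans ?_ (le_max_left _ _)
    rw [neg_le_neg_iff, ← cos_abs (t / 2 - b)]
    exact cos_le_cos_of_nonneg_of_le_pi (abs_nonneg _) (by linarith [ht.2])
      (abs_le.2 ⟨by linarith [hb.2], by linarith [hb.1]⟩)
  have hρs : 0 ≤ ρ * s := mul_nonneg hρ hs
  nlinarith [mul_le_mul_of_nonneg_left hc hρs, sq_nonneg (ρ - s), mul_nonneg hk0 (sq_nonneg (ρ - s)),
    mul_nonneg (by linarith : 0 ≤ 1 - k) (sq_nonneg s), mul_nonneg hk0 (mul_nonneg (by linarith : 0 ≤ 1 - k) (sq_nonneg ρ))]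

theorem corner_side {R : Finset Torus} {M F : Set E4} (hM : IsC1Surface M)
    (hMs : M ⊆ Metric.sphere (0 : E4) 1) (hF : F ⊆ M) {H : E4 → ℝ → E4}
    (hH : IsCollar (linkOf R) F H) {v w : Torus} (hv : v ∈ R) (hw : w ∈ R) (i : Bool)
    (hi : ang i v = ang i w) (hne : ang (!i) v ≠ ang (!i) w) {σ : ℝ} (hσ : σ = 1 ∨ σ = -1)
    (ht : tangentPlane F (arcFrom i v 0) = contactPlane σ (arcFrom i v 0)) {D : Set E4}
    (hD0 : D.Nonempty)
    (hD : ∀ y ∈ D, ∃ s : ℝ, 0 ≤ s ∧ ∃ a ∈ circleArc (ang (!i) v) (ang (!i) w), cpx (!i) y = s * angExp a)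
    (hA : ApproachesAlong F D (arcFrom i v 0)) :
    ∃ u₀ > 0, ∀ u ∈ Ioo 0 u₀, ∀ᶠ t in 𝓝[>] (0 : ℝ),
      0 < side (!i) v (H (arcFrom i v u) t) ∧ side (!i) w (H (arcFrom i w u) t) < 0 := by
  have hpi := pi_pos
  set p := arcFrom i v 0 with hp
  have hpw : arcFrom i w 0 = p := by
    refine ext_cpx fun j => ?_
    obtain ⟨a1, a2⟩ := cpx_arcFrom i v 0
    obtain ⟨b1, b2⟩ := cpx_arcFrom i w 0
    rcases Bool.eq_or_eq_not j i with rfl | rfl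
    · rw [hp, a1, b1, hi]
    · rw [hp, a2, b2]; simp
  have hpL : p ∈ linkOf R := arcFrom_mem_linkOf hv i ⟨le_rfl, zero_le_one⟩
  have hLF : linkOf R ⊆ F := fun q hq => hH.subset ⟨(q, 0), ⟨hq, le_rfl, zero_le_one⟩, hH.zero q hq⟩
  obtain ⟨t₀, ht₀, hwt, harc⟩ := exists_lift_of_ne hne
  obtain ⟨r, hr, hgraph⟩ := exists_graph_nhds hM hMs hF i (hF (hLF hpL)) hσ ht
  set W : E4 → ℂ := fun x => cpx (!i) x with hW
  have hWc : Continuous W := (cpx (!i)).continuous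
  have hWp : W p = 0 := by rw [hW]; simp only; rw [hp, (cpx_arcFrom i v 0).2]; simp
  set c : ℝ → E4 := fun u => if 0 ≤ u then arcFrom i v u else arcFrom i w (-u) with hc
  have hcc : Continuous c := by
    refine Continuous.if_le (continuous_arcFrom i v) ((continuous_arcFrom i w).comp continuous_neg)
      continuous_const continuous_id ?_
    intro u hu
    rw [← hu, neg_zero, hpw]
  have hc0 : c 0 = p := by simp [hc, hp]
  have hcL : ∀ u, |u| ≤ 1 → c u ∈ linkOf R := by
    intro u hu
    simp only [hc]
    split_ifs with h
    · exact arcFrom_mem_linkOf hv i ⟨h, (abs_le.1 hu).2⟩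
    · exact arcFrom_mem_linkOf hw i ⟨by linarith, by linarith [(abs_le.1 hu).1]⟩
  -- points of the two arcs with given small radius
  set q : Torus → ℝ → E4 := fun a s => arcFrom i a (2 / π * arcsin s) with hq
  have hq0 : ∀ a, arcFrom i a 0 = p → ∀ᶠ s in 𝓝 (0 : ℝ), ‖q a s - p‖ < r := by
    intro a ha
    have h1 : Continuous fun s => ‖q a s - p‖ :=
      (((continuous_arcFrom i a).comp (continuous_const.mul continuous_arcsin)).sub continuous_const).norm
    refine (h1.tendsto' 0 0 ?_).eventually_lt_const hr
    simp [hq, ha]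
  obtain ⟨s₀, hs₀, hqs⟩ : ∃ s₀ > 0, ∀ s : ℝ, |s| < s₀ → ‖q v s - p‖ < r ∧ ‖q w s - p‖ < r := by
    obtain ⟨s₀, hs₀, h⟩ := Metric.eventually_nhds_iff.1 ((hq0 v rfl).and (hq0 w hpw))
    exact ⟨s₀, hs₀, fun s hs => h (by simpa using hs)⟩
  -- a box on which the collar is close to the corner
  have hbox : ∀ U ∈ 𝓝 p, ∃ δ > 0, δ ≤ 1 ∧ ∀ u t, |u| < δ → 0 ≤ t → t < δ → H (c u) t ∈ U := by
    intro U hU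
    have h1 := hH.continuousOn (p, 0) ⟨hpL, le_rfl, zero_le_one⟩
    have h2 : Function.uncurry H (p, 0) = p := hH.zero p hpL
    rw [ContinuousWithinAt, h2] at h1
    have h3 : Tendsto (fun z : ℝ × ℝ => (c z.1, z.2)) (𝓝[{z | |z.1| ≤ 1 ∧ z.2 ∈ Icc (0 : ℝ) 1}] (0, 0))
        (𝓝[linkOf R ×ˢ Icc 0 1] (p, 0)) := by
      refine tendsto_nhdsWithin_iff.2 ⟨?_, ?_⟩
      · have : Continuous fun z : ℝ × ℝ => (c z.1, z.2) := by fun_prop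
        refine (this.tendsto' (0, 0) (p, 0) (by rw [hc0])).mono_left nhdsWithin_le_nhds
      · filter_upwards [self_mem_nhdsWithin] with z hz using ⟨hcL _ hz.1, hz.2⟩
    obtain ⟨δ, hδ, h4⟩ := Metric.mem_nhdsWithin_iff.1 ((h1.comp h3) hU)
    refine ⟨min δ 1, by positivity, min_le_right _ _, fun u t hu h0 h1 => h4 (a := (u, t)) ⟨?_, ?_⟩⟩
    · rw [Metric.mem_ball, Prod.dist_eq, dist_eq, dist_eq, sub_zero, sub_zero, abs_of_nonneg h0]
      exact max_lt (hu.trans_le (min_le_left _ _)) (h1.trans_le (min_le_left _ _))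
    · exact ⟨(hu.trans_le (min_le_right _ _)).le, h0, (h1.trans_le (min_le_right _ _)).le⟩
  obtain ⟨δ, hδ, hδ1, hbx⟩ := hbox (Metric.ball p r ∩ W ⁻¹' Metric.ball 0 s₀)
    (inter_mem (Metric.ball_mem_nhds p hr)
      (hWc.continuousAt.preimage_mem_nhds (by rw [hWp]; exact Metric.ball_mem_nhds 0 hs₀)))
  have hHM : ∀ u t, |u| < δ → 0 ≤ t → t < δ → H (c u) t ∈ F := fun u t hu h0 h1 =>
    hH.subset ⟨(c u, t), ⟨hcL u (hu.le.trans hδ1), h0, h1.le.trans hδ1⟩, rfl⟩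
  -- the collar avoids the two rays
  have hray : ∀ u t, |u| < δ → 0 < t → t < δ → ∀ a, a = v ∨ a = w → ∀ s : ℝ, 0 ≤ s →
      W (H (c u) t) ≠ s * angExp (ang (!i) a) := by
    intro u t hu h0 h1 a ha s hs he
    obtain ⟨hb1, hb2⟩ := hbx u t hu h0.le h1
    have haR : a ∈ R := by rcases ha with rfl | rfl <;> assumption
    have hss : s < s₀ := by
      have h2 : ‖W (H (c u) t)‖ < s₀ := by simpa using hb2
      rw [he, norm_mul, norm_angExp, mul_one, Complex.norm_real, norm_of_nonneg hs] at h2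
      exact h2
    have hs1 : s ≤ 1 := by
      have h2 := norm_cpx_le (!i) (H (c u) t)
      have h3 := mem_sphere_zero_iff_norm.1 (hMs (hF (hHM u t hu h0.le h1)))
      change ‖W (H (c u) t)‖ ≤ _ at h2
      rwa [he, norm_mul, norm_angExp, mul_one, Complex.norm_real, norm_of_nonneg hs, h3] at h2
    have hqr : ‖q a s - p‖ < r := by
      have := hqs s (by rwa [abs_of_nonneg hs])
      rcases ha with rfl | rfl
      exacts [this.1, this.2]
    have hqL : q a s ∈ linkOf R := by
      refine arcFrom_mem_linkOf haR i ⟨?_, ?_⟩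
      · have := arcsin_nonneg.2 hs; positivity
      · have := arcsin_le_pi_div_two s
        rw [div_mul_eq_mul_div, div_le_one hpi]; linarith
    have hWq : W (q a s) = s * angExp (ang (!i) a) := by
      simp only [hW, hq]
      rw [(cpx_arcFrom i a _).2]
      congr 2
      rw [show π / 2 * (2 / π * arcsin s) = arcsin s by field_simp,
        sin_arcsin (by linarith) hs1]
    have h4 := hgraph _ (hF (hHM u t hu h0.le h1)) _ (hF (hLF hqL)) (by rw [← dist_eq_norm]; exact hb1) hqr
    change _ ≤ 2 * ‖W (H (c u) t) - W (q a s)‖ at h4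
    rw [he, hWq, sub_self, norm_zero, mul_zero] at h4
    have h5 := sub_eq_zero.1 (norm_le_zero_iff.1 h4)
    exact h0.ne' (hH.eq_zero_of_mem (hcL u (hu.le.trans hδ1)) ⟨h0.le, h1.le.trans hδ1⟩ (h5 ▸ hqL))
  set e := (starRingEnd ℂ) (angExp (ang (!i) v)) with he
  have hee : e * angExp (ang (!i) v) = 1 := conj_angExp_mul _
  set z : ℝ × ℝ → ℂ := fun a => e * W (H (c a.1) a.2) with hz
  have hWz : ∀ a, W (H (c a.1) a.2) = angExp (ang (!i) v) * z a := fun a => by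
    simp only [hz]; rw [← mul_assoc, mul_comm (angExp _), hee, one_mul]
  have hzslit : ∀ u t, |u| < δ → 0 < t → t < δ → -z (u, t) ∈ Complex.slitPlane := by
    intro u t hu h0 h1
    refine neg_mem_slitPlane fun s hs hcon => hray u t hu h0 h1 v (.inl rfl) s hs ?_
    have := hWz (u, t)
    simp only at this
    rw [this, hcon, mul_comm]
  have hWS : ∀ a, W (H (c a.1) a.2) = ‖W (H (c a.1) a.2)‖ * angExp (ang (!i) v + (posArg (z a) : Angle)) := by
    intro a
    have h1 := posArg_spec (z := z a)
    have h2 : ‖z a‖ = ‖W (H (c a.1) a.2)‖ := by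
      simp only [hz]
      rw [norm_mul, he, RCLike.norm_conj, norm_angExp, one_mul]
    rw [← h2, angExp_add, hWz a]
    nth_rewrite 1 [h1]
    ring
  have hSne : ∀ u t, |u| < δ → 0 < t → t < δ → posArg (z (u, t)) ≠ t₀ := by
    intro u t hu h0 h1 hcon
    refine hray u t hu h0 h1 w (.inr rfl) _ (norm_nonneg (W (H (c u) t))) ?_
    have := hWS (u, t)
    rwa [hcon, ← hwt] at this
  have hWne : ∀ u t, |u| < δ → 0 < t → t < δ → W (H (c u) t) ≠ 0 := by
    intro u t hu h0 h1 hcon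
    exact hray u t hu h0 h1 v (.inl rfl) 0 le_rfl (by rw [hcon]; simp)
  have hHct : ContinuousOn (fun a : ℝ × ℝ => H (c a.1) a.2) (Ioo (-δ) δ ×ˢ Ico 0 δ) := by
    refine hH.continuousOn.comp (f := fun a : ℝ × ℝ => (c a.1, a.2)) (by fun_prop) ?_
    rintro a ⟨h1, h2⟩
    exact ⟨hcL _ ((abs_lt.2 h1).le.trans hδ1), h2.1, h2.2.le.trans hδ1⟩
  have hzc : ContinuousOn z (Ioo (-δ) δ ×ˢ Ico 0 δ) :=
    continuousOn_const.mul (hWc.comp_continuousOn hHct)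
  have hbd : ∀ δ' ≤ δ, ∀ a ∈ Ioo (-δ') δ' ×ˢ Ioo 0 δ', |a.1| < δ ∧ 0 < a.2 ∧ a.2 < δ := by
    rintro δ' hδ' a ⟨h1, h2⟩
    exact ⟨(abs_lt.2 h1).trans_le hδ', h2.1, h2.2.trans_le hδ'⟩
  have hSc : ∀ δ' ≤ δ, ContinuousOn (fun a => posArg (z a)) (Ioo (-δ') δ' ×ˢ Ioo 0 δ') := by
    intro δ' hδ' a ha
    obtain ⟨h1, h2, h3⟩ := hbd δ' hδ' a ha
    have h4 : ContinuousWithinAt z (Ioo (-δ') δ' ×ˢ Ioo 0 δ') a :=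
      (hzc a ⟨abs_lt.1 h1, h2.le, h3⟩).mono (prod_mono (Ioo_subset_Ioo (by linarith) hδ')
        fun x hx => ⟨hx.1.le, hx.2.trans_le hδ'⟩)
    exact (continuousAt_posArg (hzslit a.1 a.2 h1 h2 h3)).comp_continuousWithinAt h4
  have hpre : ∀ δ' : ℝ, IsPreconnected (Ioo (-δ') δ' ×ˢ Ioo 0 δ') := fun δ' =>
    isPreconnected_Ioo.prod isPreconnected_Ioo
  have htlim : ∀ u, |u| < δ → Tendsto (fun t => z (u, t)) (𝓝[>] 0) (𝓝 (z (u, 0))) := by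
    intro u hu
    have h1 := hzc (u, 0) ⟨abs_lt.1 hu, le_rfl, hδ⟩
    refine h1.tendsto.comp (tendsto_nhdsWithin_iff.2 ⟨?_, ?_⟩)
    · exact ((by fun_prop : Continuous fun t : ℝ => (u, t)).tendsto 0).mono_left nhdsWithin_le_nhds
    · filter_upwards [Ioo_mem_nhdsGT hδ] with t ht using ⟨abs_lt.1 hu, ht.1.le, ht.2⟩
  have hz0 : ∀ u, |u| < δ → z (u, 0) = e * W (c u) := fun u hu => by
    simp only [hz]; rw [hH.zero _ (hcL u (hu.le.trans hδ1))]
  have hsin : ∀ u, 0 < u → u < δ → 0 < sin (π / 2 * u) := fun u h0 h1 =>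
    sin_pos_of_pos_of_lt_pi (by positivity) (by nlinarith [hδ1])
  -- close to the first arc
  have hnearv : ∀ u, 0 < u → u < δ → ∀ η > 0, ∀ᶠ t in 𝓝[>] (0 : ℝ),
      (0 < (z (u, t)).im ∧ posArg (z (u, t)) < η) ∨ ((z (u, t)).im < 0 ∧ 2 * π - η < posArg (z (u, t))) := by
    intro u h0 h1 η hη
    have hu : |u| < δ := by rwa [abs_of_pos h0]
    have hzu : z (u, 0) = (sin (π / 2 * u) : ℝ) := by
      rw [hz0 u hu, hc, hW]
      simp only [if_pos h0.le]
      rw [(cpx_arcFrom i v u).2, mul_left_comm, hee, mul_one]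
    have hs := hsin u h0 h1
    have hl := htlim u hu
    have a1 : Tendsto (fun t => (z (u, t)).re) (𝓝[>] 0) (𝓝 (sin (π / 2 * u))) := by
      have := (Complex.continuous_re.tendsto _).comp hl
      rwa [hzu, Complex.ofReal_re] at this
    have a2 : Tendsto (fun t => |Complex.arg (z (u, t))|) (𝓝[>] 0) (𝓝 0) := by
      have h2 : z (u, 0) ∈ Complex.slitPlane := by
        rw [hzu]; exact Complex.ofReal_mem_slitPlane.2 hs
      have := ((Complex.continuousAt_arg h2).tendsto.comp hl).abs
      rwa [hzu, Complex.arg_ofReal_of_nonneg hs.le, abs_zero] at this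
    filter_upwards [a1.eventually_const_lt hs, a2.eventually_lt_const hη, Ioo_mem_nhdsGT hδ] with t h2 h3 h4
    exact posArg_near_pos (hzslit u t hu h4.1 h4.2) h2 h3
  -- close to the second arc
  have hnearw : ∀ u, 0 < u → u < δ → Tendsto (fun t => posArg (z (-u, t))) (𝓝[>] 0) (𝓝 t₀) := by
    intro u h0 h1
    have hu : |-u| < δ := by rwa [abs_neg, abs_of_pos h0]
    have hs := hsin u h0 h1
    have hzu : z (-u, 0) = (sin (π / 2 * u) : ℝ) * angExp (t₀ : Angle) := by
      rw [hz0 _ hu, hc, hW]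
      simp only [if_neg (by linarith : ¬ 0 ≤ -u), neg_neg]
      rw [(cpx_arcFrom i w u).2, hwt, angExp_add, mul_left_comm, ← mul_assoc e, hee, one_mul]
    have hval : posArg (z (-u, 0)) = t₀ := by
      rw [hzu, posArg, angExp_coe, ← mul_neg, Complex.arg_real_mul _ hs]
      have : -Complex.exp (t₀ * Complex.I) = Complex.exp ((t₀ - π : ℝ) * Complex.I) := by
        rw [Complex.ofReal_sub, sub_mul, Complex.exp_sub, Complex.exp_pi_mul_I]; ring
      rw [this, Complex.arg_exp_mul_I, (toIocMod_eq_self _).2 ⟨by linarith [ht₀.1], by linarith [ht₀.2]⟩]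
      ring
    have hsl : -z (-u, 0) ∈ Complex.slitPlane := by
      refine neg_mem_slitPlane fun s hs' hcon => ?_
      have h2 : angExp (t₀ : Angle) = angExp 0 := by
        have h3 := congrArg norm hcon
        rw [hzu, norm_mul, norm_angExp, mul_one, Complex.norm_real, Complex.norm_real,
          norm_of_nonneg hs.le, norm_of_nonneg hs'] at h3
        rw [hzu, h3] at hcon
        have h4 : (s : ℂ) ≠ 0 := by rw [← h3]; exact Complex.ofReal_ne_zero.2 hs.ne'
        rw [mul_right_eq_self₀.1 hcon |>.resolve_right h4]
        apply Complex.ext <;> simp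
      have h3 := angExp_injective h2
      rw [h3, add_zero] at hwt
      exact hne hwt.symm
    have := (continuousAt_posArg hsl).tendsto.comp (htlim (-u) hu)
    rwa [hval] at this
  -- the side of the second arc
  have hall : ∀ u t, |u| < δ → 0 < t → t < δ → posArg (z (u, t)) < t₀ := by
    by_contra hcon
    push Not at hcon
    obtain ⟨u1, t1, hu1, ht1, ht1', hge⟩ := hcon
    have hgt := lt_of_le_of_ne hge (hSne u1 t1 hu1 ht1 ht1').symm
    have hgtall : ∀ u t, |u| < δ → 0 < t → t < δ → t₀ < posArg (z (u, t)) := by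
      intro u t hu h0 h1
      by_contra hle
      have h2 := (hpre δ).intermediate_value (a := (u, t)) (b := (u1, t1)) ⟨abs_lt.1 hu, h0, h1⟩
        ⟨abs_lt.1 hu1, ht1, ht1'⟩ (hSc δ le_rfl) ⟨not_lt.1 hle, hgt.le⟩
      obtain ⟨a, ha, hae⟩ := h2
      obtain ⟨h3, h4, h5⟩ := hbd δ le_rfl a ha
      exact hSne a.1 a.2 h3 h4 h5 hae
    obtain ⟨κ, hκ, hdist⟩ := sector_distance ht₀
    have hlo := hA.def (show 0 < κ / 4 by positivity)
    obtain ⟨U, hU, hUF⟩ := mem_nhdsWithin_iff_exists_mem_nhds_inter.1 hlo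
    obtain ⟨δ₂, hδ₂, hδ₂1, hbx2⟩ := hbox U hU
    set δ' := min δ δ₂ with hδ'
    have hδ'0 : 0 < δ' := lt_min hδ hδ₂
    have hle : δ' ≤ δ := min_le_left _ _
    set m := t₀ / 2 + π with hm
    have hu : 0 < δ' / 2 ∧ δ' / 2 < δ' := ⟨by linarith, by linarith⟩
    obtain ⟨ta, hta, hta'⟩ := (((hnearw (δ' / 2) hu.1 (hu.2.trans_le hle)).eventually_lt_const
      (show t₀ < m by linarith [ht₀.2])).and (Ioo_mem_nhdsGT hδ'0)).exists
    obtain ⟨tb, htb, htb'⟩ := ((hnearv (δ' / 2) hu.1 (hu.2.trans_le hle) (min t₀ (2 * π - m))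
      (lt_min ht₀.1 (by linarith [ht₀.2]))).and (Ioo_mem_nhdsGT hδ'0)).exists
    have habs : |δ' / 2| < δ := by rw [abs_of_pos hu.1]; exact hu.2.trans_le hle
    have htb2 : m < posArg (z (δ' / 2, tb)) := by
      rcases htb with h | h
      · have := hgtall (δ' / 2) tb habs htb'.1 (htb'.2.trans_le hle)
        linarith [h.2, min_le_left t₀ (2 * π - m)]
      · linarith [h.2, min_le_right t₀ (2 * π - m)]
    obtain ⟨a, ha, hae⟩ := (hpre δ').intermediate_value (a := (-(δ' / 2), ta)) (b := (δ' / 2, tb))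
      ⟨⟨by linarith, by linarith⟩, hta'⟩ ⟨⟨by linarith, hu.2⟩, htb'⟩ (hSc δ' hle) ⟨hta.le, htb2.le⟩
    obtain ⟨h3, h4, h5⟩ := hbd δ' hle a ha
    set x := H (c a.1) a.2 with hx
    have hxF : x ∈ F := hHM a.1 a.2 h3 h4.le h5
    have hxU : x ∈ U := by
      obtain ⟨h6, h7⟩ := ha
      exact hbx2 a.1 a.2 ((abs_lt.2 h6).trans_le (min_le_right _ _)) h7.1.le (h7.2.trans_le (min_le_right _ _))
    have h6 : ‖Metric.infDist x D‖ ≤ κ / 4 * ‖dist x p‖ := hUF ⟨hxU, hxF⟩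
    rw [norm_of_nonneg Metric.infDist_nonneg, norm_of_nonneg dist_nonneg] at h6
    have h7 : dist x p ≤ 2 * ‖W x‖ := by
      have := hgraph x (hF hxF) p (hF (hLF hpL)) (by rw [← dist_eq_norm]; exact (hbx a.1 a.2 h3 h4.le h5).1)
        (by rw [← hp, sub_self, norm_zero]; exact hr)
      change _ ≤ 2 * ‖W x - W p‖ at this
      rwa [hWp, sub_zero, ← dist_eq_norm] at this
    have h8 : κ * ‖W x‖ ≤ Metric.infDist x D := by
      refine (Metric.le_infDist hD0).2 fun y hy => ?_
      obtain ⟨s, hs, b, hb, hWy⟩ := hD y hy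
      obtain ⟨s', hs', rfl⟩ := harc b hb
      have h9 := hdist (ang (!i) v) ‖W x‖ (norm_nonneg _) s hs s' hs'
      have h10 := hWS a
      have hae' : posArg (z a) = m := hae
      rw [hae', ← hx] at h10
      rw [← h10, ← hWy] at h9
      refine h9.trans ?_
      rw [dist_eq_norm]
      have := norm_cpx_le (!i) (x - y)
      rwa [map_sub] at this
    have h9 : 0 < ‖W x‖ := norm_pos_iff.2 (hWne a.1 a.2 h3 h4 h5)
    nlinarith [mul_le_mul_of_nonneg_left h7 (show 0 ≤ κ / 4 by positivity)]
  refine ⟨δ, hδ, fun u hu => ?_⟩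
  have hu' : |u| < δ := by rw [abs_of_pos hu.1]; exact hu.2
  have hu'' : |-u| < δ := by rwa [abs_neg]
  filter_upwards [hnearv u hu.1 hu.2 (2 * π - t₀) (by linarith [ht₀.2]),
    (hnearw u hu.1 hu.2).eventually_const_lt (show t₀ - π < t₀ by linarith), Ioo_mem_nhdsGT hδ] with t h1 h2 h3
  constructor
  · have e1 : side (!i) v (H (arcFrom i v u) t) = (z (u, t)).im := by
      simp only [hz, hc, if_pos hu.1.le]; rfl
    rw [e1]
    rcases h1 with h1 | h1
    · exact h1.1
    · have := hall u t hu' h3.1 h3.2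
      linarith [h1.2]
  · have e1 : arcFrom i w u = c (-u) := by
      simp only [hc, if_neg (by linarith [hu.1] : ¬ 0 ≤ -u), neg_neg]
    have e2 := hWS (-u, t)
    simp only at e2
    have e3 : ang (!i) v = ang (!i) w + ((-t₀ : ℝ) : Angle) := by
      rw [hwt, Angle.coe_neg]; abel
    have e4 : side (!i) w (H (arcFrom i w u) t) =
        ‖W (H (c (-u)) t)‖ * sin (posArg (z (-u, t)) - t₀) := by
      rw [side, e1]
      change ((starRingEnd ℂ) (angExp (ang (!i) w)) * W (H (c (-u)) t)).im = _
      rw [e2, e3, add_assoc, angExp_add, mul_left_comm, ← mul_assoc _ (angExp (ang (!i) w)),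
        conj_angExp_mul, one_mul, ← Angle.coe_add, Complex.im_ofReal_mul, angExp_im, Angle.sin_coe,
        norm_mul, Complex.norm_real, norm_norm, norm_mul, norm_angExp, norm_angExp, mul_one, mul_one,
        neg_add_eq_sub]
    rw [e4]
    refine mul_neg_of_pos_of_neg (norm_pos_iff.2 (hWne (-u) t hu'' h3.1 h3.2)) ?_
    have h4 := hall (-u) t hu'' h3.1 h3.2
    exact sin_neg_of_neg_of_neg_pi_lt (by linarith) (by linarith)

/-! ## The framing number in terms of the framing -/

section Framing

variable {R : Finset Torus}

open Classical in
/-- `1` if `v` is the smaller vertex of its edge in direction `i`, and `-1` otherwise. -/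
def role (f : DiagramFraming R) (i : Bool) (v : Torus) : ℝ :=
  if f.lt v (partner R i v) then 1 else -1

lemma role_sign (f : DiagramFraming R) (i : Bool) (v : Torus) : role f i v = 1 ∨ role f i v = -1 := by
  unfold role; split_ifs <;> simp

lemma lt_partner_or (hR : IsLinkDiagram R) (f : DiagramFraming R) (i : Bool) {v : Torus} (hv : v ∈ R) :
    (f.lt v (partner R i v) ∧ role f i v = 1) ∨ (f.lt (partner R i v) v ∧ role f i v = -1) := by
  rcases f.total (isEdge_partner hR i hv) with h | h
  · exact .inl ⟨h, if_pos h⟩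
  · exact .inr ⟨h, if_neg (f.asymm h)⟩

lemma role_partner (hR : IsLinkDiagram R) (f : DiagramFraming R) (i : Bool) {v : Torus} (hv : v ∈ R) :
    role f i (partner R i v) = -role f i v := by
  have hp := (partner_spec hR i hv).1
  have h2 := lt_partner_or hR f i hp
  rw [partner_partner hR i hv] at h2
  rcases lt_partner_or hR f i hv with ⟨h, e⟩ | ⟨h, e⟩ <;> rcases h2 with ⟨h', e'⟩ | ⟨h', e'⟩
  · exact absurd h' (f.asymm h)
  · rw [e, e']
  · rw [e, e', neg_neg]
  · exact absurd h' (f.asymm h)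

lemma sign_sq (ε : Torus → ℤˣ) (v : Torus) : ((ε v : ℤ) : ℝ) = 1 ∨ ((ε v : ℤ) : ℝ) = -1 := by
  rcases Int.units_eq_one_or (ε v) with h | h <;> simp [h]

lemma isEdgeSign_role (hR : IsLinkDiagram R) {ε : Torus → ℤˣ} (hε : IsOrientation R ε)
    (f : DiagramFraming R) (i : Bool) (c : ℝ) (hc : c = 1 ∨ c = -1) :
    IsEdgeSign R i fun v => c * (((ε v : ℤ) : ℝ) * role f i v) := by
  refine ⟨fun v => ?_, fun v hv => ?_⟩
  · rcases hc with rfl | rfl <;> rcases sign_sq ε v with h | h <;> rcases role_sign f i v with h' | h' <;>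
      simp [h, h']
  · rw [role_partner hR f i hv, sign_partner hR hε i hv]
    push_cast; ring

lemma circleArc_nonempty (a b : Angle) : a ∈ circleArc a b := by
  by_cases h : a = b
  · exact ⟨0, 0, le_rfl, le_rfl, by have := pi_pos; positivity, by simp, by simp [h]⟩
  · obtain ⟨t, ht, hb, -⟩ := exists_lift_of_ne h
    exact ⟨0, t, le_rfl, ht.1.le, ht.2, by simp, hb⟩

lemma edgeSector_spec (v w : Torus) (i : Bool) : (edgeSector v w).Nonempty ∧
    ∀ y ∈ edgeSector v w, ∃ s : ℝ, 0 ≤ s ∧ ∃ a ∈ circleArc (ang (!i) v) (ang (!i) w),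
      cpx (!i) y = s * angExp a := by
  refine ⟨⟨_, v.1, circleArc_nonempty _ _, v.2, circleArc_nonempty _ _, 0, ⟨le_rfl, zero_le_one⟩, rfl⟩, ?_⟩
  rintro y ⟨θ, hθ, φ, hφ, τ, hτ, rfl⟩
  obtain ⟨hC, hS⟩ := half_angle_nonneg hτ
  cases i
  · exact ⟨_, hS, θ, hθ, cpx_joinPoint_true _ _ _⟩
  · exact ⟨_, hC, φ, hφ, cpx_joinPoint_false _ _ _⟩

lemma IsAssociatedFraming.approachesAlong {f : DiagramFraming R} {F : Set E4}
    (h : IsAssociatedFraming f F) (i : Bool) {v w : Torus} (hlt : f.lt v w) (hi : ang i v = ang i w) :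
    ApproachesAlong F (edgeSector v w) (arcFrom i v 0) := by
  cases i
  · exact (h v w hlt).1 hi
  · have := (h v w hlt).2 hi
    simpa [arcFrom, vertexArc] using this

lemma arcFrom_partner (hR : IsLinkDiagram R) (i : Bool) {v : Torus} (hv : v ∈ R) :
    arcFrom i (partner R i v) 0 = arcFrom i v 0 := by
  cases i
  · exact vertexArc_partner_zero hR hv
  · simpa [arcFrom] using vertexArc_partner_one hR hv

lemma corner_role (hR : IsLinkDiagram R) {M F : Set E4} (hM : IsC1Surface M)
    (hMs : M ⊆ Metric.sphere (0 : E4) 1) (hF : F ⊆ M) {H : E4 → ℝ → E4}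
    (hH : IsCollar (linkOf R) F H)
    (ht : ∀ p ∈ linkOf R, tangentPlane F p = xiPlus p ∨ tangentPlane F p = xiMinus p)
    {f : DiagramFraming R} (hf : IsAssociatedFraming f F) (i : Bool) {v : Torus} (hv : v ∈ R) :
    ∃ u₀ > 0, ∀ u ∈ Ioo 0 u₀, ∀ᶠ t in 𝓝[>] (0 : ℝ), 0 < role f i v * side (!i) v (H (arcFrom i v u) t) := by
  have hp := partner_spec hR i hv
  have hne := ang_not_partner_ne hR i hv
  obtain ⟨σ, hσ, hσt⟩ : ∃ σ : ℝ, (σ = 1 ∨ σ = -1) ∧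
      tangentPlane F (arcFrom i v 0) = contactPlane σ (arcFrom i v 0) := by
    rcases ht _ (arcFrom_mem_linkOf hv i ⟨le_rfl, zero_le_one⟩) with h | h
    · exact ⟨1, .inl rfl, h⟩
    · exact ⟨-1, .inr rfl, h⟩
  rcases lt_partner_or hR f i hv with ⟨h, e⟩ | ⟨h, e⟩
  · obtain ⟨u₀, hu₀, hu⟩ := corner_side hM hMs hF hH hv hp.1 i hp.2.2.symm hne.symm hσ hσt
      (edgeSector_spec v (partner R i v) i).1 (edgeSector_spec v (partner R i v) i).2
      (hf.approachesAlong i h hp.2.2.symm)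
    refine ⟨u₀, hu₀, fun u huu => ?_⟩
    filter_upwards [hu u huu] with t ht
    rw [e, one_mul]
    exact ht.1
  · rw [← arcFrom_partner hR i hv] at hσt
    obtain ⟨u₀, hu₀, hu⟩ := corner_side hM hMs hF hH hp.1 hv i hp.2.2 hne hσ hσt
      (edgeSector_spec (partner R i v) v i).1 (edgeSector_spec (partner R i v) v i).2
      (hf.approachesAlong i h hp.2.2)
    refine ⟨u₀, hu₀, fun u huu => ?_⟩
    filter_upwards [hu u huu] with t ht
    rw [e, neg_one_mul, neg_pos]
    exact ht.2

/-- The sign of a tangential component of the collar is constant along an arc. -/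
lemma side_sign_propagates {F : Set E4} {H : E4 → ℝ → E4} (hH : IsCollar (linkOf R) F H) {v : Torus}
    (hv : v ∈ R) (j : Bool)
    (hne : ∀ τ ∈ Ioo (0 : ℝ) 1, ∀ᶠ x in 𝓝[F] (vertexArc v τ), x ∉ linkOf R → side j v x ≠ 0)
    {r : ℝ} (hr : r = 1 ∨ r = -1) {τ₀ : ℝ} (hτ₀ : τ₀ ∈ Ioo (0 : ℝ) 1)
    (h0 : ∀ᶠ t in 𝓝[>] (0 : ℝ), 0 < r * side j v (H (vertexArc v τ₀) t)) :
    ∀ τ ∈ Ioo (0 : ℝ) 1, ∀ᶠ t in 𝓝[>] (0 : ℝ), 0 < r * side j v (H (vertexArc v τ) t) := by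
  set U : ℝ → Set ℝ := fun s => {τ | τ ∈ Ioo (0 : ℝ) 1 ∧ ∀ᶠ t in 𝓝[>] (0 : ℝ), 0 < s * side j v (H (vertexArc v τ) t)}
  have hloc : ∀ τ ∈ Ioo (0 : ℝ) 1, U 1 ∈ 𝓝 τ ∨ U (-1) ∈ 𝓝 τ := by
    intro τ hτ
    obtain ⟨V, hV, hVF⟩ := mem_nhdsWithin_iff_exists_mem_nhds_inter.1 (hne τ hτ)
    have hcon : ContinuousOn (fun z : ℝ × ℝ => H (vertexArc v z.1) z.2) (Ioo 0 1 ×ˢ Icc 0 1) :=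
      hH.continuousOn.comp (f := fun z : ℝ × ℝ => (vertexArc v z.1, z.2))
        (by have := continuous_vertexArc v; fun_prop)
        fun z hz => ⟨vertexArc_mem_linkOf hv (Ioo_subset_Icc_self hz.1), hz.2⟩
    have hmem : vertexArc v τ ∈ linkOf R := vertexArc_mem_linkOf hv (Ioo_subset_Icc_self hτ)
    have h1 : H (vertexArc v τ) 0 = vertexArc v τ := hH.zero _ hmem
    have h2 := hcon (τ, 0) ⟨hτ, le_rfl, zero_le_one⟩
    rw [ContinuousWithinAt] at h2
    simp only [h1] at h2
    obtain ⟨δ, hδ, hb⟩ := Metric.mem_nhdsWithin_iff.1 (h2 hV)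
    obtain ⟨δ', hδ', hb'⟩ := Metric.isOpen_iff.1 isOpen_Ioo τ hτ
    set d := min δ (min δ' 1)
    have hd : 0 < d := by positivity
    have hdδ : d ≤ δ := min_le_left _ _
    have hdδ' : d ≤ δ' := (min_le_right _ _).trans (min_le_left _ _)
    have hd1 : d ≤ 1 := (min_le_right _ _).trans (min_le_right _ _)
    set E : Set (ℝ × ℝ) := Ioo (τ - d) (τ + d) ×ˢ Ioo 0 d
    have hEsub : E ⊆ Ioo 0 1 ×ˢ Icc 0 1 := by
      rintro ⟨a, t⟩ ⟨ha, ht⟩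
      refine ⟨hb' ?_, ht.1.le, ht.2.le.trans hd1⟩
      rw [ball_eq_Ioo]
      exact ⟨by linarith [ha.1], by linarith [ha.2]⟩
    have hEne : ∀ z ∈ E, side j v (H (vertexArc v z.1) z.2) ≠ 0 := by
      rintro ⟨a, t⟩ hz
      have hz' := hEsub hz
      have haL : vertexArc v a ∈ linkOf R := vertexArc_mem_linkOf hv (Ioo_subset_Icc_self hz'.1)
      refine hVF ⟨hb ⟨?_, hz'⟩, hH.subset ⟨(vertexArc v a, t), ⟨haL, hz'.2⟩, rfl⟩⟩ fun hcon =>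
        hz.2.1.ne' (hH.eq_zero_of_mem haL hz'.2 hcon)
      rw [Metric.mem_ball, Prod.dist_eq, dist_eq, dist_eq, sub_zero, abs_of_pos hz.2.1]
      refine max_lt (abs_lt.2 ⟨?_, ?_⟩) (hz.2.2.trans_le hdδ)
      · linarith [hz.1.1]
      · linarith [hz.1.2]
    have hEc : ContinuousOn (fun z : ℝ × ℝ => side j v (H (vertexArc v z.1) z.2)) E :=
      (continuous_side j v).comp_continuousOn (hcon.mono hEsub)
    have hpre : IsPreconnected E := isPreconnected_Ioo.prod isPreconnected_Ioo
    have hsign : ∀ s : ℝ, (∀ z ∈ E, 0 < s * side j v (H (vertexArc v z.1) z.2)) → U s ∈ 𝓝 τ := by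
      intro s hs
      filter_upwards [Ioo_mem_nhds (show τ - d < τ by linarith) (show τ < τ + d by linarith)] with a ha
      refine ⟨(hEsub (a := (a, d / 2)) ⟨ha, by constructor <;> linarith⟩).1, ?_⟩
      filter_upwards [Ioo_mem_nhdsGT hd] with t ht using hs (a, t) ⟨ha, ht⟩
    by_cases hpos : ∀ z ∈ E, 0 < side j v (H (vertexArc v z.1) z.2)
    · exact .inl (hsign 1 fun z hz => by rw [one_mul]; exact hpos z hz)
    · refine .inr (hsign (-1) fun z hz => ?_)
      rw [neg_one_mul, neg_pos]
      by_contra hcon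
      push Not at hpos
      obtain ⟨z', hz', hle⟩ := hpos
      obtain ⟨y, hy, hy0⟩ := hpre.intermediate_value hz' hz hEc ⟨hle, not_lt.1 hcon⟩
      exact hEne y hy hy0
  have hdisj : ∀ τ, τ ∈ U 1 → τ ∈ U (-1) → False := by
    rintro τ ⟨_, h1⟩ ⟨_, h2⟩
    obtain ⟨t, h3, h4⟩ := (h1.and h2).exists
    linarith
  have key : ∀ s : ℝ, (s = 1 ∨ s = -1) → τ₀ ∈ U s → ∀ τ ∈ Ioo (0 : ℝ) 1, τ ∈ U s := by
    intro s hs hτs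
    have hlocs : ∀ τ ∈ Ioo (0 : ℝ) 1, U s ∈ 𝓝 τ ∨ U (-s) ∈ 𝓝 τ := by
      rcases hs with rfl | rfl
      · exact hloc
      · intro τ hτ; rw [neg_neg]; exact (hloc τ hτ).symm
    have hds : ∀ τ, τ ∈ U s → τ ∈ U (-s) → False := by
      rcases hs with rfl | rfl
      · exact hdisj
      · intro τ h1 h2; rw [neg_neg] at h2; exact hdisj τ h2 h1
    by_contra hcon
    push Not at hcon
    obtain ⟨τ, hτ, hτn⟩ := hcon
    have h1 := (hlocs τ hτ).resolve_left fun h => hτn (mem_of_mem_nhds h)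
    obtain ⟨y, hy, hy1, hy2⟩ := (isPreconnected_Ioo (a := (0 : ℝ)) (b := 1)) (interior (U s)) (interior (U (-s)))
      isOpen_interior isOpen_interior
      (fun a ha => (hlocs a ha).imp mem_interior_iff_mem_nhds.2 mem_interior_iff_mem_nhds.2)
      ⟨τ₀, hτ₀, mem_interior_iff_mem_nhds.2 ((hlocs τ₀ hτ₀).resolve_right fun h =>
        hds τ₀ hτs (mem_of_mem_nhds h))⟩
      ⟨τ, hτ, mem_interior_iff_mem_nhds.2 h1⟩
    exact hds y (interior_subset hy1) (interior_subset hy2)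
  exact fun τ hτ => (key r hr ⟨hτ₀, h0⟩ τ hτ).2

lemma contactPlane_endpoint {σ σ' : ℝ} (hσ : σ = 1 ∨ σ = -1) (hσ' : σ' = 1 ∨ σ' = -1) (v : Torus) {τ : ℝ}
    (hτ : τ = 0 ∨ τ = 1) : contactPlane σ (vertexArc v τ) = contactPlane σ' (vertexArc v τ) := by
  ext w
  rw [mem_contactPlane, mem_contactPlane, contactForm_vertexArc, contactForm_vertexArc]
  rcases hτ with rfl | rfl
  · simp
  · rcases hσ with rfl | rfl <;> rcases hσ' with rfl | rfl <;> simp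

/-- Along every arc, the surface is tangent to the contact structure determined by the framing. -/
lemma tangentPlane_eq_of_framing (hR : IsLinkDiagram R) {M F : Set E4} (hM : IsC1Surface M)
    (hMs : M ⊆ Metric.sphere (0 : E4) 1) (hF : F ⊆ M) {H : E4 → ℝ → E4}
    (hH : IsCollar (linkOf R) F H)
    (ht : ∀ p ∈ linkOf R, tangentPlane F p = xiPlus p ∨ tangentPlane F p = xiMinus p)
    {f : DiagramFraming R} (hf : IsAssociatedFraming f F) {v : Torus} (hv : v ∈ R) {τ : ℝ}
    (hτ : τ ∈ Icc (0 : ℝ) 1) :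
    tangentPlane F (vertexArc v τ) = contactPlane (-(role f false v * role f true v)) (vertexArc v τ) := by
  have hLF : linkOf R ⊆ F := fun q hq => hH.subset ⟨(q, 0), ⟨hq, le_rfl, zero_le_one⟩, hH.zero q hq⟩
  have hrole : -(role f false v * role f true v) = 1 ∨ -(role f false v * role f true v) = -1 := by
    rcases role_sign f false v with h | h <;> rcases role_sign f true v with h' | h' <;> simp [h, h']
  have hex : ∀ τ ∈ Icc (0 : ℝ) 1, ∃ σ : ℝ, (σ = 1 ∨ σ = -1) ∧
      tangentPlane F (vertexArc v τ) = contactPlane σ (vertexArc v τ) := by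
    intro τ hτ
    rcases ht _ (vertexArc_mem_linkOf hv hτ) with h | h
    · exact ⟨1, .inl rfl, h⟩
    · exact ⟨-1, .inr rfl, h⟩
  obtain ⟨σ, hσ, hσt⟩ := hex τ hτ
  rw [hσt]
  by_cases hend : τ = 0 ∨ τ = 1
  · exact contactPlane_endpoint hσ hrole v hend
  push Not at hend
  have hτ' : τ ∈ Ioo (0 : ℝ) 1 := ⟨hτ.1.lt_of_ne' hend.1, hτ.2.lt_of_ne hend.2⟩
  have hne : ∀ j, ∀ τ ∈ Ioo (0 : ℝ) 1, ∀ᶠ x in 𝓝[F] (vertexArc v τ), x ∉ linkOf R → side j v x ≠ 0 := by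
    intro j τ hτ
    obtain ⟨σ, hσ, hσt⟩ := hex τ (Ioo_subset_Icc_self hτ)
    filter_upwards [eventually_side_mul_neg hM hMs hF hLF hv hτ hσ hσt] with x hx hxL h0
    have := hx hxL
    cases j <;> rw [h0] at this <;> simp at this
  have hsgn : ∀ i, ∀ᶠ t in 𝓝[>] (0 : ℝ), 0 < role f i v * side (!i) v (H (vertexArc v τ) t) := by
    intro i
    obtain ⟨u₀, hu₀, hu⟩ := corner_role hR hM hMs hF hH ht hf i hv
    set u := min (u₀ / 2) (1 / 2)
    have hu1 : 0 < u := by positivity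
    have hu2 : u < u₀ := (min_le_left _ _).trans_lt (half_lt_self hu₀)
    have hu3 : u < 1 := (min_le_right _ _).trans_lt (by norm_num)
    refine side_sign_propagates hH hv (!i) (hne (!i)) (role_sign f i v)
      (τ₀ := if i then 1 - u else u) ?_ (hu u ⟨hu1, hu2⟩) τ hτ'
    cases i
    · exact ⟨hu1, hu3⟩
    · exact ⟨by simp [hu3], by simp [hu1]⟩
  have hev := eventually_side_mul_neg hM hMs hF hLF hv hτ' hσ hσt
  have hpL : vertexArc v τ ∈ linkOf R := vertexArc_mem_linkOf hv hτ
  have hto : Tendsto (fun t => H (vertexArc v τ) t) (𝓝[>] 0) (𝓝[F] (vertexArc v τ)) := by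
    refine tendsto_nhdsWithin_iff.2 ⟨?_, ?_⟩
    · have h1 := hH.continuousOn (vertexArc v τ, 0) ⟨hpL, le_rfl, zero_le_one⟩
      rw [ContinuousWithinAt, Function.uncurry_apply_pair, hH.zero _ hpL] at h1
      refine h1.comp (f := fun t => (vertexArc v τ, t)) (tendsto_nhdsWithin_iff.2 ⟨?_, ?_⟩)
      · exact ((by fun_prop : Continuous fun t : ℝ => (vertexArc v τ, t)).tendsto 0).mono_left nhdsWithin_le_nhds
      · filter_upwards [Ioo_mem_nhdsGT (zero_lt_one (α := ℝ))] with t ht using ⟨hpL, ht.1.le, ht.2.le⟩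
    · filter_upwards [Ioo_mem_nhdsGT (zero_lt_one (α := ℝ))] with t ht
      exact hH.subset ⟨(vertexArc v τ, t), ⟨hpL, ht.1.le, ht.2.le⟩, rfl⟩
  obtain ⟨t, ⟨⟨h0, h1⟩, h2⟩, h3⟩ := (((hsgn false).and (hsgn true)).and (hto.eventually hev) |>.and
    (Ioo_mem_nhdsGT (zero_lt_one (α := ℝ)))).exists
  have h4 := h2 fun hcon => h3.1.ne' (hH.eq_zero_of_mem hpL ⟨h3.1.le, h3.2.le⟩ hcon)
  simp only [Bool.not_false, Bool.not_true] at h0 h1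
  have h5 := mul_pos h0 h1
  congr 1
  rcases hσ with rfl | rfl <;> rcases role_sign f false v with h | h <;>
    rcases role_sign f true v with h' | h' <;> rw [h, h'] at h5 ⊢ <;> norm_num <;> nlinarith

theorem IsFramingNumber.eq (hR : IsLinkDiagram R) {ε : Torus → ℤˣ} (hε : IsOrientation R ε)
    {f : DiagramFraming R} {x : ℝ} (h : IsFramingNumber R ε f x) :
    x = meanLk R ε + 1 / 4 * ∑ v ∈ R, role f false v * role f true v := by
  obtain ⟨F, H, hFH, ht, hf, rfl⟩ := h
  obtain ⟨M, hM, hMs, hF, -⟩ := hFH.corners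
  rw [pushOffLk_eq hR hε hM hMs hF hFH.collar (isEdgeSign_role hR hε f false 1 (.inl rfl))
    (isEdgeSign_role hR hε f true (-1) (.inr rfl)) ?_ (fun _ _ => rfl) hFH.piecewiseC1]
  · rw [sub_eq_add_neg, ← mul_neg, ← Finset.sum_neg_distrib]
    congr 2
    refine Finset.sum_congr rfl fun v _ => ?_
    rcases sign_sq ε v with h | h <;> rw [h] <;> ring
  · intro v hv τ hτ
    rw [tangentPlane_eq_of_framing hR hM hMs hF hFH.collar ht hf hv hτ]
    congr 1
    rcases sign_sq ε v with h | h <;> rw [h] <;> ring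

lemma sum_role_mem (hR : IsLinkDiagram R) {ε : Torus → ℤˣ} (hε : IsOrientation R ε) (f : DiagramFraming R) :
    ∃ n : ℤ, meanLk R ε + 1 / 4 * ∑ v ∈ R, role f false v * role f true v = n ∧
      tbPlus R ε ≤ n ∧ (n : ℝ) ≤ -tbMinus R ε := by
  obtain ⟨n, hn⟩ := shiftedLk_int hR hε (smallShift_spec R) (isEdgeSign_role hR hε f false 1 (.inl rfl))
    (isEdgeSign_role hR hε f true (-1) (.inr rfl))
  rw [shiftedLk_eq hR hε (smallShift_spec R) (isEdgeSign_role hR hε f false 1 (.inl rfl))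
    (isEdgeSign_role hR hε f true (-1) (.inr rfl))] at hn
  have e : meanLk R ε + 1 / 4 * ∑ v ∈ R, role f false v * role f true v = n := by
    rw [← hn, sub_eq_add_neg, ← mul_neg, ← Finset.sum_neg_distrib]
    congr 2
    refine Finset.sum_congr rfl fun v _ => ?_
    rcases sign_sq ε v with h | h <;> rw [h] <;> ring
  have hab : |∑ v ∈ R, role f false v * role f true v| ≤ R.card := by
    refine (Finset.abs_sum_le_sum_abs _ _).trans ?_
    refine (Finset.sum_le_card_nsmul _ _ 1 fun v _ => ?_).trans (by simp)
    rcases role_sign f false v with h | h <;> rcases role_sign f true v with h' | h' <;> simp [h, h']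
  refine ⟨n, e, ?_, ?_⟩
  · rw [tbPlus_eq hR hε]; linarith [(abs_le.1 hab).1]
  · rw [neg_tbMinus_eq hR hε]; linarith [(abs_le.1 hab).2]

lemma exists_framing_sum_role (hR : IsLinkDiagram R) {ε : Torus → ℤˣ} (hε : IsOrientation R ε) {n : ℤ}
    (h1 : tbPlus R ε ≤ n) (h2 : (n : ℝ) ≤ -tbMinus R ε) :
    ∃ f : DiagramFraming R, meanLk R ε + 1 / 4 * ∑ v ∈ R, role f false v * role f true v = n := by
  classical
  obtain ⟨m, hm⟩ := tbPlus_int hR hε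
  set P : Finset Torus := R.filter fun v => ε v = 1 with hP
  have hcard : (P.card : ℝ) = R.card / 2 := by
    have h := sum_sign_smul_ang hR hε true (fun _ => (1 : ℝ))
    have h3 : ∀ v ∈ R, (((ε v : ℤ) : ℝ)) • (1 : ℝ) = 2 * (if ε v = 1 then 1 else 0) - 1 := by
      intro v _
      rcases Int.units_eq_one_or (ε v) with h | h <;> simp [h]
      norm_num
    rw [Finset.sum_congr rfl h3, Finset.sum_sub_distrib, ← Finset.mul_sum, Finset.sum_boole] at h
    simp at h
    rw [hP]; linarith
  rw [hm] at h1
  have h1' : m ≤ n := by exact_mod_cast h1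
  obtain ⟨k, hk⟩ := Int.eq_ofNat_of_zero_le (sub_nonneg.2 h1')
  have hkr : (n : ℝ) = m + k := by
    have : n = m + k := by omega
    rw [this]; push_cast; ring
  have e1 := tbPlus_eq hR hε
  rw [hm] at e1
  have hkP : k ≤ P.card := by
    rw [neg_tbMinus_eq hR hε, hkr] at h2
    have : (k : ℝ) ≤ P.card := by rw [hcard]; linarith
    exact_mod_cast this
  obtain ⟨S, hSP, hSk⟩ := Finset.exists_subset_card_eq hkP
  have hSR : S ⊆ R := hSP.trans (Finset.filter_subset _ _)
  have hsg : ∀ v w, IsEdge R v w → ε w = -ε v := by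
    intro v w h
    obtain ⟨hv, i, rfl⟩ := (isEdge_iff_partner hR).1 h
    exact sign_partner hR hε i hv
  have hsymm : ∀ v w, IsEdge R v w → IsEdge R w v := fun v w h =>
    ⟨h.2.1, h.1, h.2.2.1.symm, h.2.2.2.imp Eq.symm Eq.symm⟩
  have hone : ∀ v, ε v ≠ 1 ↔ ε v = -1 := fun v => by
    rcases Int.units_eq_one_or (ε v) with h | h <;> simp [h]
  let f : DiagramFraming R :=
    { lt := fun v w => IsEdge R v w ∧
        if v.1 = w.1 ∧ v ∉ S ∧ w ∉ S then ε v = 1 else ε w = 1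
      isEdge := fun h => h.1
      total := by
        intro v w h
        have hs := hsg v w h
        have c : (v.1 = w.1 ∧ v ∉ S ∧ w ∉ S) ↔ (w.1 = v.1 ∧ w ∉ S ∧ v ∉ S) := by tauto
        by_cases hc : v.1 = w.1 ∧ v ∉ S ∧ w ∉ S
        · simp only [if_pos hc, if_pos (c.1 hc), h, hsymm _ _ h, true_and]
          rcases Int.units_eq_one_or (ε v) with h' | h' <;> simp [hs, h']
        · simp only [if_neg hc, if_neg (fun h => hc (c.2 h)), h, hsymm _ _ h, true_and]
          rcases Int.units_eq_one_or (ε v) with h' | h' <;> simp [hs, h']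
      asymm := by
        rintro v w ⟨h, hvw⟩ ⟨-, hwv⟩
        have hs := hsg v w h
        have c : (v.1 = w.1 ∧ v ∉ S ∧ w ∉ S) ↔ (w.1 = v.1 ∧ w ∉ S ∧ v ∉ S) := by tauto
        by_cases hc : v.1 = w.1 ∧ v ∉ S ∧ w ∉ S
        · simp only [if_pos hc, if_pos (c.1 hc)] at hvw hwv
          rw [hvw, hwv] at hs; exact absurd hs (by decide)
        · simp only [if_neg hc, if_neg (fun h => hc (c.2 h))] at hvw hwv
          rw [hvw, hwv] at hs; exact absurd hs (by decide) }
  refine ⟨f, ?_⟩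
  have r0 : ∀ v ∈ R, role f false v = -((ε v : ℤ) : ℝ) := by
    intro v hv
    have hE := isEdge_partner hR false hv
    have hne : v.1 ≠ (partner R false v).1 := (ang_not_partner_ne hR false hv).symm
    have e : f.lt v (partner R false v) ↔ ε v = -1 := by
      change (_ ∧ _) ↔ _
      rw [if_neg (fun h => hne h.1), hsg _ _ hE]
      rcases Int.units_eq_one_or (ε v) with h | h <;> simp [hE, h]
    rw [role]
    simp only [e]
    rcases Int.units_eq_one_or (ε v) with h | h <;> simp [h]
  have r1 : ∀ v ∈ R, role f true v = ((ε v : ℤ) : ℝ) * (if v ∈ S ∨ partner R true v ∈ S then -1 else 1) := by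
    intro v hv
    have hE := isEdge_partner hR true hv
    have heq : v.1 = (partner R true v).1 := (partner_spec hR true hv).2.2.symm
    by_cases hS : v ∈ S ∨ partner R true v ∈ S
    · have e : f.lt v (partner R true v) ↔ ε v = -1 := by
        change (_ ∧ _) ↔ _
        rw [if_neg (fun h => by tauto), hsg _ _ hE]
        rcases Int.units_eq_one_or (ε v) with h | h <;> simp [hE, h]
      rw [role, if_pos hS]
      simp only [e]
      rcases Int.units_eq_one_or (ε v) with h | h <;> simp [h]
    · have e : f.lt v (partner R true v) ↔ ε v = 1 := by
        change (_ ∧ _) ↔ _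
        rw [if_pos ⟨heq, by tauto, by tauto⟩]
        simp [hE]
      rw [role, if_neg hS]
      simp only [e]
      rcases Int.units_eq_one_or (ε v) with h | h <;> simp [h]
  have hprod : ∀ v ∈ R, role f false v * role f true v =
      2 * ((if v ∈ S then 1 else 0) + (if partner R true v ∈ S then 1 else 0)) - 1 := by
    intro v hv
    rw [r0 v hv, r1 v hv]
    have hex : ¬ (v ∈ S ∧ partner R true v ∈ S) := by
      rintro ⟨a, b⟩
      have a' := (Finset.mem_filter.1 (hSP a)).2
      have b' := (Finset.mem_filter.1 (hSP b)).2
      rw [sign_partner hR hε true hv, a'] at b'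
      exact absurd b' (by decide)
    by_cases a : v ∈ S <;> by_cases b : partner R true v ∈ S
    · exact absurd ⟨a, b⟩ hex
    all_goals rcases sign_sq ε v with h | h <;> simp [a, b, h] <;> norm_num
  have c1 : ∑ v ∈ R, (if v ∈ S then (1 : ℝ) else 0) = k := by
    rw [Finset.sum_boole, Finset.filter_mem_eq_inter, Finset.inter_eq_right.2 hSR, hSk]
  have c2 : ∑ v ∈ R, (if partner R true v ∈ S then (1 : ℝ) else 0) = k := by
    rw [← c1]
    exact Finset.sum_bij' (fun v _ => partner R true v) (fun v _ => partner R true v)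
      (fun v hv => (partner_spec hR true hv).1) (fun v hv => (partner_spec hR true hv).1)
      (fun v hv => partner_partner hR true hv) (fun v hv => partner_partner hR true hv) (fun v hv => rfl)
  rw [Finset.sum_congr rfl hprod, Finset.sum_sub_distrib, ← Finset.mul_sum, Finset.sum_add_distrib, c1, c2, hkr]
  simp
  linarith

end Framing

/-! ## The profile of a band -/

/-- A smooth step from `0` on `(-∞, 1/3]` to `1` on `[2/3, ∞)`. -/
def middleStep (x : ℝ) : ℝ := smoothTransition (3 * x - 1)

lemma contDiff_middleStep : ContDiff ℝ ∞ middleStep :=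
  smoothTransition.contDiff.comp (by fun_prop)

lemma middleStep_nonneg (x : ℝ) : 0 ≤ middleStep x := smoothTransition.nonneg _
lemma middleStep_le_one (x : ℝ) : middleStep x ≤ 1 := smoothTransition.le_one _
lemma middleStep_eq_zero {x : ℝ} (h : x ≤ 1 / 3) : middleStep x = 0 :=
  smoothTransition.zero_of_nonpos (by linarith)
lemma middleStep_eq_one {x : ℝ} (h : 2 / 3 ≤ x) : middleStep x = 1 :=
  smoothTransition.one_of_one_le (by linarith)
lemma middleStep_pos {x : ℝ} (h : 1 / 3 < x) : 0 < middleStep x :=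
  smoothTransition.pos_of_pos (by linarith)

/-- The squared radius of a point of the band, in terms of the parameter `s` of the arc and the
distance `Y` from it. -/
def kap (s Y : ℝ) : ℝ := (1 - 2 * Y ^ 2) * sin (π / 2 * s) ^ 2 + Y ^ 2

lemma kap_one_sub (s Y : ℝ) : kap (1 - s) Y = 1 - kap s Y := by
  have : sin (π / 2 * (1 - s)) = cos (π / 2 * s) := by
    rw [← sin_pi_div_two_sub]; ring_nf
  rw [kap, kap, this, cos_sq']; ring

lemma contDiff_kap (Y : ℝ) : ContDiff ℝ ∞ fun s => kap s Y := by
  unfold kap; fun_prop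

lemma continuous_kap : Continuous fun q : ℝ × ℝ => kap q.1 q.2 := by
  unfold kap; fun_prop

lemma sq_le_kap {Y : ℝ} (hY : 2 * Y ^ 2 ≤ 1) (s : ℝ) : Y ^ 2 ≤ kap s Y := by
  have := mul_nonneg (sub_nonneg.2 hY) (sq_nonneg (sin (π / 2 * s)))
  rw [kap]; linarith

lemma kap_le {Y : ℝ} (hY : 2 * Y ^ 2 ≤ 1) (s : ℝ) : kap s Y ≤ 1 - Y ^ 2 := by
  have := sq_le_kap hY (1 - s)
  rw [kap_one_sub] at this; linarith

lemma exists_kap_eq {Y κ : ℝ} (h0 : Y ^ 2 ≤ κ) (h1 : κ ≤ 1 - Y ^ 2) (hY : 2 * Y ^ 2 < 1) :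
    ∃ s ∈ Icc (0 : ℝ) 1, kap s Y = κ := by
  have hc : ContinuousOn (fun s => kap s Y) (Icc 0 1) := (contDiff_kap Y).continuous.continuousOn
  refine intermediate_value_Icc zero_le_one hc ⟨?_, ?_⟩ <;> simp [kap] <;> linarith

lemma kap_lt_kap {Y : ℝ} (hY : 2 * Y ^ 2 < 1) {s s' : ℝ} (hs : 0 ≤ s) (hss : s < s') (hs' : s' ≤ 1) :
    kap s Y < kap s' Y := by
  have hp := pi_pos
  have h1 : sin (π / 2 * s) < sin (π / 2 * s') :=
    sin_lt_sin_of_lt_of_le_pi_div_two (by nlinarith) (by nlinarith) (by nlinarith)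
  have h2 : 0 ≤ sin (π / 2 * s) := sin_nonneg_of_nonneg_of_le_pi (by nlinarith) (by nlinarith)
  have h3 := pow_lt_pow_left₀ h1 h2 two_ne_zero
  have : 0 < 1 - 2 * Y ^ 2 := by linarith
  rw [kap, kap]
  nlinarith [mul_lt_mul_of_pos_left h3 this]

lemma kap_injOn {Y : ℝ} (hY : 2 * Y ^ 2 < 1) : InjOn (fun s => kap s Y) (Icc 0 1) :=
  StrictMonoOn.injOn fun _ hs _ hs' h => kap_lt_kap hY hs.1 h hs'.2

/-- The height of the band over the core arc, where `a` and `b` are the angles of the sectors at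
its ends, divided by `π`. -/
def bandHeight (a b κ Y : ℝ) : ℝ :=
  middleStep (1 - κ) * (κ * (a * arcsin (Y / √κ))) +
    middleStep κ * ((1 - κ) * (b * arcsin (Y / √(1 - κ))))

lemma bandHeight_swap (a b κ Y : ℝ) : bandHeight b a (1 - κ) Y = bandHeight a b κ Y := by
  rw [bandHeight, bandHeight, sub_sub_cancel, add_comm]

@[simp] lemma bandHeight_zero (a b κ : ℝ) : bandHeight a b κ 0 = 0 := by simp [bandHeight]

lemma bandHeight_of_le {a b κ Y : ℝ} (h : κ ≤ 1 / 3) :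
    bandHeight a b κ Y = κ * (a * arcsin (Y / √κ)) := by
  rw [bandHeight, middleStep_eq_zero h, middleStep_eq_one (by linarith)]; ring

lemma continuous_bandHeight_right (a b κ : ℝ) : Continuous (bandHeight a b κ) := by
  unfold bandHeight; fun_prop

lemma arcsin_le_mul {x : ℝ} (h0 : 0 ≤ x) (h1 : x ≤ 1) : arcsin x ≤ π / 2 * x := by
  have h2 := mul_le_sin (arcsin_nonneg.2 h0) (arcsin_le_pi_div_two x)
  rw [sin_arcsin (by linarith) h1] at h2
  have : π / 2 * (2 / π * arcsin x) ≤ π / 2 * x := by gcongr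
  have e : π / 2 * (2 / π * arcsin x) = arcsin x := by field_simp
  linarith

lemma mul_arcsin_le {κ Y : ℝ} (h1 : κ ≤ 1) (hY : 0 ≤ Y) (hYκ : Y ^ 2 ≤ κ) :
    κ * arcsin (Y / √κ) ≤ π / 2 * Y := by
  have h0 : 0 ≤ κ := (sq_nonneg Y).trans hYκ
  rcases h0.eq_or_lt with rfl | h
  · simpa using by positivity
  have hs : 0 < √κ := sqrt_pos.2 h
  have h2 : arcsin (Y / √κ) ≤ π / 2 * (Y / √κ) :=
    arcsin_le_mul (by positivity) ((div_le_one hs).2 (le_sqrt_of_sq_le hYκ))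
  have h3 : κ * (π / 2 * (Y / √κ)) = √κ * (π / 2 * Y) := by
    nth_rewrite 1 [← mul_self_sqrt h0]; field_simp
  have h4 : √κ ≤ 1 := sqrt_le_one.2 h1
  have h5 : 0 ≤ π / 2 * Y := by have := pi_pos; positivity
  nlinarith [mul_le_mul_of_nonneg_left h2 h0, mul_le_mul_of_nonneg_right h4 h5]

section
variable {a b : ℝ} (ha : 0 < a) (hb : 0 < b)
include ha hb

lemma bandHeight_nonneg {κ Y : ℝ} (h0 : 0 ≤ κ) (h1 : κ ≤ 1) (hY : 0 ≤ Y) : 0 ≤ bandHeight a b κ Y := by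
  have h2 := arcsin_nonneg.2 (div_nonneg hY (sqrt_nonneg κ))
  have h3 := arcsin_nonneg.2 (div_nonneg hY (sqrt_nonneg (1 - κ)))
  have h4 := middleStep_nonneg κ
  have h5 := middleStep_nonneg (1 - κ)
  unfold bandHeight; positivity

lemma bandHeight_le (ha2 : a ≤ 2) (hb2 : b ≤ 2) {κ Y : ℝ} (hY : 0 ≤ Y) (h0 : Y ^ 2 ≤ κ)
    (h1 : κ ≤ 1 - Y ^ 2) : bandHeight a b κ Y ≤ 2 * π * Y := by
  have h2 := mul_arcsin_le (by nlinarith) hY h0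
  have h3 := mul_arcsin_le (κ := 1 - κ) (by nlinarith) hY (by linarith)
  have h5 : 0 ≤ κ * arcsin (Y / √κ) :=
    mul_nonneg (by nlinarith) (arcsin_nonneg.2 (by positivity))
  have h6 : 0 ≤ (1 - κ) * arcsin (Y / √(1 - κ)) :=
    mul_nonneg (by nlinarith) (arcsin_nonneg.2 (by positivity))
  have h7 : middleStep (1 - κ) * (κ * (a * arcsin (Y / √κ))) ≤ 1 * (2 * (π / 2 * Y)) := by
    refine mul_le_mul (middleStep_le_one _) ?_ (by nlinarith) zero_le_one
    nlinarith
  have h8 : middleStep κ * ((1 - κ) * (b * arcsin (Y / √(1 - κ)))) ≤ 1 * (2 * (π / 2 * Y)) := by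
    refine mul_le_mul (middleStep_le_one _) ?_ (by nlinarith) zero_le_one
    nlinarith
  unfold bandHeight; linarith

lemma bandHeight_lt {κ Y Y' : ℝ} (h0 : 0 < κ) (h1 : κ < 1) (hY : 0 ≤ Y) (hYY : Y < Y')
    (h2 : Y ^ 2 < κ) (h3 : Y ^ 2 < 1 - κ) : bandHeight a b κ Y < bandHeight a b κ Y' := by
  have key : ∀ κ : ℝ, 0 < κ → Y ^ 2 < κ → arcsin (Y / √κ) < arcsin (Y' / √κ) := by
    intro κ h0 h2
    have hs : 0 < √κ := sqrt_pos.2 h0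
    have h4 : Y / √κ < 1 := (div_lt_one hs).2 (lt_sqrt_of_sq_lt h2)
    have h5 : 0 ≤ Y / √κ := by positivity
    have h6 : Y / √κ < Y' / √κ := by gcongr
    rcases le_or_gt (Y' / √κ) 1 with h | h
    · exact strictMonoOn_arcsin ⟨by linarith, h4.le⟩ ⟨by linarith, h⟩ h6
    · rw [arcsin_of_one_le h.le]
      exact arcsin_lt_pi_div_two.2 h4
  have e0 := key κ h0 h2
  have e1 := key (1 - κ) (by linarith) h3
  have h4 := middleStep_nonneg κ
  have h5 := middleStep_nonneg (1 - κ)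
  have f0 : κ * (a * arcsin (Y / √κ)) < κ * (a * arcsin (Y' / √κ)) := by gcongr
  have f1 : (1 - κ) * (b * arcsin (Y / √(1 - κ))) < (1 - κ) * (b * arcsin (Y' / √(1 - κ))) := by
    have : 0 < 1 - κ := by linarith
    gcongr
  unfold bandHeight
  rcases le_or_gt κ (1 / 2) with h | h
  · have := middleStep_pos (x := 1 - κ) (by linarith)
    exact add_lt_add_of_lt_of_le (mul_lt_mul_of_pos_left f0 this) (mul_le_mul_of_nonneg_left f1.le h4)
  · have := middleStep_pos (x := κ) (by linarith)
    exact add_lt_add_of_le_of_lt (mul_le_mul_of_nonneg_left f0.le h5) (mul_lt_mul_of_pos_left f1 this)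

lemma bandHeight_injective {κ Y Y' : ℝ} (hY : 0 ≤ Y) (hY' : 0 ≤ Y')
    (h0 : Y ^ 2 ≤ κ) (h1 : κ ≤ 1 - Y ^ 2) (h0' : Y' ^ 2 ≤ κ) (h1' : κ ≤ 1 - Y' ^ 2)
    (h : bandHeight a b κ Y = bandHeight a b κ Y') : Y = Y' := by
  by_contra hne
  wlog hlt : Y < Y' generalizing Y Y'
  · exact this hY' hY h0' h1' h0 h1 h.symm (Ne.symm hne) (lt_of_le_of_ne (not_lt.1 hlt) (Ne.symm hne))
  have : Y ^ 2 < Y' ^ 2 := pow_lt_pow_left₀ hlt hY two_ne_zero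
  exact (bandHeight_lt ha hb (by nlinarith) (by nlinarith) hY hlt (by linarith) (by linarith)).ne h

lemma bandHeight_clamp {κ η Y : ℝ} (hY : 0 ≤ Y) (hη : Y ≤ η)
    (h : κ = Y ^ 2 ∨ 1 - κ = Y ^ 2) (hY3 : Y ^ 2 ≤ 1 / 3) : bandHeight a b κ η = bandHeight a b κ Y := by
  have key : ∀ a b : ℝ, bandHeight a b (Y ^ 2) η = bandHeight a b (Y ^ 2) Y := by
    intro a b
    rw [bandHeight_of_le hY3, bandHeight_of_le hY3, sqrt_sq hY]
    rcases hY.eq_or_lt with rfl | hpos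
    · simp
    · rw [arcsin_of_one_le ((one_le_div hpos).2 hη), div_self hpos.ne', arcsin_one]
  rcases h with rfl | h
  · exact key a b
  · rw [← bandHeight_swap, ← bandHeight_swap (Y := Y), h, key]

lemma exists_bandHeight_eq {κ η N : ℝ} (hη0 : 0 ≤ η) (hη : η ^ 2 ≤ 1 / 3) (h0 : 0 ≤ κ) (h1 : κ ≤ 1)
    (hN : 0 ≤ N) (hN' : N ≤ bandHeight a b κ η) :
    ∃ Y ∈ Icc 0 η, Y ^ 2 ≤ κ ∧ κ ≤ 1 - Y ^ 2 ∧ bandHeight a b κ Y = N := by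
  obtain ⟨m, hm0, hmη, hmk, hmk', hm⟩ : ∃ m, 0 ≤ m ∧ m ≤ η ∧ m ^ 2 ≤ κ ∧ m ^ 2 ≤ 1 - κ ∧
      bandHeight a b κ η = bandHeight a b κ m := by
    by_cases hk : κ ≤ η ^ 2
    · refine ⟨√κ, sqrt_nonneg _, sqrt_le_iff.2 ⟨hη0, hk⟩, (sq_sqrt h0).le, ?_, ?_⟩
      · rw [sq_sqrt h0]; linarith
      · exact bandHeight_clamp ha hb (sqrt_nonneg _) (sqrt_le_iff.2 ⟨hη0, hk⟩)
          (Or.inl (sq_sqrt h0).symm) (by rw [sq_sqrt h0]; linarith)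
    by_cases hk' : 1 - κ ≤ η ^ 2
    · have h2 : 0 ≤ 1 - κ := by linarith
      refine ⟨√(1 - κ), sqrt_nonneg _, sqrt_le_iff.2 ⟨hη0, hk'⟩, ?_, (sq_sqrt h2).le, ?_⟩
      · rw [sq_sqrt h2]; linarith
      · exact bandHeight_clamp ha hb (sqrt_nonneg _) (sqrt_le_iff.2 ⟨hη0, hk'⟩)
          (Or.inr (sq_sqrt h2).symm) (by rw [sq_sqrt h2]; linarith)
    exact ⟨η, hη0, le_rfl, (not_le.1 hk).le, (not_le.1 hk').le, rfl⟩
  obtain ⟨Y, hY, hYN⟩ := intermediate_value_Icc hm0 (continuous_bandHeight_right a b κ).continuousOn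
    ⟨by simpa using hN, hm ▸ hN'⟩
  have : Y ^ 2 ≤ m ^ 2 := pow_le_pow_left₀ hY.1 hY.2 2
  exact ⟨Y, ⟨hY.1, hY.2.trans hmη⟩, by linarith, by linarith, hYN⟩

end

/-! ## Angles -/

lemma le_abs_of_coe_eq {x y c : ℝ} (h : (x : Angle) = y) (hx : |x| ≤ π) (hc : 0 ≤ c)
    (h1 : c ≤ y) (h2 : y ≤ 2 * π - c) : c ≤ |x| := by
  by_contra! hlt
  have e : cos |x| = cos y := by
    rw [cos_abs, ← Angle.cos_coe, h, Angle.cos_coe]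
  have h3 : cos c < cos |x| :=
    strictAntiOn_cos ⟨abs_nonneg x, hx⟩ ⟨hc, by linarith⟩ hlt
  have h4 : cos y ≤ cos c := by
    rcases le_total y π with hy | hy
    · exact cos_le_cos_of_nonneg_of_le_pi hc hy h1
    · rw [← cos_two_pi_sub y]
      exact cos_le_cos_of_nonneg_of_le_pi hc (by linarith) (by linarith)
  linarith

lemma eq_of_coe_eq {x y : ℝ} (h : (x : Angle) = y) (hxy : |x - y| < 2 * π) : x = y := by
  obtain ⟨k, hk⟩ := Angle.angle_eq_iff_two_pi_dvd_sub.1 h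
  have hp := pi_pos
  rw [hk, abs_mul, abs_of_pos (by positivity : 0 < 2 * π)] at hxy
  have : |(k : ℝ)| < 1 := by
    by_contra! hh
    nlinarith
  have hk0 : k = 0 := by
    rw [← Int.abs_lt_one_iff]; exact_mod_cast this
  rw [hk0] at hk
  simp at hk; linarith

/-- The argument of `ζ` relative to the coordinate number `j` of `v`. -/
def offset (j : Bool) (v : Torus) (ζ : ℂ) : ℝ :=
  Complex.arg (ζ * (starRingEnd ℂ) (angExp (ang j v)))

lemma abs_offset_le (j : Bool) (v : Torus) (ζ : ℂ) : |offset j v ζ| ≤ π :=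
  Complex.abs_arg_le_pi _

lemma eq_offset (j : Bool) (v : Torus) (ζ : ℂ) :
    ζ = ‖ζ‖ * angExp (ang j v + (offset j v ζ : Angle)) := by
  have h := Complex.norm_mul_exp_arg_mul_I (ζ * (starRingEnd ℂ) (angExp (ang j v)))
  rw [norm_mul, RCLike.norm_conj, norm_angExp, mul_one, ← angExp_coe] at h
  rw [angExp_add, mul_left_comm, offset, h, mul_left_comm, mul_comm (angExp _), conj_angExp_mul, mul_one]

lemma offset_mul_angExp (j : Bool) (v : Torus) {ρ x : ℝ} (hρ : 0 < ρ) (hx : x ∈ Ioc (-π) π) :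
    offset j v (ρ * angExp (ang j v + (x : Angle))) = x := by
  rw [offset, angExp_add, mul_assoc, mul_right_comm, mul_comm (angExp _) ((starRingEnd ℂ) _), conj_angExp_mul, one_mul,
    angExp_coe, Complex.exp_mul_I, Complex.arg_mul_cos_add_sin_mul_I hρ hx]

lemma coe_offset_eq {j : Bool} {v w : Torus} {ρ x : ℝ} (hρ : 0 < ρ) :
    (offset j w (ρ * angExp (ang j v + (x : Angle))) : Angle) = ang j v + (x : Angle) - ang j w := by
  have h := eq_offset j w (ρ * angExp (ang j v + (x : Angle)))
  rw [norm_mul, norm_angExp, mul_one, Complex.norm_real, norm_of_nonneg hρ.le] at h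
  have h2 := angExp_injective (mul_left_cancel₀ (Complex.ofReal_ne_zero.2 hρ.ne') h)
  exact eq_sub_of_add_eq' h2.symm

/-! ## Band widths -/

section Band

variable {R : Finset Torus}

/-- The angle of the sector which is prescribed by the framing for an edge in direction `i`. -/
def edgeLen (f : DiagramFraming R) (i : Bool) (v : Torus) : ℝ :=
  toIcoMod two_pi_pos 0 (role f i v * (ang (!i) (partner R i v) - ang (!i) v).toReal)

/-- `δ` and `η` are small compared with the distances between the vertices of `R`. -/
structure IsBandWidth (R : Finset Torus) (δ η : ℝ) : Prop where
  pos : 0 < δ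
  le : 20 * δ ≤ 1
  gap : ∀ i, ∀ v ∈ R, ∀ w ∈ R, ang i v ≠ ang i w → 20 * δ < |(ang i v - ang i w).toReal|
  height_pos : 0 < η
  height_le : 40 * η ≤ δ

lemma exists_isBandWidth (R : Finset Torus) : ∃ δ η, IsBandWidth R δ η := by
  have h : ∀ᶠ δ : ℝ in 𝓝[>] 0, ∀ v ∈ R, ∀ w ∈ R, ∀ i ∈ (Finset.univ : Finset Bool),
      ang i v ≠ ang i w → 20 * δ < |(ang i v - ang i w).toReal| := by
    refine (Finset.eventually_all R).2 fun v _ => (Finset.eventually_all R).2 fun w _ =>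
      (Finset.eventually_all _).2 fun i _ => ?_
    by_cases hne : ang i v = ang i w
    · exact Eventually.of_forall fun _ h => absurd hne h
    · have : 0 < |(ang i v - ang i w).toReal| := abs_pos.2 fun h =>
        hne (sub_eq_zero.1 (Angle.toReal_eq_zero_iff.1 h))
      filter_upwards [Ioo_mem_nhdsGT (show 0 < |(ang i v - ang i w).toReal| / 20 by positivity)] with δ hδ _
      linarith [hδ.2]
  obtain ⟨δ, h1, h2⟩ := (h.and (Ioo_mem_nhdsGT (show (0 : ℝ) < 1 / 20 by norm_num))).exists
  exact ⟨δ, δ / 40, h2.1, by linarith [h2.2], fun i v hv w hw => h1 v hv w hw i (Finset.mem_univ _),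
    by linarith [h2.1], by linarith⟩

variable {f : DiagramFraming R} {δ η : ℝ}

lemma role_sq (f : DiagramFraming R) (i : Bool) (v : Torus) : role f i v * role f i v = 1 := by
  rcases role_sign f i v with h | h <;> rw [h] <;> norm_num

lemma abs_role (f : DiagramFraming R) (i : Bool) (v : Torus) : |role f i v| = 1 := by
  rcases role_sign f i v with h | h <;> rw [h] <;> norm_num

lemma ang_partner_edgeLen (f : DiagramFraming R) (i : Bool) (v : Torus) :
    ang (!i) (partner R i v) = ang (!i) v + ((role f i v * edgeLen f i v : ℝ) : Angle) := by
  have h := Angle.coe_toIcoMod (role f i v * (ang (!i) (partner R i v) - ang (!i) v).toReal) 0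
  rcases role_sign f i v with hr | hr <;> rw [edgeLen] <;> rw [hr] at h ⊢
  · rw [one_mul, h, one_mul, Angle.coe_toReal]; abel
  · rw [neg_one_mul (toIcoMod _ _ _), Angle.coe_neg, h, neg_one_mul, Angle.coe_neg,
      Angle.coe_toReal]; abel

variable (hR : IsLinkDiagram R) (hW : IsBandWidth R δ η)

include hR hW in
lemma edgeLen_mem (f : DiagramFraming R) (i : Bool)
    {v : Torus} (hv : v ∈ R) : edgeLen f i v ∈ Ioo (8 * δ) (2 * π - 8 * δ) := by
  have h0 := toIcoMod_mem_Ico two_pi_pos 0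
    (role f i v * (ang (!i) (partner R i v) - ang (!i) v).toReal)
  have hg := hW.gap (!i) _ (partner_spec hR i hv).1 v hv (ang_not_partner_ne hR i hv)
  rw [ang_partner_edgeLen f i v, add_sub_cancel_left] at hg
  change edgeLen f i v ∈ _ at h0
  have hp := pi_gt_three
  have hδ := hW.le
  have hδ0 := hW.pos
  have key : ∀ x : ℝ, (x : Angle) = ((role f i v * edgeLen f i v : ℝ) : Angle) → 20 * δ < |x| := by
    intro x hx
    by_contra! hle
    rw [← hx, Angle.toReal_coe_eq_self_iff.2 ⟨by linarith [(abs_le.1 hle).1], by linarith [(abs_le.1 hle).2]⟩] at hg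
    linarith
  constructor
  · have := key _ rfl
    rw [abs_mul, abs_role, one_mul, abs_of_nonneg h0.1] at this
    linarith
  · have := key (role f i v * (edgeLen f i v - 2 * π)) (by
      have h2 : ((role f i v * (2 * π) : ℝ) : Angle) = 0 := by
        rcases role_sign f i v with hr | hr <;> rw [hr]
        · rw [one_mul, Angle.coe_two_pi]
        · rw [neg_one_mul, Angle.coe_neg, Angle.coe_two_pi, neg_zero]
      rw [mul_sub, Angle.coe_sub, h2, sub_zero])
    rw [abs_mul, abs_role, one_mul, abs_of_nonpos (by linarith [h0.2])] at this
    linarith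

include hR hW in
lemma edgeLen_partner (f : DiagramFraming R) (i : Bool)
    {v : Torus} (hv : v ∈ R) : edgeLen f i (partner R i v) = edgeLen f i v := by
  have hp := (partner_spec hR i hv).1
  have h1 := ang_partner_edgeLen f i v
  have h2 := ang_partner_edgeLen f i (partner R i v)
  have m1 := edgeLen_mem hR hW f i hv
  have m2 := edgeLen_mem hR hW f i hp
  have hδ := hW.pos
  rw [partner_partner hR i hv, role_partner hR f i hv] at h2
  have h3 : ((role f i v * edgeLen f i (partner R i v) : ℝ) : Angle) = (role f i v * edgeLen f i v : ℝ) := by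
    rw [neg_mul, Angle.coe_neg] at h2
    rw [← sub_eq_zero]
    rw [h1] at h2
    have := h2
    rw [eq_comm, add_assoc, add_eq_left] at this
    rw [← neg_eq_zero, ← this]; abel
  have h4 := eq_of_coe_eq h3 (by
    rw [← mul_sub, abs_mul, abs_role, one_mul, abs_lt]; constructor <;> linarith [m1.1, m1.2, m2.1, m2.2])
  rcases role_sign f i v with hr | hr <;> rw [hr] at h4 <;> linarith

/-- The value at `κ = ‖w‖²` of the squared norm of the coordinate number `!i`. -/
def wt (i : Bool) (κ : ℝ) : ℝ := if i then 1 - κ else κ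

lemma wt_not (i : Bool) (κ : ℝ) : wt (!i) κ = 1 - wt i κ := by cases i <;> simp [wt]
lemma wt_wt (i : Bool) (κ : ℝ) : wt i (wt i κ) = κ := by cases i <;> simp [wt]
lemma continuous_wt (i : Bool) : Continuous (wt i) := by
  cases i
  · exact continuous_id
  · exact continuous_const.sub continuous_id
lemma wt_mem (i : Bool) {κ : ℝ} (h : κ ∈ Icc (0 : ℝ) 1) : wt i κ ∈ Icc (0 : ℝ) 1 := by
  cases i
  · exact h
  · exact ⟨sub_nonneg.2 h.2, by simpa [wt] using h.1⟩

/-- A smooth cut-off function, equal to `1` on `[-δ, δ]` and to `0` outside of `[-2δ, 2δ]`. -/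
def cutoff (δ x : ℝ) : ℝ := smoothTransition (2 - (x / δ) ^ 2)

lemma contDiff_cutoff (δ : ℝ) : ContDiff ℝ ∞ (cutoff δ) :=
  smoothTransition.contDiff.comp (by fun_prop)

lemma abs_cutoff_le (δ x : ℝ) : |cutoff δ x| ≤ 1 := by
  rw [cutoff, abs_of_nonneg (smoothTransition.nonneg _)]
  exact smoothTransition.le_one _

lemma cutoff_eq_one (hδ : 0 < δ) {x : ℝ} (h : |x| ≤ δ) : cutoff δ x = 1 := by
  refine smoothTransition.one_of_one_le ?_
  have : (x / δ) ^ 2 ≤ 1 := by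
    rw [sq_le_one_iff_abs_le_one, abs_div, abs_of_pos hδ, div_le_one hδ]; exact h
  linarith

lemma cutoff_eq_zero (hδ : 0 < δ) {x : ℝ} (h : 2 * δ ≤ |x|) : cutoff δ x = 0 := by
  refine smoothTransition.zero_of_nonpos ?_
  have : 2 ≤ |x / δ| := by rwa [abs_div, abs_of_pos hδ, le_div_iff₀ hδ]
  nlinarith [sq_abs (x / δ)]

lemma cutoff_neg (δ x : ℝ) : cutoff δ (-x) = cutoff δ x := by simp [cutoff, neg_div]

lemma cutoff_role_mul (f : DiagramFraming R) (i : Bool) (v : Torus) (x : ℝ) :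
    cutoff δ (role f i v * x) = cutoff δ x := by
  rcases role_sign f i v with h | h <;> rw [h] <;> simp [cutoff_neg]

lemma abs_mul_cutoff_le (hδ : 0 < δ) (x : ℝ) : |x * cutoff δ x| ≤ 2 * δ := by
  rcases le_or_gt (2 * δ) |x| with h | h
  · rw [cutoff_eq_zero hδ h]; simp; positivity
  · rw [abs_mul]
    nlinarith [abs_cutoff_le δ x, abs_nonneg x, abs_nonneg (cutoff δ x)]

/-- The points of the band: `κ = ‖w‖²`, and `N` is the height over the arc `v̂`. -/
def bandPoint (f : DiagramFraming R) (δ : ℝ) (v : Torus) (κ N : ℝ) : E4 :=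
  ofCpx
    ((√(1 - κ) : ℝ) * angExp (v.2 + ((role f true v * (N / (1 - κ) * cutoff δ (N / κ)) : ℝ) : Angle)))
    ((√κ : ℝ) * angExp (v.1 + ((role f false v * (N / κ * cutoff δ (N / (1 - κ))) : ℝ) : Angle)))

lemma cpx_bandPoint (f : DiagramFraming R) (δ : ℝ) (i : Bool) (v : Torus) (κ N : ℝ) :
    cpx (!i) (bandPoint f δ v κ N) = (√(wt i κ) : ℝ) * angExp (ang (!i) v +
      ((role f i v * (N / wt i κ * cutoff δ (N / wt (!i) κ)) : ℝ) : Angle)) := by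
  cases i <;> simp [bandPoint, wt, ang]

lemma norm_cpx_bandPoint_sq (f : DiagramFraming R) (δ : ℝ) (i : Bool) (v : Torus) {κ : ℝ} (hκ : κ ∈ Icc (0 : ℝ) 1)
    (N : ℝ) : ‖cpx (!i) (bandPoint f δ v κ N)‖ ^ 2 = wt i κ := by
  rw [cpx_bandPoint, norm_mul, norm_angExp, mul_one, Complex.norm_real, norm_of_nonneg (sqrt_nonneg _),
    sq_sqrt (wt_mem i hκ).1]

/-- The height, over the coordinate plane number `!i`, of the surface containing the band. -/
def graphAngle (f : DiagramFraming R) (δ : ℝ) (i : Bool) (v : Torus) (ζ : ℂ) : ℝ :=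
  role f i v * role f (!i) v * (offset (!i) v ζ * cutoff δ (offset (!i) v ζ)) +
    role f i (partner R i v) * role f (!i) (partner R i v) *
      (offset (!i) (partner R i v) ζ * cutoff δ (offset (!i) (partner R i v) ζ))

/-- The surface containing the band is the graph of this function near the circle number `i`. -/
def graphFun (f : DiagramFraming R) (δ : ℝ) (i : Bool) (v : Torus) (ζ : ℂ) : ℂ :=
  (√(1 - ‖ζ‖ ^ 2) : ℝ) * angExp (ang i v +
    ((‖ζ‖ ^ 2 / (1 - ‖ζ‖ ^ 2) * graphAngle f δ i v ζ : ℝ) : Angle))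

lemma graphFun_partner (hR : IsLinkDiagram R) (f : DiagramFraming R) (δ : ℝ) (i : Bool) {v : Torus} (hv : v ∈ R)
    (ζ : ℂ) : graphFun f δ i (partner R i v) ζ = graphFun f δ i v ζ := by
  rw [graphFun, graphFun, graphAngle, graphAngle, partner_partner hR i hv, (partner_spec hR i hv).2.2,
    add_comm (role f i v * _ * _)]

include hR hW in
/-- Points that are close to one vertex of an edge are far from the other one. -/
lemma cutoff_offset_partner (f : DiagramFraming R) (i : Bool)
    {v : Torus} (hv : v ∈ R) {ρ A : ℝ} (hρ : 0 < ρ) (hA0 : -(2 * δ) ≤ A) (hA : A ≤ edgeLen f i v / 2) :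
    cutoff δ (offset (!i) (partner R i v) (ρ * angExp (ang (!i) v + ((role f i v * A : ℝ) : Angle)))) = 0 := by
  have h := coe_offset_eq (j := !i) (v := v) (w := partner R i v) (x := role f i v * A) hρ
  have hm := edgeLen_mem hR hW f i hv
  have hδ := hW.pos
  rw [ang_partner_edgeLen f i v] at h
  refine cutoff_eq_zero hδ ?_
  set x := offset (!i) (partner R i v) (ρ * angExp (ang (!i) v + ((role f i v * A : ℝ) : Angle)))
  have h2 : ((-(role f i v * x) : ℝ) : Angle) = ((edgeLen f i v - A : ℝ) : Angle) := by
    rcases role_sign f i v with hr | hr <;> rw [hr] at h ⊢ <;> simp [h]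
    abel
  have := le_abs_of_coe_eq (c := 2 * δ) h2 (by rw [abs_neg, abs_mul, abs_role, one_mul]; exact abs_offset_le _ _ _)
    (by linarith) (by linarith [hm.1]) (by linarith [hm.2])
  rwa [abs_neg, abs_mul, abs_role, one_mul] at this

include hR hW in
lemma graphAngle_eq (f : DiagramFraming R) (i : Bool)
    {v : Torus} (hv : v ∈ R) {ρ A : ℝ} (hρ : 0 < ρ) (hA0 : -(2 * δ) ≤ A) (hA : A ≤ edgeLen f i v / 2) :
    graphAngle f δ i v (ρ * angExp (ang (!i) v + ((role f i v * A : ℝ) : Angle))) =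
      role f (!i) v * (A * cutoff δ A) := by
  have hm := edgeLen_mem hR hW f i hv
  have hδ := hW.pos
  rw [graphAngle, cutoff_offset_partner hR hW f i hv hρ hA0 hA, offset_mul_angExp _ _ hρ, cutoff_role_mul]
  · linear_combination (role f (!i) v * (A * cutoff δ A)) * role_sq f i v
  · rcases role_sign f i v with h | h <;> rw [h] <;> constructor <;> linarith [hm.1, hm.2]

include hR hW in
/-- Away from the circle number `!i`, the band is contained in the graph. -/
lemma bandPoint_chart (f : DiagramFraming R) (i : Bool)
    {v : Torus} (hv : v ∈ R) {κ N : ℝ} (hκ : κ ∈ Icc (0 : ℝ) 1) (hi : wt i κ ≤ 2 / 3) (hN : -(δ / 3) ≤ N)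
    (hNκ : -(2 * δ * wt i κ) ≤ N) (hN' : N ≤ δ / 3) (hNl : N ≤ wt i κ * (edgeLen f i v / 2)) :
    cpx (!i) (bandPoint f δ v κ N) =
        (√(wt i κ) : ℝ) * angExp (ang (!i) v + ((role f i v * (N / wt i κ) : ℝ) : Angle)) ∧
      cpx i (bandPoint f δ v κ N) = graphFun f δ i v (cpx (!i) (bandPoint f δ v κ N)) := by
  have hδ := hW.pos
  have h0 := (wt_mem i hκ).1
  have e1 : cutoff δ (N / wt (!i) κ) = 1 := by
    have hw : 1 / 3 ≤ wt (!i) κ := by rw [wt_not]; linarith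
    refine cutoff_eq_one hδ (abs_le.2 ⟨?_, ?_⟩)
    · rw [le_div_iff₀ (by linarith)]; nlinarith
    · rw [div_le_iff₀ (by linarith)]; nlinarith
  have e2 : cpx (!i) (bandPoint f δ v κ N) =
      (√(wt i κ) : ℝ) * angExp (ang (!i) v + ((role f i v * (N / wt i κ) : ℝ) : Angle)) := by
    rw [cpx_bandPoint, e1, mul_one]
  refine ⟨e2, ?_⟩
  have e3 := cpx_bandPoint f δ (!i) v κ N
  rw [Bool.not_not] at e3
  rw [graphFun, norm_cpx_bandPoint_sq f δ i v hκ, e3, e2, wt_not]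
  congr 4
  rcases h0.eq_or_lt with h | h
  · have : N = 0 := le_antisymm (by simpa [← h] using hNl) (by simpa [← h] using hNκ)
    simp [← h, this]
  rw [graphAngle_eq hR hW f i hv (sqrt_pos.2 h) (by rw [le_div_iff₀ h]; linarith)
    (by rw [div_le_iff₀ h]; linarith)]
  field_simp

end Band

/-! ## Surfaces which are locally graphs -/

/-- The point whose coordinate number `i` is `a` and whose other coordinate is `b`. -/
def ofPair (i : Bool) (a b : ℂ) : E4 := if i then ofCpx b a else ofCpx a b

@[simp] lemma cpx_ofPair (i : Bool) (a b : ℂ) : cpx i (ofPair i a b) = a := by cases i <;> simp [ofPair]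
@[simp] lemma cpx_not_ofPair (i : Bool) (a b : ℂ) : cpx (!i) (ofPair i a b) = b := by
  cases i <;> simp [ofPair]

lemma ext_cpx' (i : Bool) {x y : E4} (h : cpx i x = cpx i y) (h' : cpx (!i) x = cpx (!i) y) : x = y :=
  ext_cpx fun j => by
    cases i <;> cases j
    exacts [h, h', h', h]

lemma contDiff_ofPair (i : Bool) : ContDiff ℝ ∞ fun q : ℂ × ℂ => ofPair i q.1 q.2 := by
  have hre : ContDiff ℝ ∞ Complex.re := Complex.reCLM.contDiff
  have him : ContDiff ℝ ∞ Complex.im := Complex.imCLM.contDiff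
  rw [contDiff_euclidean]
  intro k
  cases i <;> fin_cases k
  · exact hre.comp contDiff_fst
  · exact him.comp contDiff_fst
  · exact hre.comp contDiff_snd
  · exact him.comp contDiff_snd
  · exact hre.comp contDiff_snd
  · exact him.comp contDiff_snd
  · exact hre.comp contDiff_fst
  · exact him.comp contDiff_fst

lemma isC1Surface_of_graph {M : Set E4} (h : ∀ p ∈ M, ∃ (i : Bool) (U : Set E4) (V : Set ℂ) (g : ℂ → ℂ),
    IsOpen U ∧ p ∈ U ∧ IsOpen V ∧ cpx (!i) p ∈ V ∧ ContDiffOn ℝ 1 g V ∧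
      ∀ x ∈ U, cpx (!i) x ∈ V → (x ∈ M ↔ cpx i x = g (cpx (!i) x))) : IsC1Surface M := by
  intro p hp
  obtain ⟨i, U, V, g, hU, hpU, hV, hpV, hg, hM⟩ := h p hp
  have hop : ContDiff ℝ 1 fun q : ℂ × ℂ => ofPair false q.1 q.2 := (contDiff_ofPair false).of_le (by simp)
  have hop' : ContDiff ℝ 1 fun q : ℂ × ℂ => ofPair i q.1 q.2 := (contDiff_ofPair i).of_le (by simp)
  set Φ : E4 → E4 := fun x => ofPair false (cpx (!i) x) (cpx i x - g (cpx (!i) x)) with hΦdef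
  set Ψ : E4 → E4 := fun y => ofPair i (cpx true y + g (cpx false y)) (cpx false y) with hΨdef
  have ht : ∀ a b : ℂ, cpx true (ofPair false a b) = b := fun a b => cpx_not_ofPair false a b
  have hΦ : ContDiffOn ℝ 1 Φ (cpx (!i) ⁻¹' V) := by
    refine hop.comp_contDiffOn (((cpx (!i)).contDiff.contDiffOn).prodMk
      ((cpx i).contDiff.contDiffOn.sub (hg.comp (cpx (!i)).contDiff.contDiffOn fun x hx => hx)))
  have hΨ : ContDiffOn ℝ 1 Ψ (cpx false ⁻¹' V) := by
    refine hop'.comp_contDiffOn ((((cpx true).contDiff.contDiffOn).add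
      (hg.comp (cpx false).contDiff.contDiffOn fun x hx => hx)).prodMk (cpx false).contDiff.contDiffOn)
  have hl : ∀ x, Ψ (Φ x) = x := fun x => ext_cpx' i (by simp [Φ, Ψ, ht]) (by simp [Φ, Ψ])
  have hr : ∀ y, Φ (Ψ y) = y := fun y => ext_cpx' false (by simp [Φ, Ψ]) (by simp [Φ, Ψ, ht])
  refine ⟨⟨⟨⟨Φ, Ψ, cpx (!i) ⁻¹' V ∩ U, cpx false ⁻¹' V ∩ Ψ ⁻¹' U, ?_, ?_, fun x _ => hl x, fun y _ => hr y⟩,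
    hΦ.continuousOn.mono inter_subset_left, hΨ.continuousOn.mono inter_subset_left⟩,
    (hV.preimage (cpx (!i)).continuous).inter hU,
    hΨ.continuousOn.isOpen_inter_preimage (hV.preimage (cpx false).continuous) hU⟩,
    ⟨hpV, hpU⟩, hΦ.mono inter_subset_left, hΨ.mono inter_subset_left, ?_⟩
  · rintro x ⟨hx, hx'⟩
    exact ⟨by simpa [Φ] using hx, by rw [mem_preimage, hl]; exact hx'⟩
  · rintro y ⟨hy, hy'⟩
    exact ⟨by simpa [Ψ] using hy, hy'⟩
  · rintro x ⟨hx, hx'⟩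
    rw [hM x hx' hx]
    change _ ↔ (Φ x) 2 = 0 ∧ (Φ x) 3 = 0
    rw [← cpx_true_re, ← cpx_true_im, hΦdef, ht, ← sub_eq_zero, Complex.ext_iff]
    rfl

/-- A function which is homogeneous of degree two and `C¹` off the origin is `C¹`. -/
lemma contDiff_one_of_homogeneous {b : ℂ → ℝ} (h : ∀ t : ℝ, 0 < t → ∀ ζ : ℂ, b (t • ζ) = t ^ 2 * b ζ)
    (hs : ContDiffOn ℝ 1 b {0}ᶜ) : ContDiff ℝ 1 b := by
  have hopen : IsOpen ({0}ᶜ : Set ℂ) := isOpen_compl_singleton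
  have hb0 : b 0 = 0 := by
    have := h 2 two_pos 0
    rw [smul_zero] at this; linarith
  have hd : ∀ ζ : ℂ, ζ ≠ 0 → DifferentiableAt ℝ b ζ := fun ζ hζ =>
    (hs.contDiffAt (hopen.mem_nhds hζ)).differentiableAt one_ne_zero
  have hcd : ContinuousOn (fderiv ℝ b) {0}ᶜ := hs.continuousOn_fderiv_of_isOpen hopen le_rfl
  have hsub : Metric.sphere (0 : ℂ) 1 ⊆ {0}ᶜ := fun ζ hζ h0 => by
    rw [mem_singleton_iff.1 h0] at hζ; simp at hζ
  obtain ⟨C, hC⟩ := (isCompact_sphere (0 : ℂ) 1).exists_bound_of_continuousOn (hs.continuousOn.mono hsub)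
  obtain ⟨C', hC'⟩ := (isCompact_sphere (0 : ℂ) 1).exists_bound_of_continuousOn (hcd.mono hsub)
  have hdec : ∀ ζ : ℂ, ζ ≠ 0 → 0 < ‖ζ‖ ∧ ‖ζ‖⁻¹ • ζ ∈ Metric.sphere (0 : ℂ) 1 ∧ ‖ζ‖ • (‖ζ‖⁻¹ • ζ) = ζ := by
    intro ζ hζ
    have := norm_pos_iff.2 hζ
    refine ⟨this, ?_, smul_inv_smul₀ this.ne' ζ⟩
    rw [mem_sphere_zero_iff_norm, norm_smul, norm_inv, norm_norm, inv_mul_cancel₀ this.ne']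
  have hbb : ∀ ζ, ‖b ζ‖ ≤ C * ‖ζ‖ ^ 2 := by
    intro ζ
    by_cases hζ : ζ = 0
    · simp [hζ, hb0]
    obtain ⟨h1, h2, h3⟩ := hdec ζ hζ
    rw [← h3, h _ h1, norm_mul, h3]
    have := hC _ h2
    rw [norm_pow, norm_norm]
    nlinarith [sq_nonneg ‖ζ‖]
  have hfd : ∀ ζ, ζ ≠ 0 → ‖fderiv ℝ b ζ‖ ≤ C' * ‖ζ‖ := by
    intro ζ hζ
    obtain ⟨h1, h2, h3⟩ := hdec ζ hζ
    set u := ‖ζ‖⁻¹ • ζ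
    have hu : u ≠ 0 := hsub h2
    have e1 : HasFDerivAt (fun x => b (‖ζ‖ • x)) (‖ζ‖ • fderiv ℝ b ζ) u := by
      have := ((h3.symm ▸ hd ζ hζ : DifferentiableAt ℝ b (‖ζ‖ • u)).hasFDerivAt).comp u
        ((hasFDerivAt_id u).const_smul ‖ζ‖)
      rw [h3] at this
      refine this.congr_fderiv ?_
      ext; simp
    have e2 : HasFDerivAt (fun x => b (‖ζ‖ • x)) (‖ζ‖ ^ 2 • fderiv ℝ b u) u := by
      refine ((hd u hu).hasFDerivAt.const_smul (‖ζ‖ ^ 2)).congr_of_eventuallyEq (Eventually.of_forall fun x => ?_)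
      exact h _ h1 x
    have e3 := e1.unique e2
    have e4 : fderiv ℝ b ζ = ‖ζ‖ • fderiv ℝ b u := by
      rw [sq, mul_smul] at e3
      exact smul_right_injective _ h1.ne' e3
    rw [e4, norm_smul, norm_norm, mul_comm]
    exact mul_le_mul_of_nonneg_right (hC' _ h2) h1.le
  have h0 : HasFDerivAt b (0 : ℂ →L[ℝ] ℝ) 0 := by
    rw [hasFDerivAt_iff_isLittleO]
    have : (fun ζ : ℂ => b ζ) =O[𝓝 0] fun ζ => ‖ζ‖ ^ 2 :=
      IsBigO.of_bound C (Eventually.of_forall fun ζ => by simpa using hbb ζ)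
    refine (this.trans_isLittleO (isLittleO_norm_pow_id one_lt_two)).congr (fun ζ => by simp [hb0]) fun ζ => by simp
  rw [contDiff_one_iff_fderiv]
  refine ⟨fun ζ => ?_, continuous_iff_continuousAt.2 fun ζ => ?_⟩
  · by_cases hζ : ζ = 0
    · exact hζ ▸ h0.differentiableAt
    · exact hd ζ hζ
  · by_cases hζ : ζ = 0
    · subst hζ
      rw [ContinuousAt, h0.fderiv]
      refine squeeze_zero_norm (a := fun ζ => |C'| * ‖ζ‖) (fun ζ => ?_)
        (Continuous.tendsto' (by fun_prop) _ _ (by simp))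
      by_cases hζ : ζ = 0
      · rw [hζ, h0.fderiv]; simp
      · exact (hfd ζ hζ).trans (mul_le_mul_of_nonneg_right (le_abs_self C') (norm_nonneg _))
    · exact hcd.continuousAt (hopen.mem_nhds hζ)

lemma contDiff_normSq_mul_arg {δ : ℝ} (hδ : 0 < δ) (hδ' : 4 * δ ≤ π) (c : ℂ) (hc : ‖c‖ = 1) :
    ContDiff ℝ 1 fun ζ : ℂ => ‖ζ‖ ^ 2 * (Complex.arg (ζ * c) * cutoff δ (Complex.arg (ζ * c))) := by
  have key : ContDiff ℝ 1 fun ζ : ℂ => ‖ζ‖ ^ 2 * (Complex.arg ζ * cutoff δ (Complex.arg ζ)) := by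
    refine contDiff_one_of_homogeneous (fun t ht ζ => ?_) fun ζ hζ => ContDiffAt.contDiffWithinAt ?_
    · rw [norm_smul, Complex.real_smul, Complex.arg_real_mul _ ht, mul_pow, norm_of_nonneg ht.le]; ring
    · by_cases hs : ζ ∈ Complex.slitPlane
      · have h1 : ContDiffAt ℝ 1 Complex.arg ζ := by
          have : ContDiffAt ℝ 1 Complex.log ζ := (Complex.contDiffAt_log hs).restrict_scalars ℝ
          exact (Complex.imCLM.contDiff.contDiffAt.comp ζ this).congr_of_eventuallyEq
            (Eventually.of_forall fun z => by simp [Complex.log_im])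
        exact (contDiff_norm_sq ℝ).contDiffAt.mul (h1.mul
          (((contDiff_cutoff δ).of_le (by simp)).contDiffAt.comp ζ h1))
      · have hre : ζ.re < 0 := by
          rw [Complex.mem_slitPlane_iff] at hs
          push Not at hs
          refine lt_of_le_of_ne hs.1 fun h => hζ (Complex.ext h hs.2)
        refine contDiffAt_const (c := (0 : ℝ)) |>.congr_of_eventuallyEq ?_
        filter_upwards [(isOpen_lt Complex.continuous_re continuous_const).mem_nhds hre] with z hz
        have : π / 2 < |Complex.arg z| := by
          rw [← not_le, Complex.abs_arg_le_pi_div_two_iff]; exact not_le.2 hz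
        rw [cutoff_eq_zero hδ (by linarith)]; simp
  have h2 : ContDiff ℝ 1 fun ζ : ℂ => ζ * c := by fun_prop
  simpa [Function.comp_def, hc] using key.comp h2

lemma continuous_normSq_mul_abs_arg (c : ℂ) (hc : ‖c‖ = 1) :
    Continuous fun ζ : ℂ => ‖ζ‖ ^ 2 * |Complex.arg (ζ * c)| := by
  have key : Continuous fun ζ : ℂ => ‖ζ‖ ^ 2 * |Complex.arg ζ| := by
    refine continuous_iff_continuousAt.2 fun ζ => ?_
    by_cases hζ : ζ = 0
    · subst hζ
      rw [ContinuousAt, norm_zero, zero_pow two_ne_zero, zero_mul]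
      refine squeeze_zero (g := fun ζ : ℂ => ‖ζ‖ ^ 2 * π) (fun ζ => by positivity) (fun ζ => ?_)
        (Continuous.tendsto' (by fun_prop) _ _ (by simp))
      exact mul_le_mul_of_nonneg_left (Complex.abs_arg_le_pi ζ) (sq_nonneg _)
    · have e : ∀ z : ℂ, z ≠ 0 → arccos (z.re / ‖z‖) = |Complex.arg z| := by
        intro z hz
        rcases le_or_gt 0 z.im with h | h
        · rw [Complex.arg_of_im_nonneg_of_ne_zero h hz, abs_of_nonneg (arccos_nonneg _)]
        · rw [Complex.arg_of_im_neg h, abs_neg, abs_of_nonneg (arccos_nonneg _)]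
      have h1 : ContinuousAt (fun z : ℂ => ‖z‖ ^ 2 * arccos (z.re / ‖z‖)) ζ := by
        refine ContinuousAt.mul (by fun_prop) (continuous_arccos.continuousAt.comp ?_)
        exact Complex.continuous_re.continuousAt.div continuous_norm.continuousAt (norm_ne_zero_iff.2 hζ)
      refine h1.congr ?_
      filter_upwards [isOpen_compl_singleton.mem_nhds hζ] with z hz
      rw [e z hz]
  refine (key.comp (continuous_mul_const c)).congr fun ζ => ?_
  simp [hc]

/-! ## The surface containing the bands -/

section Band

variable {R : Finset Torus} {f : DiagramFraming R} {δ η : ℝ}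

lemma contDiffOn_graphFun (hW : IsBandWidth R δ η) (f : DiagramFraming R) (i : Bool) (v : Torus) :
    ContDiffOn ℝ 1 (graphFun f δ i v) {ζ | ‖ζ‖ ^ 2 < 2 / 3} := by
  have hδ := hW.pos
  have hδ' : 4 * δ ≤ π := by linarith [hW.le, pi_gt_three]
  have hB : ∀ u : Torus, ContDiff ℝ 1 fun ζ : ℂ => ‖ζ‖ ^ 2 * (offset (!i) u ζ * cutoff δ (offset (!i) u ζ)) :=
    fun u => contDiff_normSq_mul_arg hδ hδ' _ (by rw [RCLike.norm_conj, norm_angExp])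
  have hn : ContDiff ℝ 1 fun ζ : ℂ => ‖ζ‖ ^ 2 := contDiff_norm_sq ℝ
  have h1 : ContDiffOn ℝ 1 (fun ζ : ℂ => ‖ζ‖ ^ 2 / (1 - ‖ζ‖ ^ 2) * graphAngle f δ i v ζ) {ζ | ‖ζ‖ ^ 2 < 2 / 3} := by
    have : ContDiff ℝ 1 fun ζ : ℂ => ‖ζ‖ ^ 2 * graphAngle f δ i v ζ := by
      have := ((hB v).const_smul (role f i v * role f (!i) v)).add
        ((hB (partner R i v)).const_smul (role f i (partner R i v) * role f (!i) (partner R i v)))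
      convert this using 2 with ζ
      simp only [graphAngle, smul_eq_mul]; ring
    refine (this.contDiffOn.div ((contDiff_const (c := (1 : ℝ))).sub hn).contDiffOn fun ζ hζ => ?_).congr fun ζ _ => ?_
    · have : ‖ζ‖ ^ 2 < 2 / 3 := hζ
      exact (by linarith : (0 : ℝ) < 1 - ‖ζ‖ ^ 2).ne'
    · simp only [Pi.div_apply]; ring
  have h2 : ContDiffOn ℝ 1 (fun ζ : ℂ => √(1 - ‖ζ‖ ^ 2)) {ζ | ‖ζ‖ ^ 2 < 2 / 3} :=
    (contDiff_const.sub hn).contDiffOn.sqrt fun ζ hζ => by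
      have : ‖ζ‖ ^ 2 < 2 / 3 := hζ
      exact (by linarith : (0 : ℝ) < 1 - ‖ζ‖ ^ 2).ne'
  have h3 := (Complex.ofRealCLM.contDiff.comp_contDiffOn h2).mul
    ((contDiffOn_const (c := angExp (ang i v))).mul
      (((Complex.ofRealCLM.contDiff.comp_contDiffOn h1).mul contDiffOn_const (g := fun _ => Complex.I)).cexp))
  refine h3.congr fun ζ _ => ?_
  rw [graphFun, angExp_add, angExp_coe]
  rfl

variable (f δ) in
/-- A `C¹` surface which contains the band. -/
def bandSurface : Set E4 := {x | ‖x‖ = 1 ∧ ∃ i, ∃ v ∈ R, ‖cpx (!i) x‖ ^ 2 < 2 / 3 ∧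
  ‖cpx (!i) x‖ ^ 2 * |offset (!i) v (cpx (!i) x)| < δ / 3 ∧ cpx i x = graphFun f δ i v (cpx (!i) x)}

lemma bandSurface_subset : bandSurface f δ ⊆ Metric.sphere 0 1 := fun x hx => by
  rw [mem_sphere_zero_iff_norm]; exact hx.1

lemma norm_graphFun {i : Bool} {v : Torus} {ζ : ℂ} (h : ‖ζ‖ ^ 2 ≤ 1) :
    ‖graphFun f δ i v ζ‖ ^ 2 = 1 - ‖ζ‖ ^ 2 := by
  rw [graphFun, norm_mul, norm_angExp, mul_one, Complex.norm_real, norm_of_nonneg (sqrt_nonneg _),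
    sq_sqrt (by linarith)]

lemma norm_of_graphFun {i : Bool} {v : Torus} {x : E4} (h : ‖cpx (!i) x‖ ^ 2 ≤ 1)
    (hx : cpx i x = graphFun f δ i v (cpx (!i) x)) : ‖x‖ = 1 := by
  have := norm_sq_eq_cpx' i x
  rw [hx, norm_graphFun h] at this
  exact (sq_eq_sq₀ (norm_nonneg _) zero_le_one).1 (by rw [this]; ring)

variable (hR : IsLinkDiagram R) (hW : IsBandWidth R δ η)

include hR hW in
/-- A point of the graph over the sector at a vertex is a point of the band. -/
lemma eq_bandPoint {i : Bool} {v : Torus} (hv : v ∈ R)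
    {x : E4} (h0 : 0 < ‖cpx (!i) x‖) (h1 : ‖cpx (!i) x‖ ^ 2 ≤ 2 / 3)
    (hx : cpx i x = graphFun f δ i v (cpx (!i) x)) {A : ℝ}
    (hA : (A : Angle) = ((role f i v * offset (!i) v (cpx (!i) x) : ℝ) : Angle)) (hA0 : -(2 * δ) ≤ A)
    (hA1 : A ≤ edgeLen f i v / 2) (hA2 : ‖cpx (!i) x‖ ^ 2 * |A| ≤ δ / 3) :
    x = bandPoint f δ v (wt i (‖cpx (!i) x‖ ^ 2)) (‖cpx (!i) x‖ ^ 2 * A) := by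
  set κ := ‖cpx (!i) x‖ ^ 2 with hκ
  have hκ0 : 0 < κ := by positivity
  have h2 := abs_le.1 (show |κ * A| ≤ δ / 3 by rwa [abs_mul, abs_of_pos hκ0])
  obtain ⟨e1, e2⟩ := bandPoint_chart hR hW f i hv (κ := wt i κ) (N := κ * A)
    (wt_mem i ⟨hκ0.le, by linarith⟩) (by rwa [wt_wt]) (by linarith) (by rw [wt_wt]; nlinarith) h2.2
    (by rw [wt_wt]; gcongr)
  have e3 : cpx (!i) x = cpx (!i) (bandPoint f δ v (wt i κ) (κ * A)) := by
    rw [e1, wt_wt, mul_div_cancel_left₀ _ hκ0.ne', hκ, sqrt_sq (norm_nonneg _)]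
    conv_lhs => rw [eq_offset (!i) v (cpx (!i) x)]
    congr 3
    rcases role_sign f i v with hr | hr <;> rw [hr] at hA ⊢
    · rw [one_mul, hA, one_mul]
    · rw [neg_one_mul, Angle.coe_neg, hA, neg_one_mul, Angle.coe_neg, neg_neg]
  exact ext_cpx' i (by rw [hx, e3, e2]) e3

include hR hW in
/-- The two descriptions of the surface agree on their common domain. -/
lemma bandSurface_switch {i : Bool} {v : Torus} (hv : v ∈ R)
    {x : E4} (h0 : 1 / 3 < ‖cpx (!i) x‖ ^ 2) (h1 : ‖cpx (!i) x‖ ^ 2 < 2 / 3)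
    (hN : ‖cpx (!i) x‖ ^ 2 * |offset (!i) v (cpx (!i) x)| < δ / 3)
    (hx : cpx i x = graphFun f δ i v (cpx (!i) x)) :
    ‖cpx i x‖ ^ 2 < 2 / 3 ∧ ‖cpx i x‖ ^ 2 * |offset i v (cpx i x)| < δ / 3 ∧
      cpx (!i) x = graphFun f δ (!i) v (cpx i x) := by
  have hδ := hW.pos
  have hδ' := hW.le
  have hpi := pi_gt_three
  set κ := ‖cpx (!i) x‖ ^ 2 with hκ
  have h00 : 0 < ‖cpx (!i) x‖ := (norm_nonneg _).lt_of_ne fun h => by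
    rw [hκ, ← h] at h0; norm_num at h0
  have hm := edgeLen_mem hR hW f i hv
  have hm' := edgeLen_mem hR hW f (!i) hv
  have hA : |role f i v * offset (!i) v (cpx (!i) x)| = |offset (!i) v (cpx (!i) x)| := by
    rw [abs_mul, abs_role, one_mul]
  have hA1 : |offset (!i) v (cpx (!i) x)| ≤ δ := by
    by_contra! hh
    nlinarith
  have hA2 := abs_le.1 (hA.trans_le hA1)
  set A := role f i v * offset (!i) v (cpx (!i) x)
  have hxp := eq_bandPoint hR hW hv h00 h1.le hx (A := A) rfl
    (by linarith) (by linarith [hm.1]) (by rw [hA]; exact hN.le)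
  rw [← hκ] at hxp
  have hN2 : |κ * A| < δ / 3 := by rwa [abs_mul, abs_of_pos (by linarith), hA]
  have hN3 := abs_lt.1 hN2
  have hwt : wt (!i) (wt i κ) = 1 - κ := by rw [wt_not, wt_wt]
  obtain ⟨e1, e2⟩ := bandPoint_chart hR hW f (!i) hv (κ := wt i κ) (N := κ * A)
    (wt_mem i ⟨by linarith, by linarith⟩) (by rw [hwt]; linarith) (by linarith) (by rw [hwt]; nlinarith)
    hN3.2.le (by rw [hwt]; nlinarith [hm'.1])
  rw [← hxp, Bool.not_not] at e1 e2
  rw [hwt] at e1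
  have hn : ‖cpx i x‖ ^ 2 = 1 - κ := by rw [hx, norm_graphFun (by linarith)]
  refine ⟨by rw [hn]; linarith, ?_, e2⟩
  have hB : |κ * A / (1 - κ)| ≤ 1 := by
    rw [abs_div, abs_of_pos (by linarith : 0 < 1 - κ), div_le_one (by linarith)]; linarith
  have hrB : |role f (!i) v * (κ * A / (1 - κ))| ≤ 1 := by rwa [abs_mul, abs_role, one_mul]
  rw [hn, e1, offset_mul_angExp _ _ (sqrt_pos.2 (by linarith))
    ⟨by linarith [(abs_le.1 hrB).1], by linarith [(abs_le.1 hrB).2]⟩, abs_mul, abs_role, one_mul, abs_div,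
    abs_of_pos (by linarith : 0 < 1 - κ), mul_div_cancel₀ _ (by linarith : (1 - κ) ≠ 0)]
  exact hN2

include hR hW in
/-- The part of the surface lying over one coordinate plane. -/
lemma exists_chart_of_mem {x : E4} (hx : x ∈ bandSurface f δ) (i : Bool)
    (hi : ‖cpx (!i) x‖ ^ 2 < 2 / 3) : ∃ v ∈ R,
      ‖cpx (!i) x‖ ^ 2 * |offset (!i) v (cpx (!i) x)| < δ / 3 ∧ cpx i x = graphFun f δ i v (cpx (!i) x) := by
  obtain ⟨h1, j, v, hv, hj, h2, h3⟩ := hx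
  by_cases hij : j = i
  · subst hij; exact ⟨v, hv, h2, h3⟩
  · obtain rfl : i = !j := by cases i <;> cases j <;> simp_all
    rw [Bool.not_not] at hi
    have := norm_sq_eq_cpx' j x
    rw [h1] at this
    obtain ⟨-, h5, h6⟩ := bandSurface_switch hR hW hv (by linarith) hj h2 h3
    rw [Bool.not_not]
    exact ⟨v, hv, h5, h6⟩

lemma abs_graphAngle_le (hW : IsBandWidth R δ η) (f : DiagramFraming R) (i : Bool) (v : Torus) (ζ : ℂ) :
    |graphAngle f δ i v ζ| ≤ 4 * δ := by
  have h : ∀ u x, |role f i u * role f (!i) u * (x * cutoff δ x)| ≤ 2 * δ := fun u x => by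
    rw [abs_mul, abs_mul, abs_role, abs_role, one_mul, one_mul]; exact abs_mul_cutoff_le hW.pos x
  exact (abs_add_le _ _).trans (by linarith [h v (offset (!i) v ζ), h (partner R i v) (offset (!i) (partner R i v) ζ)])

lemma abs_graphHeight_le (hW : IsBandWidth R δ η) (f : DiagramFraming R) (i : Bool) (v : Torus) {ζ : ℂ}
    (hζ : ‖ζ‖ ^ 2 < 2 / 3) : |‖ζ‖ ^ 2 / (1 - ‖ζ‖ ^ 2) * graphAngle f δ i v ζ| ≤ 8 * δ := by
  have h3 : ‖ζ‖ ^ 2 / (1 - ‖ζ‖ ^ 2) ≤ 2 := by rw [div_le_iff₀ (by linarith)]; linarith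
  have h4 : 0 ≤ ‖ζ‖ ^ 2 / (1 - ‖ζ‖ ^ 2) := div_nonneg (sq_nonneg _) (by linarith)
  rw [abs_mul, abs_of_nonneg h4]
  nlinarith [abs_graphAngle_le hW f i v ζ, abs_nonneg (graphAngle f δ i v ζ)]

/-- The graphs belonging to different edges are separated. -/
lemma ang_eq_of_re_lt (hW : IsBandWidth R δ η) {i : Bool} {v w : Torus} (hv : v ∈ R) (hw : w ∈ R) {y ρ : ℝ}
    (hρ : 0 ≤ ρ) (hy : |y| ≤ 8 * δ) :
    ρ * cos (9 * δ) < (ρ * angExp (ang i w + (y : Angle)) * (starRingEnd ℂ) (angExp (ang i v))).re →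
      ang i w = ang i v := by
  intro h
  by_contra hne
  have hδ := hW.pos
  have hδ' := hW.le
  have hpi := pi_gt_three
  have hg := hW.gap i w hw v hv hne
  rw [← angExp_neg, mul_assoc, ← angExp_add, Complex.re_ofReal_mul, angExp_re] at h
  have hc : cos (9 * δ) < (ang i w + (y : Angle) + -ang i v).cos := lt_of_mul_lt_mul_left h hρ
  set z := (ang i w + (y : Angle) + -ang i v).toReal with hz
  rw [← Angle.coe_toReal (ang i w + (y : Angle) + -ang i v), Angle.cos_coe, ← hz, ← cos_abs z] at hc
  have hz9 : |z| < 9 * δ := by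
    by_contra! hh
    have := cos_le_cos_of_nonneg_of_le_pi (by linarith) (Angle.abs_toReal_le_pi _) hh
    linarith
  have e : ang i w - ang i v = ((z - y : ℝ) : Angle) := by
    rw [Angle.coe_sub, hz, Angle.coe_toReal]; abel
  have h1 := abs_lt.1 hz9
  have h2 := abs_le.1 hy
  rw [e, Angle.toReal_coe_eq_self_iff.2 ⟨by linarith, by linarith⟩] at hg
  linarith [(abs_lt.2 ⟨by linarith, by linarith⟩ : |z - y| < 17 * δ)]

lemma isOpen_chartDomain (j : Bool) (v : Torus) :
    IsOpen {ζ : ℂ | ‖ζ‖ ^ 2 < 2 / 3 ∧ ‖ζ‖ ^ 2 * |offset j v ζ| < δ / 3} := by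
  have h1 : IsOpen {ζ : ℂ | ‖ζ‖ ^ 2 < 2 / 3} := isOpen_lt (by fun_prop) continuous_const
  have h2 : IsOpen {ζ : ℂ | ‖ζ‖ ^ 2 * |offset j v ζ| < δ / 3} :=
    isOpen_lt (continuous_normSq_mul_abs_arg _ (by rw [RCLike.norm_conj, norm_angExp])) continuous_const
  exact h1.inter h2

include hR hW in
/-- A neighbourhood on which the surface is a graph. -/
lemma exists_nhds_graph {i : Bool} {v : Torus} (hv : v ∈ R)
    {p : E4} (h1 : ‖cpx (!i) p‖ ^ 2 < 2 / 3) (hp : cpx i p = graphFun f δ i v (cpx (!i) p)) :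
    ∃ U : Set E4, IsOpen U ∧ p ∈ U ∧ ∀ x ∈ U, x ∈ bandSurface f δ →
      ‖cpx (!i) x‖ ^ 2 < 2 / 3 ∧ cpx i x = graphFun f δ i v (cpx (!i) x) := by
  have hδ := hW.pos
  have hδ' := hW.le
  have hpi := pi_gt_three
  have hy := fun u (ζ : ℂ) => abs_graphHeight_le (ζ := ζ) hW f i u
  refine ⟨{x | ‖cpx (!i) x‖ ^ 2 < 2 / 3 ∧
    ‖cpx i x‖ * cos (9 * δ) < (cpx i x * (starRingEnd ℂ) (angExp (ang i v))).re}, ?_, ⟨h1, ?_⟩, ?_⟩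
  · refine (isOpen_lt ((cpx (!i)).continuous.norm.pow 2) continuous_const).inter
      (isOpen_lt ((cpx i).continuous.norm.mul continuous_const)
        (Complex.continuous_re.comp ((cpx i).continuous.mul continuous_const)))
  · rw [hp, graphFun, norm_mul, norm_angExp, mul_one, Complex.norm_real, norm_of_nonneg (sqrt_nonneg _),
      ← angExp_neg, mul_assoc, ← angExp_add, Complex.re_ofReal_mul, angExp_re, add_neg_cancel_comm, Angle.cos_coe]
    refine mul_lt_mul_of_pos_left ?_ (sqrt_pos.2 (by linarith))
    have := hy v _ h1
    rw [← cos_abs (_ / _ * _)]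
    exact strictAntiOn_cos ⟨abs_nonneg _, this.trans (by linarith)⟩
      (show 9 * δ ∈ _ from ⟨by linarith, by linarith⟩) (this.trans_lt (by linarith))
  · rintro x ⟨hx1, hx2⟩ hxM
    refine ⟨hx1, ?_⟩
    obtain ⟨w, hw, -, h4⟩ := exists_chart_of_mem hR hW hxM i hx1
    have e : ang i w = ang i v := by
      refine ang_eq_of_re_lt hW hv hw (sqrt_nonneg (1 - ‖cpx (!i) x‖ ^ 2)) (hy w _ hx1) ?_
      rw [h4, graphFun, norm_mul, norm_angExp, mul_one, Complex.norm_real,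
        norm_of_nonneg (sqrt_nonneg _)] at hx2
      exact hx2
    rcases eq_or_eq_partner hR i hv hw e with rfl | rfl
    · exact h4
    · rw [h4, graphFun_partner hR f δ i hv]

theorem isC1Surface_bandSurface (hR : IsLinkDiagram R) (hW : IsBandWidth R δ η) : IsC1Surface (bandSurface f δ) := by
  refine isC1Surface_of_graph fun p hp => ?_
  obtain ⟨i, v, hv, h1, h2, h3⟩ := hp.2
  obtain ⟨U, hU, hpU, hM⟩ := exists_nhds_graph hR hW hv h1 h3
  refine ⟨i, U, {ζ : ℂ | ‖ζ‖ ^ 2 < 2 / 3 ∧ ‖ζ‖ ^ 2 * |offset (!i) v ζ| < δ / 3}, graphFun f δ i v, hU, hpU,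
    isOpen_chartDomain _ _, ⟨h1, h2⟩, (contDiffOn_graphFun hW f i v).mono fun ζ hζ => hζ.1, ?_⟩
  rintro x hxU ⟨hx1, hx2⟩
  refine ⟨fun hxM => (hM x hxU hxM).2, fun hx => ⟨norm_of_graphFun (by linarith) hx, i, v, hv, hx1, hx2, hx⟩⟩

/-! ## The collar of the link in the band -/

/-- The height of the band over the arc `v̂`. -/
def bandFun (f : DiagramFraming R) (v : Torus) (κ Y : ℝ) : ℝ :=
  bandHeight (edgeLen f false v / π) (edgeLen f true v / π) κ Y

lemma bandFun_eq (f : DiagramFraming R) (i : Bool) (v : Torus) (κ Y : ℝ) :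
    bandFun f v κ Y = bandHeight (edgeLen f i v / π) (edgeLen f (!i) v / π) (wt i κ) Y := by
  cases i
  · rfl
  · exact (bandHeight_swap _ _ _ _).symm

include hR hW in
lemma edgeLen_div_pi (f : DiagramFraming R) (i : Bool)
    {v : Torus} (hv : v ∈ R) : 0 < edgeLen f i v / π ∧ edgeLen f i v / π ≤ 2 := by
  have hm := edgeLen_mem hR hW f i hv
  have hδ := hW.pos
  have hp := pi_pos
  exact ⟨div_pos (by linarith [hm.1]) hp, by rw [div_le_iff₀ hp]; linarith [hm.2]⟩

lemma IsBandWidth.sq_le (hW : IsBandWidth R δ η) {Y : ℝ} (hY : Y ∈ Icc 0 (2 * η)) : Y ^ 2 ≤ 1 / 100 := by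
  have := hW.le
  have := hW.height_le
  nlinarith [hY.1, hY.2]

include hR hW in
lemma bandFun_lt (f : DiagramFraming R)
    {v : Torus} (hv : v ∈ R) {κ Y : ℝ} (hY : Y ∈ Icc 0 (2 * η)) (h0 : Y ^ 2 ≤ κ) (h1 : κ ≤ 1 - Y ^ 2) :
    bandFun f v κ Y < δ / 3 := by
  have h2 := edgeLen_div_pi hR hW f false hv
  have h3 := edgeLen_div_pi hR hW f true hv
  have h4 := bandHeight_le h2.1 h3.1 h2.2 h3.2 hY.1 h0 h1
  have h5 := hW.height_le
  have h6 := hW.height_pos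
  have hp := pi_lt_d2
  have : 2 * π * Y ≤ 2 * π * (2 * η) := mul_le_mul_of_nonneg_left hY.2 (by positivity)
  unfold bandFun
  nlinarith

include hR hW in
lemma bandFun_nonneg (f : DiagramFraming R)
    {v : Torus} (hv : v ∈ R) {κ Y : ℝ} (hκ : κ ∈ Icc (0 : ℝ) 1) (hY : 0 ≤ Y) : 0 ≤ bandFun f v κ Y :=
  bandHeight_nonneg (edgeLen_div_pi hR hW f false hv).1 (edgeLen_div_pi hR hW f true hv).1 hκ.1 hκ.2 hY

include hR hW in
lemma bandFun_le_edgeLen (f : DiagramFraming R) (i : Bool)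
    {v : Torus} (hv : v ∈ R) {κ Y : ℝ} (hY : Y ∈ Icc 0 (2 * η)) (h0 : Y ^ 2 ≤ κ) (h1 : κ ≤ 1 - Y ^ 2) :
    bandFun f v κ Y ≤ wt i κ * (edgeLen f i v / 2) := by
  have hm := edgeLen_mem hR hW f i hv
  have hδ := hW.pos
  have hw := (wt_mem i (κ := κ) ⟨by nlinarith, by nlinarith⟩).1
  rcases le_or_gt (wt i κ) (1 / 3) with h | h
  · rw [bandFun_eq f i, bandHeight_of_le h]
    refine mul_le_mul_of_nonneg_left ?_ hw
    calc _ ≤ edgeLen f i v / π * (π / 2) :=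
          mul_le_mul_of_nonneg_left (arcsin_le_pi_div_two _) (edgeLen_div_pi hR hW f i hv).1.le
      _ = _ := by field_simp
  · have := bandFun_lt hR hW f hv hY h0 h1
    nlinarith [hm.1]

/-- The point of the collar over the point with parameter `s` of the arc `v̂`. -/
def collarPoint (f : DiagramFraming R) (δ : ℝ) (v : Torus) (s Y : ℝ) : E4 :=
  bandPoint f δ v (kap s Y) (bandFun f v (kap s Y) Y)

lemma kap_bounds (hW : IsBandWidth R δ η) {Y : ℝ} (hY : Y ∈ Icc 0 (2 * η)) (s : ℝ) :
    Y ^ 2 ≤ kap s Y ∧ kap s Y ≤ 1 - Y ^ 2 ∧ kap s Y ∈ Icc (0 : ℝ) 1 := by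
  have h := hW.sq_le hY
  have h1 := sq_le_kap (Y := Y) (by linarith) s
  have h2 := kap_le (Y := Y) (by linarith) s
  exact ⟨h1, h2, by nlinarith, by nlinarith⟩

lemma sq_le_wt {κ Y : ℝ} (i : Bool) (h0 : Y ^ 2 ≤ κ) (h1 : κ ≤ 1 - Y ^ 2) : Y ^ 2 ≤ wt i κ := by
  cases i
  · exact h0
  · simp only [wt, if_true]; linarith

include hR hW in
lemma collarPoint_chart (f : DiagramFraming R) (i : Bool)
    {v : Torus} (hv : v ∈ R) {s Y : ℝ} (hY : Y ∈ Icc 0 (2 * η)) (hi : wt i (kap s Y) ≤ 2 / 3) :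
    cpx (!i) (collarPoint f δ v s Y) = (√(wt i (kap s Y)) : ℝ) * angExp (ang (!i) v +
        ((role f i v * (bandFun f v (kap s Y) Y / wt i (kap s Y)) : ℝ) : Angle)) ∧
      cpx i (collarPoint f δ v s Y) = graphFun f δ i v (cpx (!i) (collarPoint f δ v s Y)) := by
  obtain ⟨h0, h1, h2⟩ := kap_bounds hW hY s
  have h3 := bandFun_nonneg hR hW f hv h2 hY.1
  have hδ := hW.pos
  exact bandPoint_chart hR hW f i hv h2 hi (by linarith) (by nlinarith [(wt_mem i h2).1])
    (bandFun_lt hR hW f hv hY h0 h1).le (bandFun_le_edgeLen hR hW f i hv hY h0 h1)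

lemma exists_wt_le_half (κ : ℝ) : ∃ i, wt i κ ≤ 1 / 2 := by
  rcases le_total κ (1 / 2) with h | h
  · exact ⟨false, h⟩
  · exact ⟨true, by simp only [wt, if_true]; linarith⟩

include hR hW in
lemma collarAngle_mem (f : DiagramFraming R) (i : Bool)
    {v : Torus} (hv : v ∈ R) {s Y : ℝ} (hY : Y ∈ Icc 0 (2 * η)) :
    bandFun f v (kap s Y) Y / wt i (kap s Y) ∈ Icc 0 (edgeLen f i v / 2) := by
  obtain ⟨h0, h1, h2⟩ := kap_bounds hW hY s
  have hw := (wt_mem i h2).1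
  have hm := edgeLen_mem hR hW f i hv
  have hδ := hW.pos
  refine ⟨div_nonneg (bandFun_nonneg hR hW f hv h2 hY.1) hw, ?_⟩
  exact div_le_of_le_mul₀ hw (by linarith [hm.1]) (by
    rw [mul_comm]; exact bandFun_le_edgeLen hR hW f i hv hY h0 h1)

lemma norm_cpx_collarPoint_sq (hW : IsBandWidth R δ η) (f : DiagramFraming R) (i : Bool) (v : Torus) {s Y : ℝ}
    (hY : Y ∈ Icc 0 (2 * η)) : ‖cpx (!i) (collarPoint f δ v s Y)‖ ^ 2 = wt i (kap s Y) :=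
  norm_cpx_bandPoint_sq f δ i v (kap_bounds hW hY s).2.2 _

include hR hW in
lemma collarPoint_mem_bandSurface (f : DiagramFraming R)
    {v : Torus} (hv : v ∈ R) {s Y : ℝ} (hY : Y ∈ Icc 0 (2 * η)) : collarPoint f δ v s Y ∈ bandSurface f δ := by
  obtain ⟨i, hi⟩ := exists_wt_le_half (kap s Y)
  obtain ⟨h0, h1, h2⟩ := kap_bounds hW hY s
  obtain ⟨e1, e2⟩ := collarPoint_chart (s := s) hR hW f i hv hY (by linarith)
  have hA := collarAngle_mem hR hW f i hv (s := s) hY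
  have hm := edgeLen_mem hR hW f i hv
  have hδ := hW.pos
  have hw := (wt_mem i h2).1
  refine ⟨norm_of_graphFun ?_ e2, i, v, hv, ?_, ?_, e2⟩
  · rw [norm_cpx_collarPoint_sq hW f i v hY]; linarith
  · rw [norm_cpx_collarPoint_sq hW f i v hY]; linarith
  · rw [norm_cpx_collarPoint_sq hW f i v hY, e1]
    rcases hw.eq_or_lt with h | h
    · rw [← h, zero_mul]; positivity
    · rw [offset_mul_angExp _ _ (sqrt_pos.2 h), abs_mul, abs_role, one_mul, abs_of_nonneg hA.1, mul_div_cancel₀ _ h.ne']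
      · exact bandFun_lt hR hW f hv hY h0 h1
      · rcases role_sign f i v with hr | hr <;> rw [hr] <;> constructor <;> linarith [hm.1, hm.2, hA.1, hA.2]

lemma ang_eq_of_graphFun_eq (hW : IsBandWidth R δ η) {i : Bool} {v w : Torus} (hv : v ∈ R) (hw : w ∈ R) {ζ : ℂ}
    (hζ : ‖ζ‖ ^ 2 < 2 / 3) (h : graphFun f δ i v ζ = graphFun f δ i w ζ) : ang i w = ang i v := by
  by_contra hne
  have hδ' := hW.le
  have hpi := pi_gt_three
  have hg := hW.gap i w hw v hv hne
  have hs : (√(1 - ‖ζ‖ ^ 2) : ℂ) ≠ 0 := Complex.ofReal_ne_zero.2 (sqrt_pos.2 (by linarith)).ne'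
  have h2 := angExp_injective (mul_left_cancel₀ hs h)
  have h3 := abs_le.1 (abs_graphHeight_le hW f i v hζ)
  have h4 := abs_le.1 (abs_graphHeight_le hW f i w hζ)
  set y := ‖ζ‖ ^ 2 / (1 - ‖ζ‖ ^ 2) * graphAngle f δ i v ζ
  set y' := ‖ζ‖ ^ 2 / (1 - ‖ζ‖ ^ 2) * graphAngle f δ i w ζ
  have e : ang i w - ang i v = ((y - y' : ℝ) : Angle) := by
    rw [Angle.coe_sub, sub_eq_sub_iff_add_eq_add, add_comm (y : Angle), h2]
  rw [e, Angle.toReal_coe_eq_self_iff.2 ⟨by linarith, by linarith⟩] at hg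
  linarith [(abs_le.2 ⟨by linarith, by linarith⟩ : |y - y'| ≤ 16 * δ)]

/-- The parameter of the endpoint of an arc on the circle number `i`. -/
def corner (i : Bool) : ℝ := if i then 1 else 0

lemma corner_mem (i : Bool) : corner i ∈ Icc (0 : ℝ) 1 := by cases i <;> simp [corner]

lemma wt_kap_corner (i : Bool) (Y : ℝ) : wt i (kap (corner i) Y) = Y ^ 2 := by
  cases i
  · simp [wt, corner, kap]
  · simp [wt, corner, kap]; ring

lemma eq_corner {i : Bool} {s Y : ℝ} (hY : 2 * Y ^ 2 < 1) (hs : s ∈ Icc (0 : ℝ) 1) (h : wt i (kap s Y) = Y ^ 2) :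
    s = corner i := by
  rw [← wt_kap_corner i Y] at h
  have := congrArg (wt i) h
  rw [wt_wt, wt_wt] at this
  exact kap_injOn hY hs (corner_mem i) this

lemma vertexArc_partner_corner (hR : IsLinkDiagram R) (i : Bool) {v : Torus} (hv : v ∈ R) :
    vertexArc (partner R i v) (corner i) = vertexArc v (corner i) := by
  cases i
  · exact vertexArc_partner_zero hR hv
  · exact vertexArc_partner_one hR hv

lemma sqrt_kap_zero {s : ℝ} (hs : s ∈ Icc (0 : ℝ) 1) : √(kap s 0) = sin (π / 2 * s) := by
  rw [kap, zero_pow two_ne_zero, mul_zero, sub_zero, one_mul, add_zero, sqrt_sq (half_angle_nonneg hs).2]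

lemma sqrt_one_sub_kap_zero {s : ℝ} (hs : s ∈ Icc (0 : ℝ) 1) : √(1 - kap s 0) = cos (π / 2 * s) := by
  rw [kap, zero_pow two_ne_zero, mul_zero, sub_zero, one_mul, add_zero, ← cos_sq',
    sqrt_sq (half_angle_nonneg hs).1]

@[simp] lemma bandFun_zero (f : DiagramFraming R) (v : Torus) (κ : ℝ) : bandFun f v κ 0 = 0 := bandHeight_zero _ _ _

lemma collarPoint_zero (f : DiagramFraming R) (δ : ℝ) (v : Torus) {s : ℝ} (hs : s ∈ Icc (0 : ℝ) 1) :
    collarPoint f δ v s 0 = vertexArc v s := by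
  refine ext_cpx fun i => ?_
  cases i
  · simp [collarPoint, bandPoint, vertexArc, cpx_joinPoint_false, sqrt_one_sub_kap_zero hs]
  · simp [collarPoint, bandPoint, vertexArc, cpx_joinPoint_true, sqrt_kap_zero hs]

include hR hW in
lemma collarPoint_partner_corner (f : DiagramFraming R) (i : Bool)
    {v : Torus} (hv : v ∈ R) {Y : ℝ} (hY : Y ∈ Icc 0 (2 * η)) :
    collarPoint f δ (partner R i v) (corner i) Y = collarPoint f δ v (corner i) Y := by
  rcases hY.1.eq_or_lt with rfl | hpos
  · rw [collarPoint_zero f δ _ (corner_mem i), collarPoint_zero f δ _ (corner_mem i), vertexArc_partner_corner hR i hv]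
  have hp := (partner_spec hR i hv).1
  have hsq := hW.sq_le hY
  have hw : wt i (kap (corner i) Y) ≤ 2 / 3 := by rw [wt_kap_corner]; linarith
  have hA : ∀ u, bandFun f u (kap (corner i) Y) Y / wt i (kap (corner i) Y) = edgeLen f i u / 2 := fun u => by
    rw [bandFun_eq f i, wt_kap_corner, bandHeight_of_le (by linarith), sqrt_sq hpos.le, div_self hpos.ne',
      arcsin_one]
    field_simp
  obtain ⟨e1, e2⟩ := collarPoint_chart hR hW f i hv hY hw
  obtain ⟨e1', e2'⟩ := collarPoint_chart hR hW f i hp hY hw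
  have e : cpx (!i) (collarPoint f δ (partner R i v) (corner i) Y) = cpx (!i) (collarPoint f δ v (corner i) Y) := by
    rw [e1, e1', hA, hA, edgeLen_partner hR hW f i hv, role_partner hR f i hv, ang_partner_edgeLen f i v, add_assoc,
      ← Angle.coe_add]
    congr 4
    ring
  exact ext_cpx' i (by rw [e2, e2', e, graphFun_partner hR f δ i hv]) e

include hR hW in
/-- The collar is injective. -/
lemma collarPoint_injective {v v' : Torus} (hv : v ∈ R) (hv' : v' ∈ R)
    {s s' Y Y' : ℝ} (hs : s ∈ Icc (0 : ℝ) 1) (hs' : s' ∈ Icc (0 : ℝ) 1) (hY : Y ∈ Icc 0 (2 * η))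
    (hY' : Y' ∈ Icc 0 (2 * η)) (h : collarPoint f δ v s Y = collarPoint f δ v' s' Y') :
    Y = Y' ∧ vertexArc v s = vertexArc v' s' := by
  obtain ⟨h0, h1, h2⟩ := kap_bounds hW hY s
  obtain ⟨h0', h1', h2'⟩ := kap_bounds hW hY' s'
  have hκ : kap s Y = kap s' Y' := by
    have e1 := norm_cpx_collarPoint_sq hW f false v (s := s) hY
    have e2 := norm_cpx_collarPoint_sq hW f false v' (s := s') hY'
    rw [h, e2] at e1
    exact e1.symm
  have hsq' := hW.sq_le hY'
  have hδ := hW.pos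
  obtain ⟨i, hi⟩ := exists_wt_le_half (kap s Y)
  obtain ⟨e1, e2⟩ := collarPoint_chart (s := s) hR hW f i hv hY (by linarith)
  obtain ⟨e1', e2'⟩ := collarPoint_chart hR hW f i hv' hY' (by rw [← hκ]; linarith)
  have hn := norm_cpx_collarPoint_sq hW f i v (s := s) hY
  have hA := collarAngle_mem hR hW f i hv (s := s) hY
  have hA' := collarAngle_mem hR hW f i hv' (s := s') hY'
  have hm := edgeLen_mem hR hW f i hv
  have hlt := bandFun_lt hR hW f hv hY h0 h1
  rw [← h, ← hκ] at e1'
  rw [← h] at e2'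
  rw [← hκ] at hA' h0' h1'
  have hang := ang_eq_of_graphFun_eq hW hv hv' (by rw [hn]; linarith) (e2.symm.trans e2')
  have hYw := sq_le_wt i h0 h1
  have hYw' := sq_le_wt i h0' h1'
  set κ := wt i (kap s Y) with hκdef
  rcases (wt_mem i h2).1.eq_or_lt with hz | hpos
  · have hY0 : Y = 0 := by nlinarith [hY.1]
    have hY0' : Y' = 0 := by nlinarith [hY'.1]
    rw [hY0, hY0', collarPoint_zero f δ _ hs, collarPoint_zero f δ _ hs'] at h
    exact ⟨hY0.trans hY0'.symm, h⟩
  change 0 < κ at hpos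
  have e3 := angExp_injective (mul_left_cancel₀ (Complex.ofReal_ne_zero.2 (sqrt_pos.2 hpos).ne') (e1.symm.trans e1'))
  set A := bandFun f v (kap s Y) Y / κ with hAdef
  set A' := bandFun f v' (kap s Y) Y' / κ with hAdef'
  rcases eq_or_eq_partner hR i hv hv' hang with rfl | rfl
  · have e4 := eq_of_coe_eq (add_left_cancel e3) (by
      rw [← mul_sub, abs_mul, abs_role, one_mul, abs_lt]
      constructor <;> linarith [hm.1, hm.2, hA.1, hA.2, hA'.1, hA'.2])
    have e5 : A = A' := by rcases role_sign f i v' with hr | hr <;> rw [hr] at e4 <;> linarith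
    have e6 : bandFun f v' (kap s Y) Y = bandFun f v' (kap s Y) Y' := by
      rw [hAdef, hAdef', div_left_inj' hpos.ne'] at e5; exact e5
    have e7 := bandHeight_injective (edgeLen_div_pi hR hW f false hv).1 (edgeLen_div_pi hR hW f true hv).1 hY.1 hY'.1
      h0 h1 h0' h1' e6
    subst e7
    exact ⟨rfl, by rw [kap_injOn (by linarith) hs hs' hκ]⟩
  · rw [edgeLen_partner hR hW f i hv] at hA'
    have e4 := eq_of_coe_eq (x := role f i v * A) (y := role f i v * (edgeLen f i v - A')) (by
      rw [role_partner hR f i hv, ang_partner_edgeLen f i v, add_assoc, ← Angle.coe_add] at e3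
      rw [add_left_cancel e3]
      congr 1; ring) (by
      rw [← mul_sub, abs_mul, abs_role, one_mul, abs_lt]
      constructor <;> linarith [hm.1, hm.2, hA.1, hA.2, hA'.1, hA'.2])
    have e5 : A = edgeLen f i v - A' := by rcases role_sign f i v with hr | hr <;> rw [hr] at e4 <;> linarith
    have e6 : A = edgeLen f i v / 2 := le_antisymm hA.2 (by linarith [hA'.2])
    have e6' : A' = edgeLen f i v / 2 := by linarith
    have hκ3 : κ ≤ 1 / 3 := by
      by_contra! hh
      rw [hAdef, div_eq_iff hpos.ne'] at e6
      nlinarith [hm.1]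
    have key : ∀ u y : _, 0 ≤ y → y ^ 2 ≤ κ → edgeLen f i u = edgeLen f i v →
        bandFun f u (kap s Y) y / κ = edgeLen f i v / 2 → y ^ 2 = κ := by
      intro u y hy hyκ hu he
      rw [bandFun_eq f i, ← hκdef, bandHeight_of_le hκ3, mul_div_cancel_left₀ _ hpos.ne', hu] at he
      have hasin : arcsin (y / √κ) = π / 2 := by
        have : edgeLen f i v ≠ 0 := by linarith [hm.1]
        field_simp at he
        linarith
      have := arcsin_eq_pi_div_two.1 hasin
      rw [one_le_div (sqrt_pos.2 hpos), sqrt_le_iff] at this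
      exact le_antisymm hyκ this.2
    have e7 := key v Y hY.1 hYw rfl e6
    have e7' := key _ Y' hY'.1 hYw' (edgeLen_partner hR hW f i hv) e6'
    have e8 : Y = Y' := (sq_eq_sq₀ hY.1 hY'.1).1 (e7.trans e7'.symm)
    subst e8
    refine ⟨rfl, ?_⟩
    rw [eq_corner (Y := Y) (by linarith) hs e7.symm, eq_corner (i := i) (Y := Y) (by linarith) hs' (by rw [← hκ, e7]),
      vertexArc_partner_corner hR i hv]

lemma continuousAt_bandHeight {a b : ℝ} {q₀ : ℝ × ℝ} (h0 : 0 < q₀.1) (h1 : q₀.1 < 1) :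
    ContinuousAt (fun q : ℝ × ℝ => bandHeight a b q.1 q.2) q₀ := by
  have hs := contDiff_middleStep.continuous
  have ha := continuous_arcsin
  have e0 : ContinuousAt (fun q : ℝ × ℝ => arcsin (q.2 / √q.1)) q₀ :=
    ha.continuousAt.comp (continuousAt_snd.div (continuous_sqrt.continuousAt.comp continuousAt_fst)
      (sqrt_pos.2 h0).ne')
  have e1 : ContinuousAt (fun q : ℝ × ℝ => arcsin (q.2 / √(1 - q.1))) q₀ :=
    ha.continuousAt.comp (continuousAt_snd.div
      ((continuous_sqrt.comp (continuous_const.sub continuous_fst)).continuousAt)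
      (sqrt_pos.2 (sub_pos.2 h1)).ne')
  unfold bandHeight
  fun_prop

include hR hW in
lemma continuousOn_collarPoint (f : DiagramFraming R)
    {v : Torus} (hv : v ∈ R) :
    ContinuousOn (fun q : ℝ × ℝ => collarPoint f δ v q.1 q.2) (univ ×ˢ Icc 0 (2 * η)) := by
  rintro ⟨s₀, Y₀⟩ ⟨-, hY₀⟩
  obtain ⟨i, hi⟩ := exists_wt_le_half (kap s₀ Y₀)
  set S : Set (ℝ × ℝ) := univ ×ˢ Icc 0 (2 * η)
  have hk : Continuous fun q : ℝ × ℝ => wt i (kap q.1 q.2) := (continuous_wt i).comp continuous_kap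
  have hev : ∀ᶠ q in 𝓝[S] (s₀, Y₀), wt i (kap q.1 q.2) < 2 / 3 :=
    nhdsWithin_le_nhds (hk.continuousAt.eventually_lt continuousAt_const (by simp only; linarith))
  set ζ : ℝ × ℝ → ℂ := fun q => cpx (!i) (collarPoint f δ v q.1 q.2) with hζ
  have hnorm : ∀ q ∈ S, ‖ζ q‖ ^ 2 = wt i (kap q.1 q.2) := fun q hq =>
    norm_cpx_collarPoint_sq hW f i v hq.2
  have h₀ : ((s₀, Y₀) : ℝ × ℝ) ∈ S := ⟨mem_univ _, hY₀⟩
  have hζc : ContinuousWithinAt ζ S (s₀, Y₀) := by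
    rcases (wt_mem i (kap_bounds hW hY₀ s₀).2.2).1.eq_or_lt with hz | hpos
    · have hz0 : ζ (s₀, Y₀) = 0 := by
        have := hnorm _ h₀
        rw [← hz] at this
        simpa using this
      rw [ContinuousWithinAt, hz0, tendsto_zero_iff_norm_tendsto_zero]
      have h1 : Tendsto (fun q : ℝ × ℝ => √(wt i (kap q.1 q.2))) (𝓝[S] (s₀, Y₀)) (𝓝 0) := by
        have := (continuous_sqrt.comp hk).tendsto (s₀, Y₀)
        simp only [Function.comp_def, ← hz, sqrt_zero] at this
        exact this.mono_left nhdsWithin_le_nhds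
      refine h1.congr' ?_
      filter_upwards [self_mem_nhdsWithin] with q hq
      rw [← hnorm q hq, sqrt_sq (norm_nonneg _)]
    · have hF : ContinuousAt (fun q : ℝ × ℝ => bandFun f v (kap q.1 q.2) q.2) (s₀, Y₀) := by
        have e : (fun q : ℝ × ℝ => bandFun f v (kap q.1 q.2) q.2) = (fun q : ℝ × ℝ =>
          bandHeight (edgeLen f i v / π) (edgeLen f (!i) v / π) q.1 q.2) ∘
            fun q => (wt i (kap q.1 q.2), q.2) := funext fun q => bandFun_eq f i v _ _
        rw [e]
        exact ContinuousAt.comp (continuousAt_bandHeight hpos (by simp only; linarith))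
          (hk.prodMk continuous_snd).continuousAt
      have hc : ContinuousAt (fun q : ℝ × ℝ => ((√(wt i (kap q.1 q.2)) : ℝ) : ℂ) * angExp (ang (!i) v +
          ((role f i v * (bandFun f v (kap q.1 q.2) q.2 / wt i (kap q.1 q.2)) : ℝ) : Angle))) (s₀, Y₀) := by
        refine ContinuousAt.mul ?_ ?_
        · exact (Complex.continuous_ofReal.comp (continuous_sqrt.comp hk)).continuousAt
        · refine continuous_angExp.continuousAt.comp (continuousAt_const.add
            (Angle.continuous_coe.continuousAt.comp (continuousAt_const.mul (hF.div hk.continuousAt hpos.ne'))))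
      refine hc.continuousWithinAt.congr_of_eventuallyEq_of_mem ?_ h₀
      filter_upwards [hev, self_mem_nhdsWithin] with q hq hqS
      exact (collarPoint_chart hR hW f i hv hqS.2 hq.le).1
  have hg : ContinuousWithinAt (fun q => ofPair i (graphFun f δ i v (ζ q)) (ζ q)) S (s₀, Y₀) := by
    have h2 : ContinuousAt (graphFun f δ i v) (ζ (s₀, Y₀)) :=
      (contDiffOn_graphFun hW f i v).continuousOn.continuousAt
        ((isOpen_lt (by fun_prop) continuous_const).mem_nhds (by
          change ‖ζ (s₀, Y₀)‖ ^ 2 < 2 / 3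
          rw [hnorm _ h₀]; simp only; linarith))
    exact (contDiff_ofPair i).continuous.continuousAt.comp_continuousWithinAt
      ((h2.comp_continuousWithinAt hζc).prodMk hζc)
  refine hg.congr_of_eventuallyEq_of_mem ?_ h₀
  filter_upwards [hev, self_mem_nhdsWithin] with q hq hqS
  exact ext_cpx' i (by rw [cpx_ofPair]; exact (collarPoint_chart hR hW f i hv hqS.2 hq.le).2) (by rw [cpx_not_ofPair])

/-- The parameter of a point of the link. -/
def arcParam (x : E4) : ℝ := 2 / π * arccos ‖cpx false x‖

lemma continuous_arcParam : Continuous arcParam :=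
  continuous_const.mul (continuous_arccos.comp (cpx false).continuous.norm)

lemma arcParam_vertexArc (v : Torus) {s : ℝ} (hs : s ∈ Icc (0 : ℝ) 1) : arcParam (vertexArc v s) = s := by
  have hp := pi_pos
  rw [arcParam, vertexArc, cpx_joinPoint_false, norm_mul, norm_angExp, mul_one, Complex.norm_real,
    norm_of_nonneg (half_angle_nonneg hs).1, arccos_cos (by nlinarith [hs.1]) (by nlinarith [hs.2])]
  field_simp

lemma vertexArc_eq_iff (hR : IsLinkDiagram R) {v v' : Torus} (hv : v ∈ R) (hv' : v' ∈ R) {s s' : ℝ} (hs : s ∈ Icc (0 : ℝ) 1)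
    (hs' : s' ∈ Icc (0 : ℝ) 1) (h : vertexArc v s = vertexArc v' s') :
    s = s' ∧ (v' = v ∨ ∃ i, s = corner i ∧ v' = partner R i v) := by
  have hss : s = s' := by rw [← arcParam_vertexArc v hs, h, arcParam_vertexArc v' hs']
  subst hss
  refine ⟨rfl, ?_⟩
  by_contra! hne
  have h0 : ∀ i, s = corner i → ang i v' ≠ ang i v := fun i hi hang => by
    rcases eq_or_eq_partner hR i hv hv' hang with e | e
    · exact hne.1 e
    · exact hne.2 i hi e
  have h1 := congrArg (cpx false) h
  have h2 := congrArg (cpx true) h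
  rw [vertexArc, vertexArc, cpx_joinPoint_false, cpx_joinPoint_false] at h1
  rw [vertexArc, vertexArc, cpx_joinPoint_true, cpx_joinPoint_true] at h2
  rcases hs.1.eq_or_lt with rfl | hs0
  · exact h0 false rfl (angExp_injective (by simpa [ang] using h1)).symm
  rcases hs.2.eq_or_lt with rfl | hs1
  · exact h0 true rfl (angExp_injective (by simpa [ang] using h2)).symm
  obtain ⟨hc, hsn⟩ := half_angle_pos ⟨hs0, hs1⟩
  exact hne.1 (Prod.ext (angExp_injective (mul_left_cancel₀ (Complex.ofReal_ne_zero.2 hsn.ne') h2))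
    (angExp_injective (mul_left_cancel₀ (Complex.ofReal_ne_zero.2 hc.ne') h1))).symm

include hR hW in
lemma collarPoint_congr (f : DiagramFraming R) {v v' : Torus}
    (hv : v ∈ R) (hv' : v' ∈ R) {s s' Y : ℝ} (hs : s ∈ Icc (0 : ℝ) 1) (hs' : s' ∈ Icc (0 : ℝ) 1)
    (hY : Y ∈ Icc 0 (2 * η)) (h : vertexArc v s = vertexArc v' s') :
    collarPoint f δ v s Y = collarPoint f δ v' s' Y := by
  obtain ⟨rfl, rfl | ⟨i, rfl, rfl⟩⟩ := vertexArc_eq_iff hR hv hv' hs hs' h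
  · rfl
  · exact (collarPoint_partner_corner hR hW f i hv hY).symm

open Classical in
/-- The collar of `R̂` in the band. -/
def bandCollar (f : DiagramFraming R) (δ η : ℝ) (x : E4) (t : ℝ) : E4 :=
  if h : ∃ v ∈ R, x ∈ vertexArc v '' Icc (0 : ℝ) 1 then collarPoint f δ h.choose (arcParam x) (η * t) else 0

lemma mul_mem_height (hW : IsBandWidth R δ η) {t : ℝ} (ht : t ∈ Icc (0 : ℝ) 2) : η * t ∈ Icc 0 (2 * η) := by
  have := hW.height_pos
  exact ⟨mul_nonneg this.le ht.1, by nlinarith [ht.2]⟩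

include hR hW in
lemma bandCollar_vertexArc (f : DiagramFraming R) {v : Torus}
    (hv : v ∈ R) {s t : ℝ} (hs : s ∈ Icc (0 : ℝ) 1) (ht : t ∈ Icc (0 : ℝ) 2) :
    bandCollar f δ η (vertexArc v s) t = collarPoint f δ v s (η * t) := by
  have h : ∃ v' ∈ R, vertexArc v s ∈ vertexArc v' '' Icc (0 : ℝ) 1 := ⟨v, hv, s, hs, rfl⟩
  rw [bandCollar, dif_pos h, arcParam_vertexArc v hs]
  obtain ⟨s', hs', e⟩ := h.choose_spec.2
  have : s' = s := by rw [← arcParam_vertexArc _ hs', e, arcParam_vertexArc v hs]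
  subst this
  exact collarPoint_congr hR hW f h.choose_spec.1 hv hs' hs (mul_mem_height hW ht) e

lemma mem_linkOf_iff {x : E4} : x ∈ linkOf R ↔ ∃ v ∈ R, ∃ s ∈ Icc (0 : ℝ) 1, vertexArc v s = x := by
  simp [linkOf]

include hR hW in
lemma continuousOn_bandCollar (f : DiagramFraming R) :
    ContinuousOn (Function.uncurry (bandCollar f δ η)) (linkOf R ×ˢ Icc 0 2) := by
  have hcov : linkOf R ×ˢ Icc (0 : ℝ) 2 = ⋃ v : R, (vertexArc v '' Icc (0 : ℝ) 1) ×ˢ Icc (0 : ℝ) 2 := by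
    ext ⟨x, t⟩
    simp [linkOf]
  rw [hcov]
  refine (locallyFinite_of_finite _).continuousOn_iUnion (fun v => ?_) fun v => ?_
  · exact (isCompact_Icc.image (continuous_vertexArc v)).isClosed.prod isClosed_Icc
  · have h0 : Continuous fun q : E4 × ℝ => (arcParam q.1, η * q.2) :=
      (continuous_arcParam.comp continuous_fst).prodMk (continuous_const.mul continuous_snd)
    have hm : MapsTo (fun q : E4 × ℝ => (arcParam q.1, η * q.2))
        ((vertexArc v '' Icc (0 : ℝ) 1) ×ˢ Icc (0 : ℝ) 2) (univ ×ˢ Icc 0 (2 * η)) :=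
      fun q hq => ⟨mem_univ _, mul_mem_height hW hq.2⟩
    have h1 := (continuousOn_collarPoint hR hW f v.2).comp h0.continuousOn hm
    refine h1.congr ?_
    rintro ⟨_, t⟩ ⟨⟨s, hs, rfl⟩, ht⟩
    simp only [Function.uncurry_apply_pair]
    rw [bandCollar_vertexArc hR hW f v.2 hs ht, Function.comp_apply, arcParam_vertexArc _ hs]

include hR hW in
lemma injOn_bandCollar (f : DiagramFraming R) :
    InjOn (Function.uncurry (bandCollar f δ η)) (linkOf R ×ˢ Icc 0 2) := by
  rintro ⟨x, t⟩ ⟨hx, ht⟩ ⟨y, t'⟩ ⟨hy, ht'⟩ h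
  obtain ⟨v, hv, s, hs, rfl⟩ := mem_linkOf_iff.1 hx
  obtain ⟨v', hv', s', hs', rfl⟩ := mem_linkOf_iff.1 hy
  simp only [Function.uncurry_apply_pair] at h ht ht'
  rw [bandCollar_vertexArc hR hW f hv hs ht, bandCollar_vertexArc hR hW f hv' hs' ht'] at h
  obtain ⟨h1, h2⟩ := collarPoint_injective hR hW hv hv' hs hs' (mul_mem_height hW ht) (mul_mem_height hW ht') h
  exact Prod.ext h2 (mul_left_cancel₀ hW.height_pos.ne' h1)

lemma Icc_one_subset_two : Icc (0 : ℝ) 1 ⊆ Icc 0 2 := Icc_subset_Icc_right one_le_two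

variable (f δ η) in
/-- The band. -/
def band : Set E4 := Function.uncurry (bandCollar f δ η) '' (linkOf R ×ˢ Icc 0 1)

include hR hW in
lemma isCollar_bandCollar (f : DiagramFraming R) :
    IsCollar (linkOf R) (band f δ η) (bandCollar f δ η) where
  continuousOn := (continuousOn_bandCollar hR hW f).mono (prod_mono_right Icc_one_subset_two)
  injOn := (injOn_bandCollar hR hW f).mono (prod_mono_right Icc_one_subset_two)
  zero x hx := by
    obtain ⟨v, hv, s, hs, rfl⟩ := mem_linkOf_iff.1 hx
    rw [bandCollar_vertexArc hR hW f hv hs ⟨le_rfl, zero_le_two⟩, mul_zero, collarPoint_zero f δ v hs]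
  subset := subset_rfl
  nhds _ _ := self_mem_nhdsWithin

include hR hW in
lemma mem_band_iff {x : E4} : x ∈ band f δ η ↔
    ∃ v ∈ R, ∃ s ∈ Icc (0 : ℝ) 1, ∃ Y ∈ Icc 0 η, x = collarPoint f δ v s Y := by
  have hη := hW.height_pos
  constructor
  · rintro ⟨⟨y, t⟩, ⟨hy, ht⟩, rfl⟩
    obtain ⟨v, hv, s, hs, rfl⟩ := mem_linkOf_iff.1 hy
    exact ⟨v, hv, s, hs, η * t, ⟨mul_nonneg hη.le ht.1, by nlinarith [ht.2]⟩,
      bandCollar_vertexArc hR hW f hv hs (Icc_one_subset_two ht)⟩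
  · rintro ⟨v, hv, s, hs, Y, hY, rfl⟩
    have ht : Y / η ∈ Icc (0 : ℝ) 1 := ⟨div_nonneg hY.1 hη.le, (div_le_one hη).2 hY.2⟩
    refine ⟨(vertexArc v s, Y / η), ⟨vertexArc_mem_linkOf hv hs, ht⟩, ?_⟩
    rw [Function.uncurry_apply_pair, bandCollar_vertexArc hR hW f hv hs (Icc_one_subset_two ht),
      mul_div_cancel₀ _ hη.ne']

lemma Icc_height_subset (hW : IsBandWidth R δ η) : Icc 0 η ⊆ Icc 0 (2 * η) :=
  Icc_subset_Icc_right (by linarith [hW.height_pos])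

include hR hW in
lemma band_subset : band f δ η ⊆ bandSurface f δ := fun x hx => by
  obtain ⟨v, hv, s, hs, Y, hY, rfl⟩ := (mem_band_iff hR hW).1 hx
  exact collarPoint_mem_bandSurface hR hW f hv (Icc_height_subset hW hY)

include hR hW in
lemma isCompact_band : IsCompact (band f δ η) :=
  ((isCompact_linkOf R).prod isCompact_Icc).image_of_continuousOn (isCollar_bandCollar hR hW f).continuousOn

include hR hW in
/-- The band is the region under the graph of `bandFun`. -/
lemma bandPoint_mem_band {v : Torus} (hv : v ∈ R) {κ N : ℝ}
    (hκ : κ ∈ Icc (0 : ℝ) 1) (hN : 0 ≤ N) (hN' : N ≤ bandFun f v κ η) : bandPoint f δ v κ N ∈ band f δ η := by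
  have hη := hW.height_pos
  have hsq := hW.sq_le (Y := η) ⟨hη.le, by linarith⟩
  obtain ⟨Y, hY, h0, h1, e⟩ := exists_bandHeight_eq (edgeLen_div_pi hR hW f false hv).1 (edgeLen_div_pi hR hW f true hv).1
    hη.le (by linarith) hκ.1 hκ.2 hN hN'
  have hsq' := hW.sq_le (Icc_height_subset hW hY)
  obtain ⟨s, hs, rfl⟩ := exists_kap_eq h0 h1 (by linarith)
  refine (mem_band_iff hR hW).2 ⟨v, hv, s, hs, Y, hY, ?_⟩
  rw [collarPoint, bandFun, e]

lemma continuousAt_offset {j : Bool} {v : Torus} {ζ : ℂ} (h0 : ζ ≠ 0) (h : |offset j v ζ| < π) :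
    ContinuousAt (offset j v) ζ := by
  have hs : ζ * (starRingEnd ℂ) (angExp (ang j v)) ∈ Complex.slitPlane := by
    rw [Complex.mem_slitPlane_iff_arg]
    refine ⟨fun h2 => ?_, mul_ne_zero h0 ((map_ne_zero _).2 (angExp_ne_zero _))⟩
    rw [offset, h2, abs_of_pos pi_pos] at h
    exact lt_irrefl _ h
  exact ContinuousAt.comp (f := fun z : ℂ => z * (starRingEnd ℂ) (angExp (ang j v))) (Complex.continuousAt_arg hs)
    (continuous_mul_const _).continuousAt

include hR hW in
lemma bandFun_pos (f : DiagramFraming R)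
    {v : Torus} (hv : v ∈ R) {κ Y : ℝ} (hκ : κ ∈ Ioo (0 : ℝ) 1) (hY : 0 < Y) : 0 < bandFun f v κ Y := by
  have := bandHeight_lt (edgeLen_div_pi hR hW f false hv).1 (edgeLen_div_pi hR hW f true hv).1 hκ.1 hκ.2
    le_rfl hY (by simpa using hκ.1) (by simpa using hκ.2)
  rwa [bandHeight_zero] at this

lemma role_mul_offset_partner (f : DiagramFraming R) (hR : IsLinkDiagram R) (i : Bool) {v : Torus} (hv : v ∈ R) {ζ : ℂ}
    (hζ : ζ ≠ 0) : ((edgeLen f i v - role f i v * offset (!i) v ζ : ℝ) : Angle) =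
      ((role f i (partner R i v) * offset (!i) (partner R i v) ζ : ℝ) : Angle) := by
  have h1 := eq_offset (!i) v ζ
  have h2 := eq_offset (!i) (partner R i v) ζ
  have h3 := angExp_injective (mul_left_cancel₀ (Complex.ofReal_ne_zero.2 (norm_ne_zero_iff.2 hζ)) (h1.symm.trans h2))
  rw [ang_partner_edgeLen f i v, add_assoc, add_left_cancel_iff] at h3
  rw [role_partner hR f i hv, Angle.coe_sub]
  rcases role_sign f i v with hr | hr <;> rw [hr] at h3 ⊢
  · simp only [one_mul, neg_mul, Angle.coe_neg] at h3 ⊢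
    rw [h3]; abel
  · simp only [one_mul, neg_mul, neg_neg, Angle.coe_neg] at h3 ⊢
    rw [h3]; abel

include hR hW in
/-- The points of the collar off its boundary are interior to the band. -/
lemma band_mem_nhdsWithin {v : Torus} (hv : v ∈ R) {s Y : ℝ}
    (hY : Y ∈ Ioo 0 η) : band f δ η ∈ 𝓝[bandSurface f δ] (collarPoint f δ v s Y) := by
  have hη := hW.height_pos
  have hpi4 := pi_lt_d2
  have hY2 : Y ∈ Icc 0 (2 * η) := ⟨hY.1.le, by linarith [hY.2]⟩
  have hsq' := hW.sq_le (Y := η) ⟨hη.le, by linarith⟩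
  obtain ⟨i, hi⟩ := exists_wt_le_half (kap s Y)
  obtain ⟨h0, h1, h2⟩ := kap_bounds hW hY2 s
  obtain ⟨e1, e2⟩ := collarPoint_chart (s := s) hR hW f i hv hY2 (by linarith)
  have hn := norm_cpx_collarPoint_sq hW f i v (s := s) hY2
  have hA := collarAngle_mem hR hW f i hv (s := s) hY2
  have hm := edgeLen_mem hR hW f i hv
  have hlt := bandFun_lt hR hW f hv hY2 h0 h1
  have hYw := sq_le_wt i h0 h1
  have hpos : 0 < wt i (kap s Y) := by nlinarith [hY.1]
  have hNpos : 0 < bandFun f v (kap s Y) Y := bandFun_pos hR hW f hv ⟨by nlinarith [hY.1], by nlinarith [hY.1]⟩ hY.1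
  obtain ⟨U, hU, hpU, hUM⟩ := exists_nhds_graph hR hW hv (by rw [hn]; linarith) e2
  set p := collarPoint f δ v s Y with hp
  set κ := wt i (kap s Y) with hκ
  set A := bandFun f v (kap s Y) Y / κ with hAdef
  have hNA : bandFun f v (kap s Y) Y = κ * A := by rw [hAdef, mul_div_cancel₀ _ hpos.ne']
  have hA0 : 0 < A := div_pos hNpos hpos
  have hoff : offset (!i) v (cpx (!i) p) = role f i v * A := by
    rw [e1, offset_mul_angExp _ _ (sqrt_pos.2 hpos)]
    rcases role_sign f i v with hr | hr <;> rw [hr] <;> constructor <;> linarith [hm.1, hm.2, hA.1, hA.2]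
  have hp0 : cpx (!i) p ≠ 0 := fun h => by rw [h] at hn; simp at hn; linarith
  have hk : ContinuousAt (fun x => ‖cpx (!i) x‖ ^ 2) p := ((cpx (!i)).continuous.norm.pow 2).continuousAt
  have ha : ContinuousAt (fun x => role f i v * offset (!i) v (cpx (!i) x)) p := by
    refine continuousAt_const.mul (ContinuousAt.comp (g := offset (!i) v) (continuousAt_offset hp0 ?_)
      (cpx (!i)).continuous.continuousAt)
    rw [hoff, abs_mul, abs_role, one_mul, abs_of_pos hA0]
    linarith [hm.2, hA.2]
  have hka : ContinuousAt (fun x => ‖cpx (!i) x‖ ^ 2 * (role f i v * offset (!i) v (cpx (!i) x))) p := hk.mul ha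
  have hap : role f i v * offset (!i) v (cpx (!i) p) = A := by rw [hoff, ← mul_assoc, role_sq, one_mul]
  have ev1 : ∀ᶠ x in 𝓝 p, 0 < role f i v * offset (!i) v (cpx (!i) x) :=
    continuousAt_const.eventually_lt ha (by rw [hap]; exact hA0)
  have ev2 : ∀ᶠ x in 𝓝 p, ‖cpx (!i) x‖ ^ 2 * (role f i v * offset (!i) v (cpx (!i) x)) < δ / 3 :=
    hka.eventually_lt continuousAt_const (by rw [hap, hn, ← hNA]; exact hlt)
  have ev3 : ∀ᶠ x in 𝓝 p, 0 < ‖cpx (!i) x‖ ^ 2 :=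
    continuousAt_const.eventually_lt hk (by rw [hn]; exact hpos)
  -- points of the graph lying over the sector of a vertex of the edge
  have main : ∀ u ∈ R, ∀ x : E4, ∀ a : ℝ, 0 < ‖cpx (!i) x‖ ^ 2 → ‖cpx (!i) x‖ ^ 2 < 2 / 3 →
      cpx i x = graphFun f δ i u (cpx (!i) x) →
      (a : Angle) = ((role f i u * offset (!i) u (cpx (!i) x) : ℝ) : Angle) →
      0 ≤ a → a ≤ edgeLen f i u / 2 → ‖cpx (!i) x‖ ^ 2 * a ≤ δ / 3 →
      ‖cpx (!i) x‖ ^ 2 * a ≤ bandFun f u (wt i (‖cpx (!i) x‖ ^ 2)) η → x ∈ band f δ η := by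
    intro u hu x a h3 h4 h5 h6 h7 h8 h9 h10
    have h11 : 0 < ‖cpx (!i) x‖ := (norm_nonneg _).lt_of_ne fun h => by rw [← h] at h3; norm_num at h3
    rw [eq_bandPoint hR hW hu h11 h4.le h5 h6 (by linarith) h8 (by rwa [abs_of_nonneg h7])]
    exact bandPoint_mem_band hR hW hu (wt_mem i ⟨h3.le, by linarith⟩) (mul_nonneg h3.le h7) h10
  rcases hYw.lt_or_eq with hY3 | hY3
  · have hAl : A < edgeLen f i v / 2 := by
      rcases le_or_gt κ (1 / 3) with h | h
      · have h4 : arcsin (Y / √κ) < π / 2 :=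
          arcsin_lt_pi_div_two.2 ((div_lt_one (sqrt_pos.2 hpos)).2 (lt_sqrt_of_sq_lt hY3))
        have h5 := mul_lt_mul_of_pos_left h4 (edgeLen_div_pi hR hW f i hv).1
        rw [hAdef, bandFun_eq f i, ← hκ, bandHeight_of_le h, mul_div_cancel_left₀ _ hpos.ne']
        refine h5.trans_eq ?_
        field_simp
      · nlinarith [hm.1]
    have hlt2 : bandFun f v (kap s Y) Y < bandFun f v (kap s Y) η := by
      rw [bandFun_eq f i, bandFun_eq f i]
      exact bandHeight_lt (edgeLen_div_pi hR hW f i hv).1 (edgeLen_div_pi hR hW f (!i) hv).1 hpos (by linarith) hY.1.le hY.2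
        hY3 (by linarith)
    have hb : ContinuousAt (fun x => bandFun f v (wt i (‖cpx (!i) x‖ ^ 2)) η) p := by
      have e : (fun x => bandFun f v (wt i (‖cpx (!i) x‖ ^ 2)) η) = (fun q : ℝ × ℝ =>
          bandHeight (edgeLen f i v / π) (edgeLen f (!i) v / π) q.1 q.2) ∘
            fun x => (‖cpx (!i) x‖ ^ 2, η) := funext fun x => by
        rw [bandFun_eq f i, wt_wt]; rfl
      rw [e]
      exact ContinuousAt.comp (continuousAt_bandHeight (by simp only; rw [hn]; exact hpos) (by simp only; rw [hn]; linarith))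
        (hk.prodMk continuousAt_const)
    have ev4 : ∀ᶠ x in 𝓝 p, role f i v * offset (!i) v (cpx (!i) x) < edgeLen f i v / 2 :=
      ha.eventually_lt continuousAt_const (by rw [hap]; exact hAl)
    have ev5 := hka.eventually_lt hb (by
      rw [hap, hn, ← hNA]
      have : wt i κ = kap s Y := wt_wt i _
      rw [this]; exact hlt2)
    filter_upwards [nhdsWithin_le_nhds (hU.mem_nhds hpU), nhdsWithin_le_nhds ev1, nhdsWithin_le_nhds ev2,
      nhdsWithin_le_nhds ev3, nhdsWithin_le_nhds ev4, nhdsWithin_le_nhds ev5, self_mem_nhdsWithin] with x x0 x1 x2 x3 x4 x5 x6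
    obtain ⟨x7, x8⟩ := hUM x x0 x6
    exact main v hv x _ x3 x7 x8 rfl x1.le x4.le x2.le x5.le
  · have ev4 : ∀ᶠ x in 𝓝 p, role f i v * offset (!i) v (cpx (!i) x) < edgeLen f i v :=
      ha.eventually_lt continuousAt_const (by rw [hap]; linarith [hA.2, hm.1])
    have ev5 : ∀ᶠ x in 𝓝 p, ‖cpx (!i) x‖ ^ 2 < η ^ 2 :=
      hk.eventually_lt continuousAt_const (by rw [hn, ← hY3]; exact pow_lt_pow_left₀ hY.2 hY.1.le two_ne_zero)
    have hmax : ∀ u, ∀ k : ℝ, 0 < k → k < η ^ 2 → bandFun f u (wt i k) η = k * (edgeLen f i u / 2) := by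
      intro u k hk0 hk1
      rw [bandFun_eq f i, wt_wt, bandHeight_of_le (by linarith), arcsin_of_one_le]
      · field_simp
      · rw [one_le_div (sqrt_pos.2 hk0), sqrt_le_iff]; exact ⟨hη.le, hk1.le⟩
    filter_upwards [nhdsWithin_le_nhds (hU.mem_nhds hpU), nhdsWithin_le_nhds ev1, nhdsWithin_le_nhds ev2,
      nhdsWithin_le_nhds ev3, nhdsWithin_le_nhds ev4, nhdsWithin_le_nhds ev5, self_mem_nhdsWithin] with x x0 x1 x2 x3 x4 x5 x6
    obtain ⟨x7, x8⟩ := hUM x x0 x6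
    have hx0 : cpx (!i) x ≠ 0 := fun h => by rw [h] at x3; simp at x3
    rcases le_or_gt (role f i v * offset (!i) v (cpx (!i) x)) (edgeLen f i v / 2) with hle | hgt
    · refine main v hv x _ x3 x7 x8 rfl x1.le hle x2.le ?_
      rw [hmax v _ x3 x5]; gcongr
    · have hpl := edgeLen_partner hR hW f i hv
      have hle : edgeLen f i v - role f i v * offset (!i) v (cpx (!i) x) ≤ edgeLen f i v / 2 := by linarith
      refine main (partner R i v) (partner_spec hR i hv).1 x _ x3 x7 (by rw [x8, graphFun_partner hR f δ i hv])
        (role_mul_offset_partner f hR i hv hx0) (by linarith) (by rw [hpl]; exact hle) ?_ ?_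
      · have : ‖cpx (!i) x‖ ^ 2 * (edgeLen f i v - role f i v * offset (!i) v (cpx (!i) x)) ≤ η ^ 2 * 4 :=
          mul_le_mul x5.le (by linarith [hm.2]) (by linarith) (by positivity)
        nlinarith
      · rw [hmax _ _ x3 x5, hpl]; gcongr

include hR hW in
lemma continuous_collarPoint_right (f : DiagramFraming R) {v : Torus}
    (hv : v ∈ R) (s : ℝ) : ContinuousOn (collarPoint f δ v s) (Icc 0 (2 * η)) :=
  (continuousOn_collarPoint hR hW f hv).comp (f := fun Y : ℝ => (s, Y)) (by fun_prop) fun Y hY => ⟨mem_univ _, hY⟩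

include hR hW in
lemma band_notMem_nhds_outer {v : Torus} (hv : v ∈ R) {s : ℝ}
    (hs : s ∈ Icc (0 : ℝ) 1) : band f δ η ∉ 𝓝[bandSurface f δ] (collarPoint f δ v s η) := by
  intro h
  have hη := hW.height_pos
  have h1 : Tendsto (collarPoint f δ v s) (𝓝[>] η) (𝓝[bandSurface f δ] (collarPoint f δ v s η)) := by
    have hsub : Ioo η (2 * η) ⊆ Icc 0 (2 * η) := fun y hy => ⟨by linarith [hy.1], hy.2.le⟩
    have hmem : Ioo η (2 * η) ∈ 𝓝[>] η := Ioo_mem_nhdsGT (by linarith)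
    refine tendsto_nhdsWithin_iff.2 ⟨?_, ?_⟩
    · exact ((continuous_collarPoint_right hR hW f hv s) η ⟨hη.le, by linarith⟩).mono_left
        (nhdsWithin_le_iff.2 (mem_of_superset hmem hsub))
    · filter_upwards [hmem] with y hy using collarPoint_mem_bandSurface hR hW f hv (hsub hy)
  obtain ⟨Y, hY, hY1⟩ := ((h1.eventually_mem h).and (Ioo_mem_nhdsGT (show η < 2 * η by linarith))).exists
  obtain ⟨v', hv', s', hs', Y', hY', e⟩ := (mem_band_iff hR hW).1 hY
  have := (collarPoint_injective hR hW hv hv' hs hs' ⟨by linarith [hY1.1], hY1.2.le⟩ (Icc_height_subset hW hY') e).1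
  linarith [hY1.1, hY'.2]

lemma continuous_bandPoint (f : DiagramFraming R) (δ : ℝ) (v : Torus) (κ : ℝ) : Continuous (bandPoint f δ v κ) := by
  have hc := (contDiff_cutoff δ).continuous
  have ha := continuous_angExp
  have hA := Angle.continuous_coe
  refine continuous_ofCpx.comp (Continuous.prodMk ?_ ?_)
  all_goals
    refine continuous_const.mul (ha.comp (continuous_const.add (hA.comp ?_)))
    fun_prop

include hR hW in
/-- The points of the surface on the other side of the arc. -/
lemma bandPoint_neg {v : Torus} (hv : v ∈ R) {κ : ℝ}
    (hκ : κ ∈ Ioo (0 : ℝ) 1) :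
    ∀ᶠ N in 𝓝[<] (0 : ℝ), bandPoint f δ v κ N ∈ bandSurface f δ \ band f δ η := by
  have hδ := hW.pos
  have hδ' := hW.le
  have hpi := pi_gt_three
  obtain ⟨i, hi⟩ := exists_wt_le_half κ
  have hκ' : κ ∈ Icc (0 : ℝ) 1 := ⟨hκ.1.le, hκ.2.le⟩
  have hw0 : 0 < wt i κ := by cases i <;> simp [wt, hκ.1, hκ.2]
  have hm := edgeLen_mem hR hW f i hv
  filter_upwards [Ioo_mem_nhdsLT (show -(δ / 3) < 0 by linarith), Ioo_mem_nhdsLT (show -(2 * δ * wt i κ) < 0 by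
    have := mul_pos hδ hw0; linarith)] with N hN1 hN2
  obtain ⟨e1, e2⟩ := bandPoint_chart hR hW f i hv hκ' (by linarith) hN1.1.le hN2.1.le (by linarith [hN1.2])
    (by nlinarith [hN1.2, hm.1])
  have hn := norm_cpx_bandPoint_sq f δ i v hκ' N
  have hq0 : N / wt i κ < 0 := div_neg_of_neg_of_pos hN1.2 hw0
  have hq1 : -(2 * δ) < N / wt i κ := by rw [lt_div_iff₀ hw0]; linarith [hN2.1]
  refine ⟨⟨norm_of_graphFun (by rw [hn]; linarith) e2, i, v, hv, by rw [hn]; linarith, ?_, e2⟩, fun hmem => ?_⟩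
  · rw [hn, e1, offset_mul_angExp _ _ (sqrt_pos.2 hw0), abs_mul, abs_role, one_mul, abs_div, abs_of_pos hw0,
      mul_div_cancel₀ _ hw0.ne', abs_of_neg hN1.2]
    · linarith [hN1.1]
    · rcases role_sign f i v with hr | hr <;> rw [hr] <;> constructor <;> linarith
  · obtain ⟨v', hv', s', hs', Y', hY', e⟩ := (mem_band_iff hR hW).1 hmem
    have hY2 := Icc_height_subset hW hY'
    have hκκ : κ = kap s' Y' := by
      have e3 := norm_cpx_bandPoint_sq f δ false v hκ' N
      rw [e, norm_cpx_collarPoint_sq hW f false v' hY2] at e3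
      exact e3.symm
    obtain ⟨e1', e2'⟩ := collarPoint_chart (s := s') hR hW f i hv' hY2 (by rw [← hκκ]; linarith)
    have hA' := collarAngle_mem hR hW f i hv' (s := s') hY2
    rw [← e] at e1' e2'
    rw [← hκκ] at e1' hA'
    have hang := ang_eq_of_graphFun_eq hW hv hv' (by rw [hn]; linarith) (e2.symm.trans e2')
    have e3 := angExp_injective (mul_left_cancel₀ (Complex.ofReal_ne_zero.2 (sqrt_pos.2 hw0).ne') (e1.symm.trans e1'))
    rcases eq_or_eq_partner hR i hv hv' hang with rfl | rfl
    · have e4 := eq_of_coe_eq (add_left_cancel e3) (by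
        rw [← mul_sub, abs_mul, abs_role, one_mul, abs_lt]
        constructor <;> linarith [hm.1, hm.2, hA'.1, hA'.2])
      rcases role_sign f i v' with hr | hr <;> rw [hr] at e4 <;> linarith [hA'.1]
    · rw [edgeLen_partner hR hW f i hv] at hA'
      set A' := bandFun f (partner R i v) κ Y' / wt i κ
      have e4 := eq_of_coe_eq (x := role f i v * (N / wt i κ)) (y := role f i v * (edgeLen f i v - A')) (by
        rw [role_partner hR f i hv, ang_partner_edgeLen f i v, add_assoc, ← Angle.coe_add] at e3
        rw [add_left_cancel e3]
        congr 1; ring) (by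
        rw [← mul_sub, abs_mul, abs_role, one_mul, abs_lt]
        constructor <;> linarith [hm.1, hm.2, hA'.1, hA'.2])
      rcases role_sign f i v with hr | hr <;> rw [hr] at e4 <;> linarith [hA'.2, hm.1]

lemma kap_zero_mem {s : ℝ} (hs : s ∈ Ioo (0 : ℝ) 1) : kap s 0 ∈ Ioo (0 : ℝ) 1 := by
  obtain ⟨h1, h2⟩ := half_angle_pos hs
  have h3 := sin_sq_add_cos_sq (π / 2 * s)
  rw [kap]
  constructor
  · simp only [ne_eq, OfNat.ofNat_ne_zero, not_false_eq_true, zero_pow, mul_zero, sub_zero, one_mul, add_zero]; positivity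
  · nlinarith

include hR hW in
lemma band_notMem_nhds_inner {v : Torus} (hv : v ∈ R) {s : ℝ}
    (hs : s ∈ Icc (0 : ℝ) 1) : band f δ η ∉ 𝓝[bandSurface f δ] (vertexArc v s) := by
  intro h
  have hη := hW.height_pos
  have h0 : (0 : ℝ) ∈ Icc 0 (2 * η) := ⟨le_rfl, by linarith⟩
  have hz : ∀ s ∈ Icc (0 : ℝ) 1, vertexArc v s = bandPoint f δ v (kap s 0) 0 := fun s hs => by
    rw [← collarPoint_zero f δ v hs, collarPoint, bandFun_zero]
  have h1 := eventually_eventually_nhdsWithin.2 h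
  have h2 : Tendsto (vertexArc v) (𝓝[Ioo 0 1] s) (𝓝[bandSurface f δ] (vertexArc v s)) := by
    refine tendsto_nhdsWithin_iff.2 ⟨(continuous_vertexArc v).continuousAt.mono_left nhdsWithin_le_nhds, ?_⟩
    filter_upwards [self_mem_nhdsWithin] with s hs
    rw [← collarPoint_zero f δ v ⟨hs.1.le, hs.2.le⟩]
    exact collarPoint_mem_bandSurface hR hW f hv h0
  have : (𝓝[Ioo (0 : ℝ) 1] s).NeBot := mem_closure_iff_nhdsWithin_neBot.1 (by rwa [closure_Ioo zero_ne_one])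
  obtain ⟨s', hs', hs''⟩ := ((h2.eventually h1).and self_mem_nhdsWithin).exists
  have hneg := bandPoint_neg (f := f) hR hW hv (kap_zero_mem hs'')
  have h3 : Tendsto (bandPoint f δ v (kap s' 0)) (𝓝[<] 0) (𝓝[bandSurface f δ] (vertexArc v s')) := by
    rw [hz s' ⟨hs''.1.le, hs''.2.le⟩]
    exact tendsto_nhdsWithin_iff.2 ⟨(continuous_bandPoint f δ v _).continuousAt.mono_left nhdsWithin_le_nhds,
      hneg.mono fun N hN => hN.1⟩
  obtain ⟨N, hN1, hN2⟩ := ((h3.eventually hs').and hneg).exists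
  exact hN2.2 hN1

include hR hW in
lemma band_boundary :
    linkOf R ∪ (fun x => bandCollar f δ η x 1) '' linkOf R =
      {p | p ∈ band f δ η ∧ band f δ η ∉ 𝓝[bandSurface f δ] p} := by
  have hη := hW.height_pos
  ext p
  constructor
  · rintro (hp | ⟨x, hx, rfl⟩)
    · obtain ⟨v, hv, s, hs, rfl⟩ := mem_linkOf_iff.1 hp
      refine ⟨(mem_band_iff hR hW).2 ⟨v, hv, s, hs, 0, ⟨le_rfl, hη.le⟩, (collarPoint_zero f δ v hs).symm⟩,
        band_notMem_nhds_inner hR hW hv hs⟩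
    · obtain ⟨v, hv, s, hs, rfl⟩ := mem_linkOf_iff.1 hx
      simp only [mem_ofPred_eq]
      rw [bandCollar_vertexArc hR hW f hv hs ⟨zero_le_one, one_le_two⟩, mul_one]
      exact ⟨(mem_band_iff hR hW).2 ⟨v, hv, s, hs, η, ⟨hη.le, le_rfl⟩, rfl⟩, band_notMem_nhds_outer hR hW hv hs⟩
  · rintro ⟨hp, hp'⟩
    obtain ⟨v, hv, s, hs, Y, hY, rfl⟩ := (mem_band_iff hR hW).1 hp
    rcases hY.1.eq_or_lt with rfl | h0
    · left; rw [collarPoint_zero f δ v hs]; exact vertexArc_mem_linkOf hv hs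
    rcases hY.2.eq_or_lt with rfl | h1
    · right
      refine ⟨vertexArc v s, vertexArc_mem_linkOf hv hs, ?_⟩
      simp only
      rw [bandCollar_vertexArc hR hW f hv hs ⟨zero_le_one, one_le_two⟩, mul_one]
    · exact absurd (band_mem_nhdsWithin hR hW hv ⟨h0, h1⟩) hp'

include hR hW in
lemma band_subset_closure :
    band f δ η ⊆ closure {p | p ∈ band f δ η ∧ band f δ η ∈ 𝓝[bandSurface f δ] p} := by
  have hη := hW.height_pos
  intro p hp
  obtain ⟨v, hv, s, hs, Y, hY, rfl⟩ := (mem_band_iff hR hW).1 hp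
  have : (𝓝[Ioo 0 η] Y).NeBot := mem_closure_iff_nhdsWithin_neBot.1 (by rwa [closure_Ioo hη.ne])
  have hsub : Ioo 0 η ⊆ Icc 0 (2 * η) := Ioo_subset_Icc_self.trans (Icc_height_subset hW)
  have h1 : Tendsto (collarPoint f δ v s) (𝓝[Ioo 0 η] Y) (𝓝 (collarPoint f δ v s Y)) :=
    ((continuous_collarPoint_right hR hW f hv s) Y (Icc_height_subset hW hY)).mono_left (nhdsWithin_mono _ hsub)
  refine mem_closure_of_tendsto h1 ?_
  filter_upwards [self_mem_nhdsWithin] with y hy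
  exact ⟨(mem_band_iff hR hW).2 ⟨v, hv, s, hs, y, ⟨hy.1.le, hy.2.le⟩, rfl⟩, band_mem_nhdsWithin hR hW hv hy⟩

end Band

/-! ## Closed curves composed of arcs -/

lemma IsUnionOfCurves.of_finite {P : (ℝ → E4) → Prop} {ι : Type*} [Finite ι] (γ : ι → ℝ → E4) (h : ∀ i, P (γ i))
    (hd : Pairwise fun i j => Disjoint (range (γ i)) (range (γ j))) : IsUnionOfCurves P (⋃ i, range (γ i)) := by
  let e := Finite.equivFin ι
  refine ⟨Nat.card ι, fun k => γ (e.symm k), fun k => h _, fun k l hkl => hd (e.symm.injective.ne hkl), ?_⟩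
  exact (e.symm.surjective.iUnion_comp fun i => range (γ i)).symm

lemma IsUnionOfCurves.union {P : (ℝ → E4) → Prop} {A B : Set E4} (hA : IsUnionOfCurves P A) (hB : IsUnionOfCurves P B)
    (hd : Disjoint A B) : IsUnionOfCurves P (A ∪ B) := by
  obtain ⟨k, α, hα, hα', rfl⟩ := hA
  obtain ⟨l, β, hβ, hβ', rfl⟩ := hB
  have h := IsUnionOfCurves.of_finite (Sum.elim α β) (P := P) (by rintro (i | j); exacts [hα i, hβ j]) (by
    rintro (i | i) (j | j) hij
    · exact hα' fun h => hij (congrArg _ h)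
    · exact hd.mono (subset_iUnion_of_subset i subset_rfl) (subset_iUnion_of_subset j subset_rfl)
    · exact hd.symm.mono (subset_iUnion_of_subset i subset_rfl) (subset_iUnion_of_subset j subset_rfl)
    · exact hβ' fun h => hij (congrArg _ h))
  rwa [iUnion_sum] at h

lemma isPiecewiseC1_of_contDiffOn {c : ℝ → E4} (h : ContDiffOn ℝ 1 c (Icc 0 1)) : IsPiecewiseC1 c := by
  refine ⟨h.continuousOn, 1, fun i => (i : ℝ), ?_, by simp, by simp, fun i => ?_⟩
  · intro i j hij; change ((i : ℕ) : ℝ) < (j : ℕ); exact_mod_cast hij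
  · fin_cases i; simpa using h

lemma IsSmoothClosedCurve.isCuspFree {γ : ℝ → E4} (h : IsSmoothClosedCurve γ) : IsCuspFreeClosedCurve γ := by
  have hd : ∀ t, DifferentiableAt ℝ γ t := fun t => (h.smooth.differentiable (by simp)) t
  have hl : ∀ t, derivWithin γ (Iic t) t = deriv γ t := fun t => (hd t).derivWithin (uniqueDiffWithinAt_Iic t)
  have hr : ∀ t, derivWithin γ (Ici t) t = deriv γ t := fun t => (hd t).derivWithin (uniqueDiffWithinAt_Ici t)
  refine ⟨h.periodic, h.injOn, isPiecewiseC1_of_contDiffOn (h.smooth.of_le (by simp)).contDiffOn,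
    fun t => hl t ▸ h.deriv_ne_zero t, fun t => hr t ▸ h.deriv_ne_zero t, fun t => ?_⟩
  rw [hl, hr]
  exact fun hs => h.deriv_ne_zero t (eq_zero_of_sameRay_self_neg hs)

lemma IsUnionOfCurves.mono {P Q : (ℝ → E4) → Prop} (hPQ : ∀ γ, P γ → Q γ) {A : Set E4} (h : IsUnionOfCurves P A) :
    IsUnionOfCurves Q A := by
  obtain ⟨k, γ, h1, h2, h3⟩ := h
  exact ⟨k, γ, fun i => hPQ _ (h1 i), h2, h3⟩

section Loop

variable {R : Finset Torus} {ε : Torus → ℤˣ}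

/-- The circle number `outgoing ε v` contains the terminal point of the oriented arc `v̂`. -/
def outgoing (ε : Torus → ℤˣ) (v : Torus) : Bool := decide (ε v = 1)

lemma outgoing_partner (hR : IsLinkDiagram R) (hε : IsOrientation R ε) (i : Bool) {v : Torus} (hv : v ∈ R) :
    outgoing ε (partner R i v) = !outgoing ε v := by
  rw [outgoing, outgoing, sign_partner hR hε i hv]
  rcases Int.units_eq_one_or (ε v) with h | h <;> rw [h] <;> decide

/-- The permutation of the vertices of an oriented diagram defined by following the link. -/
def nextVertex (hR : IsLinkDiagram R) (hε : IsOrientation R ε) : Equiv.Perm R where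
  toFun v := ⟨partner R (outgoing ε v) v, (partner_spec hR _ v.2).1⟩
  invFun v := ⟨partner R (!outgoing ε v) v, (partner_spec hR _ v.2).1⟩
  left_inv v := Subtype.ext (by
    simp only; rw [outgoing_partner hR hε _ v.2, Bool.not_not, partner_partner hR _ v.2])
  right_inv v := Subtype.ext (by
    simp only; rw [outgoing_partner hR hε _ v.2, partner_partner hR _ v.2])

/-- The change of parameter which reverses the negative arcs. -/
def orient (ε : Torus → ℤˣ) (v : Torus) (t : ℝ) : ℝ := if outgoing ε v then t else 1 - t

lemma orient_mem {v : Torus} {t : ℝ} (ht : t ∈ Icc (0 : ℝ) 1) : orient ε v t ∈ Icc (0 : ℝ) 1 := by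
  unfold orient; split_ifs
  · exact ht
  · exact ⟨by linarith [ht.2], by linarith [ht.1]⟩

lemma orient_zero (v : Torus) : orient ε v 0 = corner (!outgoing ε v) := by
  unfold orient corner; cases outgoing ε v <;> simp

lemma orient_one (v : Torus) : orient ε v 1 = corner (outgoing ε v) := by
  unfold orient corner; cases outgoing ε v <;> simp

lemma orient_injective (v : Torus) : Function.Injective (orient ε v) := fun t t' h => by
  unfold orient at h; split_ifs at h
  · exact h
  · linarith

lemma orient_orient (v : Torus) (t : ℝ) : orient ε v (orient ε v t) = t := by
  unfold orient; split_ifs <;> simp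

/-- The parametrization of the component of the link containing `v̂`. -/
def linkPath (hR : IsLinkDiagram R) (hε : IsOrientation R ε) (v : R) (u : ℝ) : E4 :=
  vertexArc ((nextVertex hR hε ^ ⌊u⌋) v : R) (orient ε ((nextVertex hR hε ^ ⌊u⌋) v : R) (Int.fract u))

variable (hR : IsLinkDiagram R) (hε : IsOrientation R ε)
include hR hε

lemma vertexArc_orient_one (v : R) :
    vertexArc v (orient ε v 1) = vertexArc (nextVertex hR hε v) (orient ε (nextVertex hR hε v : R) 0) := by
  have e : ((nextVertex hR hε v : R) : Torus) = partner R (outgoing ε v) v := rfl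
  rw [e, orient_zero, orient_one, outgoing_partner hR hε _ v.2, Bool.not_not, vertexArc_partner_corner hR _ v.2]

lemma vertexArc_orient_injective {v v' : Torus} (hv : v ∈ R) (hv' : v' ∈ R) {t t' : ℝ} (ht : t ∈ Ico (0 : ℝ) 1)
    (ht' : t' ∈ Ico (0 : ℝ) 1) (h : vertexArc v (orient ε v t) = vertexArc v' (orient ε v' t')) : v = v' ∧ t = t' := by
  obtain ⟨h1, h2⟩ := vertexArc_eq_iff hR hv hv' (orient_mem (Ico_subset_Icc_self ht)) (orient_mem (Ico_subset_Icc_self ht')) h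
  rcases h2 with rfl | ⟨i, hi, rfl⟩
  · exact ⟨rfl, orient_injective _ h1⟩
  · exfalso
    have h3 := outgoing_partner hR hε i hv
    rw [hi] at h1
    have key : ∀ u t, t ∈ Ico (0 : ℝ) 1 → orient ε u t = corner i → outgoing ε u = !i := by
      intro u t ht h
      have : t = orient ε u (corner i) := by rw [← h, orient_orient]
      by_contra hne
      have h4 : outgoing ε u = i := by cases i <;> cases h5 : outgoing ε u <;> simp_all
      rw [← h4, ← orient_one, orient_orient] at this
      exact ht.2.ne this
    rw [key v t ht hi, key _ t' ht' h1.symm] at h3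
    cases i <;> simp at h3

lemma linkPath_mem (v : R) (u : ℝ) : linkPath hR hε v u ∈ linkOf R :=
  vertexArc_mem_linkOf (Subtype.prop _) (orient_mem ⟨Int.fract_nonneg u, (Int.fract_lt_one u).le⟩)

lemma linkPath_eq_iff {v v' : R} {u u' : ℝ} (h : linkPath hR hε v u = linkPath hR hε v' u') :
    (nextVertex hR hε ^ ⌊u⌋) v = (nextVertex hR hε ^ ⌊u'⌋) v' ∧ Int.fract u = Int.fract u' := by
  obtain ⟨h1, h2⟩ := vertexArc_orient_injective hR hε (Subtype.prop _) (Subtype.prop _)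
    ⟨Int.fract_nonneg u, Int.fract_lt_one u⟩ ⟨Int.fract_nonneg u', Int.fract_lt_one u'⟩ h
  exact ⟨Subtype.ext h1, h2⟩

/-- The number of arcs of a component of the link. -/
def pathPeriod (v : R) : ℕ := Function.minimalPeriod (nextVertex hR hε) v

lemma pathPeriod_pos (v : R) : 0 < pathPeriod hR hε v :=
  Function.minimalPeriod_pos_of_mem_periodicPts (Function.Injective.mem_periodicPts (nextVertex hR hε).injective v)

lemma zpow_pathPeriod (v : R) : (nextVertex hR hε ^ (pathPeriod hR hε v : ℤ)) v = v := by
  rw [zpow_natCast, ← Equiv.Perm.iterate_eq_pow]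
  exact Function.iterate_minimalPeriod

lemma linkPath_periodic (v : R) : Function.Periodic (linkPath hR hε v) (pathPeriod hR hε v) := by
  intro u
  rw [linkPath, linkPath, Int.floor_add_natCast, Int.fract_add_natCast, zpow_add, Equiv.Perm.mul_apply, zpow_pathPeriod]

lemma zpow_injOn (v : R) {k k' : ℤ} (hk : k ∈ Ico (0 : ℤ) (pathPeriod hR hε v)) (hk' : k' ∈ Ico (0 : ℤ) (pathPeriod hR hε v))
    (h : (nextVertex hR hε ^ k) v = (nextVertex hR hε ^ k') v) : k = k' := by
  obtain ⟨a, rfl⟩ := Int.eq_ofNat_of_zero_le hk.1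
  obtain ⟨b, rfl⟩ := Int.eq_ofNat_of_zero_le hk'.1
  rw [zpow_natCast, zpow_natCast, ← Equiv.Perm.iterate_eq_pow, ← Equiv.Perm.iterate_eq_pow] at h
  have := Function.iterate_injOn_Iio_minimalPeriod (f := nextVertex hR hε) (x := v)
    (show a ∈ Iio _ by exact_mod_cast hk.2) (show b ∈ Iio _ by exact_mod_cast hk'.2) h
  rw [this]

lemma linkPath_injOn (v : R) : InjOn (linkPath hR hε v) (Ico 0 (pathPeriod hR hε v)) := by
  intro u hu u' hu' h
  obtain ⟨h1, h2⟩ := linkPath_eq_iff hR hε h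
  have hf : ∀ u : ℝ, u ∈ Ico (0 : ℝ) (pathPeriod hR hε v) → ⌊u⌋ ∈ Ico (0 : ℤ) (pathPeriod hR hε v) := fun u hu =>
    ⟨Int.floor_nonneg.2 hu.1, Int.floor_lt.2 (by exact_mod_cast hu.2)⟩
  have h3 := zpow_injOn hR hε v (hf u hu) (hf u' hu') h1
  rw [← Int.floor_add_fract u, h3, h2, Int.floor_add_fract]

/-- The image of the link under an injective map is a union of closed curves. -/
lemma isUnionOfCurves_image {P : (ℝ → E4) → Prop} {β : E4 → E4} (hβ : InjOn β (linkOf R))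
    (hP : ∀ v : R, P fun u => β (linkPath hR hε v (pathPeriod hR hε v * u))) : IsUnionOfCurves P (β '' linkOf R) := by
  let S := Equiv.Perm.SameCycle.setoid (nextVertex hR hε)
  let γ : Quotient S → ℝ → E4 := fun q u => β (linkPath hR hε q.out (pathPeriod hR hε q.out * u))
  have h := IsUnionOfCurves.of_finite γ (fun q => hP q.out) (by
    intro q q' hq
    refine disjoint_left.2 ?_
    rintro _ ⟨u, rfl⟩ ⟨u', h⟩
    obtain ⟨h1, -⟩ := linkPath_eq_iff hR hε (hβ (linkPath_mem hR hε _ _) (linkPath_mem hR hε _ _) h)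
    refine hq ?_
    rw [← Quotient.out_eq q, ← Quotient.out_eq q']
    refine Quotient.sound ?_
    change Equiv.Perm.SameCycle _ _ _
    have := (Equiv.Perm.sameCycle_zpow_left (f := nextVertex hR hε) (n := ⌊(pathPeriod hR hε q'.out : ℝ) * u'⌋) (x := q'.out)
      (y := q'.out)).2 (Equiv.Perm.SameCycle.refl _ _)
    rw [h1] at this
    exact (Equiv.Perm.sameCycle_zpow_left.1 this))
  convert h
  ext x
  simp only [mem_image, mem_iUnion, mem_range]
  constructor
  · rintro ⟨y, hy, rfl⟩
    obtain ⟨v, hv, s, hs, rfl⟩ := mem_linkOf_iff.1 hy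
    obtain ⟨w, t, ht, e⟩ : ∃ (w : R) (t : ℝ), t ∈ Ico (0 : ℝ) 1 ∧ vertexArc w (orient ε w t) = vertexArc v s := by
      have hm := orient_mem (ε := ε) (v := v) hs
      rcases hm.2.eq_or_lt with h1 | h1
      · refine ⟨nextVertex hR hε ⟨v, hv⟩, 0, by simp, ?_⟩
        rw [← vertexArc_orient_one hR hε ⟨v, hv⟩]
        simp only
        rw [← h1, orient_orient]
      · exact ⟨⟨v, hv⟩, _, ⟨hm.1, h1⟩, by simp only; rw [orient_orient]⟩
    have hsc : Equiv.Perm.SameCycle (nextVertex hR hε) (Quotient.mk S w).out w := Quotient.mk_out (s := S) w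
    obtain ⟨k, hk⟩ := hsc
    have hm : ((pathPeriod hR hε (Quotient.mk S w).out : ℕ) : ℝ) ≠ 0 :=
      Nat.cast_ne_zero.2 (pathPeriod_pos hR hε _).ne'
    refine ⟨Quotient.mk S w, (k + t) / pathPeriod hR hε (Quotient.mk S w).out, ?_⟩
    simp only [γ]
    rw [mul_div_cancel₀ _ hm, linkPath, Int.floor_intCast_add, Int.floor_eq_zero_iff.2 ht, add_zero, hk,
      Int.fract_intCast_add, Int.fract_eq_self.2 ht, e]
  · rintro ⟨q, u, rfl⟩
    exact ⟨_, linkPath_mem hR hε _ _, rfl⟩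

lemma comp_linkPath_periodic (β : E4 → E4) (v : R) :
    Function.Periodic (fun u => β (linkPath hR hε v (pathPeriod hR hε v * u))) 1 := fun u => by
  simp only
  rw [mul_add, mul_one, linkPath_periodic hR hε v]

lemma comp_linkPath_injOn {β : E4 → E4} (hβ : InjOn β (linkOf R)) (v : R) :
    InjOn (fun u => β (linkPath hR hε v (pathPeriod hR hε v * u))) (Ico 0 1) := by
  intro u hu u' hu' h
  have hm : (0 : ℝ) < pathPeriod hR hε v := Nat.cast_pos.2 (pathPeriod_pos hR hε v)
  have := linkPath_injOn hR hε v ⟨by nlinarith [hu.1], by nlinarith [hu.2]⟩ ⟨by nlinarith [hu'.1], by nlinarith [hu'.2]⟩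
    (hβ (linkPath_mem hR hε _ _) (linkPath_mem hR hε _ _) h)
  exact mul_left_cancel₀ hm.ne' this

lemma linkPath_eqOn_Ico (v : R) (k : ℤ) {u : ℝ} (hu : u ∈ Ico (k : ℝ) (k + 1)) :
    linkPath hR hε v u = vertexArc ((nextVertex hR hε ^ k) v : R) (orient ε ((nextVertex hR hε ^ k) v : R) (u - k)) := by
  have : ⌊u⌋ = k := Int.floor_eq_iff.2 ⟨hu.1, hu.2⟩
  rw [linkPath, this, Int.fract, this]

lemma linkPath_eqOn_Icc (v : R) (k : ℤ) {u : ℝ} (hu : u ∈ Icc (k : ℝ) (k + 1)) :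
    linkPath hR hε v u = vertexArc ((nextVertex hR hε ^ k) v : R) (orient ε ((nextVertex hR hε ^ k) v : R) (u - k)) := by
  rcases hu.2.eq_or_lt with h | h
  · rw [linkPath_eqOn_Ico hR hε v (k + 1) (by rw [h]; push_cast; constructor <;> linarith), h]
    have e := vertexArc_orient_one hR hε ((nextVertex hR hε ^ k) v)
    rw [← Equiv.Perm.mul_apply, ← zpow_one_add, add_comm] at e
    rw [add_sub_cancel_left, e]
    push_cast
    rw [sub_self]
  · exact linkPath_eqOn_Ico hR hε v k ⟨hu.1, h⟩

end Loop

/-! ## The outer boundary of the band -/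

section Band

variable {R : Finset Torus} {f : DiagramFraming R} {δ η : ℝ}

/-- A signed version of the distance from the circle number `i` along the outer boundary. -/
def outerRad (η : ℝ) (i : Bool) (s : ℝ) : ℝ :=
  √(1 - 2 * η ^ 2) * (if i then cos (π / 2 * s) else sin (π / 2 * s))

/-- The angle at the circle number `i` along the outer boundary. -/
def outerAngle (η : ℝ) (i : Bool) (s : ℝ) : ℝ := π / 2 - arctan (outerRad η i s / η)

lemma wt_kap (hW : IsBandWidth R δ η) (i : Bool) (s : ℝ) : wt i (kap s η) = outerRad η i s ^ 2 + η ^ 2 := by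
  have := hW.sq_le ⟨hW.height_pos.le, by linarith [hW.height_pos]⟩
  rw [outerRad, mul_pow, sq_sqrt (by linarith)]
  cases i
  · simp [wt, kap]
  · simp [wt, kap, sin_sq]; ring

lemma contDiff_outerRad (η : ℝ) (i : Bool) : ContDiff ℝ ∞ (outerRad η i) := by
  unfold outerRad; cases i <;> simp only [if_true, Bool.false_eq_true, if_false] <;> fun_prop

lemma contDiff_outerAngle (η : ℝ) (i : Bool) : ContDiff ℝ ∞ (outerAngle η i) :=
  contDiff_const.sub ((contDiff_outerRad η i).div_const η).arctan

lemma outerRad_nonneg (η : ℝ) (i : Bool) {s : ℝ} (hs : s ∈ Icc (0 : ℝ) 1) : 0 ≤ outerRad η i s := by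
  refine mul_nonneg (sqrt_nonneg _) ?_
  cases i
  exacts [(half_angle_nonneg hs).2, (half_angle_nonneg hs).1]

lemma outerRad_corner (η : ℝ) (i : Bool) : outerRad η i (corner i) = 0 := by
  cases i <;> simp [outerRad, corner]

lemma outerAngle_corner (η : ℝ) (i : Bool) : outerAngle η i (corner i) = π / 2 := by
  simp [outerAngle, outerRad_corner]

lemma outerRad_reflect (η : ℝ) (i : Bool) (s : ℝ) : outerRad η i (2 * corner i - s) = -outerRad η i s := by
  cases i
  · simp [outerRad, corner]
  · have : π / 2 * (2 * 1 - s) = π - π / 2 * s := by ring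
    simp only [outerRad, corner, if_true, this, cos_pi_sub]; ring

lemma outerAngle_reflect (η : ℝ) (i : Bool) (s : ℝ) :
    outerAngle η i (2 * corner i - s) = π - outerAngle η i s := by
  rw [outerAngle, outerAngle, outerRad_reflect, neg_div, arctan_neg]; ring

lemma arcsin_eq_outerAngle (hW : IsBandWidth R δ η) (i : Bool) {s : ℝ} (hs : s ∈ Icc (0 : ℝ) 1) :
    arcsin (η / √(wt i (kap s η))) = outerAngle η i s := by
  have hη := hW.height_pos
  have hX := outerRad_nonneg η i hs
  have h0 := arctan_nonneg.2 (div_nonneg hX hη.le)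
  have h1 := arctan_lt_pi_div_two (outerRad η i s / η)
  refine arcsin_eq_of_sin_eq ?_ ⟨by unfold outerAngle; linarith, by unfold outerAngle; linarith⟩
  rw [outerAngle, sin_pi_div_two_sub, cos_arctan, wt_kap hW, div_pow]
  have e : 1 + outerRad η i s ^ 2 / η ^ 2 = (outerRad η i s ^ 2 + η ^ 2) / η ^ 2 := by field_simp; ring
  rw [e, sqrt_div (by positivity), sqrt_sq hη.le, one_div_div]

/-- The height of the outer boundary. -/
def outerHeight (f : DiagramFraming R) (η : ℝ) (v : Torus) (s : ℝ) : ℝ :=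
  middleStep (1 - kap s η) * (kap s η * (edgeLen f false v / π * outerAngle η false s)) +
    middleStep (kap s η) * ((1 - kap s η) * (edgeLen f true v / π * outerAngle η true s))

lemma contDiff_outerHeight (f : DiagramFraming R) (η : ℝ) (v : Torus) :
    ContDiff ℝ ∞ (outerHeight f η v) := by
  have h1 := contDiff_kap η
  have h2 := contDiff_outerAngle η false
  have h3 := contDiff_outerAngle η true
  have h4 := contDiff_middleStep.comp h1
  have h5 := contDiff_middleStep.comp (contDiff_const (c := (1 : ℝ)) |>.sub h1)
  exact (h5.mul (h1.mul (contDiff_const.mul h2))).add (h4.mul ((contDiff_const.sub h1).mul (contDiff_const.mul h3)))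

lemma outerHeight_of_le (f : DiagramFraming R) (i : Bool) (v : Torus) {s : ℝ} (h : wt i (kap s η) ≤ 1 / 3) :
    outerHeight f η v s = wt i (kap s η) * (edgeLen f i v / π * outerAngle η i s) := by
  cases i
  · simp only [wt, Bool.false_eq_true, if_false] at h ⊢
    rw [outerHeight, middleStep_eq_zero h, middleStep_eq_one (by linarith)]; ring
  · simp only [wt, if_true] at h ⊢
    rw [outerHeight, middleStep_eq_zero h, middleStep_eq_one (by linarith)]; ring

variable (f δ η) in
/-- The outer boundary of the band over `v̂`, extended beyond the ends. -/
def outerArc (v : Torus) (s : ℝ) : E4 := bandPoint f δ v (kap s η) (outerHeight f η v s)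

lemma outerArc_eq (hW : IsBandWidth R δ η) (f : DiagramFraming R) (v : Torus) {s : ℝ} (hs : s ∈ Icc (0 : ℝ) 1) :
    outerArc f δ η v s = collarPoint f δ v s η := by
  rw [outerArc, collarPoint, bandFun, bandHeight, outerHeight, ← arcsin_eq_outerAngle hW false hs,
    ← arcsin_eq_outerAngle hW true hs]
  rfl

lemma wt_kap_pos (hW : IsBandWidth R δ η) (i : Bool) (s : ℝ) : 0 < wt i (kap s η) := by
  have := hW.height_pos
  rw [wt_kap hW]; positivity

lemma contDiff_wt_kap (η : ℝ) (i : Bool) : ContDiff ℝ ∞ fun s => wt i (kap s η) := by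
  have := contDiff_kap η
  cases i
  exacts [this, contDiff_const.sub this]

lemma contDiff_outerArc (hW : IsBandWidth R δ η) (f : DiagramFraming R) (v : Torus) :
    ContDiff ℝ ∞ (outerArc f δ η v) := by
  have h : ∀ i, ContDiff ℝ ∞ fun s => cpx (!i) (outerArc f δ η v s) := fun i => by
    simp only [outerArc, cpx_bandPoint, angExp_add, angExp_coe]
    have h1 := contDiff_wt_kap η i
    have h2 := contDiff_wt_kap η (!i)
    have h3 := contDiff_outerHeight f η v
    have h4 : ContDiff ℝ ∞ fun s => role f i v *
        (outerHeight f η v s / wt i (kap s η) * cutoff δ (outerHeight f η v s / wt (!i) (kap s η))) :=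
      contDiff_const.mul ((h3.div h1 fun s => (wt_kap_pos hW i s).ne').mul
        ((contDiff_cutoff δ).comp (h3.div h2 fun s => (wt_kap_pos hW _ s).ne')))
    exact (Complex.ofRealCLM.contDiff.comp (h1.sqrt fun s => (wt_kap_pos hW i s).ne')).mul (contDiff_const.mul
      (((Complex.ofRealCLM.contDiff.comp h4).mul contDiff_const).cexp))
  have e : outerArc f δ η v = fun s => ofPair true (cpx true (outerArc f δ η v s)) (cpx false (outerArc f δ η v s)) :=
    funext fun s => ext_cpx' true (by rw [cpx_ofPair]) (by rw [cpx_not_ofPair]; rfl)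
  rw [e]
  exact (contDiff_ofPair true).comp ((h false).prodMk (h true))

variable (hR : IsLinkDiagram R) (hW : IsBandWidth R δ η)

include hR hW in
/-- Near the circle number `i` the outer boundary is an arc of a curve lying over a ray. -/
lemma eventually_cpx_outerArc (f : DiagramFraming R) (i : Bool)
    {v : Torus} (hv : v ∈ R) : ∀ᶠ s in 𝓝 (corner i),
      cpx i (outerArc f δ η v s) = (√(1 - wt i (kap s η)) : ℝ) * angExp (ang i v) ∧
      cpx (!i) (outerArc f δ η v s) = (√(wt i (kap s η)) : ℝ) *
        angExp (ang (!i) v + ((role f i v * (edgeLen f i v / π * outerAngle η i s) : ℝ) : Angle)) := by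
  have hη := hW.height_pos
  have hδ := hW.pos
  have hsq := hW.sq_le ⟨hη.le, by linarith⟩
  have hm := edgeLen_mem hR hW f i hv
  have hpi' := pi_lt_d2
  have hwc := (contDiff_wt_kap η i).continuous
  have hac := (contDiff_outerAngle η i).continuous
  have h1 : ∀ᶠ s in 𝓝 (corner i), wt i (kap s η) < 1 / 3 :=
    hwc.continuousAt.eventually_lt continuousAt_const (by rw [wt_kap_corner]; linarith)
  have h2 : ∀ᶠ s in 𝓝 (corner i), 2 * δ < edgeLen f i v / π * outerAngle η i s :=
    continuousAt_const.eventually_lt (continuous_const.mul hac).continuousAt (by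
      rw [outerAngle_corner]; field_simp; linarith [hm.1])
  have h3 : ∀ᶠ s in 𝓝 (corner i), wt i (kap s η) * (edgeLen f i v / π * outerAngle η i s) < δ / 2 :=
    (hwc.mul (continuous_const.mul hac)).continuousAt.eventually_lt continuousAt_const (by
      change wt i (kap (corner i) η) * (edgeLen f i v / π * outerAngle η i (corner i)) < δ / 2
      rw [wt_kap_corner, outerAngle_corner]
      have : η ^ 2 * (edgeLen f i v / π * (π / 2)) = η * (η * (edgeLen f i v / 2)) := by field_simp
      rw [this]
      have := hW.height_le
      have := hW.le
      have e2 : η * (edgeLen f i v / 2) ≤ η * π := mul_le_mul_of_nonneg_left (by linarith [hm.2]) hη.le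
      nlinarith)
  filter_upwards [h1, h2, h3] with s h1 h2 h3
  have hw := wt_kap_pos hW i s
  have e : outerHeight f η v s / wt i (kap s η) = edgeLen f i v / π * outerAngle η i s := by
    rw [outerHeight_of_le f i v h1.le, mul_div_cancel_left₀ _ hw.ne']
  have e' := cpx_bandPoint f δ (!i) v (kap s η) (outerHeight f η v s)
  rw [Bool.not_not, e, cutoff_eq_zero hδ (h2.le.trans (le_abs_self _)), wt_not] at e'
  refine ⟨by rw [outerArc, e']; simp, ?_⟩
  rw [outerArc, cpx_bandPoint, e, cutoff_eq_one hδ, mul_one]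
  rw [outerHeight_of_le f i v h1.le, wt_not, abs_of_nonneg (div_nonneg (by nlinarith) (by linarith)), div_le_iff₀ (by linarith)]
  nlinarith

include hR hW in
lemma eventually_outerArc_reflect (f : DiagramFraming R) (i : Bool)
    {v : Torus} (hv : v ∈ R) : ∀ᶠ s in 𝓝 (corner i),
      outerArc f δ η (partner R i v) (2 * corner i - s) = outerArc f δ η v s := by
  have hp := (partner_spec hR i hv).1
  have ht : Tendsto (fun s => 2 * corner i - s) (𝓝 (corner i)) (𝓝 (corner i)) := by
    have : Continuous fun s => 2 * corner i - s := by fun_prop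
    simpa [two_mul] using this.tendsto (corner i)
  filter_upwards [eventually_cpx_outerArc hR hW f i hv, ht.eventually (eventually_cpx_outerArc hR hW f i hp)]
    with s ⟨h1, h2⟩ ⟨h3, h4⟩
  have hw : wt i (kap (2 * corner i - s) η) = wt i (kap s η) := by
    rw [wt_kap hW, wt_kap hW, outerRad_reflect, neg_sq]
  refine ext_cpx' i ?_ ?_
  · rw [h1, h3, hw, (partner_spec hR i hv).2.2]
  · have hpi := pi_pos
    rw [h2, h4, hw, outerAngle_reflect, edgeLen_partner hR hW f i hv, role_partner hR f i hv, ang_partner_edgeLen f i v,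
      add_assoc, ← Angle.coe_add]
    congr 4
    field_simp; ring

include hR hW in
lemma deriv_outerArc_ne_zero (f : DiagramFraming R) {v : Torus}
    (hv : v ∈ R) {s : ℝ} (hs : s ∈ Icc (0 : ℝ) 1) : deriv (outerArc f δ η v) s ≠ 0 := by
  intro h0
  have hη := hW.height_pos
  have hδ := hW.pos
  have hsq := hW.sq_le ⟨hη.le, by linarith⟩
  have hpi := pi_pos
  have hr : 0 < √(1 - 2 * η ^ 2) := sqrt_pos.2 (by linarith)
  have hd : HasDerivAt (outerArc f δ η v) 0 s :=
    h0 ▸ ((contDiff_outerArc hW f v).differentiable (by simp) s).hasDerivAt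
  have hc : ∀ i, HasDerivAt (fun s => cpx i (outerArc f δ η v s)) 0 s := fun i => by
    have := (cpx i).hasFDerivAt.comp_hasDerivAt s hd
    rwa [map_zero] at this
  have hr' : ∀ i, HasDerivAt (outerRad η i)
      (√(1 - 2 * η ^ 2) * (π / 2 * if i then -sin (π / 2 * s) else cos (π / 2 * s))) s := fun i => by
    have h1 : HasDerivAt (fun s : ℝ => π / 2 * s) (π / 2) s := by simpa using (hasDerivAt_id s).const_mul (π / 2)
    cases i
    · exact (h1.sin.const_mul √(1 - 2 * η ^ 2)).congr_deriv (by simp only [Bool.false_eq_true, if_false]; ring)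
    · exact (h1.cos.const_mul √(1 - 2 * η ^ 2)).congr_deriv (by simp only [if_true]; ring)
  by_cases hcor : ∃ i, s = corner i
  · obtain ⟨i, rfl⟩ := hcor
    set φ : ℝ → ℝ := fun s => role f i v * (edgeLen f i v / π * outerAngle η i s) with hφ
    set c := cpx (!i) (outerArc f δ η v (corner i)) with hcdef
    have h1 : HasDerivAt (fun s => ((starRingEnd ℂ) c * cpx (!i) (outerArc f δ η v s)).im) 0 (corner i) := by
      have := (hc (!i)).const_mul ((starRingEnd ℂ) c)
      have := Complex.imCLM.hasFDerivAt.comp_hasDerivAt _ this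
      rwa [mul_zero, map_zero] at this
    have hev := eventually_cpx_outerArc hR hW f i hv
    have h2 : (fun s => ((starRingEnd ℂ) c * cpx (!i) (outerArc f δ η v s)).im) =ᶠ[𝓝 (corner i)]
        fun s => √(wt i (kap s η)) * (η * sin (φ s - φ (corner i))) := by
      filter_upwards [hev] with s hs
      have e := hev.self_of_nhds.2
      rw [← hcdef, wt_kap_corner, sqrt_sq hη.le] at e
      rw [e, hs.2, angExp_add, angExp_add]
      have e3 := conj_angExp_mul (ang (!i) v)
      have e4 : (starRingEnd ℂ) (η * (angExp (ang (!i) v) * angExp (φ (corner i) : Angle))) *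
          (√(wt i (kap s η)) * (angExp (ang (!i) v) * angExp (φ s : Angle))) =
          ((√(wt i (kap s η)) * η : ℝ) : ℂ) * angExp ((φ s - φ (corner i) : ℝ) : Angle) := by
        rw [sub_eq_add_neg, Angle.coe_add, Angle.coe_neg, angExp_add, angExp_neg]
        simp only [map_mul, Complex.conj_ofReal, Complex.ofReal_mul]
        linear_combination (√(wt i (kap s η)) * η * angExp (φ s : Angle) *
          (starRingEnd ℂ) (angExp (φ (corner i) : Angle))) * e3
      rw [e4, Complex.im_ofReal_mul, mul_assoc]
      exact congrArg _ (congrArg _ (Angle.sin_coe _))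
    have hφd : HasDerivAt φ (role f i v * (edgeLen f i v / π * -(1 / (1 + (outerRad η i (corner i) / η) ^ 2) *
        ((√(1 - 2 * η ^ 2) * (π / 2 * if i then -sin (π / 2 * corner i) else cos (π / 2 * corner i))) / η))))
          (corner i) :=
      ((((hr' i).div_const η).arctan.const_sub _).const_mul _).const_mul _
    have hwd := ((contDiff_wt_kap η i).differentiable (by simp) (corner i)).hasDerivAt.sqrt (wt_kap_pos hW i _).ne'
    have h3 := hwd.mul ((hφd.sub_const (φ (corner i))).sin.const_mul η)
    have h4 := (h3.congr_of_eventuallyEq h2).unique h1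
    rw [sub_self, sin_zero, cos_zero, wt_kap_corner, sqrt_sq hη.le, outerRad_corner] at h4
    have hm := edgeLen_mem hR hW f i hv
    have hl : 0 < edgeLen f i v := by linarith [hm.1]
    rcases role_sign f i v with h | h <;> cases i <;> simp [h, corner, hη.ne', hr.ne', hl.ne', hpi.ne'] at h4
  · have hs' : s ∈ Ioo (0 : ℝ) 1 :=
      ⟨hs.1.lt_of_ne fun h => hcor ⟨false, h.symm⟩, hs.2.lt_of_ne fun h => hcor ⟨true, h⟩⟩
    have h1 : HasDerivAt (fun s => ‖cpx true (outerArc f δ η v s)‖ ^ 2) 0 s := by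
      simpa using (hc true).norm_sq
    have h2 : (fun s => ‖cpx true (outerArc f δ η v s)‖ ^ 2) = fun s => outerRad η false s ^ 2 + η ^ 2 := by
      funext s
      rw [← wt_kap hW]
      exact norm_cpx_bandPoint_sq f δ false v (kap_bounds hW ⟨hη.le, by linarith⟩ s).2.2 _
    rw [h2] at h1
    have h3 := (((hr' false).pow 2).add_const (η ^ 2)).unique h1
    obtain ⟨hc', hs''⟩ := half_angle_pos hs'
    simp [outerRad, hr.ne', hpi.ne', hc'.ne', hs''.ne'] at h3

end Band

section Loop

variable {R : Finset Torus} {ε : Torus → ℤˣ} {f : DiagramFraming R} {δ η : ℝ}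

lemma hasDerivAt_orient (ε : Torus → ℤˣ) (v : Torus) (t : ℝ) :
    HasDerivAt (orient ε v) (if outgoing ε v then 1 else -1) t := by
  unfold orient
  split_ifs
  · exact hasDerivAt_id t
  · simpa using (hasDerivAt_id t).const_sub 1

lemma contDiff_orient (ε : Torus → ℤˣ) (v : Torus) {n : WithTop ℕ∞} : ContDiff ℝ n (orient ε v) := by
  unfold orient
  split_ifs
  exacts [contDiff_id, contDiff_const.sub contDiff_id]

lemma bandCollar_linkPath (hR : IsLinkDiagram R) (hε : IsOrientation R ε) (hW : IsBandWidth R δ η) (f : DiagramFraming R)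
    (v : R) (k : ℤ) {u : ℝ} (hu : u ∈ Icc (k : ℝ) (k + 1)) : bandCollar f δ η (linkPath hR hε v u) 1 =
      outerArc f δ η ((nextVertex hR hε ^ k) v : R) (orient ε ((nextVertex hR hε ^ k) v : R) (u - k)) := by
  have hm : u - k ∈ Icc (0 : ℝ) 1 := ⟨by linarith [hu.1], by linarith [hu.2]⟩
  rw [linkPath_eqOn_Icc hR hε v k hu, bandCollar_vertexArc hR hW f (Subtype.prop _) (orient_mem hm)
    ⟨zero_le_one, one_le_two⟩, mul_one, outerArc_eq hW f _ (orient_mem hm)]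

lemma eventually_bandCollar_linkPath (hR : IsLinkDiagram R) (hε : IsOrientation R ε) (hW : IsBandWidth R δ η)
    (f : DiagramFraming R) (v : R) (u₀ : ℝ) : ∃ w ∈ R, ∃ k : ℤ, u₀ - k ∈ Icc (0 : ℝ) 1 ∧
      ∀ᶠ u in 𝓝 u₀, bandCollar f δ η (linkPath hR hε v u) 1 = outerArc f δ η w (orient ε w (u - k)) := by
  have hk0 := Int.floor_le u₀
  have hk1 := Int.lt_floor_add_one u₀
  set k := ⌊u₀⌋
  refine ⟨((nextVertex hR hε ^ k) v : R), Subtype.prop _, k, ⟨by linarith, by linarith⟩, ?_⟩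
  rcases hk0.lt_or_eq with h | h
  · filter_upwards [Ioo_mem_nhds h hk1] with u hu
    exact bandCollar_linkPath hR hε hW f v k (Ioo_subset_Icc_self hu)
  · set w' : R := (nextVertex hR hε ^ (k - 1)) v with hw'
    have hn : (nextVertex hR hε ^ k) v = nextVertex hR hε w' := by
      rw [hw', ← Equiv.Perm.mul_apply, ← zpow_one_add, add_sub_cancel]
    have e : (((nextVertex hR hε ^ k) v : R) : Torus) = partner R (outgoing ε w') w' := by rw [hn]; rfl
    have ht : Tendsto (fun u : ℝ => orient ε w' (u - (k - 1 : ℤ))) (𝓝 u₀) (𝓝 (corner (outgoing ε w'))) := by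
      have := ((contDiff_orient ε w' (n := 0)).continuous.comp (continuous_sub_right ((k - 1 : ℤ) : ℝ))).tendsto u₀
      have e2 : u₀ - ((k - 1 : ℤ) : ℝ) = 1 := by push_cast; linarith
      rwa [Function.comp_apply, e2, orient_one] at this
    filter_upwards [Ioo_mem_nhds (show u₀ - 1 < u₀ by linarith) hk1,
      ht.eventually (eventually_outerArc_reflect hR hW f (outgoing ε w') w'.2)] with u hu hrefl
    rcases le_total (k : ℝ) u with hku | hku
    · exact bandCollar_linkPath hR hε hW f v k ⟨hku, hu.2.le⟩
    · rw [bandCollar_linkPath hR hε hW f v (k - 1) ⟨by push_cast; linarith [hu.1], by push_cast; linarith⟩, ← hw', ← hrefl, ← e]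
      congr 1
      have h5 := outgoing_partner hR hε (outgoing ε w') w'.2
      rw [← e] at h5
      rw [orient, orient, h5, corner]
      cases outgoing ε w' <;> simp <;> ring

lemma isSmoothClosedCurve_outer (hR : IsLinkDiagram R) (hε : IsOrientation R ε) (hW : IsBandWidth R δ η)
    (f : DiagramFraming R) (hβ : InjOn (fun x => bandCollar f δ η x 1) (linkOf R)) (v : R) :
    IsSmoothClosedCurve fun u => bandCollar f δ η (linkPath hR hε v (pathPeriod hR hε v * u)) 1 := by
  set m := (pathPeriod hR hε v : ℝ) with hm
  have hm0 : m ≠ 0 := Nat.cast_ne_zero.2 (pathPeriod_pos hR hε v).ne'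
  have key : ∀ u₀ : ℝ, ∃ w ∈ R, ∃ k : ℤ, m * u₀ - k ∈ Icc (0 : ℝ) 1 ∧
      (fun u => bandCollar f δ η (linkPath hR hε v (m * u)) 1) =ᶠ[𝓝 u₀]
        fun u => outerArc f δ η w (orient ε w (m * u - k)) := fun u₀ => by
    obtain ⟨w, hw, k, hk, h⟩ := eventually_bandCollar_linkPath hR hε hW f v (m * u₀)
    exact ⟨w, hw, k, hk, (continuous_const_mul m).continuousAt.eventually h⟩
  refine ⟨comp_linkPath_periodic hR hε (fun x => bandCollar f δ η x 1) v, comp_linkPath_injOn hR hε hβ v,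
    contDiff_iff_contDiffAt.2 fun u₀ => ?_, fun u₀ => ?_⟩
  · obtain ⟨w, hw, k, hk, h⟩ := key u₀
    refine ContDiffAt.congr_of_eventuallyEq ?_ h
    exact ((contDiff_outerArc hW f w).comp ((contDiff_orient ε w).comp (by fun_prop))).contDiffAt
  · obtain ⟨w, hw, k, hk, h⟩ := key u₀
    rw [h.deriv_eq]
    have h1 : HasDerivAt (fun u : ℝ => m * u - k) m u₀ := by simpa using ((hasDerivAt_id u₀).const_mul m).sub_const (k : ℝ)
    have h2 := (hasDerivAt_orient ε w (m * u₀ - k)).comp u₀ h1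
    have h3 := ((contDiff_outerArc hW f w).differentiable (by simp) (orient ε w (m * u₀ - k))).hasDerivAt.scomp u₀ h2
    change deriv (outerArc f δ η w ∘ (orient ε w ∘ fun u => m * u - k)) u₀ ≠ 0
    rw [h3.deriv]
    exact smul_ne_zero (mul_ne_zero (by split_ifs <;> norm_num) hm0) (deriv_outerArc_ne_zero hR hW f hw (orient_mem hk))

lemma cpx_deriv_vertexArc (v : Torus) (s : ℝ) :
    cpx false (deriv (vertexArc v) s) = ((-(π / 2) * sin (π / 2 * s) : ℝ) : ℂ) * angExp v.2 ∧
    cpx true (deriv (vertexArc v) s) = ((π / 2 * cos (π / 2 * s) : ℝ) : ℂ) * angExp v.1 := by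
  rw [(vertexArc_hasDerivAt v s).deriv]
  constructor <;> apply Complex.ext <;> simp [cpx, angExp] <;> ring

lemma cpx_deriv_vertexArc_corner (i : Bool) (v : Torus) : cpx (!i) (deriv (vertexArc v) (corner i)) =
    (((if i then -1 else 1) * (π / 2) : ℝ) : ℂ) * angExp (ang (!i) v) := by
  cases i
  · rw [Bool.not_false, (cpx_deriv_vertexArc v _).2]; simp [corner, ang]
  · rw [Bool.not_true, (cpx_deriv_vertexArc v _).1]; simp [corner, ang]

lemma deriv_vertexArc_ne_zero (v : Torus) (s : ℝ) : deriv (vertexArc v) s ≠ 0 := fun h => by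
  obtain ⟨h1, h2⟩ := cpx_deriv_vertexArc v s
  have hne : ∀ a, angExp a ≠ 0 := fun a => norm_ne_zero_iff.1 (by rw [norm_angExp]; exact one_ne_zero)
  have hpi := pi_pos.ne'
  rw [h, map_zero, eq_comm, mul_eq_zero_iff_right (hne _), Complex.ofReal_eq_zero] at h1 h2
  have := sin_sq_add_cos_sq (π / 2 * s)
  simp [hpi] at h1 h2
  simp [h1, h2] at this

lemma contDiff_vertexArc (v : Torus) : ContDiff ℝ 1 (vertexArc v) := by
  refine contDiff_euclidean.2 fun i => ?_
  fin_cases i <;> simp [vertexArc, joinPoint] <;> fun_prop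

variable (hR : IsLinkDiagram R) (hε : IsOrientation R ε)
include hR hε

lemma linkPath_hasDerivWithinAt (v : R) (k : ℤ) {c u : ℝ} {S : Set ℝ} (hS : ∀ᶠ x in 𝓝[S] u, c * x ∈ Icc (k : ℝ) (k + 1))
    (hu : c * u ∈ Icc (k : ℝ) (k + 1)) : HasDerivWithinAt (fun x => linkPath hR hε v (c * x))
      (((if outgoing ε ((nextVertex hR hε ^ k) v : R) then 1 else -1) * c) •
        deriv (vertexArc ((nextVertex hR hε ^ k) v : R)) (orient ε ((nextVertex hR hε ^ k) v : R) (c * u - k))) S u := by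
  set w := (((nextVertex hR hε ^ k) v : R) : Torus)
  have h1 : HasDerivAt (fun u : ℝ => c * u - k) c u := by simpa using ((hasDerivAt_id u).const_mul c).sub_const (k : ℝ)
  have h2 := (hasDerivAt_orient ε w (c * u - k)).comp u h1
  have h3 := ((contDiff_vertexArc w).differentiable one_ne_zero (orient ε w (c * u - k))).hasDerivAt.scomp u h2
  refine h3.hasDerivWithinAt.congr_of_eventuallyEq ?_ (linkPath_eqOn_Icc hR hε v k hu)
  filter_upwards [hS] with x hx
  exact linkPath_eqOn_Icc hR hε v k hx

lemma isCuspFreeClosedCurve_linkPath (v : R) :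
    IsCuspFreeClosedCurve fun u => linkPath hR hε v (pathPeriod hR hε v * u) := by
  set m := (pathPeriod hR hε v : ℝ) with hm
  have hm0 : 0 < m := Nat.cast_pos.2 (pathPeriod_pos hR hε v)
  have hright : ∀ (k : ℤ) (u : ℝ), m * u ∈ Ico (k : ℝ) (k + 1) → ∀ᶠ x in 𝓝[≥] u, m * x ∈ Icc (k : ℝ) (k + 1) := by
    intro k u hu
    filter_upwards [self_mem_nhdsWithin, nhdsWithin_le_nhds ((continuous_const_mul m).continuousAt.eventually_lt
      continuousAt_const hu.2)] with x hx hx'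
    exact ⟨hu.1.trans (mul_le_mul_of_nonneg_left hx hm0.le), hx'.le⟩
  have hleft : ∀ (k : ℤ) (u : ℝ), m * u ∈ Ioc (k : ℝ) (k + 1) → ∀ᶠ x in 𝓝[≤] u, m * x ∈ Icc (k : ℝ) (k + 1) := by
    intro k u hu
    filter_upwards [self_mem_nhdsWithin, nhdsWithin_le_nhds (continuousAt_const.eventually_lt
      (continuous_const_mul m).continuousAt hu.1)] with x hx hx'
    exact ⟨hx'.le, (mul_le_mul_of_nonneg_left hx hm0.le).trans hu.2⟩
  have dr := fun (k : ℤ) (u : ℝ) (hu : m * u ∈ Ico (k : ℝ) (k + 1)) =>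
    linkPath_hasDerivWithinAt hR hε v k (hright k u hu) (Ico_subset_Icc_self hu)
  have dl := fun (k : ℤ) (u : ℝ) (hu : m * u ∈ Ioc (k : ℝ) (k + 1)) =>
    linkPath_hasDerivWithinAt hR hε v k (hleft k u hu) (Ioc_subset_Icc_self hu)
  have kr : ∀ u : ℝ, m * u ∈ Ico (⌊m * u⌋ : ℝ) (⌊m * u⌋ + 1) := fun u => ⟨Int.floor_le _, Int.lt_floor_add_one _⟩
  have kl : ∀ u : ℝ, m * u ∈ Ioc ((⌈m * u⌉ - 1 : ℤ) : ℝ) ((⌈m * u⌉ - 1 : ℤ) + 1) := fun u => by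
    push_cast
    exact ⟨by linarith [Int.ceil_lt_add_one (m * u)], by linarith [Int.le_ceil (m * u)]⟩
  have hne : ∀ (w : Torus) (s : ℝ), ((if outgoing ε w then 1 else -1) * m) • deriv (vertexArc w) s ≠ 0 := fun w s =>
    smul_ne_zero (mul_ne_zero (by split_ifs <;> norm_num) hm0.ne') (deriv_vertexArc_ne_zero w s)
  refine ⟨comp_linkPath_periodic hR hε id v, comp_linkPath_injOn hR hε (injOn_id _) v, ⟨?_, pathPeriod hR hε v,
    fun i => i / m, ?_, by simp, by simp [hm, (pathPeriod_pos hR hε v).ne'], fun i => ?_⟩, fun u => ?_, fun u => ?_, fun u => ?_⟩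
  · exact fun u _ => (continuousAt_iff_continuous_left_right.2
      ⟨(dl _ u (kl u)).continuousWithinAt, (dr _ u (kr u)).continuousWithinAt⟩).continuousWithinAt
  · intro i j hij
    have : ((i : ℕ) : ℝ) < (j : ℕ) := by exact_mod_cast hij
    exact div_lt_div_of_pos_right this hm0
  · have h1 : ContDiff ℝ 1 fun u : ℝ => vertexArc ((nextVertex hR hε ^ (i : ℤ)) v : R)
        (orient ε ((nextVertex hR hε ^ (i : ℤ)) v : R) (m * u - i)) :=
      (contDiff_vertexArc _).comp ((contDiff_orient ε _).comp (by fun_prop))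
    refine h1.contDiffOn.congr fun u hu => ?_
    have h2 := (div_le_iff₀ hm0).1 hu.1
    have h3 := (le_div_iff₀ hm0).1 hu.2
    simp only [Fin.val_castSucc, Fin.val_succ, Nat.cast_add, Nat.cast_one] at h2 h3
    have := linkPath_eqOn_Icc hR hε v (i : ℤ) (u := m * u) ⟨by push_cast; linarith, by push_cast; linarith⟩
    simpa using this
  · rw [(dl _ u (kl u)).derivWithin (uniqueDiffWithinAt_Iic u)]
    exact hne _ _
  · rw [(dr _ u (kr u)).derivWithin (uniqueDiffWithinAt_Ici u)]
    exact hne _ _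
  · set k := ⌊m * u⌋ with hk
    have hku := kr u
    rcases hku.1.lt_or_eq with h | h
    · rw [(dr k u hku).derivWithin (uniqueDiffWithinAt_Ici u),
        (dl k u ⟨h, hku.2.le⟩).derivWithin (uniqueDiffWithinAt_Iic u)]
      exact fun hs => hne _ _ (eq_zero_of_sameRay_self_neg hs)
    · rw [(dr k u hku).derivWithin (uniqueDiffWithinAt_Ici u),
        (dl (k - 1) u ⟨by push_cast; linarith, by push_cast; linarith⟩).derivWithin (uniqueDiffWithinAt_Iic u)]
      set w' : R := (nextVertex hR hε ^ (k - 1)) v with hw'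
      have hn : (nextVertex hR hε ^ k) v = nextVertex hR hε w' := by
        rw [hw', ← Equiv.Perm.mul_apply, ← zpow_one_add, add_sub_cancel]
      have e : (((nextVertex hR hε ^ k) v : R) : Torus) = partner R (outgoing ε w') w' := by rw [hn]; rfl
      have e1 : m * u - ((k - 1 : ℤ) : ℝ) = 1 := by push_cast; linarith
      have h5 := outgoing_partner hR hε (outgoing ε w') w'.2
      rw [e, ← h, sub_self, orient_zero, h5, Bool.not_not, h, e1, orient_one]
      intro hs
      have h6 := hs.map (cpx (!outgoing ε w')).toLinearMap
      simp only [ContinuousLinearMap.coe_coe, map_neg, map_smul, cpx_deriv_vertexArc_corner] at h6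
      have h7 : ∀ (a b : ℝ) (z : ℂ), a • ((b : ℂ) * z) = ((a * b : ℝ) : ℂ) * z := fun a b z => by
        rw [Complex.real_smul]; push_cast; ring
      have h8 : ∀ a, ‖(((-(m * (π / 2)) : ℝ)) : ℂ) * angExp a‖ = m * (π / 2) := fun a => by
        rw [norm_mul, norm_angExp, Complex.norm_real, mul_one, norm_neg, norm_of_nonneg (by positivity)]
      have h9 : ang (!outgoing ε w') w' = ang (!outgoing ε w') (partner R (outgoing ε w') w') := by
        refine angExp_injective (mul_left_cancel₀ (a := (((-(m * (π / 2)) : ℝ)) : ℂ)) ?_ ?_)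
        · exact Complex.ofReal_ne_zero.2 (neg_ne_zero.2 (by positivity))
        · refine (sameRay_iff_of_norm_eq (by rw [h8, h8])).1 ?_
          have c1 : ∀ o : Bool, (if o then 1 else -1) * m * ((if o then -1 else 1) * (π / 2)) = -(m * (π / 2)) := by
            rintro (_ | _) <;> simp
          have c2 : ∀ o : Bool, (if !o then 1 else -1) * m * ((if o then -1 else 1) * (π / 2)) = m * (π / 2) := by
            rintro (_ | _) <;> simp
          rw [h7, h7, c1, c2, ← neg_mul (_ : ℂ), ← Complex.ofReal_neg] at h6
          exact h6
      exact ang_not_partner_ne hR (outgoing ε w') w'.2 h9.symm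

lemma isUnionOfCurves_linkOf : IsUnionOfCurves IsCuspFreeClosedCurve (linkOf R) := by
  have := isUnionOfCurves_image (β := id) hR hε (injOn_id _) (isCuspFreeClosedCurve_linkPath hR hε)
  rwa [image_id] at this

end Loop

/-! ## Tangent planes of the band -/

lemma mem_tangentPlane_of_hasDerivAt {F : Set E4} {c : ℝ → E4} {c' p : E4} {a : ℝ} (ha : 0 < a)
    (hc : HasDerivAt c c' 0) (hF : ∀ t ∈ Icc 0 a, c t ∈ F) (hp : c 0 = p) : c' ∈ tangentPlane F p := by
  subst hp
  have h1 : a - 0 ∈ tangentConeAt ℝ (Icc 0 a) 0 :=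
    mem_tangentConeAt_of_segment_subset (by rw [segment_eq_Icc ha.le])
  have h2 := Submodule.subset_span (R := ℝ) (tangentConeAt_mono (image_subset_iff.2 hF)
    ((hc.hasFDerivAt.hasFDerivWithinAt (s := Icc 0 a)).mapsTo_tangent_cone h1))
  rw [sub_zero] at h2
  have h3 : (ContinuousLinearMap.toSpanSingleton ℝ c') a = a • c' := by simp
  rw [h3] at h2
  exact (Submodule.smul_mem_iff _ ha.ne').1 h2

lemma hasDerivAt_of_cpx {c : ℝ → E4} {c' : E4} {t : ℝ} (i : Bool) (h : HasDerivAt (fun t => cpx i (c t)) (cpx i c') t)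
    (h' : HasDerivAt (fun t => cpx (!i) (c t)) (cpx (!i) c') t) : HasDerivAt c c' t := by
  have h0 : ∀ j, HasDerivAt (fun t => cpx j (c t)) (cpx j c') t := fun j => by
    rcases Bool.eq_or_eq_not j i with rfl | rfl <;> assumption
  have hre : ∀ j, HasDerivAt (fun t => (cpx j (c t)).re) (cpx j c').re t := fun j =>
    Complex.reCLM.hasFDerivAt.comp_hasDerivAt t (h0 j)
  have him : ∀ j, HasDerivAt (fun t => (cpx j (c t)).im) (cpx j c').im t := fun j =>
    Complex.imCLM.hasFDerivAt.comp_hasDerivAt t (h0 j)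
  have h1 := hre false
  have h2 := him false
  have h3 := hre true
  have h4 := him true
  simp only [cpx_false_re, cpx_false_im, cpx_true_re, cpx_true_im] at h1 h2 h3 h4
  exact hasDerivAt_E4.2 fun j => by fin_cases j; exacts [h1, h2, h3, h4]

lemma tangentPlane_eq_contactPlane {M F : Set E4} (hM : IsC1Surface M) (hF : F ⊆ M) {p : E4} (hp : p ∈ M) {σ : ℝ}
    (h : contactPlane σ p ≤ tangentPlane F p) : tangentPlane F p = contactPlane σ p := by
  obtain ⟨D, hD, hlo⟩ := hM.exists_conormal hp
  have hsub := tangentPlane_le_ker hF hp hlo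
  have heq : contactPlane σ p = D.ker := Submodule.eq_of_le_of_finrank_le (h.trans hsub)
    (hD.trans (contactPlane_finrank σ p))
  exact le_antisymm (heq ▸ hsub) h

lemma cpx_eq_rad_side (j : Bool) (v : Torus) (w : E4) :
    cpx j w = (rad j v w + side j v w * Complex.I) * angExp (ang j v) := by
  have h := conj_angExp_mul (ang j v)
  rw [rad, side, Complex.re_add_im]
  linear_combination -(cpx j w) * h

lemma inner_vertexArc (v : Torus) (s : ℝ) (w : E4) : inner ℝ (vertexArc v s) w =
    cos (π / 2 * s) * rad false v w + sin (π / 2 * s) * rad true v w := by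
  have e : π * s / 2 = π / 2 * s := by ring
  simp [vertexArc, joinPoint, PiLp.inner_apply, Fin.sum_univ_four, rad, ang, e]
  ring

section Band

variable {R : Finset Torus} {f : DiagramFraming R} {δ η : ℝ}

variable (hR : IsLinkDiagram R) (hW : IsBandWidth R δ η)

include hR hW in
lemma linkOf_subset_band : linkOf R ⊆ band f δ η := fun x hx =>
  ⟨(x, 0), ⟨hx, le_rfl, zero_le_one⟩, (isCollar_bandCollar hR hW f).zero x hx⟩

include hR hW in
lemma contactPlane_le_of_mem_Ioo {v : Torus} (hv : v ∈ R) {s : ℝ}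
    (hs : s ∈ Ioo (0 : ℝ) 1) : contactPlane (-(role f false v * role f true v)) (vertexArc v s) ≤
      tangentPlane (band f δ η) (vertexArc v s) := by
  have hδ := hW.pos
  obtain ⟨hC, hS⟩ := half_angle_pos hs
  have eS := sqrt_kap_zero (Ioo_subset_Icc_self hs)
  have eC := sqrt_one_sub_kap_zero (Ioo_subset_Icc_self hs)
  have hκ : kap s 0 ∈ Ioo (0 : ℝ) 1 := ⟨sqrt_pos.1 (eS ▸ hS), sub_pos.1 (sqrt_pos.1 (eC ▸ hC))⟩
  have hT1 : deriv (vertexArc v) s ∈ tangentPlane (band f δ η) (vertexArc v s) := by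
    refine mem_tangentPlane_of_hasDerivAt (c := fun t => vertexArc v (s + t)) (sub_pos.2 hs.2) ?_ (fun t ht => ?_) (by simp)
    · have := (vertexArc_hasDerivAt v (s + 0)).comp_const_add s 0
      rw [add_zero] at this
      rwa [(vertexArc_hasDerivAt v s).deriv]
    · exact linkOf_subset_band hR hW (vertexArc_mem_linkOf hv ⟨by linarith [ht.1, hs.1], by linarith [ht.2]⟩)
  have hwt : ∀ i, 0 < wt i (kap s 0) := by
    rintro (_ | _)
    exacts [hκ.1, sub_pos.2 hκ.2]
  set T2 : E4 := ofCpx ((role f true v / cos (π / 2 * s) : ℝ) * Complex.I * angExp v.2)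
    ((role f false v / sin (π / 2 * s) : ℝ) * Complex.I * angExp v.1) with hT2def
  have hT2 : T2 ∈ tangentPlane (band f δ η) (vertexArc v s) := by
    refine mem_tangentPlane_of_hasDerivAt (c := fun N => bandPoint f δ v (kap s 0) N)
      (bandFun_pos hR hW f hv hκ hW.height_pos) ?_ (fun N hN => bandPoint_mem_band hR hW hv (Ioo_subset_Icc_self hκ) hN.1 hN.2) ?_
    · have key : ∀ i, HasDerivAt (fun N => cpx (!i) (bandPoint f δ v (kap s 0) N))
          ((role f i v / √(wt i (kap s 0)) : ℝ) * Complex.I * angExp (ang (!i) v)) 0 := fun i => by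
        have hev : (fun N => cpx (!i) (bandPoint f δ v (kap s 0) N)) =ᶠ[𝓝 0] fun N =>
            (√(wt i (kap s 0)) * angExp (ang (!i) v)) * Complex.exp (((role f i v * (N / wt i (kap s 0)) : ℝ) : ℂ) * Complex.I) := by
          have : ∀ᶠ N : ℝ in 𝓝 0, |N / wt (!i) (kap s 0)| < δ :=
            ((continuous_id.div_const _).abs.tendsto 0).eventually (gt_mem_nhds (by simpa using hδ))
          filter_upwards [this] with N hN
          rw [cpx_bandPoint, cutoff_eq_one hδ hN.le, mul_one, angExp_add, angExp_coe, mul_assoc]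
        have h1 : HasDerivAt (fun N : ℝ => role f i v * (N / wt i (kap s 0))) (role f i v * (1 / wt i (kap s 0))) 0 :=
          ((hasDerivAt_id (0 : ℝ)).div_const _).const_mul _
        refine HasDerivAt.congr_of_eventuallyEq ?_ hev
        refine (((h1.ofReal_comp.mul_const Complex.I).cexp).const_mul _).congr_deriv ?_
        have e := mul_self_sqrt (hwt i).le
        have e2 : (role f i v / √(wt i (kap s 0)) : ℝ) = √(wt i (kap s 0)) * (role f i v * (1 / wt i (kap s 0))) := by
          nth_rewrite 3 [← e]; field_simp
        rw [e2]
        simp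
        ring
      refine hasDerivAt_of_cpx false ?_ ?_
      · have := key true
        simp only [wt, if_true, eC] at this
        rw [hT2def, cpx_ofCpx_false]
        exact this
      · have := key false
        simp only [wt, Bool.false_eq_true, if_false, eS] at this
        rw [hT2def, Bool.not_false, cpx_ofCpx_true]
        exact this
    · have := collarPoint_zero f δ v (Ioo_subset_Icc_self hs)
      rwa [collarPoint, bandFun_zero] at this
  intro w hw
  obtain ⟨h1, h2⟩ := mem_contactPlane.1 hw
  rw [inner_vertexArc] at h1
  rw [contactForm_vertexArc] at h2
  have h3 := sin_sq_add_cos_sq (π / 2 * s)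
  obtain ⟨d1, d2⟩ := cpx_deriv_vertexArc v s
  set C := cos (π / 2 * s)
  set S := sin (π / 2 * s)
  have hr0 := role_sq f false v
  have hr1 := role_sq f true v
  have e : w = (2 / π * (C * rad true v w - S * rad false v w)) • deriv (vertexArc v) s +
      (role f true v * C * side false v w) • T2 := by
    refine ext_cpx' false ?_ ?_
    · rw [map_add, map_smul, map_smul, d1, hT2def, cpx_ofCpx_false, cpx_eq_rad_side false v w, Complex.real_smul,
        Complex.real_smul]
      have a1 : rad false v w = 2 / π * (C * rad true v w - S * rad false v w) * (-(π / 2) * S) := by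
        field_simp; linear_combination C * h1 - rad false v w * h3
      have a2 : side false v w = role f true v * C * side false v w * (role f true v / C) := by
        field_simp; linear_combination -side false v w * hr1
      have a1' := congrArg Complex.ofReal a1
      have a2' := congrArg Complex.ofReal a2
      rw [Complex.ofReal_mul] at a1' a2'
      change _ = _ * (_ * angExp (ang false v)) + _ * (_ * _ * angExp (ang false v))
      linear_combination (a1' + Complex.I * a2') * angExp (ang false v)
    · rw [Bool.not_false, map_add, map_smul, map_smul, d2, hT2def, cpx_ofCpx_true, cpx_eq_rad_side true v w, Complex.real_smul,
        Complex.real_smul]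
      have a1 : rad true v w = 2 / π * (C * rad true v w - S * rad false v w) * (π / 2 * C) := by
        field_simp; linear_combination S * h1 - rad true v w * h3
      have a2 : side true v w = role f true v * C * side false v w * (role f false v / S) := by
        field_simp
        linear_combination -role f true v * role f false v * h2 - S * side true v w * hr0 * role f true v ^ 2 - S * side true v w * hr1
      have a1' := congrArg Complex.ofReal a1
      have a2' := congrArg Complex.ofReal a2
      rw [Complex.ofReal_mul] at a1' a2'
      change _ = _ * (_ * angExp (ang true v)) + _ * (_ * _ * angExp (ang true v))
      linear_combination (a1' + Complex.I * a2') * angExp (ang true v)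
  rw [e]
  exact add_mem (Submodule.smul_mem _ _ hT1) (Submodule.smul_mem _ _ hT2)

lemma IsBandWidth.mono (hW : IsBandWidth R δ η) {Y : ℝ} (hY : 0 < Y) (hY' : Y ≤ η) : IsBandWidth R δ Y :=
  { hW with height_pos := hY, height_le := by linarith [hW.height_le] }

include hR hW in
lemma contactPlane_le_corner {v : Torus} (hv : v ∈ R) (i : Bool) {σ : ℝ}
    (hσ : σ = 1 ∨ σ = -1) : contactPlane σ (vertexArc v (corner i)) ≤ tangentPlane (band f δ η) (vertexArc v (corner i)) := by
  have hpi := pi_pos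
  have hδ := hW.pos
  have hη := hW.height_pos
  have hm := edgeLen_mem hR hW f i hv
  obtain ⟨p1, p2⟩ := cpx_arcFrom i v 0
  have hp : arcFrom i v 0 = vertexArc v (corner i) := by cases i <;> simp [arcFrom, corner]
  have hT1 : ofPair i 0 ((π / 2 : ℝ) * angExp (ang (!i) v)) ∈ tangentPlane (band f δ η) (vertexArc v (corner i)) := by
    refine mem_tangentPlane_of_hasDerivAt (c := arcFrom i v) one_pos (hasDerivAt_of_cpx i ?_ ?_)
      (fun t ht => linkOf_subset_band hR hW (arcFrom_mem_linkOf hv i ht)) hp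
    · simp only [fun t => (cpx_arcFrom i v t).1, cpx_ofPair]
      have h1 : HasDerivAt (fun t : ℝ => cos (π / 2 * t)) 0 0 := by
        simpa using ((hasDerivAt_id (0 : ℝ)).const_mul (π / 2)).cos
      simpa using h1.ofReal_comp.mul_const (angExp (ang i v))
    · simp only [fun t => (cpx_arcFrom i v t).2, cpx_not_ofPair]
      have h1 : HasDerivAt (fun t : ℝ => sin (π / 2 * t)) (π / 2) 0 := by
        simpa using ((hasDerivAt_id (0 : ℝ)).const_mul (π / 2)).sin
      exact h1.ofReal_comp.mul_const (angExp (ang (!i) v))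
  set x := role f i v * (edgeLen f i v / 2) with hx
  have hT2 : ofPair i 0 (angExp (ang (!i) v + (x : Angle))) ∈ tangentPlane (band f δ η) (vertexArc v (corner i)) := by
    refine mem_tangentPlane_of_hasDerivAt (c := fun Y => ofPair i ((√(1 - Y ^ 2) : ℝ) * angExp (ang i v))
      ((Y : ℂ) * angExp (ang (!i) v + (x : Angle)))) hη (hasDerivAt_of_cpx i ?_ ?_) (fun Y hY => ?_) ?_
    · simp only [cpx_ofPair]
      have h1 : HasDerivAt (fun Y : ℝ => √(1 - Y ^ 2)) 0 0 := by
        simpa using (((hasDerivAt_id (0 : ℝ)).pow 2).const_sub 1).sqrt (by simp)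
      simpa using h1.ofReal_comp.mul_const (angExp (ang i v))
    · simp only [cpx_not_ofPair]
      simpa using (hasDerivAt_id (0 : ℝ)).ofReal_comp.mul_const (angExp (ang (!i) v + (x : Angle)))
    · rcases hY.1.eq_or_lt with rfl | hpos
      · convert linkOf_subset_band (f := f) hR hW (arcFrom_mem_linkOf hv i ⟨le_rfl, zero_le_one⟩) using 1
        exact ext_cpx' i (by rw [cpx_ofPair, p1]; simp) (by rw [cpx_not_ofPair, p2]; simp)
      · have hW' := hW.mono hpos hY.2
        obtain ⟨e1, e2⟩ := (eventually_cpx_outerArc hR hW' f i hv).self_of_nhds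
        rw [outerArc_eq hW' f v (corner_mem i)] at e1 e2
        refine (mem_band_iff hR hW).2 ⟨v, hv, corner i, corner_mem i, Y, hY, ext_cpx' i ?_ ?_⟩
        · rw [cpx_ofPair, e1, wt_kap_corner]
        · have : role f i v * (edgeLen f i v / π * (π / 2)) = x := by rw [hx]; field_simp
          rw [cpx_not_ofPair, e2, wt_kap_corner, sqrt_sq hpos.le, outerAngle_corner, this]
    · rw [← hp]
      exact ext_cpx' i (by rw [cpx_ofPair, p1]; simp) (by rw [cpx_not_ofPair, p2]; simp)
  intro w hw
  obtain ⟨h1, h2⟩ := mem_contactPlane.1 hw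
  rw [inner_vertexArc] at h1
  rw [contactForm_vertexArc] at h2
  have hσ0 : σ ≠ 0 := by rcases hσ with rfl | rfl <;> norm_num
  have hz : rad i v w = 0 ∧ side i v w = 0 := by
    cases i <;> simp [corner, hσ0] at h1 h2 <;> exact ⟨h1, h2⟩
  have hsin : sin x ≠ 0 := by
    have := sin_pos_of_pos_of_lt_pi (x := edgeLen f i v / 2) (by linarith [hm.1]) (by linarith [hm.2])
    rcases role_sign f i v with h | h <;> rw [hx, h] <;> simp [this.ne']
  have e : w = (2 / π * (rad (!i) v w - side (!i) v w / sin x * cos x)) •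
      ofPair i 0 ((π / 2 : ℝ) * angExp (ang (!i) v)) +
      (side (!i) v w / sin x) • ofPair i 0 (angExp (ang (!i) v + (x : Angle))) := by
    refine ext_cpx' i ?_ ?_
    · rw [map_add, map_smul, map_smul, cpx_ofPair, cpx_ofPair, cpx_eq_rad_side i v w, hz.1, hz.2]; simp
    · rw [map_add, map_smul, map_smul, cpx_not_ofPair, cpx_not_ofPair, cpx_eq_rad_side (!i) v w, angExp_add, angExp_coe,
        Complex.exp_mul_I, Complex.real_smul, Complex.real_smul, ← Complex.ofReal_cos, ← Complex.ofReal_sin]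
      have : (sin x : ℂ) ≠ 0 := Complex.ofReal_ne_zero.2 hsin
      push_cast [-Complex.ofReal_cos, -Complex.ofReal_sin]
      field_simp
      ring
  rw [e]
  exact add_mem (Submodule.smul_mem _ _ hT1) (Submodule.smul_mem _ _ hT2)

include hR hW in
lemma tangentPlane_band {p : E4} (hp : p ∈ linkOf R) :
    tangentPlane (band f δ η) p = xiPlus p ∨ tangentPlane (band f δ η) p = xiMinus p := by
  obtain ⟨v, hv, s, hs, rfl⟩ := mem_linkOf_iff.1 hp
  have hrole : -(role f false v * role f true v) = 1 ∨ -(role f false v * role f true v) = -1 := by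
    rcases role_sign f false v with h | h <;> rcases role_sign f true v with h' | h' <;> simp [h, h']
  have key : tangentPlane (band f δ η) (vertexArc v s) = contactPlane (-(role f false v * role f true v)) (vertexArc v s) := by
    refine tangentPlane_eq_contactPlane (isC1Surface_bandSurface (f := f) hR hW) (band_subset hR hW)
      (band_subset hR hW (linkOf_subset_band hR hW hp)) ?_
    rcases hs.1.eq_or_lt with rfl | h0
    · exact contactPlane_le_corner hR hW hv false hrole
    rcases hs.2.eq_or_lt with rfl | h1
    · exact contactPlane_le_corner hR hW hv true hrole
    exact contactPlane_le_of_mem_Ioo hR hW hv ⟨h0, h1⟩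
  rcases hrole with h | h <;> rw [h] at key
  exacts [.inl key, .inr key]

/-! ## The band represents the framing -/

lemma infDist_edgeSector_le (hW : IsBandWidth R δ η) {i : Bool} {v w : Torus} {ζ : ℂ} {x : E4} {A ℓ : ℝ}
    (hζ : ‖ζ‖ ^ 2 < 2 / 3) (hx : cpx (!i) x = ζ) (hx' : cpx i x = graphFun f δ i v ζ) (hA : 0 ≤ A) (hA' : A ≤ ℓ)
    (hℓ : ℓ < 2 * π) (hw : ang (!i) w = ang (!i) v + (ℓ : Angle))
    (hζA : ζ = ‖ζ‖ * angExp (ang (!i) v + (A : Angle))) :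
    Metric.infDist x (edgeSector v w) ≤ ‖ζ‖ ^ 2 := by
  have hδ' := hW.le
  have hρ : 0 ≤ ‖ζ‖ := norm_nonneg ζ
  have hρ1 : ‖ζ‖ ≤ 1 := by nlinarith
  set θ := ang (!i) v + (A : Angle)
  set t := 2 / π * arcsin ‖ζ‖
  have ht : π / 2 * t = arcsin ‖ζ‖ := by simp only [t]; field_simp
  have ht01 : t ∈ Icc (0 : ℝ) 1 := by
    have h0 := arcsin_nonneg.2 hρ
    have h1 := arcsin_le_pi_div_two ‖ζ‖
    constructor <;> by_contra! hlt <;> nlinarith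
  have hθ : θ ∈ circleArc (ang (!i) v) (ang (!i) w) := ⟨A, ℓ, hA, hA', hℓ, rfl, hw⟩
  obtain ⟨u, hu1, hu2, hmem⟩ : ∃ u : Torus, ang i u = ang i v ∧ ang (!i) u = θ ∧ arcFrom i u t ∈ edgeSector v w := by
    cases i
    · exact ⟨(θ, v.2), rfl, rfl, θ, hθ, v.2, circleArc_nonempty _ _, t, ht01, rfl⟩
    · exact ⟨(v.1, θ), rfl, rfl, v.1, circleArc_nonempty _ _, θ, hθ, 1 - t, ⟨by linarith [ht01.2], by linarith [ht01.1]⟩, rfl⟩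
  obtain ⟨y1, y2⟩ := cpx_arcFrom i u t
  rw [ht, sin_arcsin (by linarith) hρ1, hu2, ← hζA] at y2
  rw [ht, cos_arcsin, hu1] at y1
  refine (Metric.infDist_le_dist_of_mem hmem).trans ?_
  rw [dist_eq_norm]
  refine (norm_le_cpx_add i _).trans ?_
  rw [map_sub, map_sub, hx, y2, sub_self, norm_zero, add_zero, hx', y1, graphFun]
  set h := ‖ζ‖ ^ 2 / (1 - ‖ζ‖ ^ 2) * graphAngle f δ i v ζ with hh
  have e : (√(1 - ‖ζ‖ ^ 2) : ℂ) * angExp (ang i v + (h : Angle)) - √(1 - ‖ζ‖ ^ 2) * angExp (ang i v) =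
      √(1 - ‖ζ‖ ^ 2) * angExp (ang i v) * (Complex.exp (Complex.I * h) - 1) := by
    rw [angExp_add, angExp_coe, mul_comm Complex.I]; ring
  rw [e, norm_mul, norm_mul, norm_angExp, mul_one, Complex.norm_real, norm_of_nonneg (sqrt_nonneg _)]
  have h1 : √(1 - ‖ζ‖ ^ 2) ≤ 1 := sqrt_le_one.2 (by nlinarith)
  have h2 := norm_exp_I_mul_ofReal_sub_one_le (x := h)
  have h3 : ‖h‖ ≤ ‖ζ‖ ^ 2 := by
    have h4 := abs_graphAngle_le hW f i v ζ
    have h5 : 0 < 1 - ‖ζ‖ ^ 2 := by linarith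
    rw [hh, norm_mul, norm_div, norm_of_nonneg (sq_nonneg _), norm_of_nonneg h5.le, norm_eq_abs, div_mul_eq_mul_div,
      div_le_iff₀ h5]
    exact mul_le_mul_of_nonneg_left (by linarith) (sq_nonneg _)
  calc _ ≤ 1 * ‖h‖ := mul_le_mul h1 h2 (norm_nonneg _) zero_le_one
    _ ≤ _ := by rwa [one_mul]

include hR hW in
lemma approachesAlong_band {v w : Torus} (hlt : f.lt v w) (i : Bool)
    (hi : ang i v = ang i w) : ApproachesAlong (band f δ η) (edgeSector v w) (vertexArc v (corner i)) := by
  obtain ⟨hv, hw, hne, -⟩ := f.isEdge hlt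
  obtain rfl := (eq_or_eq_partner hR i hv hw hi.symm).resolve_left hne.symm
  have hrole : role f i v = 1 := by
    rcases lt_partner_or hR f i hv with h | h
    exacts [h.2, absurd h.1 (f.asymm hlt)]
  have hδ := hW.pos
  have hm := edgeLen_mem hR hW f i hv
  obtain ⟨p1, p2⟩ := cpx_arcFrom i v 0
  have hp : arcFrom i v 0 = vertexArc v (corner i) := by cases i <;> simp [arcFrom, corner]
  rw [hp] at p1 p2
  set p := vertexArc v (corner i)
  have p2' : cpx (!i) p = 0 := by rw [p2]; simp
  obtain ⟨U, hU, hpU, hUM⟩ := exists_nhds_graph (f := f) (p := p) hR hW hv (by rw [p2']; norm_num)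
    (by rw [p2', p1]; simp [graphFun])
  refine isLittleO_iff.2 fun c hc => ?_
  filter_upwards [self_mem_nhdsWithin, nhdsWithin_le_nhds (hU.mem_nhds hpU),
    nhdsWithin_le_nhds (Metric.ball_mem_nhds p hc)] with x hx hxU hxc
  obtain ⟨hζ, hxg⟩ := hUM x hxU (band_subset hR hW hx)
  obtain ⟨v', hv', s, hs, Y, hY, rfl⟩ := (mem_band_iff hR hW).1 hx
  have hY2 := Icc_height_subset hW hY
  have hn := norm_cpx_collarPoint_sq hW f i v' (s := s) hY2
  obtain ⟨e1, e2⟩ := collarPoint_chart (s := s) hR hW f i hv' hY2 (by rw [← hn]; exact hζ.le)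
  have hA := collarAngle_mem hR hW f i hv' (s := s) hY2
  set x := collarPoint f δ v' s Y
  set A := bandFun f v' (kap s Y) Y / wt i (kap s Y)
  rw [← hn, sqrt_sq (norm_nonneg _)] at e1
  have hle : Metric.infDist x (edgeSector v (partner R i v)) ≤ ‖cpx (!i) x‖ ^ 2 := by
    have hw := ang_partner_edgeLen f i v
    rw [hrole, one_mul] at hw
    rcases eq_or_eq_partner hR i hv hv' (ang_eq_of_graphFun_eq hW hv hv' hζ (hxg.symm.trans e2)) with rfl | rfl
    · rw [hrole, one_mul] at e1
      exact infDist_edgeSector_le hW hζ rfl hxg hA.1 (hA.2.trans (by linarith [hm.1])) (by linarith [hm.2]) hw e1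
    · rw [edgeLen_partner hR hW f i hv] at hA
      rw [role_partner hR f i hv, hrole, hw, add_assoc, ← Angle.coe_add, neg_one_mul, ← sub_eq_add_neg] at e1
      exact infDist_edgeSector_le hW hζ rfl hxg (by linarith [hA.2, hm.1]) (by linarith [hA.1]) (by linarith [hm.2]) hw e1
  have hd : ‖cpx (!i) x‖ ≤ dist x p := by
    rw [dist_eq_norm, ← sub_zero (cpx (!i) x), ← p2', ← map_sub]
    exact norm_cpx_le _ _
  rw [norm_of_nonneg Metric.infDist_nonneg, norm_of_nonneg dist_nonneg]
  calc _ ≤ dist x p * dist x p := hle.trans (by rw [sq]; gcongr)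
    _ ≤ _ := mul_le_mul_of_nonneg_right (Metric.mem_ball.1 hxc).le dist_nonneg

lemma isFramingSurface_band {ε : Torus → ℤˣ} (hR : IsLinkDiagram R) (hε : IsOrientation R ε) (hW : IsBandWidth R δ η)
    (f : DiagramFraming R) : IsFramingSurface R (band f δ η) (bandCollar f δ η) := by
  have hH := isCollar_bandCollar hR hW f
  have hβ : InjOn (fun x => bandCollar f δ η x 1) (linkOf R) := fun x hx y hy h => by
    have h' : Function.uncurry (bandCollar f δ η) (x, 1) = Function.uncurry (bandCollar f δ η) (y, 1) := h
    exact congrArg Prod.fst (hH.injOn ⟨hx, zero_le_one, le_rfl⟩ ⟨hy, zero_le_one, le_rfl⟩ h')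
  have hs := isUnionOfCurves_image hR hε hβ (isSmoothClosedCurve_outer hR hε hW f hβ)
  refine ⟨hH, rfl, ⟨bandSurface f δ, isC1Surface_bandSurface hR hW, bandSurface_subset, band_subset hR hW,
    fun x hx => (isCompact_band hR hW).isClosed.closure_eq ▸ hx.2, band_subset_closure hR hW, band_boundary hR hW,
    (isUnionOfCurves_linkOf hR hε).union (hs.mono fun _ h => h.isCuspFree) ?_⟩, hs, fun v hv => ?_⟩
  · rw [disjoint_left]
    rintro _ hx ⟨y, hy, rfl⟩
    have h : Function.uncurry (bandCollar f δ η) (bandCollar f δ η y 1, 0) = Function.uncurry (bandCollar f δ η) (y, 1) :=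
      hH.zero _ hx
    exact zero_ne_one (congrArg Prod.snd (hH.injOn ⟨hx, le_rfl, zero_le_one⟩ ⟨hy, zero_le_one, le_rfl⟩ h))
  · refine isPiecewiseC1_of_contDiffOn (((contDiff_outerArc hW f v).of_le (by simp)).contDiffOn.congr fun s hs => ?_)
    rw [bandCollar_vertexArc hR hW f hv hs ⟨zero_le_one, one_le_two⟩, mul_one, outerArc_eq hW f v hs]

lemma exists_isFramingNumber {ε : Torus → ℤˣ} (hR : IsLinkDiagram R) (hε : IsOrientation R ε) (f : DiagramFraming R) :
    ∃ x, IsFramingNumber R ε f x := by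
  obtain ⟨δ, η, hW⟩ := exists_isBandWidth R
  refine ⟨_, band f δ η, bandCollar f δ η, isFramingSurface_band hR hε hW f, fun p hp => tangentPlane_band hR hW hp,
    fun v w hlt => ⟨fun h => ?_, fun h => ?_⟩, rfl⟩
  · exact approachesAlong_band hR hW hlt false h
  · exact approachesAlong_band hR hW hlt true h

end Band

end

theorem mainTheorem5 (R : Finset Torus) (hR : IsLinkDiagram R)
    (ε : Torus → ℤˣ) (hε : IsOrientation R ε) :
    -- (i)
    (∀ (F B : Set E4) (β : E4 → E4), IsSurfaceWithCorners F B → linkOf R ⊆ B →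
      IsPushOff R F β →
        ((∀ p ∈ linkOf R, tangentPlane F p = xiPlus p) → pushOffLk R ε β = tbPlus R ε) ∧
        ((∀ p ∈ linkOf R, tangentPlane F p = xiMinus p) → pushOffLk R ε β = -tbMinus R ε)) ∧
    -- (ii)
    tbPlus R ε + tbMinus R ε = -(R.card : ℝ) / 2 ∧
    -- (iii)
    (∀ f : DiagramFraming R, ∃! x : ℝ, IsFramingNumber R ε f x) ∧
    {x : ℝ | ∃ f : DiagramFraming R, IsFramingNumber R ε f x} =
      {x : ℝ | ∃ n : ℤ, x = n ∧ tbPlus R ε ≤ n ∧ (n : ℝ) ≤ -tbMinus R ε} := by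
  have h1 := tbPlus_eq hR hε
  have h2 := neg_tbMinus_eq hR hε
  refine ⟨fun F B β hF _ hβ => ⟨fun ht => pushOffLk_of_xiPlus hR hε hF hβ ht,
    fun ht => pushOffLk_of_xiMinus hR hε hF hβ ht⟩, by linarith, fun f => ?_, ?_⟩
  · obtain ⟨x, hx⟩ := exists_isFramingNumber hR hε f
    exact ⟨x, hx, fun y hy => (hy.eq hR hε).trans (hx.eq hR hε).symm⟩
  · ext x
    constructor
    · rintro ⟨f, hf⟩
      obtain ⟨n, hn, hn1, hn2⟩ := sum_role_mem hR hε f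
      exact ⟨n, (hf.eq hR hε).trans hn, hn1, hn2⟩
    · rintro ⟨n, rfl, hn1, hn2⟩
      obtain ⟨f, hf⟩ := exists_framing_sum_role hR hε hn1 hn2
      obtain ⟨x, hx⟩ := exists_isFramingNumber hR hε f
      have : x = n := (hx.eq hR hε).trans hf
      exact ⟨f, this ▸ hx⟩
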